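/- Conventions. Manifolds are smooth, finite-dimensional, Hausdorff, second countable and without boundary; $S^1=\mathbb R/\mathbb Z$. A spacetime $(M,g)$ is a manifold $M$ with a smooth Lorentzian metric $g$ (signature $(-,+,\dots,+)$) and a time orientation. A curve is timelike if it is smooth and its tangents are all future pointing timelike vectors or all past pointing timelike vectors. A convex normal neighbourhood is an open set $U\subset M$ that is a normal neighbourhood of each of its points $q$, i.e. $\exp_q$ maps some open set of $T_qM$ that is star-shaped about $0$ diffeomorphically onto $U$; for such $U$ let $I_U$ be the set of pairs $(p,q)\in U\times U$ that can be joined by a timelike curve contained in $U$. A continuous curve $\gamma\colon\mathbb R\to M$ is essentially timelike if for each $t$ there are $\delta>0$ and a convex normal neighbourhood $U$ of $\gamma(t)$ with $\gamma((t-\delta,t+\delta))\subset U$ and $(\gamma(\sigma),\gamma(\tau))\in I_U$ for all $\sigma\neq\tau$ in $(t-\delta,t+\delta)$. A loop $S^1\to M$ is called timelike, or essentially timelike, if its periodic lift $\mathbb R\to M$ is. A uniform family of $(M,g)$ is a continuous proper map $H\colon\mathcal M\times S^1\to M$, with $\mathcal M$ a manifold, such that $x\mapsto H(x,0)$ is a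 smooth surjective submersion $\mathcal M\to M$ and the loop $H(x,\cdot)$ is essentially timelike for every $x\in\mathcal M$. A spacetime is uniformly vicious if it admits a uniform family. Proposition. Let $(M,g)$ be a uniformly vicious spacetime and let $H\colon\mathcal M\times S^1\to M$ be a uniform family of it. Then there exists a smooth uniform family $H'\colon\mathcal M\times S^1\to M$, with the same parameter manifold $\mathcal M$, such that for every $x\in\mathcal M$ the loop $H'(x,\cdot)$ is timelike, i.e. has timelike tangents. -/

import Mathlib

open Set Function
open scoped Manifold ContDiff Topology Bundle

noncomputable section

/-- A smooth Lorentzian metric (signature `(-,+,…,+)`) on a smooth `n`-dimensional manifold: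
a smooth section of symmetric bilinear forms on the tangent spaces, each of which has a vector `v`
with `g(v,v) < 0` on whose orthogonal complement it is positive definite. -/
structure LorentzianMetric (n : ℕ) (M : Type*) [TopologicalSpace M]
    [ChartedSpace (EuclideanSpace ℝ (Fin n)) M] [IsManifold (𝓡 n) ∞ M] where
  /-- The bilinear form on the tangent space at `p`. -/
  val (p : M) : TangentSpace (𝓡 n) p →L[ℝ] TangentSpace (𝓡 n) p →L[ℝ] ℝ
  symm (p : M) (v w : TangentSpace (𝓡 n) p) : val p v w = val p w v
  signature (p : M) : ∃ v : TangentSpace (𝓡 n) p, val p v v < 0 ∧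
    ∀ w : TangentSpace (𝓡 n) p, val p v w = 0 → w ≠ 0 → 0 < val p w w
  contMDiff : ContMDiff (𝓡 n)
    ((𝓡 n).prod 𝓘(ℝ, EuclideanSpace ℝ (Fin n) →L[ℝ] EuclideanSpace ℝ (Fin n) →L[ℝ] ℝ)) ∞
    (fun p ↦ Bundle.TotalSpace.mk'
      (EuclideanSpace ℝ (Fin n) →L[ℝ] EuclideanSpace ℝ (Fin n) →L[ℝ] ℝ) p (val p))

/-- A spacetime structure on `M`: a Lorentzian metric together with a time orientation, given by
a smooth timelike vector field (declared to be future pointing). -/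
structure Spacetime (n : ℕ) (M : Type*) [TopologicalSpace M]
    [ChartedSpace (EuclideanSpace ℝ (Fin n)) M] [IsManifold (𝓡 n) ∞ M]
    extends LorentzianMetric n M where
  /-- The time-orienting vector field. -/
  orient (p : M) : TangentSpace (𝓡 n) p
  orient_contMDiff : ContMDiff (𝓡 n) ((𝓡 n).prod 𝓘(ℝ, EuclideanSpace ℝ (Fin n))) ∞
    (fun p ↦ (⟨p, orient p⟩ : TangentBundle (𝓡 n) M))
  orient_timelike (p : M) : val p (orient p) (orient p) < 0

section Curves

variable {n : ℕ} {M : Type*} [TopologicalSpace M] [ChartedSpace (EuclideanSpace ℝ (Fin n)) M]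

/-- The tangent vector `c'(s)` of a curve `c : ℝ → M`. -/
def velocity (n : ℕ) {M : Type*} [TopologicalSpace M]
    [ChartedSpace (EuclideanSpace ℝ (Fin n)) M] (c : ℝ → M) (s : ℝ) :
    TangentSpace (𝓡 n) (c s) :=
  mfderiv 𝓘(ℝ, ℝ) (𝓡 n) c s (1 : ℝ)

variable [IsManifold (𝓡 n) ∞ M]

/-- The coefficients of the metric in the chart around `p₀`: the bilinear form at the point `y`
of the chart's target, applied to coordinate vectors `v`, `w`. -/
def LorentzianMetric.inChart (g : LorentzianMetric n M) (p₀ : M)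
    (y v w : EuclideanSpace ℝ (Fin n)) : ℝ :=
  g.val ((extChartAt (𝓡 n) p₀).symm y)
    (mfderiv 𝓘(ℝ, EuclideanSpace ℝ (Fin n)) (𝓡 n) (extChartAt (𝓡 n) p₀).symm y v)
    (mfderiv 𝓘(ℝ, EuclideanSpace ℝ (Fin n)) (𝓡 n) (extChartAt (𝓡 n) p₀).symm y w)

/-- `c` is a geodesic (of the Levi-Civita connection, affinely parametrized) on the open parameter
set `J`: it is smooth on `J`, and in each chart its coordinate expression `u` satisfies
`d/ds g_u(u', w) = ½ (∂_w g)_u(u', u')` for every constant vector `w`. This is the geodesic equation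
`u'' + Γ(u',u') = 0` with the index lowered by means of the metric. -/
def LorentzianMetric.IsGeodesicOn (g : LorentzianMetric n M) (c : ℝ → M) (J : Set ℝ) : Prop :=
  ContMDiffOn 𝓘(ℝ, ℝ) (𝓡 n) ∞ c J ∧
  ∀ s ∈ J, ∀ p₀ : M, c s ∈ (extChartAt (𝓡 n) p₀).source →
    ∀ w : EuclideanSpace ℝ (Fin n),
      HasDerivAt
        (fun r ↦ g.inChart p₀ (extChartAt (𝓡 n) p₀ (c r))
          (deriv (fun r' ↦ extChartAt (𝓡 n) p₀ (c r')) r) w)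
        ((1 / 2 : ℝ) * fderiv ℝ
          (fun y ↦ g.inChart p₀ y
            (deriv (fun r' ↦ extChartAt (𝓡 n) p₀ (c r')) s)
            (deriv (fun r' ↦ extChartAt (𝓡 n) p₀ (c r')) s))
          (extChartAt (𝓡 n) p₀ (c s)) w)
        s

/-- `U` is a normal neighbourhood of `q`: the exponential map at `q` restricts to a diffeomorphism
`e` of an open set, star-shaped about `0`, of the tangent space at `q` onto `U`. That `e` is the
exponential map is expressed by: `s ↦ e (s v)` is the geodesic with initial velocity `v`. -/
def LorentzianMetric.IsNormalNbhd (g : LorentzianMetric n M) (q : M) (U : Set M) : Prop :=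
  ∃ e : OpenPartialHomeomorph (EuclideanSpace ℝ (Fin n)) M,
    (0 : EuclideanSpace ℝ (Fin n)) ∈ e.source ∧
    StarConvex ℝ (0 : EuclideanSpace ℝ (Fin n)) e.source ∧
    e.target = U ∧
    ContMDiffOn 𝓘(ℝ, EuclideanSpace ℝ (Fin n)) (𝓡 n) ∞ e e.source ∧
    ContMDiffOn (𝓡 n) 𝓘(ℝ, EuclideanSpace ℝ (Fin n)) ∞ e.symm e.target ∧
    e 0 = q ∧
    ∀ v ∈ e.source,
      g.IsGeodesicOn (fun s : ℝ ↦ e (s • v)) {s : ℝ | s • v ∈ e.source} ∧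
      (velocity n (fun s : ℝ ↦ e (s • v)) 0 : EuclideanSpace ℝ (Fin n)) = v

/-- `U` is convex normal: open, and a normal neighbourhood of each of its points. -/
def LorentzianMetric.IsConvexNormal (g : LorentzianMetric n M) (U : Set M) : Prop :=
  IsOpen U ∧ ∀ q ∈ U, g.IsNormalNbhd q U

namespace Spacetime

/-- A tangent vector is future pointing timelike. -/
def FutureTimelike (S : Spacetime n M) {p : M} (v : TangentSpace (𝓡 n) p) : Prop :=
  S.val p v v < 0 ∧ S.val p v (S.orient p) < 0

/-- A tangent vector is past pointing timelike. -/
def PastTimelike (S : Spacetime n M) {p : M} (v : TangentSpace (𝓡 n) p) : Prop :=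
  S.val p v v < 0 ∧ 0 < S.val p v (S.orient p)

/-- `c` is a timelike curve on the parameter interval `J`: smooth (on a neighbourhood of every point
of `J`), causal (future pointing or past pointing), and with timelike tangents. -/
def IsTimelikeOn (S : Spacetime n M) (c : ℝ → M) (J : Set ℝ) : Prop :=
  (∀ s ∈ J, ContMDiffAt 𝓘(ℝ, ℝ) (𝓡 n) ∞ c s) ∧
  ((∀ s ∈ J, S.FutureTimelike (velocity n c s)) ∨ (∀ s ∈ J, S.PastTimelike (velocity n c s)))

/-- The relation `I_U`: `p` and `q` are joined by a timelike curve inside `U`. -/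
def ChronIn (S : Spacetime n M) (U : Set M) (p q : M) : Prop :=
  ∃ c : ℝ → M, S.IsTimelikeOn c (Icc 0 1) ∧ MapsTo c (Icc 0 1) U ∧ c 0 = p ∧ c 1 = q

/-- A continuous curve `γ : ℝ → M` is essentially timelike: around each parameter `t`, the curve
stays in a convex normal neighbourhood `U` of `γ t`, and any two of its points belonging to distinct
parameters near `t` are joined by a timelike curve in `U`. -/
def IsEssentiallyTimelike (S : Spacetime n M) (γ : ℝ → M) : Prop :=
  Continuous γ ∧ ∀ t : ℝ, ∃ δ > 0, ∃ U : Set M, S.IsConvexNormal U ∧ γ t ∈ U ∧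
    MapsTo γ (Ioo (t - δ) (t + δ)) U ∧
    ∀ σ ∈ Ioo (t - δ) (t + δ), ∀ τ ∈ Ioo (t - δ) (t + δ), σ ≠ τ → S.ChronIn U (γ σ) (γ τ)

/-- A loop `ℝ/ℤ → M` is essentially timelike if its periodic lift to `ℝ` is. -/
def IsEssentiallyTimelikeLoop (S : Spacetime n M) (γ : UnitAddCircle → M) : Prop :=
  S.IsEssentiallyTimelike (fun s : ℝ ↦ γ (s : UnitAddCircle))

/-- A loop `ℝ/ℤ → M` is timelike if its periodic lift to `ℝ` is. -/
def IsTimelikeLoop (S : Spacetime n M) (γ : UnitAddCircle → M) : Prop :=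
  S.IsTimelikeOn (fun s : ℝ ↦ γ (s : UnitAddCircle)) univ

/-- `H : N × ℝ/ℤ → M` is a uniform family: continuous and proper (`IsProperMap` includes
continuity), its restriction to `N × {0}` is a smooth surjective submersion onto `M`, and each loop
`H (x, ·)` is essentially timelike. -/
structure IsUniformFamily (S : Spacetime n M) (k : ℕ) {N : Type*} [TopologicalSpace N]
    [ChartedSpace (EuclideanSpace ℝ (Fin k)) N] (H : N × UnitAddCircle → M) : Prop where
  isProperMap : IsProperMap H
  contMDiff_zero : ContMDiff (𝓡 k) (𝓡 n) ∞ (fun x : N ↦ H (x, 0))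
  surjective_zero : Surjective (fun x : N ↦ H (x, 0))
  submersion_zero : ∀ x : N, Surjective (mfderiv (𝓡 k) (𝓡 n) (fun x : N ↦ H (x, 0)) x)
  essentiallyTimelike : ∀ x : N, S.IsEssentiallyTimelikeLoop (fun t ↦ H (x, t))

end Spacetime

/-- Smoothness of a map `H : N × ℝ/ℤ → M`, for the smooth structure on `ℝ/ℤ` that makes the
projection `ℝ → ℝ/ℤ` a local diffeomorphism: the lift `N × ℝ → M` is smooth. -/
def SmoothOnCircleProduct (n k : ℕ) {M N : Type*} [TopologicalSpace M]
    [ChartedSpace (EuclideanSpace ℝ (Fin n)) M] [TopologicalSpace N]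
    [ChartedSpace (EuclideanSpace ℝ (Fin k)) N] (H : N × UnitAddCircle → M) : Prop :=
  ContMDiff ((𝓡 k).prod 𝓘(ℝ, ℝ)) (𝓡 n) ∞
    (fun z : N × ℝ ↦ H (z.1, (z.2 : UnitAddCircle)))

end Curves

end

/-! The initial points `H (x, 0)` are kept, so smoothness, surjectivity and the submersion property
at time 0 are inherited. What has to be found is a smooth family of timelike loops with these
initial points, close enough to `H` for properness to survive. Along an essentially timelike curve
only pairs of points are related; its difference quotients may be unbounded or degenerate towards
the light cone, so averaging the curves directly need not give timelike tangents.

The way out is an intermediate condition, `StrictAt`: near each point, and in a chart, all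
difference quotients in time lie in one compact convex set of future timelike vectors. It is stable
under small errors, under gluing and under averaging; it makes derivatives timelike
(`StrictAt.futureTimelike_velocity`) and curves essentially timelike (`StrictAt.exists_fchron`).

Strictness is produced by geodesic chords. In a convex normal set the Gauss lemma shows that
chronologically related points are joined by a timelike geodesic (`symm_mem_futureCone_of_le`,
`Spacetime.fchron_iff`), and near each point this chord and its velocity depend continuously on the
end points (`exists_chordSystem`). A cutoff `ρ` on the parameter manifold is built in without
interpolating curves: in a time cell `[a₀, b]` the curve is followed up to time `b - ρ x * (b - a₀)`
and then replaced by the chord to its point at time `b`. The curves remain future directed, they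
become strict where `ρ = 1`, and strictness already gained is preserved, because the velocity of a
short chord differs from a difference quotient only by a quadratic error
(`MeshSetup.exists_strict`).

A strict family is then mollified in charts, corrected by a time independent term so that the
initial points are exact, and blended with the old family by a smooth cutoff (`exists_strictAt`,
`BoxSetup.exists_smooth`). Both kinds of modification are carried out over a countable locally
finite cover; near each point only finitely many take place, so the limit exists
(`exists_limit_of_locallyFinite`).

Two global matters remain. The loops have a time direction that is locally constant in `x`, so
replacing `t` by `-t` on some components makes all of them future directed (`exists_orientation`).
Closeness is expressed by an open set containing the graph of the family, and for `properNbhd` it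
implies properness. -/

/-! ### Linear algebra of timelike vectors -/

section LorentzAlgebra

variable {n : ℕ} {M : Type*} [TopologicalSpace M] [ChartedSpace (EuclideanSpace ℝ (Fin n)) M]
  [IsManifold (𝓡 n) ∞ M]

namespace LorentzianMetric

variable (g : LorentzianMetric n M)

/-- The orthogonal complement of a timelike vector is spacelike. -/
theorem pos_of_orthogonal_timelike {p : M} {a w : TangentSpace (𝓡 n) p} (ha : g.val p a a < 0)
    (haw : g.val p a w = 0) (hw : w ≠ 0) : 0 < g.val p w w := by
  obtain ⟨v, -, hpos⟩ := g.signature p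
  by_contra! hww
  have hva : g.val p v a ≠ 0 := by
    intro h0
    have ha0 : a ≠ 0 := by
      rintro rfl
      simp at ha
    exact absurd (hpos a h0 ha0) (by linarith)
  -- The combination of `a` and `w` that is orthogonal to the reference vector `v`. Since `a` and
  -- `w` are orthogonal, its square is a sum of nonpositive terms, so positivity on the complement
  -- of `v` forces `x = 0`; pairing with `a` then rules this out.
  set x : TangentSpace (𝓡 n) p := (g.val p v w) • a - (g.val p v a) • w with hx
  have hvx : g.val p v x = 0 := by
    simp only [hx, map_sub, map_smul, smul_eq_mul]
    ring
  have hxx : g.val p x x = (g.val p v w) ^ 2 * g.val p a a + (g.val p v a) ^ 2 * g.val p w w := by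
    have hwa : g.val p w a = 0 := by rw [g.symm, haw]
    simp only [hx, map_sub, map_smul, smul_eq_mul, sub_apply,
      smul_apply, haw, hwa]
    ring
  have hax : g.val p a x = (g.val p v w) * g.val p a a := by
    simp only [hx, map_sub, map_smul, smul_eq_mul, haw]
    ring
  by_cases h : x = 0
  · have h1 : g.val p v w = 0 := by
      rw [h] at hax
      simp only [map_zero] at hax
      rcases mul_eq_zero.1 hax.symm with h2 | h2
      · exact h2
      · exact absurd h2 ha.ne
    rw [h1, zero_smul, zero_sub] at hx
    rw [h] at hx
    have := neg_eq_zero.1 hx.symm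
    rcases smul_eq_zero.1 this with h2 | h2
    · exact hva h2
    · exact hw h2
  · have := hpos x hvx h
    have h1 : 0 ≤ (g.val p v w) ^ 2 := sq_nonneg _
    have h2 : 0 ≤ (g.val p v a) ^ 2 := sq_nonneg _
    nlinarith [mul_nonneg h1 (neg_nonneg.2 ha.le), mul_nonneg h2 (neg_nonneg.2 hww)]

theorem ne_zero_of_timelike {p : M} {a : TangentSpace (𝓡 n) p} (ha : g.val p a a < 0) :
    a ≠ 0 := by
  rintro rfl
  simp at ha

/-- Two timelike vectors are never orthogonal. -/
theorem timelike_pairing_ne_zero {p : M} {a b : TangentSpace (𝓡 n) p} (ha : g.val p a a < 0)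
    (hb : g.val p b b < 0) : g.val p a b ≠ 0 := fun h ↦
  absurd (g.pos_of_orthogonal_timelike ha h (g.ne_zero_of_timelike hb)) hb.not_gt

theorem nondegenerate {p : M} {a : TangentSpace (𝓡 n) p} (ha : ∀ w, g.val p a w = 0) : a = 0 := by
  by_contra h
  obtain ⟨v, -, hpos⟩ := g.signature p
  have := hpos a (by rw [g.symm, ha]) h
  rw [ha] at this
  exact lt_irrefl _ this

end LorentzianMetric

namespace Spacetime

variable (S : Spacetime n M)

/-- If the pairing were positive, a positive combination of `a` and the orienting vector would be
orthogonal to `b`. All terms of its square are negative, so it is timelike, and two timelike vectors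
are never orthogonal. -/
theorem FutureTimelike.pairing_neg {S : Spacetime n M} {p : M} {a b : TangentSpace (𝓡 n) p}
    (ha : S.FutureTimelike a) (hb : S.FutureTimelike b) : S.val p a b < 0 := by
  by_contra! h
  have hab : 0 < S.val p a b :=
    lt_of_le_of_ne h (S.timelike_pairing_ne_zero ha.1 hb.1).symm
  set T := S.orient p
  have ha2 := ha.2
  have hb2 := hb.2
  set x : TangentSpace (𝓡 n) p := (-S.val p b T) • a + (S.val p a b) • T with hx
  have hba : S.val p b a = S.val p a b := S.symm _ _ _
  have hTa : S.val p T a = S.val p a T := S.symm _ _ _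
  have hbx : S.val p b x = 0 := by
    simp only [hx, map_add, map_smul, smul_eq_mul, hba]
    ring
  have hxx : S.val p x x < 0 := by
    have : S.val p x x = (S.val p b T) ^ 2 * S.val p a a
        + 2 * ((-S.val p b T) * S.val p a b * S.val p a T)
        + (S.val p a b) ^ 2 * S.val p T T := by
      simp only [hx, map_add, map_smul, smul_eq_mul, add_apply,
        smul_apply, hTa]
      ring
    rw [this]
    have h1 : (S.val p b T) ^ 2 * S.val p a a < 0 :=
      mul_neg_of_pos_of_neg (by have := hb2.ne; positivity) ha.1
    have h2 : (-S.val p b T) * S.val p a b * S.val p a T < 0 :=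
      mul_neg_of_pos_of_neg (mul_pos (neg_pos.2 hb2) hab) ha2
    have h3 : (S.val p a b) ^ 2 * S.val p T T < 0 :=
      mul_neg_of_pos_of_neg (by positivity) (S.orient_timelike p)
    linarith
  exact S.timelike_pairing_ne_zero hb.1 hxx hbx

theorem FutureTimelike.add {S : Spacetime n M} {p : M} {a b : TangentSpace (𝓡 n) p}
    (ha : S.FutureTimelike a) (hb : S.FutureTimelike b) : S.FutureTimelike (a + b) := by
  have hab := ha.pairing_neg hb
  have hba : S.val p b a = S.val p a b := S.symm _ _ _
  refine ⟨?_, ?_⟩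
  · simp only [map_add, add_apply, hba]
    linarith [ha.1, hb.1]
  · simp only [map_add, add_apply]
    linarith [ha.2, hb.2]

theorem FutureTimelike.smul {S : Spacetime n M} {p : M} {a : TangentSpace (𝓡 n) p}
    (ha : S.FutureTimelike a) {c : ℝ} (hc : 0 < c) : S.FutureTimelike (c • a) := by
  refine ⟨?_, ?_⟩
  · simp only [map_smul, smul_apply, smul_eq_mul]
    exact mul_neg_of_pos_of_neg hc (mul_neg_of_pos_of_neg hc ha.1)
  · simp only [map_smul, smul_apply, smul_eq_mul]
    exact mul_neg_of_pos_of_neg hc ha.2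

/-- The same metric with the opposite time orientation. -/
noncomputable def reverse : Spacetime n M where
  toLorentzianMetric := S.toLorentzianMetric
  orient p := - S.orient p
  orient_contMDiff := by
    have := S.orient_contMDiff
    exact this.neg_section
  orient_timelike p := by simpa using S.orient_timelike p

/-- Every statement about the past becomes a statement about the future of the reversed spacetime,
so only future directed curves have to be studied. -/
theorem futureTimelike_reverse {p : M} {a : TangentSpace (𝓡 n) p} :
    S.reverse.FutureTimelike a ↔ S.PastTimelike a := by
  unfold FutureTimelike PastTimelike
  simp [reverse]

theorem futureTimelike_reverse_neg {p : M} {a : TangentSpace (𝓡 n) p} :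
    S.reverse.FutureTimelike (-a) ↔ S.FutureTimelike a := by
  unfold FutureTimelike
  simp [reverse]

end Spacetime

end LorentzAlgebra

/-! ### Pulling the metric back to the model space -/

section Pullback

variable {n : ℕ} {M : Type*} [TopologicalSpace M] [ChartedSpace (EuclideanSpace ℝ (Fin n)) M]
  [IsManifold (𝓡 n) ∞ M]

local notation "𝔼" => EuclideanSpace ℝ (Fin n)

/-- The derivative of a map from the model space to `M`, as an endomorphism of the model space. -/
noncomputable def dmap (n : ℕ) {M : Type*} [TopologicalSpace M]
    [ChartedSpace (EuclideanSpace ℝ (Fin n)) M] (ψ : EuclideanSpace ℝ (Fin n) → M)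
    (b : EuclideanSpace ℝ (Fin n)) : EuclideanSpace ℝ (Fin n) →L[ℝ] EuclideanSpace ℝ (Fin n) :=
  mfderiv 𝓘(ℝ, EuclideanSpace ℝ (Fin n)) (𝓡 n) ψ b

namespace LorentzianMetric

variable (g : LorentzianMetric n M)

/-- The metric at a point as a bilinear form on the model space. -/
noncomputable def form (p : M) : 𝔼 →L[ℝ] 𝔼 →L[ℝ] ℝ := g.val p

/-- The pullback of the metric under a map from the model space. -/
noncomputable def pullback (ψ : 𝔼 → M) (b : 𝔼) : 𝔼 →L[ℝ] 𝔼 →L[ℝ] ℝ :=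
  (g.form (ψ b)).bilinearComp (dmap n ψ b) (dmap n ψ b)

theorem pullback_symm (ψ : 𝔼 → M) (b v w : 𝔼) :
    g.pullback ψ b v w = g.pullback ψ b w v := g.symm _ _ _

end LorentzianMetric

/-- This is the tangent map of `ψ` composed with the constant section `v`; on the open set `s`
derivatives within `s` are ordinary derivatives. -/
theorem contMDiffOn_mk_dmap {ψ : 𝔼 → M} {s : Set 𝔼} (hs : IsOpen s)
    (hψ : ContMDiffOn 𝓘(ℝ, 𝔼) (𝓡 n) ∞ ψ s) (v : 𝔼) :
    ContMDiffOn 𝓘(ℝ, 𝔼) ((𝓡 n).prod 𝓘(ℝ, 𝔼)) ∞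
      (fun b ↦ (⟨ψ b, dmap n ψ b v⟩ : TangentBundle (𝓡 n) M)) s := by
  have h1 := hψ.contMDiffOn_tangentMapWithin (m := ∞) (by simp) hs.uniqueMDiffOn
  have h2 : ContMDiff 𝓘(ℝ, 𝔼) (𝓘(ℝ, 𝔼).prod 𝓘(ℝ, 𝔼)) ∞
      (fun b ↦ (⟨b, (fun _ ↦ v : Π (x : 𝔼), TangentSpace 𝓘(ℝ, 𝔼) x) b⟩ :
        TangentBundle 𝓘(ℝ, 𝔼) 𝔼)) := by
    refine contMDiff_vectorSpace_iff_contDiff.2 ?_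
    exact contDiff_const
  have h3 := h1.comp h2.contMDiffOn (s := s) (fun b hb ↦ hb)
  refine h3.congr fun b hb ↦ ?_
  simp only [tangentMapWithin, mfderivWithin_of_isOpen hs hb, Function.comp]
  rfl

namespace LorentzianMetric

variable (g : LorentzianMetric n M)

/-- In finite dimension it suffices to evaluate on constant vectors `v`, `w`, and there the
coefficient is the bundle pairing of the metric with two smooth vector fields along `ψ`. -/
theorem contDiffOn_pullback {ψ : 𝔼 → M} {s : Set 𝔼} (hs : IsOpen s)
    (hψ : ContMDiffOn 𝓘(ℝ, 𝔼) (𝓡 n) ∞ ψ s) : ContDiffOn ℝ ∞ (g.pullback ψ) s := by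
  rw [contDiffOn_clm_apply]
  intro v
  rw [contDiffOn_clm_apply]
  intro w
  rw [← contMDiffOn_iff_contDiffOn]
  have h := (g.contMDiff.contMDiffOn (s := univ)).comp hψ (fun _ _ ↦ mem_univ _)
  have := ContMDiffOn.clm_bundle_apply₂ (F₁ := 𝔼) (F₂ := 𝔼) (F₃ := ℝ)
    (E₁ := TangentSpace (𝓡 n)) (E₂ := TangentSpace (𝓡 n))
    (E₃ := Bundle.Trivial M ℝ) h (contMDiffOn_mk_dmap hs hψ v)
    (contMDiffOn_mk_dmap hs hψ w)
  intro b hb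
  have h2 := this b hb
  simp only [Bundle.contMDiffWithinAt_totalSpace] at h2
  exact h2.2

end LorentzianMetric

end Pullback

set_option synthInstance.maxHeartbeats 400000

/-! ### Invariance of the geodesic equation under coordinate changes -/

section GeodesicCovariance

variable {E : Type*} [NormedAddCommGroup E] [NormedSpace ℝ E]

/-- The product rule. The second derivatives of `κ` are the terms by which a change of coordinates
disturbs the geodesic equation; they cancel in the next theorem. -/
theorem hasFDerivAt_pullback_form {G : E → E →L[ℝ] E →L[ℝ] ℝ} {κ : E → E} {b : E}
    (hG : DifferentiableAt ℝ G (κ b)) (hκ : ContDiffAt ℝ 2 κ b) (x y z : E) :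
    HasFDerivAt (fun b' ↦ G (κ b') (fderiv ℝ κ b' x) (fderiv ℝ κ b' y))
      (fderiv ℝ (fun b' ↦ G (κ b') (fderiv ℝ κ b' x) (fderiv ℝ κ b' y)) b) b ∧
    fderiv ℝ (fun b' ↦ G (κ b') (fderiv ℝ κ b' x) (fderiv ℝ κ b' y)) b z =
      fderiv ℝ G (κ b) (fderiv ℝ κ b z) (fderiv ℝ κ b x) (fderiv ℝ κ b y)
      + G (κ b) (fderiv ℝ (fderiv ℝ κ) b z x) (fderiv ℝ κ b y)
      + G (κ b) (fderiv ℝ κ b x) (fderiv ℝ (fderiv ℝ κ) b z y) := by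
  have h1 : HasFDerivAt κ (fderiv ℝ κ b) b := (hκ.differentiableAt (by norm_num)).hasFDerivAt
  have h2 : HasFDerivAt (fderiv ℝ κ) (fderiv ℝ (fderiv ℝ κ) b) b :=
    ((hκ.fderiv_right (m := 1) (by norm_num)).differentiableAt (by norm_num)).hasFDerivAt
  have h3 : HasFDerivAt (fun b' ↦ G (κ b')) _ b :=
    HasFDerivAt.comp (g := G) (f := κ) b hG.hasFDerivAt h1
  have hx := h2.clm_apply (hasFDerivAt_const x b)
  have hy := h2.clm_apply (hasFDerivAt_const y b)
  have h4 := (h3.clm_apply hx).clm_apply hy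
  refine ⟨h4.differentiableAt.hasFDerivAt, ?_⟩
  rw [h4.fderiv]
  simp
  ring

/-- The geodesic equation is invariant under changes of coordinates; here it is transported to
coordinates in which the geodesics are straight lines through the origin. -/
theorem fderiv_pullback_form_of_geodesic {G : E → E →L[ℝ] E →L[ℝ] ℝ} {κ : E → E} {v : E} {s : ℝ}
    (hG : DifferentiableAt ℝ G (κ (s • v))) (hsymm : ∀ y a c, G y a c = G y c a)
    (hκ : ContDiffAt ℝ 2 κ (s • v))
    (hgeo : ∀ w, HasDerivAt (fun r : ℝ ↦ G (κ (r • v)) (deriv (fun r' : ℝ ↦ κ (r' • v)) r) w)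
      ((1 / 2 : ℝ) * fderiv ℝ (fun y ↦ G y (deriv (fun r' : ℝ ↦ κ (r' • v)) s)
        (deriv (fun r' : ℝ ↦ κ (r' • v)) s)) (κ (s • v)) w) s) (w : E) :
    fderiv ℝ (fun b' ↦ G (κ b') (fderiv ℝ κ b' v) (fderiv ℝ κ b' w)) (s • v) v =
      (1 / 2 : ℝ) * fderiv ℝ (fun b' ↦ G (κ b') (fderiv ℝ κ b' v) (fderiv ℝ κ b' v)) (s • v) w := by
  set b := s • v with hb
  have hline : ∀ r : ℝ, HasDerivAt (fun r' : ℝ ↦ r' • v) v r := fun r ↦ by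
    simpa using (hasDerivAt_id r).smul_const v
  have hder : ∀ r : ℝ, DifferentiableAt ℝ κ (r • v) →
      deriv (fun r' : ℝ ↦ κ (r' • v)) r = fderiv ℝ κ (r • v) v := fun r hr ↦
    (hr.hasFDerivAt.comp_hasDerivAt r (hline r)).deriv
  have hds : deriv (fun r' : ℝ ↦ κ (r' • v)) s = fderiv ℝ κ b v :=
    hder s (hκ.differentiableAt (by norm_num))
  have hev : ∀ᶠ r in 𝓝 s, DifferentiableAt ℝ κ (r • v) := by
    have h1 : ∀ᶠ b' in 𝓝 b, DifferentiableAt ℝ κ b' := by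
      filter_upwards [hκ.eventually (by norm_num)] with b' hb'
      exact hb'.differentiableAt (by norm_num)
    exact (hline s).continuousAt.eventually h1
  have h1 : HasFDerivAt κ (fderiv ℝ κ b) b := (hκ.differentiableAt (by norm_num)).hasFDerivAt
  have h2 : HasFDerivAt (fderiv ℝ κ) (fderiv ℝ (fderiv ℝ κ) b) b :=
    ((hκ.fderiv_right (m := 1) (by norm_num)).differentiableAt (by norm_num)).hasFDerivAt
  have h3 : HasFDerivAt (fun b' ↦ G (κ b')) _ b :=
    HasFDerivAt.comp (g := G) (f := κ) b hG.hasFDerivAt h1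
  -- The geodesic equation is tested against a constant vector, so the image of `w` is frozen at the
  -- base point. Letting it vary adds a term with `κ''(v, w)` on the left and one with `κ''(w, v)`
  -- on the right; these agree by symmetry of second derivatives.
  set w' := fderiv ℝ κ b w with hw'
  have h5 := (h3.clm_apply (h2.clm_apply (hasFDerivAt_const v b))).clm_apply
    (hasFDerivAt_const w' b)
  have h6 := h5.comp_hasDerivAt s (hline s)
  have h7 := (hgeo w').congr_of_eventuallyEq (f₁ := fun r : ℝ ↦
      G (κ (r • v)) (fderiv ℝ κ (r • v) v) w') (by
    filter_upwards [hev] with r hr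
    rw [hder r hr])
  have h8 := h6.unique h7
  have h9 : fderiv ℝ (fun y ↦ G y (fderiv ℝ κ b v) (fderiv ℝ κ b v)) (κ b) w' =
      fderiv ℝ G (κ b) w' (fderiv ℝ κ b v) (fderiv ℝ κ b v) := by
    have := (hG.hasFDerivAt.clm_apply (hasFDerivAt_const (fderiv ℝ κ b v) (κ b))).clm_apply
      (hasFDerivAt_const (fderiv ℝ κ b v) (κ b))
    rw [this.fderiv]
    simp
  rw [hds, h9] at h8
  rw [(hasFDerivAt_pullback_form hG hκ v w v).2, (hasFDerivAt_pullback_form hG hκ v v w).2]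
  have hsym2 : fderiv ℝ (fderiv ℝ κ) b v w = fderiv ℝ (fderiv ℝ κ) b w v :=
    (hκ.isSymmSndFDerivAt (by simp)).eq v w
  rw [hsym2, ← hw']
  rw [hsymm (κ b) (fderiv ℝ (fderiv ℝ κ) b w v)]
  simp at h8
  linarith

end GeodesicCovariance

/-! ### Normal charts and the radial geodesic equation -/

section NormalChart

variable {n : ℕ} {M : Type*} [TopologicalSpace M] [ChartedSpace (EuclideanSpace ℝ (Fin n)) M]

local notation "𝔼" => EuclideanSpace ℝ (Fin n)

theorem velocity_comp {ψ : 𝔼 → M} {κ : ℝ → 𝔼} {s : ℝ} {κ' : 𝔼}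
    (hψ : MDifferentiableAt 𝓘(ℝ, 𝔼) (𝓡 n) ψ (κ s)) (hκ : HasDerivAt κ κ' s) :
    velocity n (fun r ↦ ψ (κ r)) s = dmap n ψ (κ s) κ' := by
  have h1 : HasMFDerivAt 𝓘(ℝ, ℝ) 𝓘(ℝ, 𝔼) κ s _ := hκ.hasFDerivAt.hasMFDerivAt
  have h2 := hψ.hasMFDerivAt.comp s h1
  have h3 := h2.mfderiv
  unfold velocity
  change mfderiv 𝓘(ℝ, ℝ) (𝓡 n) (ψ ∘ κ) s (1 : ℝ) = _
  rw [h3]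
  change dmap n ψ (κ s) ((ContinuousLinearMap.toSpanSingleton ℝ κ') (1 : ℝ)) = _
  simp

theorem dmap_comp {ψ : 𝔼 → M} {κ : 𝔼 → 𝔼} {b : 𝔼}
    (hψ : MDifferentiableAt 𝓘(ℝ, 𝔼) (𝓡 n) ψ (κ b)) (hκ : DifferentiableAt ℝ κ b) :
    dmap n (fun b' ↦ ψ (κ b')) b = (dmap n ψ (κ b)).comp (fderiv ℝ κ b) := by
  have h1 : HasMFDerivAt 𝓘(ℝ, 𝔼) 𝓘(ℝ, 𝔼) κ b _ := hκ.hasFDerivAt.hasMFDerivAt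
  have h2 := hψ.hasMFDerivAt.comp b h1
  exact h2.mfderiv

theorem dmap_congr {ψ ψ' : 𝔼 → M} {b : 𝔼} (h : ψ =ᶠ[𝓝 b] ψ') : dmap n ψ b = dmap n ψ' b := by
  unfold dmap
  rw [h.mfderiv_eq]

variable [IsManifold (𝓡 n) ∞ M]

/-- `e` is the exponential map at `q`, as a diffeomorphism of a star-shaped set onto `U`. -/
structure LorentzianMetric.NormalChart (g : LorentzianMetric n M) (q : M) (U : Set M)
    (e : OpenPartialHomeomorph (EuclideanSpace ℝ (Fin n)) M) : Prop where
  zero_mem : (0 : 𝔼) ∈ e.source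
  starConvex : StarConvex ℝ (0 : 𝔼) e.source
  target_eq : e.target = U
  contMDiffOn : ContMDiffOn 𝓘(ℝ, 𝔼) (𝓡 n) ∞ e e.source
  contMDiffOn_symm : ContMDiffOn (𝓡 n) 𝓘(ℝ, 𝔼) ∞ e.symm e.target
  map_zero : e 0 = q
  geodesic : ∀ v ∈ e.source, g.IsGeodesicOn (fun s : ℝ ↦ e (s • v)) {s : ℝ | s • v ∈ e.source}
  velocity_eq : ∀ v ∈ e.source, (velocity n (fun s : ℝ ↦ e (s • v)) 0 : 𝔼) = v

theorem LorentzianMetric.IsNormalNbhd.exists_normalChart {g : LorentzianMetric n M} {q : M}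
    {U : Set M} (h : g.IsNormalNbhd q U) : ∃ e, g.NormalChart q U e := by
  obtain ⟨e, h1, h2, h3, h4, h5, h6, h7⟩ := h
  exact ⟨e, h1, h2, h3, h4, h5, h6, fun v hv ↦ (h7 v hv).1, fun v hv ↦ (h7 v hv).2⟩

theorem mdifferentiableAt_extChartAt_symm' {p₀ : M} {y : 𝔼}
    (hy : y ∈ (extChartAt (𝓡 n) p₀).target) :
    MDifferentiableAt 𝓘(ℝ, 𝔼) (𝓡 n) (extChartAt (𝓡 n) p₀).symm y :=
  ((contMDiffOn_extChartAt_symm (n := ∞) p₀).contMDiffAt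
    ((isOpen_extChartAt_target p₀).mem_nhds hy)).mdifferentiableAt (by simp)

namespace LorentzianMetric.NormalChart

variable {g : LorentzianMetric n M} {q : M} {U : Set M}
  {e : OpenPartialHomeomorph (EuclideanSpace ℝ (Fin n)) M}

theorem smul_mem (h : g.NormalChart q U e) {b : 𝔼} (hb : b ∈ e.source) {s : ℝ}
    (hs : s ∈ Icc (0 : ℝ) 1) : s • b ∈ e.source :=
  h.starConvex.smul_mem hb hs.1 hs.2

theorem contMDiffAt (h : g.NormalChart q U e) {b : 𝔼} (hb : b ∈ e.source) :
    ContMDiffAt 𝓘(ℝ, 𝔼) (𝓡 n) ∞ e b :=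
  h.contMDiffOn.contMDiffAt (e.open_source.mem_nhds hb)

theorem mdifferentiableAt (h : g.NormalChart q U e) {b : 𝔼} (hb : b ∈ e.source) :
    MDifferentiableAt 𝓘(ℝ, 𝔼) (𝓡 n) e b :=
  (h.contMDiffAt hb).mdifferentiableAt (by simp)

theorem contDiffOn_pullback (h : g.NormalChart q U e) :
    ContDiffOn ℝ ∞ (g.pullback e) e.source :=
  g.contDiffOn_pullback e.open_source h.contMDiffOn

theorem differentiableAt_pullback (h : g.NormalChart q U e) {b : 𝔼} (hb : b ∈ e.source) :
    DifferentiableAt ℝ (g.pullback e) b :=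
  (h.contDiffOn_pullback.contDiffAt (e.open_source.mem_nhds hb)).differentiableAt (by simp)

/-- The coordinate expression of a normal chart. -/
theorem contDiffAt_chart_comp (h : g.NormalChart q U e) {b : 𝔼} (hb : b ∈ e.source) {p₀ : M}
    (hp : e b ∈ (extChartAt (𝓡 n) p₀).source) :
    ContDiffAt ℝ ∞ (fun b' ↦ extChartAt (𝓡 n) p₀ (e b')) b := by
  rw [← contMDiffAt_iff_contDiffAt]
  have h1 : ContMDiffAt (𝓡 n) 𝓘(ℝ, 𝔼) ∞ (extChartAt (𝓡 n) p₀) (e b) :=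
    contMDiffAt_extChartAt' (by rwa [extChartAt_source] at hp)
  exact h1.comp b (h.contMDiffAt hb)

/-- The chain rule for `e` written as the inverse chart after its coordinate expression. A whole
neighbourhood of `b` is needed because the pulled back metric will be differentiated. -/
theorem eventually_pullback_eq (h : g.NormalChart q U e) {b : 𝔼} (hb : b ∈ e.source) {p₀ : M}
    (hp : e b ∈ (extChartAt (𝓡 n) p₀).source) :
    ∀ᶠ b' in 𝓝 b, dmap n e b' = (dmap n (extChartAt (𝓡 n) p₀).symm (extChartAt (𝓡 n) p₀ (e b'))).comp
      (fderiv ℝ (fun b' ↦ extChartAt (𝓡 n) p₀ (e b')) b') := by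
  have h1 : ∀ᶠ b' in 𝓝 b, e b' ∈ (extChartAt (𝓡 n) p₀).source :=
    (e.continuousAt hb).eventually ((isOpen_extChartAt_source p₀).mem_nhds hp)
  filter_upwards [h1.eventually_nhds, e.open_source.mem_nhds hb] with b' hb' hbs
  rw [← dmap_comp (mdifferentiableAt_extChartAt_symm' ((extChartAt (𝓡 n) p₀).map_source hb'.self_of_nhds))
    ((h.contDiffAt_chart_comp hbs hb'.self_of_nhds).differentiableAt (by simp))]
  refine dmap_congr ?_
  filter_upwards [hb'] with b'' hb''
  exact ((extChartAt (𝓡 n) p₀).left_inv hb'').symm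

/-- In normal coordinates the geodesic `s • v` has constant velocity `v`, so its equation only
involves first derivatives of the metric. It is read off in the chart around `e (s • v)` and
transported by covariance. -/
theorem fderiv_pullback (h : g.NormalChart q U e) {v : 𝔼} {s : ℝ} (hv : v ∈ e.source)
    (hs : s • v ∈ e.source) (w : 𝔼) :
    fderiv ℝ (g.pullback e) (s • v) v v w = (1 / 2 : ℝ) * fderiv ℝ (g.pullback e) (s • v) w v v := by
  set p₀ := e (s • v) with hp₀
  have hp : e (s • v) ∈ (extChartAt (𝓡 n) p₀).source := mem_extChartAt_source p₀
  set κ : 𝔼 → 𝔼 := fun b' ↦ extChartAt (𝓡 n) p₀ (e b') with hκdef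
  set G := g.pullback (extChartAt (𝓡 n) p₀).symm with hGdef
  have hG : DifferentiableAt ℝ G (κ (s • v)) := by
    have := g.contDiffOn_pullback (isOpen_extChartAt_target p₀)
      (contMDiffOn_extChartAt_symm (n := ∞) p₀)
    exact (this.contDiffAt ((isOpen_extChartAt_target p₀).mem_nhds
      ((extChartAt (𝓡 n) p₀).map_source hp))).differentiableAt (by simp)
  have hκ : ContDiffAt ℝ 2 κ (s • v) := (h.contDiffAt_chart_comp hs hp).of_le
    (WithTop.coe_le_coe.2 le_top)
  have key := fderiv_pullback_form_of_geodesic (G := G) (κ := κ) (v := v) (s := s) hG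
    (fun y a c ↦ g.pullback_symm _ _ _ _) hκ (fun w ↦ (h.geodesic v hv).2 s hs p₀ hp w) w
  have hev : ∀ x y : 𝔼, (fun b' ↦ G (κ b') (fderiv ℝ κ b' x) (fderiv ℝ κ b' y)) =ᶠ[𝓝 (s • v)]
      (fun b' ↦ g.pullback e b' x y) := by
    intro x y
    filter_upwards [h.eventually_pullback_eq hs hp, (e.continuousAt hs).eventually
      ((isOpen_extChartAt_source p₀).mem_nhds hp)] with b' hb' hb2
    have hinv : (extChartAt (𝓡 n) p₀).symm (κ b') = e b' := (extChartAt (𝓡 n) p₀).left_inv hb2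
    have e1 : G (κ b') (fderiv ℝ κ b' x) (fderiv ℝ κ b' y) =
      g.form ((extChartAt (𝓡 n) p₀).symm (κ b'))
        (((dmap n (extChartAt (𝓡 n) p₀).symm (κ b')).comp (fderiv ℝ κ b')) x)
        (((dmap n (extChartAt (𝓡 n) p₀).symm (κ b')).comp (fderiv ℝ κ b')) y) := rfl
    rw [e1, hinv]
    change _ = g.form (e b') (dmap n e b' x) (dmap n e b' y)
    rw [hb']
  have hd : ∀ x y z : 𝔼, fderiv ℝ (fun b' ↦ g.pullback e b' x y) (s • v) z =
      fderiv ℝ (g.pullback e) (s • v) z x y := by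
    intro x y z
    have := ((h.differentiableAt_pullback hs).hasFDerivAt.clm_apply
      (hasFDerivAt_const x (s • v))).clm_apply (hasFDerivAt_const y (s • v))
    rw [this.fderiv]
    simp
  rw [(hev v w).fderiv_eq, (hev v v).fderiv_eq, hd, hd] at key
  exact key

end LorentzianMetric.NormalChart

end NormalChart

/-! ### The Gauss lemma and timelike radial geodesics -/

section GaussLemma

variable {n : ℕ} {M : Type*} [TopologicalSpace M] [ChartedSpace (EuclideanSpace ℝ (Fin n)) M]
  [IsManifold (𝓡 n) ∞ M]

local notation "𝔼" => EuclideanSpace ℝ (Fin n)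

namespace LorentzianMetric.NormalChart

variable {g : LorentzianMetric n M} {q : M} {U : Set M}
  {e : OpenPartialHomeomorph (EuclideanSpace ℝ (Fin n)) M}

theorem hasDerivAt_pullback_line (h : g.NormalChart q U e) {b : 𝔼} {s : ℝ}
    (hs : s • b ∈ e.source) (x y : 𝔼) :
    HasDerivAt (fun r : ℝ ↦ g.pullback e (r • b) x y)
      (fderiv ℝ (g.pullback e) (s • b) b x y) s := by
  have hline : HasDerivAt (fun r' : ℝ ↦ r' • b) b s := by
    simpa using (hasDerivAt_id s).smul_const b
  have h1 := ((h.differentiableAt_pullback hs).hasFDerivAt.clm_apply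
    (hasFDerivAt_const x (s • b))).clm_apply (hasFDerivAt_const y (s • b))
  have h2 := h1.comp_hasDerivAt s hline
  simpa [Function.comp_def] using h2

/-- Putting `w = b` in the radial geodesic equation shows that the derivative along the ray is half
of itself, hence zero: geodesics have constant speed. -/
theorem pullback_radial_line (h : g.NormalChart q U e) {b : 𝔼} (hb : b ∈ e.source) {s : ℝ}
    (hs : s ∈ Icc (0 : ℝ) 1) : g.pullback e (s • b) b b = g.pullback e 0 b b := by
  have hd : ∀ r ∈ Icc (0 : ℝ) 1, HasDerivAt (fun r : ℝ ↦ g.pullback e (r • b) b b) 0 r := by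
    intro r hr
    have hrb := h.smul_mem hb hr
    have h1 := h.hasDerivAt_pullback_line hrb b b
    have h2 := h.fderiv_pullback hb hrb b
    have h3 : fderiv ℝ (g.pullback e) (r • b) b b b = 0 := by linarith
    rwa [h3] at h1
  have := constant_of_has_deriv_right_zero (f := fun r : ℝ ↦ g.pullback e (r • b) b b)
    (fun r hr ↦ (hd r hr).continuousAt.continuousWithinAt)
    (fun r hr ↦ (hd r (Ico_subset_Icc_self hr)).hasDerivWithinAt) s hs
  simpa using this

theorem pullback_radial_self (h : g.NormalChart q U e) {b : 𝔼} (hb : b ∈ e.source) :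
    g.pullback e b b b = g.pullback e 0 b b := by
  simpa using h.pullback_radial_line hb (s := 1) (by simp)

/-- The derivative of the identity `pullback_radial_self` in the direction `w`. -/
theorem fderiv_radial (h : g.NormalChart q U e) {b : 𝔼} (hb : b ∈ e.source) (w : 𝔼) :
    fderiv ℝ (g.pullback e) b w b b + 2 * g.pullback e b b w = 2 * g.pullback e 0 b w := by
  have hid : HasFDerivAt (fun b' : 𝔼 ↦ b') (ContinuousLinearMap.id ℝ 𝔼) b := hasFDerivAt_id b
  have h1 := ((h.differentiableAt_pullback hb).hasFDerivAt.clm_apply hid).clm_apply hid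
  have h2 := ((hasFDerivAt_const (g.pullback e 0) b).clm_apply hid).clm_apply hid
  have h3 : (fun b' ↦ g.pullback e b' b' b') =ᶠ[𝓝 b] (fun b' ↦ g.pullback e 0 b' b') := by
    filter_upwards [e.open_source.mem_nhds hb] with b' hb'
    exact h.pullback_radial_self hb'
  have h4 := congrArg (fun L : 𝔼 →L[ℝ] ℝ ↦ L w) ((h1.congr_of_eventuallyEq h3.symm).unique h2)
  simp at h4
  have s1 := g.pullback_symm e b b w
  have s2 := g.pullback_symm e 0 b w
  linarith

/-- **Gauss lemma**. -/
theorem gauss (h : g.NormalChart q U e) {b : 𝔼} (hb : b ∈ e.source) (w : 𝔼) :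
    g.pullback e b b w = g.pullback e 0 b w := by
  -- The product `r * h(b, w)`, with `h` the pulled back metric at `r • b`, is shown to be linear in
  -- `r`. The radial geodesic equation turns its derivative into an expression that `fderiv_radial`
  -- evaluates; the latter carries a factor `r`, so `r = 0` is treated separately.
  have hd : ∀ r ∈ Icc (0 : ℝ) 1,
      HasDerivAt (fun r : ℝ ↦ r * g.pullback e (r • b) b w) (g.pullback e 0 b w) r := by
    intro r hr
    have hrb := h.smul_mem hb hr
    have h1 := (hasDerivAt_id r).mul (h.hasDerivAt_pullback_line hrb b w)
    refine h1.congr_deriv ?_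
    rcases hr.1.eq_or_lt with h0 | h0
    · subst h0
      simp
    · have h2 := h.fderiv_pullback hb hrb w
      have h3 := h.fderiv_radial hrb w
      simp only [map_smul, smul_apply, smul_eq_mul] at h3
      have h4 : r * r * fderiv ℝ (g.pullback e) (r • b) w b b + 2 * (r * g.pullback e (r • b) b w)
        = 2 * (r * g.pullback e 0 b w) := by linarith
      have h5 : r * (r * fderiv ℝ (g.pullback e) (r • b) b b w) =
          r * (g.pullback e 0 b w - g.pullback e (r • b) b w) := by
        rw [h2]
        linarith
      have h6 := mul_left_cancel₀ h0.ne' h5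
      simp only [id, one_mul]
      linarith
  have hd2 : ∀ r ∈ Icc (0 : ℝ) 1,
      HasDerivAt (fun r : ℝ ↦ r * g.pullback e (r • b) b w - r * g.pullback e 0 b w) 0 r := by
    intro r hr
    have := (hd r hr).sub ((hasDerivAt_id r).mul_const (g.pullback e 0 b w))
    exact this.congr_deriv (by simp)
  have := constant_of_has_deriv_right_zero
    (f := fun r : ℝ ↦ r * g.pullback e (r • b) b w - r * g.pullback e 0 b w)
    (fun r hr ↦ (hd2 r hr).continuousAt.continuousWithinAt)
    (fun r hr ↦ (hd2 r (Ico_subset_Icc_self hr)).hasDerivWithinAt) 1 (by simp)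
  simp at this
  linarith

theorem velocity_radial (h : g.NormalChart q U e) {b : 𝔼} {s : ℝ} (hs : s • b ∈ e.source) :
    velocity n (fun r : ℝ ↦ e (r • b)) s = dmap n e (s • b) b :=
  velocity_comp (h.mdifferentiableAt hs) (by simpa using (hasDerivAt_id s).smul_const b)

/-- The normalisation of `e` only concerns vectors in its source. Every `v` gets there after
multiplication by a small `r ≠ 0`, which cancels by linearity. -/
theorem dmap_zero (h : g.NormalChart q U e) (v : 𝔼) : dmap n e 0 v = v := by
  have hc : Filter.Tendsto (fun r : ℝ ↦ r • v) (𝓝[≠] 0) (𝓝 (0 : 𝔼)) := by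
    have : Continuous (fun r : ℝ ↦ r • v) := by fun_prop
    have h1 := this.tendsto 0
    rw [zero_smul] at h1
    exact h1.mono_left nhdsWithin_le_nhds
  obtain ⟨r, hr, hr0⟩ := ((hc.eventually (e.open_source.mem_nhds h.zero_mem)).and
    self_mem_nhdsWithin).exists
  have h1 := h.velocity_eq (r • v) hr
  have h2 := h.velocity_radial (b := r • v) (s := 0) (by simpa using h.zero_mem)
  have h3 : dmap n e ((0 : ℝ) • (r • v)) (r • v) = r • v := h2.symm.trans h1
  rw [zero_smul, map_smul] at h3
  exact smul_right_injective _ hr0 h3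

theorem pullback_zero (h : g.NormalChart q U e) (v w : 𝔼) :
    g.pullback e 0 v w = g.form q v w := by
  have : g.pullback e 0 v w = g.form (e 0) (dmap n e 0 v) (dmap n e 0 w) := rfl
  rw [this, h.dmap_zero, h.dmap_zero, h.map_zero]

end LorentzianMetric.NormalChart

namespace Spacetime

variable (S : Spacetime n M)

/-- The time orienting vector at a point as an element of the model space. -/
noncomputable def orientVec (p : M) : 𝔼 := S.orient p

/-- The pullback of the time orientation covector under a map from the model space. -/
noncomputable def orientPullback (ψ : 𝔼 → M) (b : 𝔼) : 𝔼 →L[ℝ] ℝ :=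
  ((S.form (ψ b)).flip (S.orientVec (ψ b))).comp (dmap n ψ b)

theorem orientPullback_apply (ψ : 𝔼 → M) (b v : 𝔼) :
    S.orientPullback ψ b v = S.form (ψ b) (dmap n ψ b v) (S.orientVec (ψ b)) := rfl

theorem contDiffOn_orientPullback {ψ : 𝔼 → M} {s : Set 𝔼} (hs : IsOpen s)
    (hψ : ContMDiffOn 𝓘(ℝ, 𝔼) (𝓡 n) ∞ ψ s) : ContDiffOn ℝ ∞ (S.orientPullback ψ) s := by
  rw [contDiffOn_clm_apply]
  intro v
  rw [← contMDiffOn_iff_contDiffOn]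
  have h := (S.contMDiff.contMDiffOn (s := univ)).comp hψ (fun _ _ ↦ mem_univ _)
  have h2 := (S.orient_contMDiff.contMDiffOn (s := univ)).comp hψ (fun _ _ ↦ mem_univ _)
  have := ContMDiffOn.clm_bundle_apply₂ (F₁ := 𝔼) (F₂ := 𝔼) (F₃ := ℝ)
    (E₁ := TangentSpace (𝓡 n)) (E₂ := TangentSpace (𝓡 n))
    (E₃ := Bundle.Trivial M ℝ) h (contMDiffOn_mk_dmap hs hψ v) h2
  intro b hb
  have h2 := this b hb
  simp only [Bundle.contMDiffWithinAt_totalSpace] at h2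
  exact h2.2

/-- The cone of future timelike vectors at a point. -/
def futureCone (p : M) : Set 𝔼 := {v | S.form p v v < 0 ∧ S.form p v (S.orientVec p) < 0}

/-- The cone of vectors mapped to future timelike vectors by the derivative of `ψ`. -/
def pullbackCone (ψ : 𝔼 → M) (b : 𝔼) : Set 𝔼 := {v | dmap n ψ b v ∈ S.futureCone (ψ b)}

theorem mem_pullbackCone {ψ : 𝔼 → M} {b v : 𝔼} :
    v ∈ S.pullbackCone ψ b ↔ S.pullback ψ b v v < 0 ∧ S.orientPullback ψ b v < 0 := Iff.rfl

theorem futureCone_smul {p : M} {v : 𝔼} (hv : v ∈ S.futureCone p) {c : ℝ} (hc : 0 < c) :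
    c • v ∈ S.futureCone p := FutureTimelike.smul (S := S) (p := p) hv hc

theorem futureCone_smul_iff {p : M} {v : 𝔼} {c : ℝ} (hc : 0 < c) :
    c • v ∈ S.futureCone p ↔ v ∈ S.futureCone p := by
  refine ⟨fun h ↦ ?_, fun h ↦ S.futureCone_smul h hc⟩
  have := S.futureCone_smul h (inv_pos.2 hc)
  rwa [inv_smul_smul₀ hc.ne'] at this

theorem futureCone_add {p : M} {v w : 𝔼} (hv : v ∈ S.futureCone p) (hw : w ∈ S.futureCone p) :
    v + w ∈ S.futureCone p := FutureTimelike.add (S := S) (p := p) hv hw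

theorem convex_futureCone (p : M) : Convex ℝ (S.futureCone p) := by
  intro v hv w hw a b ha hb hab
  rcases ha.eq_or_lt with rfl | ha
  · simp at hab
    subst hab
    simpa using hw
  rcases hb.eq_or_lt with rfl | hb
  · simp at hab
    subst hab
    simpa using hv
  exact S.futureCone_add (S.futureCone_smul hv ha) (S.futureCone_smul hw hb)

theorem futureCone_pairing {p : M} {v w : 𝔼} (hv : v ∈ S.futureCone p) (hw : w ∈ S.futureCone p) :
    S.form p v w < 0 := FutureTimelike.pairing_neg (S := S) (p := p) hv hw

theorem form_orient_ne_zero {p : M} {v : 𝔼} (hv : S.form p v v < 0) :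
    S.form p v (S.orientVec p) ≠ 0 :=
  S.timelike_pairing_ne_zero (p := p) hv (S.orient_timelike p)

theorem isOpen_futureCone (p : M) : IsOpen (S.futureCone p) := by
  have h1 : Continuous fun v : 𝔼 ↦ S.form p v v := by fun_prop
  have h2 : Continuous fun v : 𝔼 ↦ S.form p v (S.orientVec p) := by fun_prop
  exact (isOpen_lt h1 continuous_const).inter (isOpen_lt h2 continuous_const)

theorem futureCone_reverse_disjoint {p : M} {v : 𝔼} (hv : v ∈ S.futureCone p) :
    v ∉ S.reverse.futureCone p := by
  intro h
  have h1 := ((S.futureTimelike_reverse (p := p) (a := v)).1 h).2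
  have h2 : S.val p v (S.orient p) < 0 := hv.2
  linarith

/-- By constancy of speed the radial velocity stays timelike. A timelike vector is never orthogonal
to the orientation, so by the intermediate value theorem the sign of this pairing is the one at the
origin. -/
theorem radial_mem_pullbackCone {q : M} {U : Set M}
    {e : OpenPartialHomeomorph (EuclideanSpace ℝ (Fin n)) M} (h : S.NormalChart q U e) {b : 𝔼}
    (hb : b ∈ e.source) (hbc : b ∈ S.futureCone q) {s : ℝ} (hs : s ∈ Icc (0 : ℝ) 1) :
    b ∈ S.pullbackCone e (s • b) := by
  have hq : ∀ r ∈ Icc (0 : ℝ) 1, S.pullback e (r • b) b b < 0 := by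
    intro r hr
    rw [h.pullback_radial_line hb hr, h.pullback_zero]
    exact hbc.1
  have hcont : ContinuousOn (fun r : ℝ ↦ S.orientPullback e (r • b) b) (Icc 0 1) := by
    have h1 := (S.contDiffOn_orientPullback e.open_source h.contMDiffOn).continuousOn
    have h2 : ContinuousOn (fun r : ℝ ↦ S.orientPullback e (r • b)) (Icc 0 1) :=
      h1.comp (by fun_prop) (fun r hr ↦ h.smul_mem hb hr)
    exact h2.clm_apply continuousOn_const
  rw [mem_pullbackCone]
  refine ⟨hq s hs, ?_⟩
  by_contra! hge
  have h0 : S.orientPullback e ((0 : ℝ) • b) b < 0 := by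
    rw [zero_smul, orientPullback_apply, h.dmap_zero, h.map_zero]
    exact hbc.2
  have hivt := intermediate_value_Icc hs.1 (hcont.mono (Icc_subset_Icc_right hs.2))
  obtain ⟨r, hr, hr0⟩ := hivt ⟨h0.le, hge⟩
  exact S.form_orient_ne_zero (hq r ⟨hr.1, hr.2.trans hs.2⟩) hr0

/-- `c` is a future pointing timelike curve from `p` to `q` inside `U`. -/
structure IsFutureCurve (U : Set M) (p q : M) (c : ℝ → M) : Prop where
  contMDiffAt : ∀ s ∈ Icc (0 : ℝ) 1, ContMDiffAt 𝓘(ℝ, ℝ) (𝓡 n) ∞ c s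
  velocity_mem : ∀ s ∈ Icc (0 : ℝ) 1, S.FutureTimelike (velocity n c s)
  mapsTo : MapsTo c (Icc 0 1) U
  map_zero : c 0 = p
  map_one : c 1 = q

/-- The chronological future relation inside `U`. -/
def FChron (U : Set M) (p q : M) : Prop := ∃ c, S.IsFutureCurve U p q c

theorem chronIn_iff {U : Set M} {p q : M} :
    S.ChronIn U p q ↔ S.FChron U p q ∨ S.reverse.FChron U p q := by
  constructor
  · rintro ⟨c, ⟨h1, h2⟩, h3, h4, h5⟩
    rcases h2 with h2 | h2
    · exact Or.inl ⟨c, h1, h2, h3, h4, h5⟩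
    · exact Or.inr ⟨c, h1, fun s hs ↦ (S.futureTimelike_reverse).2 (h2 s hs), h3, h4, h5⟩
  · rintro (⟨c, h⟩ | ⟨c, h⟩)
    · exact ⟨c, ⟨h.1, Or.inl h.2⟩, h.3, h.4, h.5⟩
    · exact ⟨c, ⟨h.1, Or.inr fun s hs ↦ (S.futureTimelike_reverse).1 (h.2 s hs)⟩, h.3, h.4, h.5⟩

theorem isFutureCurve_radial {q : M} {U : Set M}
    {e : OpenPartialHomeomorph (EuclideanSpace ℝ (Fin n)) M} (h : S.NormalChart q U e) {b : 𝔼}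
    (hb : b ∈ e.source) (hbc : b ∈ S.futureCone q) :
    S.IsFutureCurve U q (e b) (fun s : ℝ ↦ e (s • b)) where
  contMDiffAt s hs := by
    have h1 : ContMDiffAt 𝓘(ℝ, ℝ) 𝓘(ℝ, 𝔼) ∞ (fun s : ℝ ↦ s • b) s := by
      rw [contMDiffAt_iff_contDiffAt]
      fun_prop
    exact (h.contMDiffAt (h.smul_mem hb hs)).comp s h1
  velocity_mem s hs := by
    rw [h.velocity_radial (h.smul_mem hb hs)]
    exact S.radial_mem_pullbackCone h hb hbc hs
  mapsTo s hs := by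
    rw [← h.target_eq]
    exact e.map_source (h.smul_mem hb hs)
  map_zero := by simpa using h.map_zero
  map_one := by simp

end Spacetime

end GaussLemma

/-! ### Chronology in a convex normal set -/

section Chronology

variable {n : ℕ} {M : Type*} [TopologicalSpace M] [ChartedSpace (EuclideanSpace ℝ (Fin n)) M]
  [IsManifold (𝓡 n) ∞ M]

local notation "𝔼" => EuclideanSpace ℝ (Fin n)

namespace Spacetime

variable {S : Spacetime n M} {q : M} {U : Set M}
  {e : OpenPartialHomeomorph (EuclideanSpace ℝ (Fin n)) M}

/-- The expression of a future curve in a normal chart: its derivative is timelike. -/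
theorem hasDerivAt_symm_comp (h : S.NormalChart q U e) {c : ℝ → M} {s : ℝ}
    (hc : ContMDiffAt 𝓘(ℝ, ℝ) (𝓡 n) ∞ c s) (hv : S.FutureTimelike (velocity n c s))
    (hU : c s ∈ U) :
    ∃ b', HasDerivAt (fun r ↦ e.symm (c r)) b' s ∧ b' ∈ S.pullbackCone e (e.symm (c s)) := by
  have ht : c s ∈ e.target := by rwa [h.target_eq]
  have h1 : ContMDiffAt 𝓘(ℝ, ℝ) 𝓘(ℝ, 𝔼) ∞ (fun r ↦ e.symm (c r)) s :=
    (h.contMDiffOn_symm.contMDiffAt (e.open_target.mem_nhds ht)).comp s hc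
  rw [contMDiffAt_iff_contDiffAt] at h1
  have h2 : HasDerivAt (fun r ↦ e.symm (c r)) _ s :=
    (h1.differentiableAt (by simp)).hasDerivAt
  refine ⟨_, h2, ?_⟩
  have hs : e.symm (c s) ∈ e.source := e.map_target ht
  have h3 := velocity_comp (h.mdifferentiableAt hs) h2
  have h4 : (fun r ↦ e (e.symm (c r))) =ᶠ[𝓝 s] c := by
    filter_upwards [hc.continuousAt.eventually (e.open_target.mem_nhds ht)] with r hr
    exact e.right_inv hr
  have h5 : ∀ c' : ℝ → M, c' =ᶠ[𝓝 s] c → (velocity n c' s : 𝔼) = velocity n c s := by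
    intro c' hc'
    unfold velocity
    rw [hc'.mfderiv_eq]
    rfl
  have h6 : dmap n e (e.symm (c s)) (deriv (fun r ↦ e.symm (c r)) s) = velocity n c s :=
    h3.symm.trans (h5 _ h4)
  change dmap n e (e.symm (c s)) _ ∈ S.futureCone (e (e.symm (c s)))
  rw [h6, e.right_inv ht]
  exact hv

/-- A future curve which starts in the future cone of the centre of a normal neighbourhood stays
in this cone. -/
theorem symm_mem_futureCone_of_le (h : S.NormalChart q U e) {c : ℝ → M} {s₀ s₁ : ℝ}
    (hc : ∀ s ∈ Icc s₀ s₁, ContMDiffAt 𝓘(ℝ, ℝ) (𝓡 n) ∞ c s)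
    (hv : ∀ s ∈ Icc s₀ s₁, S.FutureTimelike (velocity n c s))
    (hU : MapsTo c (Icc s₀ s₁) U) (h0 : e.symm (c s₀) ∈ S.futureCone q) {s : ℝ}
    (hs : s ∈ Icc s₀ s₁) : e.symm (c s) ∈ S.futureCone q := by
  set b : ℝ → 𝔼 := fun r ↦ e.symm (c r) with hb
  have hder : ∀ r ∈ Icc s₀ s₁, ∃ b', HasDerivAt b b' r ∧ b' ∈ S.pullbackCone e (b r) :=
    fun r hr ↦ hasDerivAt_symm_comp h (hc r hr) (hv r hr) (hU hr)
  have hbs : ∀ r ∈ Icc s₀ s₁, b r ∈ e.source := fun r hr ↦ by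
    apply e.map_target
    rw [h.target_eq]
    exact hU hr
  have hcont : ContinuousOn b (Icc s₀ s₁) := fun r hr ↦ by
    obtain ⟨b', h1, -⟩ := hder r hr
    exact h1.continuousAt.continuousWithinAt
  -- By the Gauss lemma the derivative of `f` is twice the pairing, in the pulled back metric at `b
  -- r`, of the radial vector `b r` with the velocity of the curve. Both are future timelike as long
  -- as `b r` is in the cone, so `f` decreases there.
  set f : ℝ → ℝ := fun r ↦ S.form q (b r) (b r) with hf
  have hfder : ∀ r ∈ Icc s₀ s₁, b r ∈ S.futureCone q → ∃ f', HasDerivAt f f' r ∧ f' < 0 := by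
    intro r hr hrc
    obtain ⟨b', h1, h2⟩ := hder r hr
    have h3 := ((hasDerivAt_const r (S.form q)).clm_apply h1).clm_apply h1
    refine ⟨_, h3, ?_⟩
    have h4 : S.form q (b r) b' < 0 := by
      rw [← h.pullback_zero, ← h.gauss (hbs r hr)]
      have h5 : b r ∈ S.pullbackCone e (b r) := by
        simpa using S.radial_mem_pullbackCone h (hbs r hr) hrc (s := 1) (by simp)
      exact S.futureCone_pairing h5 h2
    have h5 : S.form q b' (b r) = S.form q (b r) b' := S.symm _ _ _
    simp only [zero_apply, zero_add, h5]
    linarith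
  have hfcont : ContinuousOn f (Icc s₀ s₁) := by
    have h1 : Continuous fun v : 𝔼 ↦ S.form q v v := by fun_prop
    exact h1.comp_continuousOn hcont
  -- A closed condition equivalent to what is needed: since `f r ≤ f s₀ < 0` keeps the curve away
  -- from the light cone, the weak inequality for the orientation is automatically strict. This
  -- permits continuous induction.
  set A : Set ℝ := {r | f r ≤ f s₀ ∧ S.form q (b r) (S.orientVec q) ≤ 0} with hA
  have hAcone : ∀ r ∈ A, b r ∈ S.futureCone q := by
    intro r hr
    have h1 : f r < 0 := hr.1.trans_lt h0.1
    exact ⟨h1, lt_of_le_of_ne hr.2 (S.form_orient_ne_zero h1)⟩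
  have hclosed : IsClosed (A ∩ Icc s₀ s₁) := by
    have h1 : ContinuousOn (fun r ↦ S.form q (b r) (S.orientVec q)) (Icc s₀ s₁) := by
      have h1 : Continuous fun v : 𝔼 ↦ S.form q v (S.orientVec q) := by fun_prop
      exact h1.comp_continuousOn hcont
    have h2 := hfcont.preimage_isClosed_of_isClosed isClosed_Icc (isClosed_Iic (a := f s₀))
    have h3 := h1.preimage_isClosed_of_isClosed isClosed_Icc (isClosed_Iic (a := 0))
    convert h2.inter h3 using 1
    ext r
    simp only [hA, mem_inter_iff, mem_ofPred_eq, mem_preimage, mem_Iic]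
    tauto
  have hsub : Icc s₀ s₁ ⊆ A := by
    refine hclosed.Icc_subset_of_forall_exists_gt ⟨le_rfl, h0.2.le⟩ ?_
    rintro x ⟨hxA, hx⟩ y hy
    have hxI : x ∈ Icc s₀ s₁ := Ico_subset_Icc_self hx
    obtain ⟨b', hb', -⟩ := hder x hxI
    have hev : ∀ᶠ r in 𝓝 x, b r ∈ S.futureCone q :=
      hb'.continuousAt.eventually ((S.isOpen_futureCone q).mem_nhds (hAcone x hxA))
    obtain ⟨ε, hε, hball⟩ := Metric.eventually_nhds_iff.1 hev
    set z := min (min y s₁) (x + ε / 2) with hz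
    have hxz : x < z := lt_min (lt_min hy hx.2) (by linarith)
    have hzs : z ≤ s₁ := (min_le_left _ _).trans (min_le_right _ _)
    have hcz : ∀ r ∈ Icc x z, b r ∈ S.futureCone q := by
      intro r hr
      apply hball
      have : z ≤ x + ε / 2 := min_le_right _ _
      rw [Real.dist_eq, abs_of_nonneg (by linarith [hr.1])]
      linarith [hr.2]
    have hIcc : Icc x z ⊆ Icc s₀ s₁ := Icc_subset_Icc hxI.1 hzs
    have hanti : AntitoneOn f (Icc x z) := by
      refine antitoneOn_of_deriv_nonpos (convex_Icc x z) (hfcont.mono hIcc) ?_ ?_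
      · intro r hr
        rw [interior_Icc] at hr
        obtain ⟨f', h1, -⟩ := hfder r (hIcc (Ioo_subset_Icc_self hr)) (hcz r (Ioo_subset_Icc_self hr))
        exact h1.differentiableAt.differentiableWithinAt
      · intro r hr
        rw [interior_Icc] at hr
        obtain ⟨f', h1, h2⟩ :=
          hfder r (hIcc (Ioo_subset_Icc_self hr)) (hcz r (Ioo_subset_Icc_self hr))
        rw [h1.deriv]
        exact h2.le
    refine ⟨z, ⟨?_, (hcz z ⟨hxz.le, le_rfl⟩).2.le⟩, hxz, (min_le_left _ _).trans (min_le_left _ _)⟩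
    exact (hanti ⟨le_rfl, hxz.le⟩ ⟨hxz.le, le_rfl⟩ hxz.le).trans hxA.1
  exact hAcone s (hsub hs)

/-- The curve starts at the vector 0, which is not in the open cone. Its initial velocity is, so the
difference quotient, and hence the position, lies in the cone for some small positive time; from
there on the curve cannot leave it. -/
theorem FChron.symm_mem_futureCone (h : S.NormalChart q U e) {p : M} (hqp : S.FChron U q p) :
    e.symm p ∈ S.futureCone q := by
  obtain ⟨c, hc⟩ := hqp
  obtain ⟨b', hb', hbc⟩ := hasDerivAt_symm_comp h (hc.contMDiffAt 0 (by simp))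
    (hc.velocity_mem 0 (by simp)) (hc.mapsTo (by simp))
  have hzero : e.symm (c 0) = 0 := by
    rw [hc.map_zero, ← h.map_zero, e.left_inv h.zero_mem]
  have hb'c : b' ∈ S.futureCone q := by
    rw [hzero] at hbc
    change dmap n e 0 b' ∈ S.futureCone (e 0) at hbc
    rwa [h.dmap_zero, h.map_zero] at hbc
  have h1 := hb'.tendsto_slope_zero_right
  have h2 := h1.eventually ((S.isOpen_futureCone q).mem_nhds hb'c)
  have h3 : ∀ᶠ t : ℝ in 𝓝[>] 0, t < 1 := nhdsWithin_le_nhds (eventually_lt_nhds one_pos)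
  obtain ⟨t, ⟨ht, ht1⟩, ht0⟩ := ((h2.and h3).and self_mem_nhdsWithin).exists
  change t⁻¹ • (e.symm (c (0 + t)) - e.symm (c 0)) ∈ S.futureCone q at ht
  rw [zero_add, hzero, sub_zero, S.futureCone_smul_iff (inv_pos.2 ht0)] at ht
  have hsub : Icc t 1 ⊆ Icc (0 : ℝ) 1 := Icc_subset_Icc_left (le_of_lt ht0)
  have := symm_mem_futureCone_of_le h (fun s hs ↦ hc.contMDiffAt s (hsub hs))
    (fun s hs ↦ hc.velocity_mem s (hsub hs)) (hc.mapsTo.mono_left hsub) ht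
    (s := 1) ⟨ht1.le, le_rfl⟩
  rwa [hc.map_one] at this

/-- Radial geodesics give one implication and the previous theorem the other. Chronology has become
a condition on a single vector. -/
theorem fchron_iff (h : S.NormalChart q U e) {p : M} (hp : p ∈ U) :
    S.FChron U q p ↔ e.symm p ∈ S.futureCone q := by
  refine ⟨fun hqp ↦ hqp.symm_mem_futureCone h, fun hc ↦ ?_⟩
  have ht : p ∈ e.target := by rwa [h.target_eq]
  have := S.isFutureCurve_radial h (e.map_target ht) hc
  rw [e.right_inv ht] at this
  exact ⟨_, this⟩

theorem FChron.left_mem {p : M} (h : S.FChron U q p) : q ∈ U := by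
  obtain ⟨c, hc⟩ := h
  rw [← hc.map_zero]
  exact hc.mapsTo (by simp)

theorem FChron.right_mem {p : M} (h : S.FChron U q p) : p ∈ U := by
  obtain ⟨c, hc⟩ := h
  rw [← hc.map_one]
  exact hc.mapsTo (by simp)

/-- Concatenating the two curves would create a corner, whereas timelike curves are smooth. Instead,
the first curve enters the cone of `q`, the second one does not leave it, and a radial geodesic
joins the end points. -/
theorem FChron.trans (hU : S.IsConvexNormal U) {p r : M} (h₁ : S.FChron U q p)
    (h₂ : S.FChron U p r) : S.FChron U q r := by
  obtain ⟨e, he⟩ := (hU.2 q h₁.left_mem).exists_normalChart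
  rw [fchron_iff he h₂.right_mem]
  have h3 := h₁.symm_mem_futureCone he
  obtain ⟨c, hc⟩ := h₂
  have := symm_mem_futureCone_of_le he hc.contMDiffAt hc.velocity_mem hc.mapsTo
    (by rwa [hc.map_zero]) (s := 1) (by simp)
  rwa [hc.map_one] at this

/-- The exponential vector of `p` would lie in two opposite cones. -/
theorem FChron.not_reverse (hU : S.IsConvexNormal U) {p : M} (h : S.FChron U q p) :
    ¬ S.reverse.FChron U q p := by
  intro h'
  obtain ⟨e, he⟩ := (hU.2 q h.left_mem).exists_normalChart
  exact S.futureCone_reverse_disjoint (h.symm_mem_futureCone he)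
    (h'.symm_mem_futureCone (S := S.reverse) he)

/-- Affine reparametrization of a smooth curve with future timelike tangents. -/
theorem fchron_of_Icc {c : ℝ → M} {s₀ s₁ : ℝ} (hlt : s₀ < s₁)
    (hc : ∀ s ∈ Icc s₀ s₁, ContMDiffAt 𝓘(ℝ, ℝ) (𝓡 n) ∞ c s)
    (hv : ∀ s ∈ Icc s₀ s₁, S.FutureTimelike (velocity n c s))
    (hU : MapsTo c (Icc s₀ s₁) U) : S.FChron U (c s₀) (c s₁) := by
  set a : ℝ → ℝ := fun r ↦ s₀ + r * (s₁ - s₀) with ha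
  have haI : ∀ r ∈ Icc (0 : ℝ) 1, a r ∈ Icc s₀ s₁ := by
    intro r hr
    constructor <;> simp only [ha] <;> nlinarith [hr.1, hr.2]
  have had : ∀ r, HasDerivAt a (s₁ - s₀) r := by
    intro r
    exact (((hasDerivAt_id r).mul_const (s₁ - s₀)).const_add s₀).congr_deriv (one_mul _)
  refine ⟨fun r ↦ c (a r), ⟨?_, ?_, ?_, ?_, ?_⟩⟩
  · intro r hr
    have h1 : ContMDiffAt 𝓘(ℝ, ℝ) 𝓘(ℝ, ℝ) ∞ a r := by
      rw [contMDiffAt_iff_contDiffAt]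
      fun_prop
    exact (hc (a r) (haI r hr)).comp r h1
  · intro r hr
    have h1 : HasMFDerivAt 𝓘(ℝ, ℝ) 𝓘(ℝ, ℝ) a r _ := (had r).hasFDerivAt.hasMFDerivAt
    have h2 := ((hc (a r) (haI r hr)).mdifferentiableAt (by simp)).hasMFDerivAt.comp r h1
    have h3 : velocity n (fun r ↦ c (a r)) r = (s₁ - s₀) • velocity n c (a r) := by
      unfold velocity
      change mfderiv 𝓘(ℝ, ℝ) (𝓡 n) (c ∘ a) r (1 : ℝ) = _
      rw [h2.mfderiv]
      have h4 : ∀ L : ℝ →L[ℝ] 𝔼, (L.comp (ContinuousLinearMap.toSpanSingleton ℝ (s₁ - s₀))) 1 =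
          (s₁ - s₀) • L 1 := by
        intro L
        simp [← map_smul]
      exact h4 _
    rw [h3]
    exact (hv (a r) (haI r hr)).smul (by linarith)
  · intro r hr
    exact hU (haI r hr)
  · simp [ha]
  · simp [ha]

end Spacetime

end Chronology

/-! ### Second order equations that are quadratic in the velocity -/

section QuadraticFlow

variable {E : Type*} [NormedAddCommGroup E] [NormedSpace ℝ E]

/-- Homogeneity rescales `a` to norm `δ`, where continuity bounds `F` by 1; this costs the factor
`δ⁻¹ ^ 2`. -/
theorem norm_le_sq_of_homogeneous {F : E × E → E} {z : E} (hF : ContinuousAt F (z, 0))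
    (hom : ∀ u a (l : ℝ), F (u, l • a) = l ^ 2 • F (u, a)) :
    ∃ C > 0, ∃ δ > 0, ∀ u ∈ Metric.closedBall z δ, ∀ a, ‖F (u, a)‖ ≤ C * ‖a‖ ^ 2 := by
  have h0 : F (z, 0) = 0 := by simpa using hom z 0 0
  have h1 : ∀ᶠ x in 𝓝 (z, (0 : E)), ‖F x‖ < 1 := by
    have := hF.norm
    rw [ContinuousAt, h0, norm_zero] at this
    exact this.eventually (gt_mem_nhds one_pos)
  obtain ⟨δ, hδ, hball⟩ := Metric.nhds_basis_closedBall.eventually_iff.1 h1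
  refine ⟨(δ⁻¹) ^ 2, by positivity, δ, hδ, fun u hu a ↦ ?_⟩
  rcases eq_or_ne a 0 with rfl | ha
  · have : F (u, 0) = 0 := by simpa using hom u 0 0
    simp [this]
  · have hna : 0 < ‖a‖ := norm_pos_iff.2 ha
    have h2 : F (u, a) = (δ⁻¹ * ‖a‖) ^ 2 • F (u, (δ * ‖a‖⁻¹) • a) := by
      rw [← hom, smul_smul]
      have : δ⁻¹ * ‖a‖ * (δ * ‖a‖⁻¹) = 1 := by field_simp
      rw [this, one_smul]
    have h3 : (u, (δ * ‖a‖⁻¹) • a) ∈ Metric.closedBall (z, (0 : E)) δ := by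
      rw [← closedBall_prod_same]
      refine ⟨hu, ?_⟩
      rw [mem_closedBall_zero_iff, norm_smul, norm_mul, norm_inv, norm_norm,
        Real.norm_of_nonneg hδ.le, mul_assoc, inv_mul_cancel₀ hna.ne', mul_one]
    rw [h2, norm_smul, Real.norm_of_nonneg (by positivity), mul_pow]
    have := (hball h3).le
    have h4 : 0 ≤ (δ⁻¹) ^ 2 * ‖a‖ ^ 2 := by positivity
    nlinarith

/-- The local flow, for times in `(-2, 2)`, of the second order equation `u'' = F(u, u')` with `F`
homogeneous of degree two in the velocity, for small initial velocities. -/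
theorem exists_quadratic_flow [CompleteSpace E] {F : E × E → E} {z : E}
    (hF : ContDiffAt ℝ 1 F (z, 0)) (hom : ∀ u a (l : ℝ), F (u, l • a) = l ^ 2 • F (u, a))
    {N : Set (E × E)} (hN : N ∈ 𝓝 (z, (0 : E))) :
    ∃ r > 0, ∃ C ≥ 0, ∃ Y : (E × E) × ℝ → E × E,
      ContinuousOn Y (Metric.closedBall (z, 0) r ×ˢ Icc 0 1) ∧
      ∀ x ∈ Metric.closedBall (z, (0 : E)) r, Y (x, 0) = x ∧
        (∀ s ∈ Ioo (-2 : ℝ) 2, HasDerivAt (fun s ↦ Y (x, s)) ((Y (x, s)).2, F (Y (x, s))) s ∧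
          Y (x, s) ∈ N) ∧
        ∀ s ∈ Icc (0 : ℝ) 1, ‖(Y (x, s)).2 - x.2‖ ≤ C * ‖x.2‖ ^ 2 := by
  obtain ⟨C, hC, δ, hδ, hquad⟩ := norm_le_sq_of_homogeneous hF.continuousAt hom
  obtain ⟨R₀, hR₀, hRN⟩ := Metric.mem_nhds_iff.1 hN
  -- Within radius `R` the quadratic bound holds and `C` times the velocity is at most 1/2. The
  -- velocity then grows by a factor of at most `exp (1 / 2) ≤ 2` in unit time, and squaring this 2
  -- gives the constant `4 * C` below.
  set R := min (min R₀ δ) ((2 * C)⁻¹) with hR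
  have hRpos : 0 < R := lt_min (lt_min hR₀ hδ) (by positivity)
  have hf : ContDiffAt ℝ 1 (fun x : E × E ↦ (x.2, F x)) (z, 0) := contDiffAt_snd.prodMk hF
  obtain ⟨ε, hε, a, r', L, K, hr', hPL⟩ := IsPicardLindelof.of_contDiffAt_one hf
  obtain ⟨α, hα, hαc⟩ := (hPL 0).exists_forall_mem_closedBall_eq_hasDerivWithinAt_continuousOn
  simp only [zero_sub, zero_add] at hα hαc
  have hcenter : ((z, (0 : E)), (0 : ℝ)) ∈
      Metric.closedBall (z, (0 : E)) (r' : ℝ) ×ˢ Icc (-ε) ε :=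
    ⟨Metric.mem_closedBall_self r'.2, by constructor <;> linarith⟩
  have hnear : ∀ᶠ y in 𝓝 ((z, (0 : E)), (0 : ℝ)), α y ∈ Metric.ball (z, (0 : E)) R := by
    have h1 : Metric.closedBall (z, (0 : E)) (r' : ℝ) ×ˢ Icc (-ε) ε ∈ 𝓝 ((z, (0 : E)), (0 : ℝ)) :=
      prod_mem_nhds (Metric.closedBall_mem_nhds _ hr') (Icc_mem_nhds (by linarith) hε)
    have h2 := (hαc _ hcenter).continuousAt h1
    refine h2.eventually (Metric.isOpen_ball.mem_nhds ?_)
    rw [(hα _ (Metric.mem_closedBall_self r'.2)).1]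
    exact Metric.mem_ball_self hRpos
  obtain ⟨η₀, hη₀, hη₀ball⟩ := Metric.nhds_basis_closedBall.eventually_iff.1 hnear
  set η := min η₀ (min r' ε) with hη
  have hηpos : 0 < η := lt_min hη₀ (lt_min hr' hε)
  set k := min 1 (η / 2) with hk
  have hkpos : 0 < k := lt_min one_pos (by linarith)
  have hk1 : k ≤ 1 := min_le_left _ _
  have hkη : 2 * k ≤ η := by
    have : k ≤ η / 2 := min_le_right _ _
    linarith
  have hscale : ∀ x ∈ Metric.closedBall (z, (0 : E)) (k * η),
      (x.1, k⁻¹ • x.2) ∈ Metric.closedBall (z, (0 : E)) η := by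
    intro x hx
    rw [← closedBall_prod_same] at hx ⊢
    refine ⟨Metric.closedBall_subset_closedBall (by nlinarith) hx.1, ?_⟩
    have h2 := hx.2
    rw [mem_closedBall_zero_iff] at h2 ⊢
    rw [norm_smul, norm_inv, Real.norm_of_nonneg hkpos.le, inv_mul_le_iff₀ hkpos]
    exact h2
  have htime : ∀ s ∈ Icc (-2 : ℝ) 2, k * s ∈ Icc (-η) η := by
    intro s hs
    constructor <;> nlinarith [hs.1, hs.2]
  have hηr : η ≤ r' := (min_le_right _ _).trans (min_le_left _ _)
  have hηε : η ≤ ε := (min_le_right _ _).trans (min_le_right _ _)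
  -- The solution with initial velocity `k⁻¹ • v` is run at speed `k`; homogeneity of degree two
  -- makes the result a solution with initial velocity `v`. As `2 * k ≤ η`, all times up to 2 fit
  -- into the interval on which solutions are known to exist.
  set Y : (E × E) × ℝ → E × E := fun y ↦
    ((α ((y.1.1, k⁻¹ • y.1.2), k * y.2)).1, k • (α ((y.1.1, k⁻¹ • y.1.2), k * y.2)).2) with hY
  have hYball : ∀ x ∈ Metric.closedBall (z, (0 : E)) (k * η), ∀ s ∈ Icc (-2 : ℝ) 2,
      Y (x, s) ∈ Metric.ball (z, (0 : E)) R := by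
    intro x hx s hs
    have h1 : α ((x.1, k⁻¹ • x.2), k * s) ∈ Metric.ball (z, (0 : E)) R := by
      apply hη₀ball
      rw [← closedBall_prod_same]
      refine ⟨Metric.closedBall_subset_closedBall (min_le_left _ _) (hscale x hx), ?_⟩
      have := htime s hs
      rw [mem_closedBall_zero_iff, Real.norm_eq_abs, abs_le]
      have h3 : η ≤ η₀ := min_le_left _ _
      exact ⟨by linarith [this.1], by linarith [this.2]⟩
    rw [← ball_prod_same] at h1 ⊢
    refine ⟨h1.1, ?_⟩
    have h2 := h1.2
    rw [mem_ball_zero_iff] at h2 ⊢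
    simp only [hY]
    rw [norm_smul, Real.norm_of_nonneg hkpos.le]
    calc k * _ ≤ 1 * _ := by gcongr
      _ < R := by rwa [one_mul]
  have hYder : ∀ x ∈ Metric.closedBall (z, (0 : E)) (k * η), ∀ s ∈ Ioo (-2 : ℝ) 2,
      HasDerivAt (fun s ↦ Y (x, s)) ((Y (x, s)).2, F (Y (x, s))) s := by
    intro x hx s hs
    have hks : k * s ∈ Ioo (-ε) ε := by
      constructor <;> nlinarith [hs.1, hs.2]
    have h1 := (hα _ (Metric.closedBall_subset_closedBall hηr (hscale x hx))).2 (k * s)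
      (Ioo_subset_Icc_self hks)
    have h2 := h1.hasDerivAt (Icc_mem_nhds hks.1 hks.2)
    have h3 : HasDerivAt (fun s : ℝ ↦ k * s) k s := by
      simpa using (hasDerivAt_id s).const_mul k
    have h4 := HasDerivAt.scomp s h2 h3
    have h5 := (hasFDerivAt_fst.comp_hasDerivAt s h4).prodMk
      ((hasFDerivAt_snd.comp_hasDerivAt s h4).const_smul k)
    refine h5.congr_deriv ?_
    simp only [hY, ContinuousLinearMap.coe_fst', ContinuousLinearMap.coe_snd', Prod.smul_fst,
      Prod.smul_snd, hom, smul_smul, sq]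
  refine ⟨k * η, by positivity, 4 * C, by positivity, Y, ?_, ?_⟩
  · have h1 : ContinuousOn (fun y : (E × E) × ℝ ↦ α ((y.1.1, k⁻¹ • y.1.2), k * y.2))
        (Metric.closedBall (z, (0 : E)) (k * η) ×ˢ Icc (0 : ℝ) 1) := by
      refine hαc.comp (by fun_prop) ?_
      rintro ⟨x, s⟩ ⟨hx, hs⟩
      refine ⟨Metric.closedBall_subset_closedBall hηr (hscale x hx), ?_⟩
      have := htime s ⟨by linarith [hs.1], by linarith [hs.2]⟩
      exact ⟨by linarith [this.1], by linarith [this.2]⟩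
    exact h1.fst.prodMk (h1.snd.const_smul k)
  · intro x hx
    have hY0 : Y (x, 0) = x := by
      have := (hα _ (Metric.closedBall_subset_closedBall hηr (hscale x hx))).1
      simp only [hY, mul_zero, this]
      rw [smul_inv_smul₀ hkpos.ne']
    refine ⟨hY0, fun s hs ↦ ⟨hYder x hx s hs, hRN ?_⟩, ?_⟩
    · exact Metric.ball_subset_ball ((min_le_left _ _).trans (min_le_left _ _))
        (hYball x hx s (Ioo_subset_Icc_self hs))
    · have hI : Icc (0 : ℝ) 1 ⊆ Ioo (-2 : ℝ) 2 := fun s hs ↦ ⟨by linarith [hs.1], by linarith [hs.2]⟩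
      have hder2 : ∀ s ∈ Icc (0 : ℝ) 1, HasDerivAt (fun s ↦ (Y (x, s)).2) (F (Y (x, s))) s := by
        intro s hs
        exact hasFDerivAt_snd.comp_hasDerivAt s (hYder x hx s (hI hs))
      have hFle : ∀ s ∈ Icc (0 : ℝ) 1, ‖F (Y (x, s))‖ ≤ C * ‖(Y (x, s)).2‖ ^ 2 := by
        intro s hs
        have h1 := hYball x hx s (Ioo_subset_Icc_self (hI hs))
        rw [← ball_prod_same] at h1
        refine hquad _ (Metric.ball_subset_closedBall (Metric.ball_subset_ball ?_ h1.1)) _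
        exact (min_le_left _ _).trans (min_le_right _ _)
      have hYR : ∀ s ∈ Icc (0 : ℝ) 1, C * ‖(Y (x, s)).2‖ ≤ 1 / 2 := by
        intro s hs
        have h1 := hYball x hx s (Ioo_subset_Icc_self (hI hs))
        rw [← ball_prod_same] at h1
        have h2 := h1.2
        rw [mem_ball_zero_iff] at h2
        have h3 : R ≤ (2 * C)⁻¹ := min_le_right _ _
        calc C * ‖(Y (x, s)).2‖ ≤ C * (2 * C)⁻¹ := by
              gcongr
              exact h2.le.trans h3
          _ = 1 / 2 := by field_simp
      have hgr : ∀ s ∈ Icc (0 : ℝ) 1, ‖(Y (x, s)).2‖ ≤ 2 * ‖x.2‖ := by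
        intro s hs
        have := norm_le_gronwallBound_of_norm_deriv_right_le (f := fun s ↦ (Y (x, s)).2)
          (f' := fun s ↦ F (Y (x, s))) (δ := ‖x.2‖) (K := 1 / 2) (ε := 0) (a := 0) (b := 1)
          (fun s hs ↦ (hder2 s hs).continuousAt.continuousWithinAt)
          (fun s hs ↦ (hder2 s (Ico_subset_Icc_self hs)).hasDerivWithinAt) (by rw [hY0])
          (fun s hs ↦ by
            have h1 := hFle s (Ico_subset_Icc_self hs)
            have h2 := hYR s (Ico_subset_Icc_self hs)
            nlinarith [norm_nonneg (Y (x, s)).2]) s hs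
        rw [gronwallBound_ε0, sub_zero] at this
        have he : Real.exp (1 / 2 * s) ≤ 2 := by
          have h1 : Real.exp (1 / 2 * s) ≤ Real.exp (1 / 2) := by
            apply Real.exp_le_exp.2
            linarith [hs.2]
          have h2 : Real.exp (1 / 2) ^ 2 ≤ 2 ^ 2 := by
            rw [← Real.exp_nat_mul]
            have := Real.exp_one_lt_d9
            norm_num
            linarith
          have h3 := abs_le_of_sq_le_sq h2 (by norm_num)
          exact h1.trans ((le_abs_self _).trans (by simpa using h3))
        calc _ ≤ ‖x.2‖ * Real.exp (1 / 2 * s) := this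
          _ ≤ ‖x.2‖ * 2 := by gcongr
          _ = 2 * ‖x.2‖ := mul_comm _ _
      intro s hs
      have h1 := norm_image_sub_le_of_norm_deriv_le_segment' (f := fun s ↦ (Y (x, s)).2)
        (f' := fun s ↦ F (Y (x, s))) (C := 4 * C * ‖x.2‖ ^ 2) (a := 0) (b := 1)
        (fun s hs ↦ (hder2 s hs).hasDerivWithinAt)
        (fun s hs ↦ by
          have h1 := hFle s (Ico_subset_Icc_self hs)
          have h2 := hgr s (Ico_subset_Icc_self hs)
          have h3 : ‖(Y (x, s)).2‖ ^ 2 ≤ (2 * ‖x.2‖) ^ 2 := by gcongr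
          calc _ ≤ C * ‖(Y (x, s)).2‖ ^ 2 := h1
            _ ≤ C * (2 * ‖x.2‖) ^ 2 := by gcongr
            _ = 4 * C * ‖x.2‖ ^ 2 := by ring) s hs
      rw [hY0, sub_zero] at h1
      have h2 : 0 ≤ 4 * C * ‖x.2‖ ^ 2 := by positivity
      calc _ ≤ 4 * C * ‖x.2‖ ^ 2 * s := h1
        _ ≤ 4 * C * ‖x.2‖ ^ 2 * 1 := by
            gcongr
            exact hs.2
        _ = _ := mul_one _

end QuadraticFlow

/-! ### The geodesic equation as an explicit second order equation -/

section GeodesicField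

variable {E : Type*} [NormedAddCommGroup E] [NormedSpace ℝ E]

/-- The right hand side `F` of the geodesic equation `u'' = F(u, u')` of a metric `G`. -/
noncomputable def geodesicField (G : E → E →L[ℝ] E →L[ℝ] ℝ) (x : E × E) : E :=
  (G x.1).inverse ((1 / 2 : ℝ) • fderiv ℝ (fun y ↦ G y x.2 x.2) x.1
    - fderiv ℝ (fun y ↦ G y x.2) x.1 x.2)

theorem geodesicField_smul (G : E → E →L[ℝ] E →L[ℝ] ℝ) (u a : E) (l : ℝ) :
    geodesicField G (u, l • a) = l ^ 2 • geodesicField G (u, a) := by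
  have h1 : fderiv ℝ (fun y ↦ G y (l • a) (l • a)) u = l ^ 2 • fderiv ℝ (fun y ↦ G y a a) u := by
    have h : (fun y ↦ G y (l • a) (l • a)) = l ^ 2 • fun y ↦ G y a a := by
      ext y
      simp
      ring
    rw [h, fderiv_const_smul_field]
    rfl
  have h2 : fderiv ℝ (fun y ↦ G y (l • a)) u (l • a) = l ^ 2 • fderiv ℝ (fun y ↦ G y a) u a := by
    have h3 : fderiv ℝ (fun y ↦ G y (l • a)) u = l • fderiv ℝ (fun y ↦ G y a) u := by
      have h : (fun y ↦ G y (l • a)) = l • fun y ↦ G y a := by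
        ext y
        simp
      rw [h]
      exact congrFun (fderiv_const_smul_field (𝕜 := ℝ) (f := fun y ↦ G y a) l) u
    rw [h3, map_smul, smul_apply, smul_smul, sq]
  simp only [geodesicField]
  rw [h1, h2, smul_comm, ← smul_sub, map_smul]

theorem form_geodesicField {G : E → E →L[ℝ] E →L[ℝ] ℝ} {u : E} (hG : (G u).IsInvertible) (a w : E) :
    G u (geodesicField G (u, a)) w =
      (1 / 2 : ℝ) * fderiv ℝ (fun y ↦ G y a a) u w - fderiv ℝ (fun y ↦ G y a) u a w := by
  obtain ⟨L, hL⟩ := hG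
  unfold geodesicField
  rw [← hL]
  simp

theorem contDiffAt_geodesicField [CompleteSpace E] {G : E → E →L[ℝ] E →L[ℝ] ℝ} {u a : E}
    (hG : ContDiffAt ℝ ∞ G u) (hinv : (G u).IsInvertible) :
    ContDiffAt ℝ 1 (geodesicField G) (u, a) := by
  obtain ⟨L, hL⟩ := hinv
  have h1 : ContDiffAt ℝ 1 (fun x : E × E ↦ (G x.1).inverse) (u, a) := by
    have h2 : ContDiffAt ℝ 1 ContinuousLinearMap.inverse (G u) := by
      rw [← hL]
      exact contDiffAt_map_inverse L
    exact ContDiffAt.comp (u, a) (f := fun x : E × E ↦ G x.1) h2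
      ((hG.of_le (by simp)).comp (u, a) contDiffAt_fst)
  have h3 : ContDiffAt ℝ ∞ (fun x : (E × E) × E ↦ G x.2) ((u, a), u) :=
    ContDiffAt.comp ((u, a), u) (f := fun x : (E × E) × E ↦ x.2) hG contDiffAt_snd
  have h4 : ContDiffAt ℝ ∞ (fun x : (E × E) × E ↦ x.1.2) ((u, a), u) :=
    contDiffAt_snd.comp _ contDiffAt_fst
  have h5 : ContDiffAt ℝ 1 (fun x : E × E ↦ fderiv ℝ (fun y ↦ G y x.2) x.1) (u, a) :=
    ContDiffAt.fderiv (f := fun (x : E × E) y ↦ G y x.2) (g := fun x ↦ x.1) (n := ∞)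
      (h3.clm_apply h4) contDiffAt_fst (by norm_cast)
  have h6 : ContDiffAt ℝ 1 (fun x : E × E ↦ fderiv ℝ (fun y ↦ G y x.2 x.2) x.1) (u, a) :=
    ContDiffAt.fderiv (f := fun (x : E × E) y ↦ G y x.2 x.2) (g := fun x ↦ x.1) (n := ∞)
      ((h3.clm_apply h4).clm_apply h4) contDiffAt_fst (by norm_cast)
  exact h1.clm_apply ((h6.const_smul _).sub (h5.clm_apply contDiffAt_snd))

/-- The geodesic equation prescribes the derivative of `G(u', w)`. Carrying out the product rule and
inverting the metric isolates `u''`. -/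
theorem hasDerivAt_deriv_of_geodesic {G : E → E →L[ℝ] E →L[ℝ] ℝ} {u : ℝ → E} {s : ℝ}
    (hG : DifferentiableAt ℝ G (u s)) (hinv : (G (u s)).IsInvertible) (hu : ContDiffAt ℝ 2 u s)
    (hgeo : ∀ w, HasDerivAt (fun r : ℝ ↦ G (u r) (deriv u r) w)
      ((1 / 2 : ℝ) * fderiv ℝ (fun y ↦ G y (deriv u s) (deriv u s)) (u s) w) s) :
    HasDerivAt (deriv u) (geodesicField G (u s, deriv u s)) s := by
  have h1 : HasDerivAt u (deriv u s) s := (hu.differentiableAt (by norm_num)).hasDerivAt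
  have h2 : HasDerivAt (deriv u) (deriv (deriv u) s) s := by
    have h3 : ContDiffAt ℝ 1 (deriv u) s := by
      have := (hu.fderiv_right (m := 1) (by norm_num)).clm_apply
        (contDiffAt_const (c := (1 : ℝ)))
      exact this
    exact (h3.differentiableAt (by norm_num)).hasDerivAt
  refine h2.congr_deriv ?_
  have hinj : Function.Injective (G (u s)) := by
    obtain ⟨L, hL⟩ := hinv
    rw [← hL]
    exact L.injective
  apply hinj
  ext w
  rw [form_geodesicField hinv]
  have h4 : HasDerivAt (fun r ↦ G (u r)) _ s :=
    HasFDerivAt.comp_hasDerivAt (l := G) (f := u) s hG.hasFDerivAt h1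
  have h5 := (h4.clm_apply h2).clm_apply (hasDerivAt_const s w)
  have h6 := h5.unique (hgeo w)
  have h7 := hG.hasFDerivAt.clm_apply (hasFDerivAt_const (deriv u s) (u s))
  rw [h7.fderiv]
  simp at h6 ⊢
  linarith

end GeodesicField

/-! ### Charts have invertible derivatives -/

section ChartDerivative

variable {n : ℕ} {M : Type*} [TopologicalSpace M] [ChartedSpace (EuclideanSpace ℝ (Fin n)) M]
  [IsManifold (𝓡 n) ∞ M]

local notation "𝔼" => EuclideanSpace ℝ (Fin n)

theorem dmap_chart_injective {p₀ : M} {y : 𝔼} (hy : y ∈ (extChartAt (𝓡 n) p₀).target) :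
    Function.Injective (dmap n (extChartAt (𝓡 n) p₀).symm y) := by
  have h1 := (mdifferentiableAt_extChartAt_symm' hy).hasMFDerivAt
  have h2 : MDifferentiableAt (𝓡 n) 𝓘(ℝ, 𝔼) (extChartAt (𝓡 n) p₀)
      ((extChartAt (𝓡 n) p₀).symm y) :=
    (contMDiffAt_extChartAt' (n := ∞) (by
      rw [← extChartAt_source (𝓡 n)]
      exact (extChartAt (𝓡 n) p₀).map_target hy)).mdifferentiableAt (by simp)
  have h3 := h2.hasMFDerivAt.comp y h1
  have h4 : HasMFDerivAt 𝓘(ℝ, 𝔼) 𝓘(ℝ, 𝔼)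
      (extChartAt (𝓡 n) p₀ ∘ (extChartAt (𝓡 n) p₀).symm) y (ContinuousLinearMap.id ℝ _) := by
    refine (hasMFDerivAt_id y).congr_of_eventuallyEq ?_
    filter_upwards [(isOpen_extChartAt_target p₀).mem_nhds hy] with y' hy'
    exact (extChartAt (𝓡 n) p₀).right_inv hy'
  have h5 := hasMFDerivAt_unique h3 h4
  intro a b hab
  have h6 := congrArg (fun L : 𝔼 →L[ℝ] 𝔼 ↦ L a) h5
  have h7 := congrArg (fun L : 𝔼 →L[ℝ] 𝔼 ↦ L b) h5
  set D : 𝔼 →L[ℝ] 𝔼 := mfderiv (𝓡 n) 𝓘(ℝ, 𝔼) (extChartAt (𝓡 n) p₀)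
    ((extChartAt (𝓡 n) p₀).symm y) with hD
  change D (dmap n (extChartAt (𝓡 n) p₀).symm y a) = a at h6
  change D (dmap n (extChartAt (𝓡 n) p₀).symm y b) = b at h7
  rw [← h6, ← h7, hab]

theorem dmap_chart_surjective {p₀ : M} {y : 𝔼} (hy : y ∈ (extChartAt (𝓡 n) p₀).target) :
    Function.Surjective (dmap n (extChartAt (𝓡 n) p₀).symm y) :=
  (LinearMap.injective_iff_surjective (f := (dmap n (extChartAt (𝓡 n) p₀).symm y).toLinearMap)).1
    (dmap_chart_injective hy)

/-- Nondegeneracy makes the map to the dual space injective, and the dimensions agree. -/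
theorem LorentzianMetric.isInvertible_pullback_chart (g : LorentzianMetric n M) {p₀ : M} {y : 𝔼}
    (hy : y ∈ (extChartAt (𝓡 n) p₀).target) :
    (g.pullback (extChartAt (𝓡 n) p₀).symm y).IsInvertible := by
  set G := g.pullback (extChartAt (𝓡 n) p₀).symm y with hG
  have hker : Function.Injective G := by
    rw [injective_iff_map_eq_zero]
    intro a ha
    apply dmap_chart_injective hy
    rw [map_zero]
    refine g.nondegenerate (p := (extChartAt (𝓡 n) p₀).symm y) fun w ↦ ?_
    obtain ⟨w', rfl⟩ := dmap_chart_surjective hy w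
    exact congrArg (fun L : 𝔼 →L[ℝ] ℝ ↦ L w') ha
  have hdim : Module.finrank ℝ 𝔼 = Module.finrank ℝ (𝔼 →L[ℝ] ℝ) := by
    rw [← (LinearMap.toContinuousLinearMap (𝕜 := ℝ) (E := 𝔼) (F' := ℝ)).finrank_eq]
    exact (Subspace.dual_finrank_eq).symm
  refine ⟨(LinearEquiv.ofInjectiveOfFinrankEq G.toLinearMap hker hdim).toContinuousLinearEquiv, ?_⟩
  ext x
  rfl

end ChartDerivative

/-! ### The flow in a chart agrees with the exponential maps -/

section GeodesicFlow

variable {n : ℕ} {M : Type*} [TopologicalSpace M] [ChartedSpace (EuclideanSpace ℝ (Fin n)) M]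
  [IsManifold (𝓡 n) ∞ M]

local notation "𝔼" => EuclideanSpace ℝ (Fin n)

namespace LorentzianMetric

variable {g : LorentzianMetric n M} {q : M} {U : Set M}
  {e : OpenPartialHomeomorph (EuclideanSpace ℝ (Fin n)) M}

theorem contDiffAt_pullback_chart (g : LorentzianMetric n M) {p₀ : M} {y : 𝔼}
    (hy : y ∈ (extChartAt (𝓡 n) p₀).target) :
    ContDiffAt ℝ ∞ (g.pullback (extChartAt (𝓡 n) p₀).symm) y :=
  (g.contDiffOn_pullback (isOpen_extChartAt_target p₀)
      (contMDiffOn_extChartAt_symm (n := ∞) p₀)).contDiffAt ((isOpen_extChartAt_target p₀).mem_nhds hy)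

namespace NormalChart

theorem hasDerivAt_chart_line (h : g.NormalChart q U e) {p₀ : M} {v : 𝔼} {s : ℝ}
    (hs : s • v ∈ e.source) (hp : e (s • v) ∈ (extChartAt (𝓡 n) p₀).source) :
    HasDerivAt (fun r : ℝ ↦ extChartAt (𝓡 n) p₀ (e (r • v)))
      (fderiv ℝ (fun b ↦ extChartAt (𝓡 n) p₀ (e b)) (s • v) v) s := by
  have h1 := ((h.contDiffAt_chart_comp hs hp).differentiableAt (by simp)).hasFDerivAt
  have h2 : HasDerivAt (fun r : ℝ ↦ r • v) v s := by
    simpa using (hasDerivAt_id s).smul_const v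
  exact h1.comp_hasDerivAt s h2

theorem eventually_line (_h : g.NormalChart q U e) {p₀ : M} {v : 𝔼} {s : ℝ}
    (hs : s • v ∈ e.source) (hp : e (s • v) ∈ (extChartAt (𝓡 n) p₀).source) :
    ∀ᶠ r : ℝ in 𝓝 s, r • v ∈ e.source ∧ e (r • v) ∈ (extChartAt (𝓡 n) p₀).source := by
  have h0 : ContinuousAt (fun r : ℝ ↦ r • v) s := by fun_prop
  have h1 := h0.eventually (e.open_source.mem_nhds hs)
  have h2 : ContinuousAt (fun r : ℝ ↦ e (r • v)) s := ContinuousAt.comp (f := fun r : ℝ ↦ r • v)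
    (e.continuousAt hs) h0
  exact h1.and (h2.eventually ((isOpen_extChartAt_source p₀).mem_nhds hp))

theorem hasDerivAt_fderiv_line_of_mem (h : g.NormalChart q U e) {p₀ : M} {v : 𝔼} {s : ℝ}
    (hv : v ∈ e.source) (hs : s • v ∈ e.source) (hp : e (s • v) ∈ (extChartAt (𝓡 n) p₀).source) :
    HasDerivAt (fun r : ℝ ↦ fderiv ℝ (fun b ↦ extChartAt (𝓡 n) p₀ (e b)) (r • v) v)
      (geodesicField (g.pullback (extChartAt (𝓡 n) p₀).symm) (extChartAt (𝓡 n) p₀ (e (s • v)),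
        fderiv ℝ (fun b ↦ extChartAt (𝓡 n) p₀ (e b)) (s • v) v)) s := by
  have ht := (extChartAt (𝓡 n) p₀).map_source hp
  have h1 : ContDiffAt ℝ 2 (fun r : ℝ ↦ extChartAt (𝓡 n) p₀ (e (r • v))) s := by
    have h2 := (h.contDiffAt_chart_comp hs hp).of_le (m := 2) (WithTop.coe_le_coe.2 le_top)
    have h3 : ContDiffAt ℝ 2 (fun r : ℝ ↦ r • v) s := by fun_prop
    exact ContDiffAt.comp s (f := fun r : ℝ ↦ r • v) h2 h3
  have h2 := hasDerivAt_deriv_of_geodesic (u := fun r : ℝ ↦ extChartAt (𝓡 n) p₀ (e (r • v)))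
    (s := s) ((g.contDiffAt_pullback_chart ht).differentiableAt (by simp))
    (g.isInvertible_pullback_chart ht) h1 ((h.geodesic v hv).2 s hs p₀ hp)
  rw [(h.hasDerivAt_chart_line hs hp).deriv] at h2
  refine h2.congr_of_eventuallyEq ?_
  filter_upwards [h.eventually_line hs hp] with r hr
  exact (h.hasDerivAt_chart_line hr.1 hr.2).deriv.symm

/-- Geodesics are only given for initial vectors in the source, while here only `s • v` is known to
lie there, as happens in `flow_eq`. A multiple `t • v` in the source is used instead, and the factor
is absorbed by the homogeneity of the geodesic field. -/
theorem hasDerivAt_fderiv_line (h : g.NormalChart q U e) {p₀ : M} {v : 𝔼} {s : ℝ}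
    (hs : s • v ∈ e.source) (hp : e (s • v) ∈ (extChartAt (𝓡 n) p₀).source) :
    HasDerivAt (fun r : ℝ ↦ fderiv ℝ (fun b ↦ extChartAt (𝓡 n) p₀ (e b)) (r • v) v)
      (geodesicField (g.pullback (extChartAt (𝓡 n) p₀).symm) (extChartAt (𝓡 n) p₀ (e (s • v)),
        fderiv ℝ (fun b ↦ extChartAt (𝓡 n) p₀ (e b)) (s • v) v)) s := by
  obtain ⟨t, ht0, ht⟩ : ∃ t : ℝ, t ≠ 0 ∧ t • v ∈ e.source := by
    rcases eq_or_ne s 0 with rfl | h0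
    · have hc : Filter.Tendsto (fun r : ℝ ↦ r • v) (𝓝[≠] 0) (𝓝 (0 : 𝔼)) := by
        have : Continuous (fun r : ℝ ↦ r • v) := by fun_prop
        have h1 := this.tendsto 0
        rw [zero_smul] at h1
        exact h1.mono_left nhdsWithin_le_nhds
      obtain ⟨r, hr, hr0⟩ := ((hc.eventually (e.open_source.mem_nhds h.zero_mem)).and
        self_mem_nhdsWithin).exists
      exact ⟨r, hr0, hr⟩
    · exact ⟨s, h0, hs⟩
  have hst : ∀ r : ℝ, (t⁻¹ * r) • t • v = r • v := by
    intro r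
    rw [smul_smul]
    congr 1
    field_simp
  have h1 := h.hasDerivAt_fderiv_line_of_mem (p₀ := p₀) (v := t • v) (s := t⁻¹ * s) ht
    (by rwa [hst]) (by rwa [hst])
  have h2 : HasDerivAt (fun r : ℝ ↦ t⁻¹ * r) t⁻¹ s := by
    simpa using (hasDerivAt_id s).const_mul t⁻¹
  have h3 := (HasDerivAt.scomp s h1 h2).const_smul t⁻¹
  rw [hst, map_smul, geodesicField_smul, smul_smul, smul_smul] at h3
  have h4 : t⁻¹ * t⁻¹ * t ^ 2 = 1 := by field_simp
  rw [h4, one_smul] at h3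
  refine h3.congr_of_eventuallyEq (Filter.Eventually.of_forall fun r ↦ ?_)
  simp only [Pi.smul_apply, Function.comp, hst]
  rw [map_smul, smul_smul, inv_mul_cancel₀ ht0, one_smul]

/-- Solutions of the geodesic equation in a chart are the radial geodesics of normal charts. -/
theorem flow_eq (h : g.NormalChart q U e) {p₀ : M} (hq : q ∈ (extChartAt (𝓡 n) p₀).source)
    {N : Set (𝔼 × 𝔼)} {K : NNReal} (hNo : IsOpen N)
    (hK : LipschitzOnWith K
      (fun x : 𝔼 × 𝔼 ↦ (x.2, geodesicField (g.pullback (extChartAt (𝓡 n) p₀).symm) x)) N)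
    (hNT : ∀ x ∈ N, x.1 ∈ (extChartAt (𝓡 n) p₀).target ∧ (extChartAt (𝓡 n) p₀).symm x.1 ∈ U)
    {Y : ℝ → 𝔼 × 𝔼} {v : 𝔼} (hY0 : Y 0 = (extChartAt (𝓡 n) p₀ q, v))
    (hY : ∀ s ∈ Ioo (-2 : ℝ) 2, HasDerivAt Y
      ((Y s).2, geodesicField (g.pullback (extChartAt (𝓡 n) p₀).symm) (Y s)) s ∧ Y s ∈ N)
    {w : 𝔼} (hw : w = dmap n (extChartAt (𝓡 n) p₀).symm (extChartAt (𝓡 n) p₀ q) v) :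
    ∀ s ∈ Icc (0 : ℝ) 1, s • w ∈ e.source ∧ (extChartAt (𝓡 n) p₀).symm (Y s).1 = e (s • w) ∧
      (Y s).2 = fderiv ℝ (fun b ↦ extChartAt (𝓡 n) p₀ (e b)) (s • w) w := by
  set φ := extChartAt (𝓡 n) p₀ with hφ
  set κ : 𝔼 → 𝔼 := fun b ↦ φ (e b) with hκ
  set W : ℝ → 𝔼 × 𝔼 := fun s ↦ (κ (s • w), fderiv ℝ κ (s • w) w) with hW
  have hI : ∀ s ∈ Icc (0 : ℝ) 1, s ∈ Ioo (-2 : ℝ) 2 := fun s hs ↦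
    ⟨by linarith [hs.1], by linarith [hs.2]⟩
  set A : Set ℝ := {s | s • w ∈ e.source ∧ e (s • w) ∈ φ.source ∧ Y s = W s} with hA
  have hWder : ∀ s, s • w ∈ e.source → e (s • w) ∈ φ.source →
      HasDerivAt W ((W s).2, geodesicField (g.pullback φ.symm) (W s)) s := by
    intro s hs hp
    exact (h.hasDerivAt_chart_line hs hp).prodMk (h.hasDerivAt_fderiv_line hs hp)
  have hsub : Icc (0 : ℝ) 1 ⊆ A := by
    refine IsClosed.Icc_subset_of_forall_exists_gt ?_ ?_ ?_
    -- The ray cannot leave the source at a limit time: the solution `Y` stays over `U`, which is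
    -- the whole target of `e`, so `s • w` is the preimage of a point of the target.
    · refine isClosed_of_closure_subset fun s hs ↦ ?_
      obtain ⟨x, hx, hxs⟩ := mem_closure_iff_seq_limit.1 hs
      have hsI : s ∈ Icc (0 : ℝ) 1 := isClosed_Icc.mem_of_tendsto hxs
        (Filter.Eventually.of_forall fun k ↦ (hx k).2)
      have hYs := hY s (hI s hsI)
      have hT := hNT _ hYs.2
      have hsym : φ.symm (Y s).1 ∈ e.target := by
        rw [h.target_eq]
        exact hT.2
      have hc1 : ContinuousAt φ.symm (Y s).1 := continuousAt_extChartAt_symm'' hT.1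
      have hc2 : ContinuousAt (fun r ↦ e.symm (φ.symm (Y r).1)) s := by
        have h1 : ContinuousAt (fun r ↦ (Y r).1) s := hYs.1.continuousAt.fst
        have h2 : ContinuousAt (fun r ↦ φ.symm (Y r).1) s :=
          ContinuousAt.comp (f := fun r ↦ (Y r).1) hc1 h1
        exact ContinuousAt.comp (f := fun r ↦ φ.symm (Y r).1) (e.symm.continuousAt hsym) h2
      have hxA : ∀ k, φ.symm (Y (x k)).1 = e (x k • w) := by
        intro k
        rw [(hx k).1.2.2]
        exact φ.left_inv (hx k).1.2.1
      have h3 : Filter.Tendsto (fun k ↦ x k • w) Filter.atTop (𝓝 (e.symm (φ.symm (Y s).1))) := by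
        refine (hc2.tendsto.comp hxs).congr fun k ↦ ?_
        simp only [Function.comp]
        rw [hxA k, e.left_inv (hx k).1.1]
      have h4 : s • w = e.symm (φ.symm (Y s).1) :=
        tendsto_nhds_unique (hxs.smul_const w) h3
      have h5 : s • w ∈ e.source := by
        rw [h4]
        exact e.map_target hsym
      have h6 : e (s • w) = φ.symm (Y s).1 := by rw [h4, e.right_inv hsym]
      have h7 : e (s • w) ∈ φ.source := by
        rw [h6]
        exact φ.map_target hT.1
      refine ⟨⟨h5, h7, ?_⟩, hsI⟩
      have h8 := (hWder s h5 h7).continuousAt.tendsto.comp hxs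
      have h9 := hYs.1.continuousAt.tendsto.comp hxs
      refine tendsto_nhds_unique h9 (h8.congr fun k ↦ ?_)
      exact (hx k).1.2.2.symm
    · have hq' : e ((0 : ℝ) • w) = q := by rw [zero_smul, h.map_zero]
      refine ⟨by simpa using h.zero_mem, by rwa [hq'], ?_⟩
      rw [hY0]
      simp only [hW, hκ, hq']
      congr 1
      apply dmap_chart_injective (φ.map_source hq)
      rw [← hw]
      have h1 := (h.eventually_pullback_eq h.zero_mem (p₀ := p₀) (by rwa [h.map_zero])).self_of_nhds
      have h2 := congrArg (fun L : 𝔼 →L[ℝ] 𝔼 ↦ L w) h1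
      simp only [h.dmap_zero, ContinuousLinearMap.comp_apply, h.map_zero] at h2
      rw [zero_smul]
      exact h2
    · rintro s ⟨⟨hs1, hs2, hs3⟩, hsI⟩ y hy
      have hsI' := hI s (Ico_subset_Icc_self hsI)
      have hev := h.eventually_line hs1 hs2
      have hWN : ∀ᶠ r in 𝓝 s, W r ∈ N := by
        refine (hWder s hs1 hs2).continuousAt.eventually (hNo.mem_nhds ?_)
        rw [← hs3]
        exact (hY s hsI').2
      -- Openness in the continuous induction: both curves solve the same Lipschitz equation and
      -- agree at `s`.
      have h1 : Y =ᶠ[𝓝 s] W := by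
        refine ODE_solution_unique_of_eventually (K := K) (s := fun _ ↦ N)
          (v := fun _ x ↦ (x.2, geodesicField (g.pullback φ.symm) x))
          (Filter.Eventually.of_forall fun _ ↦ hK) ?_ ?_ hs3
        · filter_upwards [Ioo_mem_nhds hsI'.1 hsI'.2] with r hr
          exact hY r hr
        · filter_upwards [hev, hWN] with r hr1 hr2
          exact ⟨hWder r hr1.1 hr1.2, hr2⟩
      have h2 : ∀ᶠ r in 𝓝[>] s, r ∈ A := by
        filter_upwards [nhdsWithin_le_nhds hev, nhdsWithin_le_nhds h1] with r hr1 hr2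
        exact ⟨hr1.1, hr1.2, hr2⟩
      obtain ⟨r, hr1, hr2⟩ := (h2.and (Ioc_mem_nhdsGT hy)).exists
      exact ⟨r, hr1, hr2⟩
  intro s hs
  obtain ⟨h1, h2, h3⟩ := hsub hs
  refine ⟨h1, ?_, ?_⟩
  · rw [h3]
    exact φ.left_inv h2
  · rw [h3]

end NormalChart

end LorentzianMetric

end GeodesicFlow

/-! ### Comparing the flow with straight lines -/

section FlowInverse

variable {E : Type*} [NormedAddCommGroup E] [NormedSpace ℝ E]

/-- The hypothesis on the velocities bounds the derivative of the position minus `s • x.2`. -/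
theorem norm_flow_sub_le {F : E × E → E} {Y : ℝ → E × E} {x : E × E} {C : ℝ}
    (h0 : Y 0 = x) (hd : ∀ s ∈ Icc (0 : ℝ) 1, HasDerivAt Y ((Y s).2, F (Y s)) s)
    (hC : ∀ s ∈ Icc (0 : ℝ) 1, ‖(Y s).2 - x.2‖ ≤ C * ‖x.2‖ ^ 2) :
    ‖(Y 1).1 - x.1 - x.2‖ ≤ C * ‖x.2‖ ^ 2 := by
  have h1 : ∀ s ∈ Icc (0 : ℝ) 1, HasDerivWithinAt (fun s ↦ (Y s).1 - s • x.2) ((Y s).2 - x.2)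
      (Icc 0 1) s := by
    intro s hs
    have h2 : HasDerivAt (fun r : ℝ ↦ r • x.2) x.2 s := by
      simpa using (hasDerivAt_id s).smul_const x.2
    have h3 := HasDerivAt.sub (hd s hs).fst h2
    exact HasDerivAt.hasDerivWithinAt (h3.congr_deriv rfl)
  have := norm_image_sub_le_of_norm_deriv_le_segment' h1
    (fun s hs ↦ hC s (Ico_subset_Icc_self hs)) 1 (by simp)
  simp only [h0, zero_smul, sub_zero, one_smul, mul_one] at this
  rwa [sub_right_comm] at this

end FlowInverse

/-! ### Continuity of solutions of uniquely solvable equations -/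

section InverseContinuity

variable {X Y Z : Type*} [TopologicalSpace X] [TopologicalSpace Y] [TopologicalSpace Z] [T2Space Z]

/-- The solution `v = V (u, y)` in a compact set of a uniquely solvable equation `P (u, v) = y` depends
continuously on the data. -/
theorem continuousOn_of_unique_solution {P : X × Y → Z} {V : X × Z → Y} {A : Set X} {B : Set (X × Z)}
    {K : Set Y} (hK : IsCompact K) (hB : IsOpen B) (hBA : ∀ x ∈ B, x.1 ∈ A)
    (hP : ContinuousOn P (A ×ˢ K)) (hinj : ∀ u ∈ A, InjOn (fun v ↦ P (u, v)) K)
    (hV : ∀ x ∈ B, V x ∈ K ∧ P (x.1, V x) = x.2) : ContinuousOn V B := by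
  intro x hx
  refine ContinuousAt.continuousWithinAt ?_
  -- Every cluster point of `V` at `x` solves the equation with data `x`, so it equals `V x`; in a
  -- compact set this forces convergence.
  refine hK.tendsto_nhds_of_unique_mapClusterPt
    (Filter.eventually_of_mem (hB.mem_nhds hx) fun y hy ↦ (hV y hy).1) fun v hv hvc ↦ ?_
  obtain ⟨l, hl, hlv⟩ := mapClusterPt_iff_ultrafilter.1 hvc
  have hBl : B ∈ (l : Filter (X × Z)) := hl (hB.mem_nhds hx)
  refine hinj x.1 (hBA x hx) hv (hV x hx).1 ?_
  have h1 : Filter.Tendsto (fun y : X × Z ↦ (y.1, V y)) l (𝓝[A ×ˢ K] (x.1, v)) := by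
    refine tendsto_nhdsWithin_iff.2 ⟨?_, ?_⟩
    · exact ((continuous_fst.tendsto x).mono_left hl).prodMk_nhds hlv
    · filter_upwards [hBl] with y hy
      exact ⟨hBA y hy, (hV y hy).1⟩
  have h2 := (hP (x.1, v) ⟨hBA x hx, hv⟩).tendsto.comp h1
  have h3 : Filter.Tendsto (fun y : X × Z ↦ y.2) l (𝓝 x.2) :=
    (continuous_snd.tendsto x).mono_left hl
  have h4 : Filter.Tendsto (fun y : X × Z ↦ P (y.1, V y)) l (𝓝 x.2) := by
    refine h3.congr' ?_
    filter_upwards [hBl] with y hy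
    exact (hV y hy).2.symm
  have := tendsto_nhds_unique h2 h4
  exact this.trans (hV x hx).2.symm

end InverseContinuity

/-! ### Geodesic chords depending continuously on their end points -/

section Chords

variable {n : ℕ} {M : Type*} [TopologicalSpace M] [ChartedSpace (EuclideanSpace ℝ (Fin n)) M]
  [IsManifold (𝓡 n) ∞ M]

local notation "𝔼" => EuclideanSpace ℝ (Fin n)

/-- A system of geodesic chords of `U`, in the chart around `z`: `ch y y' s` is the point with
parameter `s` of the geodesic from `y` to `y'`, and `a y y' s` is the velocity there. -/
structure LorentzianMetric.ChordSystem (g : LorentzianMetric n M) (U : Set M) (z : M) (ρ C : ℝ)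
    (ch a : EuclideanSpace ℝ (Fin n) → EuclideanSpace ℝ (Fin n) → ℝ → EuclideanSpace ℝ (Fin n)) :
    Prop where
  pos : 0 < ρ
  nonneg : 0 ≤ C
  ball_subset : ∀ y ∈ Metric.ball (extChartAt (𝓡 n) z z) ρ,
    y ∈ (extChartAt (𝓡 n) z).target ∧ (extChartAt (𝓡 n) z).symm y ∈ U
  continuousOn : ContinuousOn (fun x : (EuclideanSpace ℝ (Fin n) × EuclideanSpace ℝ (Fin n)) × ℝ ↦
      (ch x.1.1 x.1.2 x.2, a x.1.1 x.1.2 x.2))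
    ((Metric.ball (extChartAt (𝓡 n) z z) ρ ×ˢ Metric.ball (extChartAt (𝓡 n) z z) ρ) ×ˢ Icc 0 1)
  mem : ∀ y ∈ Metric.ball (extChartAt (𝓡 n) z z) ρ, ∀ y' ∈ Metric.ball (extChartAt (𝓡 n) z z) ρ,
    ∀ s ∈ Icc (0 : ℝ) 1,
      ch y y' s ∈ (extChartAt (𝓡 n) z).target ∧ (extChartAt (𝓡 n) z).symm (ch y y' s) ∈ U
  hasDerivAt : ∀ y ∈ Metric.ball (extChartAt (𝓡 n) z z) ρ,
    ∀ y' ∈ Metric.ball (extChartAt (𝓡 n) z z) ρ,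
    ∀ s ∈ Icc (0 : ℝ) 1, HasDerivAt (ch y y') (a y y' s) s
  zero : ∀ y ∈ Metric.ball (extChartAt (𝓡 n) z z) ρ,
    ∀ y' ∈ Metric.ball (extChartAt (𝓡 n) z z) ρ, ch y y' 0 = y
  one : ∀ y ∈ Metric.ball (extChartAt (𝓡 n) z z) ρ,
    ∀ y' ∈ Metric.ball (extChartAt (𝓡 n) z z) ρ, ch y y' 1 = y'
  norm_sub_le : ∀ y ∈ Metric.ball (extChartAt (𝓡 n) z z) ρ,
    ∀ y' ∈ Metric.ball (extChartAt (𝓡 n) z z) ρ,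
    ∀ s ∈ Icc (0 : ℝ) 1, ‖a y y' s - (y' - y)‖ ≤ C * ‖y' - y‖ ^ 2
  cone : ∀ S : Spacetime n M, S.toLorentzianMetric = g →
    ∀ y ∈ Metric.ball (extChartAt (𝓡 n) z z) ρ, ∀ y' ∈ Metric.ball (extChartAt (𝓡 n) z z) ρ,
    S.FChron U ((extChartAt (𝓡 n) z).symm y) ((extChartAt (𝓡 n) z).symm y') →
    ∀ s ∈ Icc (0 : ℝ) 1, a y y' s ∈ S.pullbackCone (extChartAt (𝓡 n) z).symm (ch y y' s)
  fchron : ∀ S : Spacetime n M, S.toLorentzianMetric = g →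
    ∀ y ∈ Metric.ball (extChartAt (𝓡 n) z z) ρ, ∀ y' ∈ Metric.ball (extChartAt (𝓡 n) z z) ρ,
    a y y' 0 ∈ S.pullbackCone (extChartAt (𝓡 n) z).symm y →
    S.FChron U ((extChartAt (𝓡 n) z).symm y) ((extChartAt (𝓡 n) z).symm y')
  fchron_sub : ∀ S : Spacetime n M, S.toLorentzianMetric = g →
    ∀ y ∈ Metric.ball (extChartAt (𝓡 n) z z) ρ, ∀ y' ∈ Metric.ball (extChartAt (𝓡 n) z z) ρ,
    S.FChron U ((extChartAt (𝓡 n) z).symm y) ((extChartAt (𝓡 n) z).symm y') →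
    ∀ V : Set M, (∀ s ∈ Icc (0 : ℝ) 1, (extChartAt (𝓡 n) z).symm (ch y y' s) ∈ V) →
    ∀ s ∈ Icc (0 : ℝ) 1, ∀ s' ∈ Icc (0 : ℝ) 1, s < s' →
    S.FChron V ((extChartAt (𝓡 n) z).symm (ch y y' s)) ((extChartAt (𝓡 n) z).symm (ch y y' s'))

theorem exists_chart_equiv {z : M} {y : 𝔼} (hy : y ∈ (extChartAt (𝓡 n) z).target) :
    ∃ L : 𝔼 ≃L[ℝ] 𝔼, ∀ v, L v = dmap n (extChartAt (𝓡 n) z).symm y v :=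
  ⟨(LinearEquiv.ofBijective (dmap n (extChartAt (𝓡 n) z).symm y).toLinearMap
    ⟨dmap_chart_injective hy, dmap_chart_surjective hy⟩).toContinuousLinearEquiv, fun _ ↦ rfl⟩

namespace LorentzianMetric

/-- The radial geodesic of a normal chart with initial vector `w`, read in a chart of the manifold,
is future timelike if `w` is. -/
theorem NormalChart.radial_cone {S : Spacetime n M} {q : M} {U : Set M}
    {e : OpenPartialHomeomorph (EuclideanSpace ℝ (Fin n)) M}
    (h : S.toLorentzianMetric.NormalChart q U e) {z : M} {w : 𝔼} (hw : w ∈ e.source)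
    (hwc : w ∈ S.futureCone q) {s : ℝ} (hs : s ∈ Icc (0 : ℝ) 1)
    (hz : e (s • w) ∈ (extChartAt (𝓡 n) z).source) :
    fderiv ℝ (fun b ↦ extChartAt (𝓡 n) z (e b)) (s • w) w ∈
      S.pullbackCone (extChartAt (𝓡 n) z).symm (extChartAt (𝓡 n) z (e (s • w))) := by
  have h1 := S.radial_mem_pullbackCone h hw hwc hs
  have h2 := (h.eventually_pullback_eq (h.smul_mem hw hs) hz).self_of_nhds
  have h3 : dmap n e (s • w) w ∈ S.futureCone (e (s • w)) := h1
  rw [h2] at h3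
  change dmap n (extChartAt (𝓡 n) z).symm _ _ ∈ S.futureCone ((extChartAt (𝓡 n) z).symm _)
  rw [(extChartAt (𝓡 n) z).left_inv hz]
  exact h3


variable {g : LorentzianMetric n M} {U : Set M}

set_option maxHeartbeats 800000 in
/-- Every point of a convex normal set has a system of geodesic chords. -/
theorem IsConvexNormal.exists_chordSystem (hU : g.IsConvexNormal U) {z : M} (hz : z ∈ U) :
    ∃ ρ C : ℝ, ∃ ch a : 𝔼 → 𝔼 → ℝ → 𝔼, g.ChordSystem U z ρ C ch a := by
  set φ := extChartAt (𝓡 n) z with hφ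
  set F : 𝔼 × 𝔼 → 𝔼 := geodesicField (g.pullback φ.symm) with hFdef
  have hzt : φ z ∈ φ.target := mem_extChartAt_target z
  have hF : ContDiffAt ℝ 1 F (φ z, 0) :=
    contDiffAt_geodesicField (g.contDiffAt_pullback_chart hzt) (g.isInvertible_pullback_chart hzt)
  have hf : ContDiffAt ℝ 1 (fun x : 𝔼 × 𝔼 ↦ (x.2, F x)) (φ z, 0) := contDiffAt_snd.prodMk hF
  obtain ⟨K, t, ht, hLip⟩ := hf.exists_lipschitzOnWith
  set T : Set 𝔼 := φ.target ∩ φ.symm ⁻¹' U with hT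
  have hTo : IsOpen T :=
    (continuousOn_extChartAt_symm z).isOpen_inter_preimage (isOpen_extChartAt_target z) hU.1
  have hzT : φ z ∈ T := ⟨hzt, by
    change φ.symm (φ z) ∈ U
    rw [φ.left_inv (mem_extChartAt_source z)]
    exact hz⟩
  set N : Set (𝔼 × 𝔼) := interior t ∩ T ×ˢ univ with hN
  have hNo : IsOpen N := isOpen_interior.inter (hTo.prod isOpen_univ)
  have hN0 : N ∈ 𝓝 (φ z, (0 : 𝔼)) :=
    hNo.mem_nhds ⟨mem_interior_iff_mem_nhds.2 ht, hzT, mem_univ _⟩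
  have hLipN : LipschitzOnWith K (fun x : 𝔼 × 𝔼 ↦ (x.2, F x)) N :=
    hLip.mono fun x hx ↦ interior_subset hx.1
  obtain ⟨r, hr, C, hC, Y, hYc, hY⟩ := exists_quadratic_flow hF
    (fun u a l ↦ geodesicField_smul (g.pullback φ.symm) u a l) hN0
  -- This gives `C * r1 ≤ 1 / 2`, so the end point of the geodesic from `u` with initial vector `v`
  -- differs from `u + v` by at most half of `‖v‖`. With `ρ = r1 / 4` below, two points of the
  -- `ρ`-ball have distance less than `r1 / 2`, and the vector joining them must have norm less than
  -- `r1`.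
  set r1 : ℝ := min r ((2 * C + 1)⁻¹) with hr1
  have hr1pos : 0 < r1 := lt_min hr (by positivity)
  have hr1r : r1 ≤ r := min_le_left _ _
  have hCr1 : C * r1 ≤ 1 / 2 := by
    have h1 : C * r1 ≤ C * (2 * C + 1)⁻¹ := mul_le_mul_of_nonneg_left (min_le_right _ _) hC
    refine h1.trans ?_
    rw [← div_eq_mul_inv, div_le_iff₀ (by positivity)]
    linarith
  set ρ : ℝ := r1 / 4 with hρ
  have hρpos : 0 < ρ := by positivity
  have hx : ∀ u ∈ Metric.ball (φ z) ρ, ∀ v ∈ Metric.closedBall (0 : 𝔼) r1,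
      (u, v) ∈ Metric.closedBall (φ z, (0 : 𝔼)) r := by
    intro u hu v hv
    rw [← closedBall_prod_same]
    exact ⟨Metric.ball_subset_closedBall (Metric.ball_subset_ball (by linarith) hu),
      Metric.closedBall_subset_closedBall hr1r hv⟩
  have hI : ∀ s ∈ Icc (0 : ℝ) 1, s ∈ Ioo (-2 : ℝ) 2 := fun s hs ↦
    ⟨by linarith [hs.1], by linarith [hs.2]⟩
  have hNT : ∀ x ∈ N, x.1 ∈ φ.target ∧ φ.symm x.1 ∈ U := fun x hx ↦ hx.2.1
  have hballT : ∀ u ∈ Metric.ball (φ z) ρ, u ∈ T := by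
    intro u hu
    have h1 := hY _ (hx u hu 0 (by simp [hr1pos.le]))
    have h2 := (h1.2.1 0 (by norm_num)).2
    rw [h1.1] at h2
    exact h2.2.1
  -- the flow is the exponential map
  have hexp : ∀ u ∈ Metric.ball (φ z) ρ, ∃ e : OpenPartialHomeomorph 𝔼 M,
      g.NormalChart (φ.symm u) U e ∧ ∀ v ∈ Metric.closedBall (0 : 𝔼) r1,
        ∀ s ∈ Icc (0 : ℝ) 1, s • dmap n φ.symm u v ∈ e.source ∧
          φ.symm (Y ((u, v), s)).1 = e (s • dmap n φ.symm u v) ∧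
          (Y ((u, v), s)).2 = fderiv ℝ (fun b ↦ φ (e b)) (s • dmap n φ.symm u v)
            (dmap n φ.symm u v) := by
    intro u hu
    obtain ⟨e, he⟩ := (hU.2 (φ.symm u) (hballT u hu).2).exists_normalChart
    refine ⟨e, he, fun v hv ↦ ?_⟩
    have h1 := hY _ (hx u hu v hv)
    have hut := (hballT u hu).1
    refine he.flow_eq (p₀ := z) (φ.map_target hut) hNo hLipN hNT (Y := fun s ↦ Y ((u, v), s)) (v := v)
      ?_ h1.2.1 ?_
    · rw [h1.1, ← hφ, φ.right_inv hut]
    · rw [← hφ, φ.right_inv hut]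
  have hYT : ∀ u ∈ Metric.ball (φ z) ρ, ∀ v ∈ Metric.closedBall (0 : 𝔼) r1, ∀ s ∈ Icc (0 : ℝ) 1,
      (Y ((u, v), s)).1 ∈ φ.target ∧ φ.symm (Y ((u, v), s)).1 ∈ U := fun u hu v hv s hs ↦
    hNT _ ((hY _ (hx u hu v hv)).2.1 s (hI s hs)).2
  set P : 𝔼 × 𝔼 → 𝔼 := fun x ↦ (Y (x, 1)).1 with hP
  have hPsub : ∀ u ∈ Metric.ball (φ z) ρ, ∀ v ∈ Metric.closedBall (0 : 𝔼) r1,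
      ‖P (u, v) - u - v‖ ≤ C * ‖v‖ ^ 2 := by
    intro u hu v hv
    have h1 := hY _ (hx u hu v hv)
    exact norm_flow_sub_le (F := F) (x := (u, v)) (Y := fun s ↦ Y ((u, v), s)) h1.1
      (fun s hs ↦ (h1.2.1 s (hI s hs)).1) h1.2.2
  have hPlow : ∀ u ∈ Metric.ball (φ z) ρ, ∀ v ∈ Metric.closedBall (0 : 𝔼) r1,
      ‖v‖ ≤ 2 * ‖P (u, v) - u‖ := by
    intro u hu v hv
    have h1 := hPsub u hu v hv
    have h2 : ‖v‖ ≤ ‖P (u, v) - u‖ + ‖P (u, v) - u - v‖ := by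
      have : v = (P (u, v) - u) - (P (u, v) - u - v) := by abel
      calc ‖v‖ = ‖(P (u, v) - u) - (P (u, v) - u - v)‖ := by rw [← this]
        _ ≤ _ := norm_sub_le _ _
    have hv' : ‖v‖ ≤ r1 := by simpa using hv
    have h3 : C * ‖v‖ ^ 2 ≤ 1 / 2 * ‖v‖ := by
      calc C * ‖v‖ ^ 2 = (C * ‖v‖) * ‖v‖ := by ring
        _ ≤ (C * r1) * ‖v‖ := by gcongr
        _ ≤ 1 / 2 * ‖v‖ := by gcongr
    linarith
  have hPc : ContinuousOn P (Metric.ball (φ z) ρ ×ˢ Metric.closedBall (0 : 𝔼) r1) := by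
    have h1 : ContinuousOn (fun x : 𝔼 × 𝔼 ↦ Y (x, 1))
        (Metric.ball (φ z) ρ ×ˢ Metric.closedBall (0 : 𝔼) r1) :=
      hYc.comp (by fun_prop) fun x hx' ↦ ⟨hx x.1 hx'.1 x.2 hx'.2, by simp⟩
    exact continuous_fst.comp_continuousOn h1
  -- Injectivity is inherited from the exponential map at `u`; the estimates above would not give
  -- it.
  have hPinj : ∀ u ∈ Metric.ball (φ z) ρ, InjOn (fun v ↦ P (u, v)) (Metric.closedBall (0 : 𝔼) r1) := by
    intro u hu v hv v' hv' hvv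
    obtain ⟨e, he, h1⟩ := hexp u hu
    have h2 := h1 v hv 1 (by simp)
    have h3 := h1 v' hv' 1 (by simp)
    simp only [one_smul] at h2 h3
    have h4 : (Y ((u, v), 1)).1 = (Y ((u, v'), 1)).1 := hvv
    have h5 : e (dmap n φ.symm u v) = e (dmap n φ.symm u v') := by
      rw [← h2.2.1, ← h3.2.1, h4]
    exact dmap_chart_injective (hballT u hu).1 (e.injOn h2.1 h3.1 h5)
  -- A connectedness argument. The image `A` of the open ball is open, because exponential maps are
  -- homeomorphisms onto open sets; the image of the closed ball is compact. By `hPlow` a limit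
  -- point of `A` at distance less than `r1 / 2` from `u` comes from the open ball, so the ball
  -- around `u` meets `A` in a nonempty relatively clopen set.
  have hsurj : ∀ u ∈ Metric.ball (φ z) ρ, ∀ y' ∈ Metric.ball (φ z) ρ,
      ∃ v ∈ Metric.closedBall (0 : 𝔼) r1, P (u, v) = y' := by
    intro u hu y' hy'
    obtain ⟨e, he, h1⟩ := hexp u hu
    set A : Set 𝔼 := (fun v ↦ P (u, v)) '' Metric.ball 0 r1 with hA
    have hAo : IsOpen A := by
      obtain ⟨L, hLv⟩ := exists_chart_equiv (hballT u hu).1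
      have h2 : IsOpen (e '' (L '' Metric.ball 0 r1)) := by
        refine e.isOpen_image_of_subset_source (L.toHomeomorph.isOpenMap _ Metric.isOpen_ball) ?_
        rintro _ ⟨v, hv, rfl⟩
        have := (h1 v (Metric.ball_subset_closedBall hv) 1 (by simp)).1
        rw [one_smul, ← hLv] at this
        exact this
      have h3 : A = φ.target ∩ φ.symm ⁻¹' (e '' (L '' Metric.ball 0 r1)) := by
        ext y
        constructor
        · rintro ⟨v, hv, rfl⟩
          have h4 := Metric.ball_subset_closedBall hv
          refine ⟨(hYT u hu v h4 1 (by simp)).1, L v, ⟨v, hv, rfl⟩, ?_⟩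
          have := (h1 v h4 1 (by simp)).2.1
          rw [one_smul, ← hLv] at this
          exact this.symm
        · rintro ⟨hy, _, ⟨v, hv, rfl⟩, hev⟩
          have h4 := Metric.ball_subset_closedBall hv
          refine ⟨v, hv, ?_⟩
          have := (h1 v h4 1 (by simp)).2.1
          rw [one_smul, ← hLv] at this
          exact φ.symm.injOn (hYT u hu v h4 1 (by simp)).1 hy (this.trans hev)
      rw [h3]
      exact (continuousOn_extChartAt_symm z).isOpen_inter_preimage (isOpen_extChartAt_target z) h2
    have hAcl : closure A ⊆ (fun v ↦ P (u, v)) '' Metric.closedBall 0 r1 := by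
      refine closure_minimal (image_mono Metric.ball_subset_closedBall) ?_
      refine ((isCompact_closedBall (0 : 𝔼) r1).image_of_continuousOn ?_).isClosed
      exact hPc.comp (by fun_prop) fun v hv ↦ ⟨hu, hv⟩
    have h4 : Metric.ball u (r1 / 2) ⊆ A := by
      refine (convex_ball u (r1 / 2)).isPreconnected.subset_of_closure_inter_subset hAo ?_ ?_
      · refine ⟨u, Metric.mem_ball_self (by positivity), 0, Metric.mem_ball_self hr1pos, ?_⟩
        have := hPsub u hu 0 (by simp [hr1pos.le])
        simpa [sub_eq_zero] using this
      · rintro y ⟨hyA, hyu⟩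
        obtain ⟨v, hv, rfl⟩ := hAcl hyA
        refine ⟨v, ?_, rfl⟩
        have h5 := hPlow u hu v hv
        rw [mem_ball_iff_norm] at hyu
        rw [mem_ball_zero_iff]
        linarith
    have h5 : y' ∈ Metric.ball u (r1 / 2) := by
      have := dist_triangle_right y' u (φ z)
      rw [Metric.mem_ball] at hu hy' ⊢
      linarith
    obtain ⟨v, hv, hvy⟩ := h4 h5
    exact ⟨v, Metric.ball_subset_closedBall hv, hvy⟩
  have hsurj' : ∀ x : 𝔼 × 𝔼, ∃ v, x ∈ Metric.ball (φ z) ρ ×ˢ Metric.ball (φ z) ρ →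
      v ∈ Metric.closedBall (0 : 𝔼) r1 ∧ P (x.1, v) = x.2 := by
    intro x
    by_cases h : x ∈ Metric.ball (φ z) ρ ×ˢ Metric.ball (φ z) ρ
    · obtain ⟨v, hv⟩ := hsurj x.1 h.1 x.2 h.2
      exact ⟨v, fun _ ↦ hv⟩
    · exact ⟨0, fun h' ↦ absurd h' h⟩
  choose V hV using hsurj'
  have hVc : ContinuousOn V (Metric.ball (φ z) ρ ×ˢ Metric.ball (φ z) ρ) :=
    continuousOn_of_unique_solution (isCompact_closedBall (0 : 𝔼) r1)
      (Metric.isOpen_ball.prod Metric.isOpen_ball) (fun x hx ↦ hx.1) hPc hPinj hV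
  have hw : ∀ y ∈ Metric.ball (φ z) ρ, ∀ y' ∈ Metric.ball (φ z) ρ,
      ∃ (e : OpenPartialHomeomorph 𝔼 M) (w : 𝔼), g.NormalChart (φ.symm y) U e ∧ w ∈ e.source ∧
        e.symm (φ.symm y') = w ∧ w = dmap n φ.symm y (V (y, y')) ∧
        ∀ s ∈ Icc (0 : ℝ) 1, s • w ∈ e.source ∧
          φ.symm (Y ((y, V (y, y')), s)).1 = e (s • w) ∧
          (Y ((y, V (y, y')), s)).1 = φ (e (s • w)) ∧ e (s • w) ∈ φ.source ∧
          (Y ((y, V (y, y')), s)).2 = fderiv ℝ (fun b ↦ φ (e b)) (s • w) w := by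
    intro y hy y' hy'
    obtain ⟨e, he, h1⟩ := hexp y hy
    have h2 := hV (y, y') ⟨hy, hy'⟩
    have h3 := h1 _ h2.1
    refine ⟨e, _, he, ?_, ?_, rfl, fun s hs ↦ ?_⟩
    · simpa using (h3 1 (by simp)).1
    · have h4 := h3 1 (by simp)
      rw [one_smul] at h4
      have h5 : (Y ((y, V (y, y')), 1)).1 = y' := h2.2
      rw [h5] at h4
      rw [h4.2.1, e.left_inv h4.1]
    · have h4 := h3 s hs
      have h5 := (hYT y hy _ h2.1 s hs).1
      refine ⟨h4.1, h4.2.1, ?_, ?_, h4.2.2⟩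
      · rw [← h4.2.1, φ.right_inv h5]
      · rw [← h4.2.1]
        exact φ.map_target h5
  -- The constant adds two errors `C * ‖V‖ ^ 2`, where `‖V‖ ≤ 2 * ‖y' - y‖`.
  refine ⟨ρ, 8 * C, fun y y' s ↦ (Y ((y, V (y, y')), s)).1, fun y y' s ↦ (Y ((y, V (y, y')), s)).2,
    hρpos, by positivity, hballT, ?_, ?_, ?_, ?_, ?_, ?_, ?_, ?_, ?_⟩
  · have h1 : ContinuousOn (fun x : (𝔼 × 𝔼) × ℝ ↦ Y ((x.1.1, V x.1), x.2))
        ((Metric.ball (φ z) ρ ×ˢ Metric.ball (φ z) ρ) ×ˢ Icc 0 1) := by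
      refine hYc.comp ?_ fun x hx' ↦ ⟨hx _ hx'.1.1 _ (hV x.1 hx'.1).1, hx'.2⟩
      have h2 : ContinuousOn (fun x : (𝔼 × 𝔼) × ℝ ↦ V x.1)
          ((Metric.ball (φ z) ρ ×ˢ Metric.ball (φ z) ρ) ×ˢ Icc 0 1) :=
        hVc.comp (by fun_prop) fun x hx' ↦ hx'.1
      exact ((by fun_prop : ContinuousOn (fun x : (𝔼 × 𝔼) × ℝ ↦ x.1.1) _).prodMk h2).prodMk
        (by fun_prop)
    exact h1
  · exact fun y hy y' hy' s hs ↦ hYT y hy _ (hV (y, y') ⟨hy, hy'⟩).1 s hs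
  · exact fun y hy y' hy' s hs ↦
      ((hY _ (hx y hy _ (hV (y, y') ⟨hy, hy'⟩).1)).2.1 s (hI s hs)).1.fst
  · intro y hy y' hy'
    simp only [(hY _ (hx y hy _ (hV (y, y') ⟨hy, hy'⟩).1)).1]
  · exact fun y hy y' hy' ↦ (hV (y, y') ⟨hy, hy'⟩).2
  · intro y hy y' hy' s hs
    have h0 := hV (y, y') ⟨hy, hy'⟩
    have h1 := hPsub y hy _ h0.1
    have h2 := hPlow y hy _ h0.1
    have h3 := (hY _ (hx y hy _ h0.1)).2.2 s hs
    simp only [h0.2] at h1 h2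
    have h4 : (Y ((y, V (y, y')), s)).2 - (y' - y) =
        ((Y ((y, V (y, y')), s)).2 - V (y, y')) - (y' - y - V (y, y')) := by abel
    calc ‖(Y ((y, V (y, y')), s)).2 - (y' - y)‖ ≤ _ := by rw [h4]; exact norm_sub_le _ _
      _ ≤ C * ‖V (y, y')‖ ^ 2 + C * ‖V (y, y')‖ ^ 2 := add_le_add h3 h1
      _ ≤ C * (2 * ‖y' - y‖) ^ 2 + C * (2 * ‖y' - y‖) ^ 2 := by gcongr
      _ = 8 * C * ‖y' - y‖ ^ 2 := by ring
  · rintro S rfl y hy y' hy' hS s hs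
    obtain ⟨e, w, he, hws, hwe, hwV, h1⟩ := hw y hy y' hy'
    have h2 := hS.symm_mem_futureCone he
    rw [hwe] at h2
    obtain ⟨-, -, h3, h4, h5⟩ := h1 s hs
    simp only [h3, h5]
    exact he.radial_cone hws h2 hs h4
  · rintro S rfl y hy y' hy' ha
    obtain ⟨e, w, he, hws, hwe, hwV, h1⟩ := hw y hy y' hy'
    rw [Spacetime.fchron_iff he (hballT y' hy').2, hwe, hwV]
    have h2 := (hY _ (hx y hy _ (hV (y, y') ⟨hy, hy'⟩).1)).1
    change (Y ((y, V (y, y')), 0)).2 ∈ _ at ha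
    rw [h2] at ha
    exact ha
  · rintro S rfl y hy y' hy' hS W hW s hs s' hs' hss
    obtain ⟨e, w, he, hws, hwe, hwV, h1⟩ := hw y hy y' hy'
    have h2 := hS.symm_mem_futureCone he
    rw [hwe] at h2
    obtain ⟨c1, c2, -, -, -⟩ := S.isFutureCurve_radial he hws h2
    have hsub : Icc s s' ⊆ Icc 0 1 := Icc_subset_Icc hs.1 hs'.2
    have := Spacetime.fchron_of_Icc (S := S) (U := W) (c := fun r : ℝ ↦ e (r • w)) hss
      (fun r hr ↦ c1 r (hsub hr)) (fun r hr ↦ c2 r (hsub hr)) (fun r hr ↦ by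
        change e (r • w) ∈ W
        rw [← (h1 r (hsub hr)).2.1]
        exact hW r (hsub hr))
    change S.FChron W (φ.symm (Y ((y, V (y, y')), s)).1) (φ.symm (Y ((y, V (y, y')), s')).1)
    rw [(h1 s hs).2.1, (h1 s' hs').2.1]
    exact this

end LorentzianMetric

end Chords

/-! ### Openness and local nature of the chronology relation -/

section ChordConsequences

variable {n : ℕ} {M : Type*} [TopologicalSpace M] [ChartedSpace (EuclideanSpace ℝ (Fin n)) M]
  [IsManifold (𝓡 n) ∞ M]

local notation "𝔼" => EuclideanSpace ℝ (Fin n)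

namespace LorentzianMetric.ChordSystem

variable {g : LorentzianMetric n M} {U : Set M} {z : M} {ρ C : ℝ}
  {ch a : EuclideanSpace ℝ (Fin n) → EuclideanSpace ℝ (Fin n) → ℝ → EuclideanSpace ℝ (Fin n)}

theorem norm_velocity_le (h : g.ChordSystem U z ρ C ch a) {y y' : 𝔼}
    (hy : y ∈ Metric.ball (extChartAt (𝓡 n) z z) ρ)
    (hy' : y' ∈ Metric.ball (extChartAt (𝓡 n) z z) ρ) {s : ℝ} (hs : s ∈ Icc (0 : ℝ) 1) :
    ‖a y y' s‖ ≤ (1 + 2 * C * ρ) * ‖y' - y‖ := by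
  have h1 := h.norm_sub_le y hy y' hy' s hs
  have h2 : ‖y' - y‖ ≤ 2 * ρ := by
    rw [← dist_eq_norm]
    have := dist_triangle_right y' y (extChartAt (𝓡 n) z z)
    rw [Metric.mem_ball] at hy hy'
    linarith
  have h3 : ‖a y y' s‖ ≤ ‖a y y' s - (y' - y)‖ + ‖y' - y‖ := by
    simpa using norm_add_le (a y y' s - (y' - y)) (y' - y)
  have h4 : C * ‖y' - y‖ ^ 2 ≤ C * (2 * ρ) * ‖y' - y‖ := by
    rw [sq, ← mul_assoc]
    have := h.nonneg
    gcongr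
  linarith

theorem dist_le (h : g.ChordSystem U z ρ C ch a) {y y' : 𝔼}
    (hy : y ∈ Metric.ball (extChartAt (𝓡 n) z z) ρ)
    (hy' : y' ∈ Metric.ball (extChartAt (𝓡 n) z z) ρ) {s : ℝ} (hs : s ∈ Icc (0 : ℝ) 1) :
    ‖ch y y' s - y‖ ≤ (1 + 2 * C * ρ) * ‖y' - y‖ := by
  have h1 := norm_image_sub_le_of_norm_deriv_le_segment'
    (fun s hs ↦ (h.hasDerivAt y hy y' hy' s hs).hasDerivWithinAt)
    (fun s hs ↦ h.norm_velocity_le hy hy' (Ico_subset_Icc_self hs)) s hs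
  rw [h.zero y hy y' hy', sub_zero] at h1
  have h2 : 0 ≤ (1 + 2 * C * ρ) * ‖y' - y‖ := by
    have := h.nonneg
    have := h.pos
    positivity
  exact h1.trans (mul_le_of_le_one_right h2 hs.2)

/-- A chord stays within a fixed multiple of the distance of its end points from its starting point,
so short chords near the centre remain in `V`. -/
theorem exists_ball_chord_mem (h : g.ChordSystem U z ρ C ch a) {V : Set 𝔼}
    (hV : V ∈ 𝓝 (extChartAt (𝓡 n) z z)) :
    ∃ r > 0, r ≤ ρ ∧ ∀ y ∈ Metric.ball (extChartAt (𝓡 n) z z) r,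
      ∀ y' ∈ Metric.ball (extChartAt (𝓡 n) z z) r, ∀ s ∈ Icc (0 : ℝ) 1, ch y y' s ∈ V := by
  obtain ⟨ε, hε, hεV⟩ := Metric.mem_nhds_iff.1 hV
  have hC := h.nonneg
  have hρ := h.pos
  set L := 1 + 2 * C * ρ with hL
  have hL0 : 0 < L := by positivity
  refine ⟨min ρ (ε / (2 * L + 1)), by positivity, min_le_left _ _, fun y hy y' hy' s hs ↦ hεV ?_⟩
  have hyρ := Metric.ball_subset_ball (min_le_left _ _) hy
  have hyρ' := Metric.ball_subset_ball (min_le_left _ _) hy'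
  have h1 := h.dist_le hyρ hyρ' hs
  have hy1 := Metric.ball_subset_ball (min_le_right _ _) hy
  have hy1' := Metric.ball_subset_ball (min_le_right _ _) hy'
  rw [Metric.mem_ball] at hy1 hy1' ⊢
  have h2 : ‖y' - y‖ < 2 * (ε / (2 * L + 1)) := by
    rw [← dist_eq_norm]
    have := dist_triangle_right y' y (extChartAt (𝓡 n) z z)
    linarith
  have h3 : dist (ch y y' s) (extChartAt (𝓡 n) z z) ≤
      ‖ch y y' s - y‖ + dist y (extChartAt (𝓡 n) z z) := by
    rw [← dist_eq_norm]
    exact dist_triangle _ _ _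
  have h4 : L * ‖y' - y‖ ≤ L * (2 * (ε / (2 * L + 1))) := by gcongr
  have h5 : L * (2 * (ε / (2 * L + 1))) + ε / (2 * L + 1) = ε := by
    field_simp
  linarith

theorem fchron_iff (S : Spacetime n M) (h : S.toLorentzianMetric.ChordSystem U z ρ C ch a) {y y' : 𝔼}
    (hy : y ∈ Metric.ball (extChartAt (𝓡 n) z z) ρ)
    (hy' : y' ∈ Metric.ball (extChartAt (𝓡 n) z z) ρ) :
    S.FChron U ((extChartAt (𝓡 n) z).symm y) ((extChartAt (𝓡 n) z).symm y') ↔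
      a y y' 0 ∈ S.pullbackCone (extChartAt (𝓡 n) z).symm y := by
  refine ⟨fun hS ↦ ?_, h.fchron S rfl y hy y' hy'⟩
  have := h.cone S rfl y hy y' hy' hS 0 (by simp)
  rwa [h.zero y hy y' hy'] at this

end LorentzianMetric.ChordSystem

namespace Spacetime

variable {S : Spacetime n M} {U : Set M}

theorem continuousOn_pullback_chart (S : Spacetime n M) (z : M) :
    ContinuousOn (S.pullback (extChartAt (𝓡 n) z).symm) (extChartAt (𝓡 n) z).target :=
  (S.contDiffOn_pullback (isOpen_extChartAt_target z)
    (contMDiffOn_extChartAt_symm (n := ∞) z)).continuousOn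

theorem continuousOn_orientPullback_chart (S : Spacetime n M) (z : M) :
    ContinuousOn (S.orientPullback (extChartAt (𝓡 n) z).symm) (extChartAt (𝓡 n) z).target :=
  (S.contDiffOn_orientPullback (isOpen_extChartAt_target z)
    (contMDiffOn_extChartAt_symm (n := ∞) z)).continuousOn

/-- The bundle of future cones is open. -/
theorem isOpen_cone_chart (S : Spacetime n M) (z : M) :
    IsOpen {x : 𝔼 × 𝔼 | x.1 ∈ (extChartAt (𝓡 n) z).target ∧
      x.2 ∈ S.pullbackCone (extChartAt (𝓡 n) z).symm x.1} := by
  have ht : IsOpen ((extChartAt (𝓡 n) z).target ×ˢ (univ : Set 𝔼)) :=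
    (isOpen_extChartAt_target z).prod isOpen_univ
  have hsub : MapsTo (fun x : 𝔼 × 𝔼 ↦ x.1) ((extChartAt (𝓡 n) z).target ×ˢ (univ : Set 𝔼))
      (extChartAt (𝓡 n) z).target := fun x hx ↦ hx.1
  have h1 : ContinuousOn (fun x : 𝔼 × 𝔼 ↦ S.pullback (extChartAt (𝓡 n) z).symm x.1 x.2 x.2)
      ((extChartAt (𝓡 n) z).target ×ˢ (univ : Set 𝔼)) :=
    (((S.continuousOn_pullback_chart z).comp (by fun_prop) hsub).clm_apply
      (by fun_prop)).clm_apply (by fun_prop)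
  have h2 : ContinuousOn (fun x : 𝔼 × 𝔼 ↦ S.orientPullback (extChartAt (𝓡 n) z).symm x.1 x.2)
      ((extChartAt (𝓡 n) z).target ×ˢ (univ : Set 𝔼)) :=
    ((S.continuousOn_orientPullback_chart z).comp (by fun_prop) hsub).clm_apply (by fun_prop)
  have h3 := (h1.isOpen_inter_preimage ht (isOpen_Iio (a := (0 : ℝ)))).inter
    (h2.isOpen_inter_preimage ht (isOpen_Iio (a := (0 : ℝ))))
  convert h3 using 1
  ext x
  simp only [mem_ofPred_eq, S.mem_pullbackCone, mem_inter_iff, mem_prod, mem_univ, and_true,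
    mem_preimage, mem_Iio]
  tauto

/-- Near the diagonal, the chronology relation of a convex normal set is open. -/
theorem exists_nhds_isOpen_fchron (hU : S.IsConvexNormal U) {z : M} (hz : z ∈ U) :
    ∃ W, IsOpen W ∧ z ∈ W ∧ W ⊆ U ∧ IsOpen {x : M × M | x.1 ∈ W ∧ x.2 ∈ W ∧ S.FChron U x.1 x.2} ∧
      IsOpen {x : M × M | x.1 ∈ W ∧ x.2 ∈ W ∧ S.reverse.FChron U x.1 x.2} := by
  obtain ⟨ρ, C, ch, a, h⟩ := hU.exists_chordSystem hz
  set φ := extChartAt (𝓡 n) z with hφ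
  set W := φ.source ∩ φ ⁻¹' Metric.ball (φ z) ρ with hW
  have hWo : IsOpen W := (continuousOn_extChartAt z).isOpen_inter_preimage
    (isOpen_extChartAt_source z) Metric.isOpen_ball
  have hcont : ContinuousOn (fun x : M × M ↦ (φ x.1, a (φ x.1) (φ x.2) 0)) (W ×ˢ W) := by
    have h1 : ContinuousOn (fun x : M × M ↦ φ x.1) (W ×ˢ W) :=
      (continuousOn_extChartAt z).comp continuousOn_fst fun x hx ↦ hx.1.1
    have h2 : ContinuousOn (fun x : M × M ↦ φ x.2) (W ×ˢ W) :=
      (continuousOn_extChartAt z).comp continuousOn_snd fun x hx ↦ hx.2.1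
    have h3 := (continuous_snd.comp_continuousOn h.continuousOn).comp
      (f := fun x : M × M ↦ ((φ x.1, φ x.2), (0 : ℝ))) ((h1.prodMk h2).prodMk continuousOn_const)
      (fun x hx ↦ ⟨⟨hx.1.2, hx.2.2⟩, by simp⟩)
    exact h1.prodMk h3
  -- The relation is the preimage of the open bundle of cones under the initial velocity of the
  -- chord, which is continuous. Quantifying over `S'` covers both time orientations with the same
  -- chords.
  have key : ∀ S' : Spacetime n M, S'.toLorentzianMetric = S.toLorentzianMetric →
      IsOpen {x : M × M | x.1 ∈ W ∧ x.2 ∈ W ∧ S'.FChron U x.1 x.2} := by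
    intro S' hS'
    rw [← hS'] at h
    have h4 := hcont.isOpen_inter_preimage (hWo.prod hWo) (S'.isOpen_cone_chart z)
    convert h4 using 1
    ext ⟨p, q⟩
    simp only [mem_ofPred_eq, mem_inter_iff, mem_prod, mem_preimage, and_assoc]
    refine and_congr_right fun hp ↦ and_congr_right fun hq ↦ ?_
    have h5 := h.fchron_iff S' hp.2 hq.2
    rw [← hφ, φ.left_inv hp.1, φ.left_inv hq.1] at h5
    rw [h5]
    exact ⟨fun h6 ↦ ⟨φ.map_source hp.1, h6⟩, fun h6 ↦ h6.2⟩
  refine ⟨W, hWo, ⟨mem_extChartAt_source z, Metric.mem_ball_self h.pos⟩, ?_, key S rfl,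
    key S.reverse rfl⟩
  intro p hp
  have := (h.ball_subset _ hp.2).2
  rwa [φ.left_inv hp.1] at this

/-- Near a point, the chronology relation does not depend on the convex normal set. -/
theorem exists_nhds_fchron_imp (hU : S.IsConvexNormal U) {z : M} (hz : z ∈ U) {V : Set M}
    (hV : V ∈ 𝓝 z) :
    ∃ W ∈ 𝓝 z, ∀ p ∈ W, ∀ q ∈ W, S.FChron U p q → S.FChron V p q := by
  obtain ⟨ρ, C, ch, a, h⟩ := hU.exists_chordSystem hz
  set φ := extChartAt (𝓡 n) z with hφ
  have hV' : φ.symm ⁻¹' V ∈ 𝓝 (φ z) := by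
    have : ContinuousAt φ.symm (φ z) := continuousAt_extChartAt_symm z
    refine this.preimage_mem_nhds ?_
    rwa [φ.left_inv (mem_extChartAt_source z)]
  obtain ⟨r, hr, hrρ, hch⟩ := h.exists_ball_chord_mem hV'
  refine ⟨φ.source ∩ φ ⁻¹' Metric.ball (φ z) r, ?_, fun p hp q hq hpq ↦ ?_⟩
  · exact ((continuousOn_extChartAt z).isOpen_inter_preimage
      (isOpen_extChartAt_source z) Metric.isOpen_ball).mem_nhds
      ⟨mem_extChartAt_source z, Metric.mem_ball_self hr⟩
  · have hp' := Metric.ball_subset_ball hrρ hp.2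
    have hq' := Metric.ball_subset_ball hrρ hq.2
    -- The chord between the two points runs in `V` and is itself the required timelike curve.
    have h1 := h.fchron_sub S rfl (φ p) hp' (φ q) hq'
      (by rwa [← hφ, φ.left_inv hp.1, φ.left_inv hq.1]) V
      (fun s hs ↦ hch _ hp.2 _ hq.2 s hs) 0 (by simp) 1 (by simp) one_pos
    rwa [h.zero _ hp' _ hq', h.one _ hp' _ hq', ← hφ, φ.left_inv hp.1, φ.left_inv hq.1] at h1

theorem FChron.of_reverse {p q : M} (h : S.reverse.FChron U p q) : S.FChron U q p := by
  obtain ⟨c, hc⟩ := h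
  have hI : ∀ s ∈ Icc (0 : ℝ) 1, 1 - s ∈ Icc (0 : ℝ) 1 := fun s hs ↦
    ⟨by linarith [hs.2], by linarith [hs.1]⟩
  have hm : ∀ s : ℝ, ContMDiffAt 𝓘(ℝ, ℝ) 𝓘(ℝ, ℝ) ∞ (fun s : ℝ ↦ 1 - s) s := fun s ↦
    ContDiffAt.contMDiffAt (by fun_prop)
  refine ⟨fun s ↦ c (1 - s), fun s hs ↦ (hc.contMDiffAt _ (hI s hs)).comp s (hm s), fun s hs ↦ ?_,
    fun s hs ↦ hc.mapsTo (hI s hs), by simpa using hc.map_one, by simpa using hc.map_zero⟩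
  have h1 := hc.velocity_mem _ (hI s hs)
  set L : ℝ →L[ℝ] 𝔼 := mfderiv 𝓘(ℝ, ℝ) (𝓡 n) c (1 - s) with hL
  have h2 : (velocity n (fun s ↦ c (1 - s)) s : 𝔼) = -(velocity n c (1 - s) : 𝔼) := by
    have h3 : HasMFDerivAt 𝓘(ℝ, ℝ) 𝓘(ℝ, ℝ) (fun s : ℝ ↦ 1 - s) s
        (ContinuousLinearMap.toSpanSingleton ℝ (-1 : ℝ)) := by
      have : HasDerivAt (fun s : ℝ ↦ 1 - s) (-1) s := by
        simpa using (hasDerivAt_id s).const_sub 1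
      exact this.hasFDerivAt.hasMFDerivAt
    have h4 := (((hc.contMDiffAt _ (hI s hs)).mdifferentiableAt (by simp)).hasMFDerivAt).comp s h3
    have h5 := congrArg (fun L : ℝ →L[ℝ] 𝔼 ↦ L 1) h4.mfderiv
    refine h5.trans ?_
    have h6 : (ContinuousLinearMap.toSpanSingleton ℝ (-1 : ℝ)) 1 = (-1 : ℝ) := by simp
    change L ((ContinuousLinearMap.toSpanSingleton ℝ (-1 : ℝ)) 1) = -(L 1)
    rw [h6, map_neg]
  have h3 : -(velocity n c (1 - s) : 𝔼) ∈ S.futureCone (c (1 - s)) :=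
    (S.futureTimelike_reverse_neg (p := c (1 - s)) (a := -velocity n c (1 - s))).1
      (by rw [neg_neg]; exact h1)
  rw [← h2] at h3
  exact h3

end Spacetime

end ChordConsequences

/-! ### The time direction of essentially timelike curves -/

section FutureCurves

variable {n : ℕ} {M : Type*} [TopologicalSpace M] [ChartedSpace (EuclideanSpace ℝ (Fin n)) M]
  [IsManifold (𝓡 n) ∞ M]

namespace Spacetime

/-- The points `γ τ`, for `τ > t` near `t`, lie in the chronological future of `γ t` relative to every
convex normal neighbourhood. -/
def FutureRight (S : Spacetime n M) (γ : ℝ → M) (t : ℝ) : Prop :=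
  ∀ U, S.IsConvexNormal U → γ t ∈ U → ∀ᶠ τ in 𝓝[>] t, S.FChron U (γ t) (γ τ)

/-- The points `γ σ`, for `σ < t` near `t`, lie in the chronological past of `γ t` relative to every
convex normal neighbourhood. -/
def FutureLeft (S : Spacetime n M) (γ : ℝ → M) (t : ℝ) : Prop :=
  ∀ U, S.IsConvexNormal U → γ t ∈ U → ∀ᶠ σ in 𝓝[<] t, S.FChron U (γ σ) (γ t)

/-- The curve `γ` is increasing for the local chronology relations near `t`. -/
def FutureAt (S : Spacetime n M) (γ : ℝ → M) (t : ℝ) : Prop :=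
  S.FutureLeft γ t ∧ S.FutureRight γ t

variable {S : Spacetime n M} {U : Set M} {γ : ℝ → M} {t : ℝ}

/-- Near a point the chronology relation does not depend on the convex normal set, so a single one
suffices as a witness. -/
theorem futureRight_of_exists (hγ : ContinuousWithinAt γ (Ioi t) t) (hU : S.IsConvexNormal U)
    (ht : γ t ∈ U) (h : ∀ᶠ τ in 𝓝[>] t, S.FChron U (γ t) (γ τ)) : S.FutureRight γ t := by
  intro V hV htV
  obtain ⟨W, hW, hWV⟩ := exists_nhds_fchron_imp (S := S) hU ht (hV.1.mem_nhds htV)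
  filter_upwards [h, hγ hW] with τ h1 h2
  exact hWV _ (mem_of_mem_nhds hW) _ h2 h1

theorem futureLeft_of_exists (hγ : ContinuousWithinAt γ (Iio t) t) (hU : S.IsConvexNormal U)
    (ht : γ t ∈ U) (h : ∀ᶠ σ in 𝓝[<] t, S.FChron U (γ σ) (γ t)) : S.FutureLeft γ t := by
  intro V hV htV
  obtain ⟨W, hW, hWV⟩ := exists_nhds_fchron_imp (S := S) hU ht (hV.1.mem_nhds htV)
  filter_upwards [h, hγ hW] with τ h1 h2
  exact hWV _ h2 _ (mem_of_mem_nhds hW) h1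

theorem FutureRight.congr {γ' : ℝ → M} (h : S.FutureRight γ t) (hγ : γ' =ᶠ[𝓝[≥] t] γ) :
    S.FutureRight γ' t := by
  intro V hV htV
  have h0 : γ' t = γ t := hγ.self_of_nhdsWithin self_mem_Ici
  rw [h0] at htV ⊢
  filter_upwards [h V hV htV, nhdsWithin_mono t Ioi_subset_Ici_self hγ] with τ h1 h2
  rwa [h2]

theorem FutureLeft.congr {γ' : ℝ → M} (h : S.FutureLeft γ t) (hγ : γ' =ᶠ[𝓝[≤] t] γ) :
    S.FutureLeft γ' t := by
  intro V hV htV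
  have h0 : γ' t = γ t := hγ.self_of_nhdsWithin self_mem_Iic
  rw [h0] at htV ⊢
  filter_upwards [h V hV htV, nhdsWithin_mono t Iio_subset_Iic_self hγ] with τ h1 h2
  rwa [h2]

theorem FutureAt.congr {γ' : ℝ → M} (h : S.FutureAt γ t) (hγ : γ' =ᶠ[𝓝 t] γ) :
    S.FutureAt γ' t :=
  ⟨h.1.congr (nhdsWithin_le_nhds hγ), h.2.congr (nhdsWithin_le_nhds hγ)⟩

/-- A locally future directed curve in a convex normal set is future directed globally. -/
theorem fchron_of_futureAt (hU : S.IsConvexNormal U) {σ τ : ℝ} (hlt : σ < τ)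
    (hγU : MapsTo γ (Icc σ τ) U) (hR : ∀ s ∈ Ico σ τ, S.FutureRight γ s)
    (hL : ∀ s ∈ Ioc σ τ, S.FutureLeft γ s) : S.FChron U (γ σ) (γ τ) := by
  -- Continuous induction, with an empty condition at `r = σ`. The left condition gives closedness
  -- and the right condition progress, each through transitivity in `U`.
  set A : Set ℝ := {r | ∀ r' ∈ Ioc σ r, S.FChron U (γ σ) (γ r')} with hA
  have hsub : Icc σ τ ⊆ A := by
    refine IsClosed.Icc_subset_of_forall_exists_gt ?_ ?_ ?_
    · refine isClosed_of_closure_subset fun s hs ↦ ?_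
      have hsI : s ∈ Icc σ τ := isClosed_Icc.closure_subset_iff.2 inter_subset_right hs
      refine ⟨fun r hr ↦ ?_, hsI⟩
      rcases hr.2.lt_or_eq with hrs | rfl
      · obtain ⟨x, hxr, hx⟩ := mem_closure_iff_nhds.1 hs _ (Ioi_mem_nhds hrs)
        exact hx.1 r ⟨hr.1, (mem_Ioi.1 hxr).le⟩
      · have h1 := hL r ⟨hr.1, hsI.2⟩ U hU (hγU hsI)
        obtain ⟨l, hl, hlr⟩ := (mem_nhdsLT_iff_exists_mem_Ico_Ioo_subset hr.1).1 h1
        obtain ⟨x, hxr, hx⟩ := mem_closure_iff_nhds.1 hs _ (Ioi_mem_nhds hl.2)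
        rcases lt_or_ge x r with hxr' | hxr'
        · have h2 : S.FChron U (γ x) (γ r) := hlr ⟨hxr, hxr'⟩
          have h3 : S.FChron U (γ σ) (γ x) := hx.1 x ⟨hl.1.trans_lt hxr, le_rfl⟩
          exact h3.trans hU h2
        · exact hx.1 r ⟨hr.1, hxr'⟩
    · intro r hr
      exact absurd (hr.1.trans_le hr.2) (lt_irrefl _)
    · rintro s ⟨hsA, hsI⟩ y hy
      have h1 := hR s hsI U hU (hγU (Ico_subset_Icc_self hsI))
      obtain ⟨u, hu, hus⟩ := (mem_nhdsGT_iff_exists_mem_Ioc_Ioo_subset hy).1 h1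
      refine ⟨(s + u) / 2, fun r hr ↦ ?_, ?_⟩
      · rcases le_or_gt r s with hrs | hrs
        · exact hsA r ⟨hr.1, hrs⟩
        · have h2 : S.FChron U (γ s) (γ r) := hus ⟨hrs, by linarith [hr.2, hu.1]⟩
          rcases hsI.1.eq_or_lt with h3 | h3
          · rwa [h3]
          · exact (hsA s ⟨h3, le_rfl⟩).trans hU h2
      · exact ⟨by linarith [hu.1], by linarith [hu.1, hu.2]⟩
  exact hsub (right_mem_Icc.2 hlt.le) τ ⟨hlt, le_rfl⟩

/-- Near each of its parameters, an essentially timelike curve has a fixed time direction. -/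
theorem IsEssentiallyTimelike.exists_direction (h : S.IsEssentiallyTimelike γ) (t : ℝ) :
    (∀ᶠ s in 𝓝 t, S.FutureAt γ s) ∨ (∀ᶠ s in 𝓝 t, S.reverse.FutureAt γ s) := by
  obtain ⟨hc, h⟩ := h
  obtain ⟨δ, hδ, U, hU, htU, hmap, hchron⟩ := h t
  obtain ⟨W, hWo, hzW, hWU, ho1, ho2⟩ := exists_nhds_isOpen_fchron (S := S) hU htU
  obtain ⟨ε, hε, hεW⟩ := Metric.mem_nhds_iff.1 (hc.continuousAt.preimage_mem_nhds (hWo.mem_nhds hzW))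
  set r := min δ ε with hr
  have hrpos : 0 < r := lt_min hδ hε
  have hIW : ∀ s ∈ Ioo (t - r) (t + r), γ s ∈ W := by
    intro s hs
    refine hεW ?_
    rw [Real.ball_eq_Ioo]
    exact Ioo_subset_Ioo (by linarith [min_le_right δ ε]) (by linarith [min_le_right δ ε]) hs
  have hIδ : Ioo (t - r) (t + r) ⊆ Ioo (t - δ) (t + δ) :=
    Ioo_subset_Ioo (by linarith [min_le_left δ ε]) (by linarith [min_le_left δ ε])
  -- The triangle of pairs `σ < τ` is convex, hence connected, and it is covered by the disjoint
  -- open sets of future related and past related pairs.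
  set D : Set (ℝ × ℝ) := (Ioo (t - r) (t + r) ×ˢ Ioo (t - r) (t + r)) ∩ {x | x.1 < x.2} with hD
  have hDc : Convex ℝ D := by
    refine ((convex_Ioo _ _).prod (convex_Ioo _ _)).inter ?_
    intro x hx y hy a b ha hb hab
    have hx' : x.1 < x.2 := hx
    have hy' : y.1 < y.2 := hy
    change a * x.1 + b * y.1 < a * x.2 + b * y.2
    rcases ha.eq_or_lt with rfl | ha
    · have : b = 1 := by linarith
      subst this
      linarith
    · nlinarith [mul_lt_mul_of_pos_left hx' ha, mul_le_mul_of_nonneg_left hy'.le hb]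
  set f : ℝ × ℝ → M × M := fun x ↦ (γ x.1, γ x.2) with hf
  have hfc : Continuous f := by fun_prop
  set A : Set (ℝ × ℝ) := f ⁻¹' {x : M × M | x.1 ∈ W ∧ x.2 ∈ W ∧ S.FChron U x.1 x.2}
  set B : Set (ℝ × ℝ) := f ⁻¹' {x : M × M | x.1 ∈ W ∧ x.2 ∈ W ∧ S.reverse.FChron U x.1 x.2}
  have hAo : IsOpen A := ho1.preimage hfc
  have hBo : IsOpen B := ho2.preimage hfc
  have hcov : D ⊆ A ∪ B := by
    rintro ⟨σ, τ⟩ ⟨⟨h1, h2⟩, h3⟩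
    have h4 := hchron σ (hIδ h1) τ (hIδ h2) (ne_of_lt h3)
    rw [chronIn_iff] at h4
    exact h4.imp (fun h5 ↦ ⟨hIW _ h1, hIW _ h2, h5⟩) (fun h5 ↦ ⟨hIW _ h1, hIW _ h2, h5⟩)
  have hdisj : D ∩ (A ∩ B) = ∅ := by
    rw [eq_empty_iff_forall_notMem]
    rintro x ⟨-, h1, h2⟩
    exact FChron.not_reverse hU h1.2.2 h2.2.2
  have key : ∀ S' : Spacetime n M, S'.toLorentzianMetric = S.toLorentzianMetric →
      (∀ x ∈ D, S'.FChron U (γ x.1) (γ x.2)) → ∀ᶠ s in 𝓝 t, S'.FutureAt γ s := by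
    intro S' hS' hall
    rw [← hS'] at hU
    filter_upwards [Ioo_mem_nhds (sub_lt_self t hrpos) (lt_add_of_pos_right t hrpos)] with s hs
    refine ⟨futureLeft_of_exists hc.continuousWithinAt hU (hWU (hIW s hs)) ?_,
      futureRight_of_exists hc.continuousWithinAt hU (hWU (hIW s hs)) ?_⟩
    · filter_upwards [Ioo_mem_nhdsLT hs.1] with σ hσ
      exact hall (σ, s) ⟨⟨⟨hσ.1, hσ.2.trans hs.2⟩, hs⟩, hσ.2⟩
    · filter_upwards [Ioo_mem_nhdsGT hs.2] with τ hτ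
      exact hall (s, τ) ⟨⟨hs, ⟨hs.1.trans hτ.1, hτ.2⟩⟩, hτ.1⟩
  rcases isPreconnected_iff_subset_of_disjoint.1 hDc.isPreconnected A B hAo hBo hcov hdisj with h1 | h1
  · exact Or.inl (key S rfl fun x hx ↦ (h1 hx).2.2)
  · exact Or.inr (key S.reverse rfl fun x hx ↦ (h1 hx).2.2)

theorem FutureAt.not_reverse (h : S.FutureAt γ t) (hex : ∃ U, S.IsConvexNormal U ∧ γ t ∈ U) :
    ¬ S.reverse.FutureAt γ t := by
  obtain ⟨U, hU, ht⟩ := hex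
  intro h'
  obtain ⟨τ, h1, h2⟩ := ((h.2 U hU ht).and (h'.2 U hU ht)).exists
  exact FChron.not_reverse hU h1 h2

/-- An essentially timelike curve is either future directed or past directed. -/
theorem IsEssentiallyTimelike.futureAt_or (h : S.IsEssentiallyTimelike γ) :
    (∀ t, S.FutureAt γ t) ∨ (∀ t, S.reverse.FutureAt γ t) := by
  have hex : ∀ t, ∃ U, S.IsConvexNormal U ∧ γ t ∈ U := fun t ↦ by
    obtain ⟨δ, hδ, U, hU, htU, -⟩ := h.2 t
    exact ⟨U, hU, htU⟩
  have ho1 : IsOpen {t | ∀ᶠ s in 𝓝 t, S.FutureAt γ s} := isOpen_setOfPred_eventually_nhds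
  have ho2 : IsOpen {t | ∀ᶠ s in 𝓝 t, S.reverse.FutureAt γ s} := isOpen_setOfPred_eventually_nhds
  rcases isPreconnected_iff_subset_of_disjoint.1 (isPreconnected_univ (α := ℝ)) _ _ ho1 ho2
    (fun t _ ↦ h.exists_direction t) (by
      rw [eq_empty_iff_forall_notMem]
      rintro t ⟨-, h1, h2⟩
      exact h1.self_of_nhds.not_reverse (hex t) h2.self_of_nhds) with h1 | h1
  · exact Or.inl fun t ↦ (h1 (mem_univ t)).self_of_nhds
  · exact Or.inr fun t ↦ (h1 (mem_univ t)).self_of_nhds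

theorem FutureAt.comp_neg (h : S.reverse.FutureAt γ (-t)) : S.FutureAt (fun s ↦ γ (-s)) t := by
  have hc : Continuous fun s : ℝ ↦ -s := by fun_prop
  refine ⟨fun V hV htV ↦ ?_, fun V hV htV ↦ ?_⟩
  · have h1 : ∀ᶠ σ in 𝓝[<] t, S.reverse.FChron V (γ (-t)) (γ (-σ)) := by
      refine (tendsto_nhdsWithin_iff.2 ⟨(hc.tendsto t).mono_left nhdsWithin_le_nhds, ?_⟩).eventually
        (h.2 V hV htV)
      filter_upwards [self_mem_nhdsWithin] with s hs
      exact neg_lt_neg (mem_Iio.1 hs)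
    exact h1.mono fun s hs ↦ hs.of_reverse
  · have h1 : ∀ᶠ τ in 𝓝[>] t, S.reverse.FChron V (γ (-τ)) (γ (-t)) := by
      refine (tendsto_nhdsWithin_iff.2 ⟨(hc.tendsto t).mono_left nhdsWithin_le_nhds, ?_⟩).eventually
        (h.1 V hV htV)
      filter_upwards [self_mem_nhdsWithin] with s hs
      exact neg_lt_neg (mem_Ioi.1 hs)
    exact h1.mono fun s hs ↦ hs.of_reverse

/-- In a continuous family of essentially timelike curves, the time direction is locally constant. -/
theorem isOpen_setOf_futureAt {N : Type*} [TopologicalSpace N] {h : N × ℝ → M} (hc : Continuous h)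
    (hess : ∀ x, S.IsEssentiallyTimelike (fun t ↦ h (x, t))) :
    IsOpen {x | ∀ t, S.FutureAt (fun t ↦ h (x, t)) t} := by
  rw [isOpen_iff_mem_nhds]
  intro x₀ hx₀
  obtain ⟨δ, hδ, U, hU, h0U, -⟩ := (hess x₀).2 0
  obtain ⟨W, hWo, hzW, hWU, ho1, -⟩ := exists_nhds_isOpen_fchron (S := S) hU h0U
  have h1 : ∀ᶠ t in 𝓝 (0 : ℝ), h (x₀, t) ∈ W :=
    (hess x₀).1.continuousAt.eventually (hWo.mem_nhds hzW)
  obtain ⟨ε, hε, hεW⟩ := Metric.eventually_nhds_iff_ball.1 h1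
  have h2 := (hx₀ 0).2 U hU h0U
  obtain ⟨τ, hτ, hτ0⟩ := (h2.and (Ioo_mem_nhdsGT hε)).exists
  have hsubW : ∀ t ∈ Icc 0 τ, h (x₀, t) ∈ W := fun t ht ↦ hεW t (by
    rw [Real.ball_eq_Ioo]
    exact ⟨by linarith [ht.1], by linarith [ht.2, hτ0.2]⟩)
  have h3 : ∀ᶠ x in 𝓝 x₀, ∀ t ∈ Icc 0 τ, h (x, t) ∈ W := by
    refine isCompact_Icc.eventually_forall_of_forall_eventually fun t ht ↦ ?_
    exact hc.continuousAt.eventually (hWo.mem_nhds (hsubW t ht))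
  have h4 : ∀ᶠ x in 𝓝 x₀, S.FChron U (h (x, 0)) (h (x, τ)) := by
    have h5 : Continuous fun x ↦ (h (x, 0), h (x, τ)) := by fun_prop
    filter_upwards [h5.continuousAt.eventually (ho1.mem_nhds ⟨hzW,
      hsubW τ (right_mem_Icc.2 hτ0.1.le), hτ⟩)] with x hx
    exact hx.2.2
  filter_upwards [h3, h4] with x hx1 hx2
  -- The single relation between the times 0 and `τ` persists for nearby `x`. A past directed curve
  -- that stays in `U` would give the opposite relation between the same points.
  rcases (hess x).futureAt_or with h6 | h6
  · exact h6
  · exfalso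
    refine FChron.not_reverse hU hx2 (fchron_of_futureAt (S := S.reverse) (γ := fun t ↦ h (x, t)) hU
      hτ0.1 (fun t ht ↦ hWU (hx1 t ht)) (fun s _ ↦ (h6 s).2) (fun s _ ↦ (h6 s).1))

end Spacetime

end FutureCurves

/-! ### Sets containing all difference quotients -/

section Slopes

variable {N E F : Type*} [NormedAddCommGroup E] [NormedSpace ℝ E] [NormedAddCommGroup F]
  [NormedSpace ℝ F]

/-- The difference quotients of `f` in the real variable, at points of `A`, lie in `K`. -/
def SlopesIn (K : Set E) (f : N × ℝ → E) (A : Set (N × ℝ)) : Prop :=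
  ∀ x t t', (x, t) ∈ A → (x, t') ∈ A → t < t' → ∃ v ∈ K, f (x, t') - f (x, t) = (t' - t) • v

theorem SlopesIn.mono {K K' : Set E} {f : N × ℝ → E} {A A' : Set (N × ℝ)} (h : SlopesIn K f A)
    (hK : K ⊆ K') (hA : A' ⊆ A) : SlopesIn K' f A' := fun x t t' h1 h2 h3 ↦
  let ⟨v, hv, hv'⟩ := h x t t' (hA h1) (hA h2) h3
  ⟨v, hK hv, hv'⟩

theorem SlopesIn.congr {K : Set E} {f g : N × ℝ → E} {A : Set (N × ℝ)} (h : SlopesIn K f A)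
    (hg : EqOn g f A) : SlopesIn K g A := fun x t t' h1 h2 h3 ↦ by
  rw [hg h1, hg h2]
  exact h x t t' h1 h2 h3

/-- After division by `t' - t`, the quotients of `g` are within `ε` of the images under `L` of the
quotients of `f`. -/
theorem SlopesIn.perturb {K : Set E} {f : N × ℝ → E} {g : N × ℝ → F} {A : Set (N × ℝ)}
    (h : SlopesIn K f A) (L : E →L[ℝ] F) {ε : ℝ}
    (hε : ∀ x t t', (x, t) ∈ A → (x, t') ∈ A → t < t' →
      ‖g (x, t') - g (x, t) - L (f (x, t') - f (x, t))‖ ≤ ε * (t' - t)) :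
    SlopesIn (Metric.cthickening ε (L '' K)) g A := by
  intro x t t' h1 h2 h3
  obtain ⟨v, hv, hvf⟩ := h x t t' h1 h2 h3
  have h4 : 0 < t' - t := sub_pos.2 h3
  refine ⟨(t' - t)⁻¹ • (g (x, t') - g (x, t)),
    Metric.mem_cthickening_of_dist_le _ (L v) ε _ (mem_image_of_mem _ hv) ?_, ?_⟩
  · have h5 := hε x t t' h1 h2 h3
    rw [hvf, map_smul] at h5
    have h6 : (t' - t)⁻¹ • (g (x, t') - g (x, t)) - L v =
        (t' - t)⁻¹ • (g (x, t') - g (x, t) - (t' - t) • L v) := by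
      rw [smul_sub _ (g (x, t') - g (x, t)), inv_smul_smul₀ h4.ne']
    rw [dist_eq_norm, h6, norm_smul, norm_inv, Real.norm_of_nonneg h4.le, inv_mul_le_iff₀ h4]
    linarith
  · rw [smul_inv_smul₀ h4.ne']

theorem SlopesIn.norm_le {K : Set E} {f : N × ℝ → E} {A : Set (N × ℝ)} (h : SlopesIn K f A) {R : ℝ}
    (hR : ∀ v ∈ K, ‖v‖ ≤ R) {x : N} {t t' : ℝ} (ht : (x, t) ∈ A) (ht' : (x, t') ∈ A) (hlt : t < t') :
    ‖f (x, t') - f (x, t)‖ ≤ R * (t' - t) := by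
  obtain ⟨v, hv, hvf⟩ := h x t t' ht ht' hlt
  rw [hvf, norm_smul, Real.norm_of_nonneg (sub_pos.2 hlt).le, mul_comm]
  exact mul_le_mul_of_nonneg_right (hR v hv) (sub_pos.2 hlt).le

/-- A vector valued mean value theorem: a difference quotient lies in every closed convex set that
contains the derivatives. -/
theorem exists_mem_smul_of_hasDerivAt {K : Set E} (hK : Convex ℝ K) (hKc : IsClosed K)
    {f f' : ℝ → E} {a b : ℝ} (hab : a < b) (hf : ContinuousOn f (Icc a b))
    (hd : ∀ s ∈ Ioo a b, HasDerivAt f (f' s) s ∧ f' s ∈ K) :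
    ∃ v ∈ K, f b - f a = (b - a) • v := by
  have h4 : 0 < b - a := sub_pos.2 hab
  refine ⟨(b - a)⁻¹ • (f b - f a), ?_, by rw [smul_inv_smul₀ h4.ne']⟩
  by_contra hv
  -- A separating functional reduces the claim to the scalar mean value theorem.
  obtain ⟨l, u, hlu, hu⟩ := geometric_hahn_banach_closed_point hK hKc hv
  obtain ⟨c, hc, hcs⟩ := exists_hasDerivAt_eq_slope (fun s ↦ l (f s)) (fun s ↦ l (f' s)) hab
    (l.continuous.comp_continuousOn hf)
    (fun s hs ↦ l.hasFDerivAt.comp_hasDerivAt s (hd s hs).1)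
  have h5 := hlu _ (hd c hc).2
  rw [map_smul, map_sub, smul_eq_mul, ← div_eq_inv_mul, ← hcs] at hu
  exact lt_asymm h5 hu

theorem isCompact_convexJoin {K L : Set E} (hK : IsCompact K) (hL : IsCompact L) :
    IsCompact (convexJoin ℝ K L) := by
  have h1 : convexJoin ℝ K L =
      (fun x : (E × E) × ℝ ↦ (1 - x.2) • x.1.1 + x.2 • x.1.2) '' ((K ×ˢ L) ×ˢ Icc 0 1) := by
    ext v
    rw [mem_convexJoin]
    constructor
    · rintro ⟨a, ha, b, hb, hv⟩
      rw [segment_eq_image] at hv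
      obtain ⟨s, hs, rfl⟩ := hv
      exact ⟨((a, b), s), ⟨⟨ha, hb⟩, hs⟩, rfl⟩
    · rintro ⟨⟨⟨a, b⟩, s⟩, ⟨⟨ha, hb⟩, hs⟩, rfl⟩
      refine ⟨a, ha, b, hb, ?_⟩
      rw [segment_eq_image]
      exact ⟨s, hs, rfl⟩
  rw [h1]
  exact ((hK.prod hL).prod isCompact_Icc).image (by fun_prop)

/-- A difference quotient across the time `θ x` is a convex combination of the quotients on the two
sides. -/
theorem SlopesIn.convexHull_union {K L : Set E} {f : N × ℝ → E} {A B : Set (N × ℝ)}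
    {θ : N → ℝ} (hA : SlopesIn K f {z ∈ A | z.2 ≤ θ z.1}) (hB : SlopesIn L f {z ∈ A | θ z.1 ≤ z.2})
    (hθ : ∀ x t t', (x, t) ∈ A → (x, t') ∈ A → t < θ x → θ x < t' → (x, θ x) ∈ A) (hBA : B ⊆ A) :
    SlopesIn (convexHull ℝ (K ∪ L)) f B := by
  intro x t t' h1 h2 h3
  have h1' := hBA h1
  have h2' := hBA h2
  rcases le_or_gt t' (θ x) with h4 | h4
  · obtain ⟨v, hv, hvf⟩ := hA x t t' ⟨h1', h3.le.trans h4⟩ ⟨h2', h4⟩ h3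
    exact ⟨v, subset_convexHull ℝ _ (Or.inl hv), hvf⟩
  rcases le_or_gt (θ x) t with h5 | h5
  · obtain ⟨v, hv, hvf⟩ := hB x t t' ⟨h1', h5⟩ ⟨h2', h5.trans h3.le⟩ h3
    exact ⟨v, subset_convexHull ℝ _ (Or.inr hv), hvf⟩
  have h6 := hθ x t t' h1' h2' h5 h4
  obtain ⟨v, hv, hvf⟩ := hA x t (θ x) ⟨h1', h5.le⟩ ⟨h6, le_rfl⟩ h5
  obtain ⟨w, hw, hwf⟩ := hB x (θ x) t' ⟨h6, le_rfl⟩ ⟨h2', h4.le⟩ h4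
  have h7 : 0 < t' - t := sub_pos.2 h3
  refine ⟨((θ x - t) / (t' - t)) • v + ((t' - θ x) / (t' - t)) • w, ?_, ?_⟩
  · have hv' : v ∈ convexHull ℝ (K ∪ L) := subset_convexHull ℝ _ (Or.inl hv)
    have hw' : w ∈ convexHull ℝ (K ∪ L) := subset_convexHull ℝ _ (Or.inr hw)
    refine (convex_convexHull ℝ (K ∪ L)) hv' hw' (div_nonneg (by linarith) h7.le)
      (div_nonneg (by linarith) h7.le) ?_
    rw [← add_div]
    rw [div_eq_one_iff_eq h7.ne']
    ring
  · have h8 : f (x, t') - f (x, t) = (f (x, θ x) - f (x, t)) + (f (x, t') - f (x, θ x)) := by abel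
    rw [h8, hvf, hwf, smul_add, smul_smul, smul_smul, mul_div_cancel₀ _ h7.ne',
      mul_div_cancel₀ _ h7.ne']

end Slopes

/-! ### Strictly future directed families -/

section Strict

variable {n : ℕ} {M : Type*} [TopologicalSpace M] [ChartedSpace (EuclideanSpace ℝ (Fin n)) M]
  [IsManifold (𝓡 n) ∞ M] {N : Type*} [TopologicalSpace N]

local notation "𝔼" => EuclideanSpace ℝ (Fin n)

namespace Spacetime

theorem isOpen_pullbackCone (S : Spacetime n M) (ψ : 𝔼 → M) (b : 𝔼) :
    IsOpen (S.pullbackCone ψ b) :=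
  (S.isOpen_futureCone (ψ b)).preimage (dmap n ψ b).continuous

theorem convex_pullbackCone (S : Spacetime n M) (ψ : 𝔼 → M) (b : 𝔼) :
    Convex ℝ (S.pullbackCone ψ b) :=
  (S.convex_futureCone (ψ b)).linear_preimage (dmap n ψ b).toLinearMap

/-- In the chart around `p₀`, the difference quotients of `h` in the time variable at points of `A`
near `z` lie in a compact convex set of future timelike vectors. -/
def StrictIn (S : Spacetime n M) (p₀ : M) (h : N × ℝ → M) (A : Set (N × ℝ)) (z : N × ℝ) : Prop :=
  ∃ K : Set 𝔼, IsCompact K ∧ Convex ℝ K ∧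
    K ⊆ S.pullbackCone (extChartAt (𝓡 n) p₀).symm (extChartAt (𝓡 n) p₀ (h z)) ∧
    ∃ O ∈ 𝓝 z, SlopesIn K (fun w ↦ extChartAt (𝓡 n) p₀ (h w)) (A ∩ O)

/-- The family `h` is strictly future directed near `z`. -/
def StrictAt (S : Spacetime n M) (h : N × ℝ → M) (z : N × ℝ) : Prop := S.StrictIn (h z) h univ z

variable {S : Spacetime n M} {p₀ p₁ : M} {h h' : N × ℝ → M} {A : Set (N × ℝ)} {z : N × ℝ}

/-- The condition is void, so `K = ∅` serves. This disposes of regions that touch a neighbourhood of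
`z` trivially. -/
theorem strictIn_of_subsingleton {O : Set (N × ℝ)} (hO : O ∈ 𝓝 z)
    (hA : ∀ x t t', (x, t) ∈ A ∩ O → (x, t') ∈ A ∩ O → t' ≤ t) : S.StrictIn p₀ h A z :=
  ⟨∅, isCompact_empty, convex_empty, empty_subset _, O, hO, fun x t t' h1 h2 h3 ↦
    absurd h3 (not_lt.2 (hA x t t' h1 h2))⟩

theorem StrictIn.mono {A' : Set (N × ℝ)} (hs : S.StrictIn p₀ h A z) (hA : A' ⊆ A) :
    S.StrictIn p₀ h A' z := by
  obtain ⟨K, h1, h2, h3, O, hO, h4⟩ := hs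
  exact ⟨K, h1, h2, h3, O, hO, h4.mono subset_rfl (inter_subset_inter_left _ hA)⟩

theorem StrictIn.congr (hs : S.StrictIn p₀ h A z) (hz : h' z = h z) {O : Set (N × ℝ)} (hO : O ∈ 𝓝 z)
    (hh : EqOn h' h (A ∩ O)) : S.StrictIn p₀ h' A z := by
  obtain ⟨K, h1, h2, h3, O', hO', h4⟩ := hs
  refine ⟨K, h1, h2, by rwa [hz], O ∩ O', Filter.inter_mem hO hO', ?_⟩
  refine (h4.mono subset_rfl (inter_subset_inter_right _ inter_subset_right)).congr
    fun w hw ↦ ?_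
  simp only [hh ⟨hw.1, hw.2.1⟩]

theorem StrictAt.congr (hs : S.StrictAt h z) (hh : h' =ᶠ[𝓝 z] h) : S.StrictAt h' z := by
  have h0 := hh.self_of_nhds
  unfold StrictAt at hs ⊢
  rw [h0]
  exact StrictIn.congr hs h0 hh fun w hw ↦ hw.2

/-- The cone is convex, so it contains the convex hull of the two compact sets. The neighbourhood is
chosen as a product with an interval, in order to contain the time `θ x` whenever it contains times
on both sides of it. -/
theorem StrictIn.split {θ : N → ℝ} (h₁ : S.StrictIn p₀ h {w ∈ A | w.2 ≤ θ w.1} z)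
    (h₂ : S.StrictIn p₀ h {w ∈ A | θ w.1 ≤ w.2} z)
    (hθ : ∀ x t t', (x, t) ∈ A → (x, t') ∈ A → t < θ x → θ x < t' → (x, θ x) ∈ A) :
    S.StrictIn p₀ h A z := by
  obtain ⟨K₁, hK₁, hc₁, hs₁, O₁, hO₁, h4₁⟩ := h₁
  obtain ⟨K₂, hK₂, hc₂, hs₂, O₂, hO₂, h4₂⟩ := h₂
  obtain ⟨u, hu, v, hv, huv⟩ := mem_nhds_prod_iff.1 (Filter.inter_mem hO₁ hO₂)
  obtain ⟨ε, hε, hεv⟩ := Metric.mem_nhds_iff.1 hv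
  have hsub : u ×ˢ Metric.ball z.2 ε ⊆ O₁ ∩ O₂ := (prod_mono subset_rfl hεv).trans huv
  refine ⟨convexHull ℝ (K₁ ∪ K₂), ?_, convex_convexHull ℝ _,
    convexHull_min (union_subset hs₁ hs₂) (S.convex_pullbackCone _ _), u ×ˢ Metric.ball z.2 ε,
    prod_mem_nhds hu (Metric.ball_mem_nhds _ hε), ?_⟩
  · rcases K₁.eq_empty_or_nonempty with rfl | hn₁
    · rwa [empty_union, hc₂.convexHull_eq]
    rcases K₂.eq_empty_or_nonempty with rfl | hn₂
    · rwa [union_empty, hc₁.convexHull_eq]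
    rw [hc₁.convexHull_union hc₂ hn₁ hn₂]
    exact isCompact_convexJoin hK₁ hK₂
  · refine SlopesIn.convexHull_union (θ := θ) (A := A ∩ u ×ˢ Metric.ball z.2 ε)
      (h4₁.mono subset_rfl ?_) (h4₂.mono subset_rfl ?_) ?_ subset_rfl
    · exact fun w hw ↦ ⟨⟨hw.1.1, hw.2⟩, (hsub hw.1.2).1⟩
    · exact fun w hw ↦ ⟨⟨hw.1.1, hw.2⟩, (hsub hw.1.2).2⟩
    · rintro x t t' ⟨h1, h1'⟩ ⟨h2, h2'⟩ h3 h4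
      refine ⟨hθ x t t' h1 h2 h3 h4, h1'.1, ?_⟩
      have h5 := h1'.2
      have h6 := h2'.2
      rw [Real.ball_eq_Ioo] at h5 h6 ⊢
      exact ⟨h5.1.trans h3, h4.trans h6.2⟩

/-- Enlarging the compact convex set of a strictness condition by small errors. -/
theorem exists_cthickening_subset_cone {K : Set 𝔼} (hK : IsCompact K) {ψ : 𝔼 → M} {b : 𝔼}
    (h : K ⊆ S.pullbackCone ψ b) :
    ∃ ε > 0, Metric.cthickening ε K ⊆ S.pullbackCone ψ b :=
  hK.exists_cthickening_subset_open (S.isOpen_pullbackCone ψ b) h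

/-- Strictness does not depend on the chart. -/
theorem StrictIn.change_chart (hs : S.StrictIn p₀ h A z) (hc : ContinuousAt h z)
    (h₀ : h z ∈ (extChartAt (𝓡 n) p₀).source) (h₁ : h z ∈ (extChartAt (𝓡 n) p₁).source) :
    S.StrictIn p₁ h A z := by
  obtain ⟨K, hK, hKc, hKs, O, hO, hslope⟩ := hs
  set φ₀ := extChartAt (𝓡 n) p₀ with hφ₀
  set φ₁ := extChartAt (𝓡 n) p₁ with hφ₁
  set T : 𝔼 → 𝔼 := fun y ↦ φ₁ (φ₀.symm y) with hT
  have hzs : φ₀ (h z) ∈ (φ₀.symm.trans φ₁).source := by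
    rw [PartialEquiv.trans_source]
    refine ⟨φ₀.map_source h₀, ?_⟩
    change φ₀.symm (φ₀ (h z)) ∈ φ₁.source
    rwa [φ₀.left_inv h₀]
  have hTd : ContDiffAt ℝ ∞ T (φ₀ (h z)) := by
    have h2 := contDiffOn_ext_coord_change (n := ∞) (I := 𝓡 n) p₁ p₀
    refine h2.contDiffAt (IsOpen.mem_nhds ?_ hzs)
    rw [PartialEquiv.trans_source]
    exact (continuousOn_extChartAt_symm p₀).isOpen_inter_preimage (isOpen_extChartAt_target p₀)
      (isOpen_extChartAt_source p₁)
  -- Strict differentiability compares `T y' - T y` with the linear map uniformly in both points. As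
  -- the old quotients are bounded by `R`, a relative error `ε / R` changes the new ones by at most
  -- `ε`.
  have hstrict := hTd.hasStrictFDerivAt (by simp)
  set T' := fderiv ℝ T (φ₀ (h z)) with hT'
  have hcone : T' '' K ⊆ S.pullbackCone φ₁.symm (φ₁ (h z)) := by
    rintro _ ⟨v, hv, rfl⟩
    have h2 : dmap n φ₀.symm (φ₀ (h z)) v ∈ S.futureCone (φ₀.symm (φ₀ (h z))) := hKs hv
    have h3 : dmap n φ₀.symm (φ₀ (h z)) =
        (dmap n φ₁.symm (T (φ₀ (h z)))).comp T' := by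
      have hTz : T (φ₀ (h z)) = φ₁ (h z) := by simp only [hT, φ₀.left_inv h₀]
      rw [hT', ← dmap_comp (mdifferentiableAt_extChartAt_symm' (by
        rw [hTz]; exact φ₁.map_source h₁)) (hTd.differentiableAt (by simp))]
      refine dmap_congr ?_
      have h4 : ∀ᶠ y in 𝓝 (φ₀ (h z)), φ₀.symm y ∈ φ₁.source := by
        refine (continuousAt_extChartAt_symm'' (φ₀.map_source h₀)).eventually ?_
        rw [φ₀.left_inv h₀]
        exact (isOpen_extChartAt_source p₁).mem_nhds h₁
      filter_upwards [h4] with y hy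
      simp only [hT]
      exact (φ₁.left_inv hy).symm
    rw [h3] at h2
    have hTz : T (φ₀ (h z)) = φ₁ (h z) := by simp only [hT, φ₀.left_inv h₀]
    rw [hTz, φ₀.left_inv h₀] at h2
    change dmap n φ₁.symm (φ₁ (h z)) (T' v) ∈ S.futureCone (φ₁.symm (φ₁ (h z)))
    rw [φ₁.left_inv h₁]
    exact h2
  have hTK : IsCompact (T' '' K) := hK.image T'.continuous
  obtain ⟨ε, hε, hεs⟩ := exists_cthickening_subset_cone hTK hcone
  obtain ⟨R, hR, hKR⟩ := hK.isBounded.exists_pos_norm_le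
  have hlo := hstrict.isLittleO.def (c := ε / R) (by positivity)
  obtain ⟨u, hu, v, hv, huv⟩ := mem_nhds_prod_iff.1 hlo
  have hcφ : ContinuousAt (fun w ↦ φ₀ (h w)) z :=
    ContinuousAt.comp (continuousAt_extChartAt' h₀) hc
  have hO' : {w | φ₀ (h w) ∈ u ∩ v ∧ h w ∈ φ₀.source} ∈ 𝓝 z :=
    (hcφ.eventually (Filter.inter_mem hu hv)).and
      (hc.eventually ((isOpen_extChartAt_source p₀).mem_nhds h₀))
  refine ⟨Metric.cthickening ε (T' '' K), hTK.cthickening,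
    (hKc.linear_image T'.toLinearMap).cthickening ε, hεs, _, Filter.inter_mem hO hO', ?_⟩
  have hsl := hslope.mono (K' := K) subset_rfl (A' := A ∩ (O ∩ {w | φ₀ (h w) ∈ u ∩ v ∧ h w ∈ φ₀.source}))
    fun w hw ↦ ⟨hw.1, hw.2.1⟩
  refine hsl.perturb T' fun x t t' h2 h3 h4 ↦ ?_
  have h5 := huv (a := (φ₀ (h (x, t')), φ₀ (h (x, t)))) ⟨h3.2.2.1.1, h2.2.2.1.2⟩
  have h6 := hsl.norm_le hKR h2 h3 h4
  simp only [mem_ofPred_eq, hT, φ₀.left_inv h3.2.2.2, φ₀.left_inv h2.2.2.2] at h5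
  calc _ ≤ ε / R * ‖φ₀ (h (x, t')) - φ₀ (h (x, t))‖ := h5
    _ ≤ ε / R * (R * (t' - t)) := by gcongr
    _ = ε * (t' - t) := by field_simp

theorem StrictAt.strictIn (hs : S.StrictAt h z) (hc : ContinuousAt h z)
    (h₁ : h z ∈ (extChartAt (𝓡 n) p₁).source) : S.StrictIn p₁ h univ z :=
  StrictIn.change_chart hs hc (mem_extChartAt_source _) h₁

theorem StrictIn.strictAt (hs : S.StrictIn p₀ h univ z) (hc : ContinuousAt h z)
    (h₀ : h z ∈ (extChartAt (𝓡 n) p₀).source) : S.StrictAt h z :=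
  StrictIn.change_chart hs hc h₀ (mem_extChartAt_source _)

/-- Differentiable strictly future directed families have future timelike tangents. -/
theorem StrictAt.futureTimelike_velocity (hs : S.StrictAt h z)
    (hd : MDifferentiableAt 𝓘(ℝ, ℝ) (𝓡 n) (fun t ↦ h (z.1, t)) z.2) :
    S.FutureTimelike (velocity n (fun t ↦ h (z.1, t)) z.2) := by
  obtain ⟨K, hK, hKc, hKs, O, hO, hslope⟩ := hs
  set φ := extChartAt (𝓡 n) (h z) with hφ
  set c : ℝ → M := fun t ↦ h (z.1, t) with hc
  have hcz : c z.2 = h z := rfl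
  have hu : DifferentiableAt ℝ (fun t ↦ φ (c t)) z.2 := by
    have h1 : MDifferentiableAt (𝓡 n) 𝓘(ℝ, 𝔼) φ (c z.2) :=
      (contMDiffAt_extChartAt (n := ∞)).mdifferentiableAt (by simp)
    exact (MDifferentiableAt.comp z.2 h1 hd).differentiableAt
  have hder := hu.hasDerivAt
  set w := deriv (fun t ↦ φ (c t)) z.2 with hw
  have hwK : w ∈ K := by
    have h1 := hder.tendsto_slope
    have h2 : Filter.Tendsto (slope (fun t ↦ φ (c t)) z.2) (𝓝[>] z.2) (𝓝 w) :=
      h1.mono_left (nhdsWithin_mono _ fun t ht ↦ ne_of_gt ht)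
    refine hK.isClosed.mem_of_tendsto h2 ?_
    have h3 : ∀ᶠ t in 𝓝 z.2, (z.1, t) ∈ O := by
      have : ContinuousAt (fun t : ℝ ↦ (z.1, t)) z.2 := by fun_prop
      exact this.eventually hO
    filter_upwards [nhdsWithin_le_nhds h3, self_mem_nhdsWithin] with t ht1 ht2
    obtain ⟨v, hv, hv2⟩ := hslope z.1 z.2 t ⟨mem_univ _, mem_of_mem_nhds hO⟩ ⟨mem_univ _, ht1⟩ ht2
    have h4 : slope (fun t ↦ φ (c t)) z.2 t = v := by
      rw [slope_def_module]
      change (t - z.2)⁻¹ • (φ (h (z.1, t)) - φ (h (z.1, z.2))) = v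
      rw [hv2, inv_smul_smul₀ (sub_pos.2 ht2).ne']
    rwa [h4]
  have h1 := hKs hwK
  have h2 : c =ᶠ[𝓝 z.2] fun t ↦ φ.symm (φ (c t)) := by
    filter_upwards [hd.continuousAt.eventually ((isOpen_extChartAt_source (I := 𝓡 n) (h z)).mem_nhds
      (mem_extChartAt_source _))] with t ht
    exact (φ.left_inv ht).symm
  have h3 : (velocity n (fun t ↦ φ.symm (φ (c t))) z.2 : 𝔼) = dmap n φ.symm (φ (c z.2)) w :=
    velocity_comp (mdifferentiableAt_extChartAt_symm' (φ.map_source (mem_extChartAt_source _))) hder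
  have h4 : (velocity n c z.2 : 𝔼) = dmap n φ.symm (φ (c z.2)) w := by
    rw [← h3]
    have := h2.mfderiv_eq (I := 𝓘(ℝ, ℝ)) (I' := 𝓡 n)
    exact congrArg (fun L : ℝ →L[ℝ] 𝔼 ↦ L 1) this
  change (velocity n c z.2 : 𝔼) ∈ S.futureCone (h z)
  rw [h4]
  have h5 : dmap n φ.symm (φ (h z)) w ∈ S.futureCone (φ.symm (φ (h z))) := h1
  rwa [φ.left_inv (mem_extChartAt_source _)] at h5

end Spacetime

end Strict

/-! ### Replacing the end of a cell by a geodesic chord -/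

section Cells

variable {n : ℕ} {M : Type*} [TopologicalSpace M] [ChartedSpace (EuclideanSpace ℝ (Fin n)) M]
  [IsManifold (𝓡 n) ∞ M] {N : Type*} [TopologicalSpace N]

local notation "𝔼" => EuclideanSpace ℝ (Fin n)

/-- The parameter at which the modified family leaves the original one in the cell `[a₀, b]`. -/
def switchTime (ρ : N → ℝ) (a₀ b : ℝ) (x : N) : ℝ := b - ρ x * (b - a₀)

open Classical in
/-- In the cell `[a₀, b]`, follow `h` up to the switching time and then a geodesic chord. -/
noncomputable def cellMap (h : N × ℝ → M) (ρ : N → ℝ) (p : M)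
    (ch : EuclideanSpace ℝ (Fin n) → EuclideanSpace ℝ (Fin n) → ℝ → EuclideanSpace ℝ (Fin n))
    (a₀ b : ℝ) (w : N × ℝ) : M :=
  if w.2 ≤ switchTime ρ a₀ b w.1 then h w else
    (extChartAt (𝓡 n) p).symm (ch (extChartAt (𝓡 n) p (h (w.1, switchTime ρ a₀ b w.1)))
      (extChartAt (𝓡 n) p (h (w.1, b)))
      ((w.2 - switchTime ρ a₀ b w.1) / (b - switchTime ρ a₀ b w.1)))

/-- The hypotheses under which a family of future directed curves can be modified in a cell. -/
structure Spacetime.CellSetup (S : Spacetime n M) (h : N × ℝ → M) (ρ : N → ℝ) (U : Set M) (p : M)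
    (r C : ℝ)
    (ch a : EuclideanSpace ℝ (Fin n) → EuclideanSpace ℝ (Fin n) → ℝ → EuclideanSpace ℝ (Fin n))
    (a₀ b : ℝ) : Prop where
  chord : S.ChordSystem U p r C ch a
  convexNormal : S.IsConvexNormal U
  continuous : Continuous h
  future : ∀ x t, S.FutureAt (fun t ↦ h (x, t)) t
  lt : a₀ < b
  continuous_cutoff : Continuous ρ
  nonneg : ∀ x, 0 ≤ ρ x
  le_one : ∀ x, ρ x ≤ 1
  mem : ∀ x ∈ tsupport ρ, ∀ t ∈ Icc a₀ b, h (x, t) ∈ (extChartAt (𝓡 n) p).source ∧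
    extChartAt (𝓡 n) p (h (x, t)) ∈ Metric.ball (extChartAt (𝓡 n) p p) r

namespace Spacetime.CellSetup

variable {S : Spacetime n M} {h : N × ℝ → M} {ρ : N → ℝ} {U : Set M} {p : M}
    {r C : ℝ}
    {ch a : EuclideanSpace ℝ (Fin n) → EuclideanSpace ℝ (Fin n) → ℝ → EuclideanSpace ℝ (Fin n)}
    {a₀ b : ℝ}

theorem continuous_switchTime (H : S.CellSetup h ρ U p r C ch a a₀ b) :
    Continuous (switchTime ρ a₀ b) := by
  have := H.continuous_cutoff
  unfold switchTime
  fun_prop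

theorem le_switchTime (H : S.CellSetup h ρ U p r C ch a a₀ b) (x : N) : a₀ ≤ switchTime ρ a₀ b x := by
  have h1 := H.le_one x
  have h2 := H.lt
  unfold switchTime
  nlinarith

theorem switchTime_le (H : S.CellSetup h ρ U p r C ch a a₀ b) (x : N) : switchTime ρ a₀ b x ≤ b := by
  have h1 := H.nonneg x
  have h2 := H.lt
  unfold switchTime
  nlinarith

theorem switchTime_mem (H : S.CellSetup h ρ U p r C ch a a₀ b) (x : N) :
    switchTime ρ a₀ b x ∈ Icc a₀ b := ⟨H.le_switchTime x, H.switchTime_le x⟩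

theorem mem_tsupport_of_lt (_H : S.CellSetup h ρ U p r C ch a a₀ b) {x : N}
    (hx : switchTime ρ a₀ b x < b) : x ∈ tsupport ρ := by
  refine subset_tsupport ρ fun h0 ↦ ?_
  simp [switchTime, h0] at hx

omit [IsManifold (𝓡 n) ∞ M] [TopologicalSpace N] in
theorem map_of_le {x : N} {t : ℝ} (ht : t ≤ switchTime ρ a₀ b x) :
    cellMap h ρ p ch a₀ b (x, t) = h (x, t) := if_pos ht

theorem map_of_notMem (H : S.CellSetup h ρ U p r C ch a a₀ b) {x : N} (hx : x ∉ tsupport ρ) {t : ℝ}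
    (ht : t ≤ b) : cellMap h ρ p ch a₀ b (x, t) = h (x, t) :=
  map_of_le (ht.trans (not_lt.1 fun h1 ↦ hx (H.mem_tsupport_of_lt h1)))

theorem ball_left (H : S.CellSetup h ρ U p r C ch a a₀ b) {x : N} (hx : x ∈ tsupport ρ) :
    extChartAt (𝓡 n) p (h (x, switchTime ρ a₀ b x)) ∈ Metric.ball (extChartAt (𝓡 n) p p) r :=
  (H.mem x hx _ (H.switchTime_mem x)).2

theorem ball_right (H : S.CellSetup h ρ U p r C ch a a₀ b) {x : N} (hx : x ∈ tsupport ρ) :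
    extChartAt (𝓡 n) p (h (x, b)) ∈ Metric.ball (extChartAt (𝓡 n) p p) r :=
  (H.mem x hx _ (right_mem_Icc.2 H.lt.le)).2

theorem div_mem {θ t : ℝ} (hθ : θ < b) (h1 : θ ≤ t) (h2 : t ≤ b) :
    (t - θ) / (b - θ) ∈ Icc (0 : ℝ) 1 :=
  ⟨div_nonneg (by linarith) (by linarith), (div_le_one (by linarith)).2 (by linarith)⟩

/-- After the switching time, the modified family is a geodesic chord. -/
theorem map_of_ge (H : S.CellSetup h ρ U p r C ch a a₀ b) {x : N}
    (hx : switchTime ρ a₀ b x < b) {t : ℝ} (ht : switchTime ρ a₀ b x ≤ t) :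
    cellMap h ρ p ch a₀ b (x, t) =
      (extChartAt (𝓡 n) p).symm (ch (extChartAt (𝓡 n) p (h (x, switchTime ρ a₀ b x)))
      (extChartAt (𝓡 n) p (h (x, b))) ((t - switchTime ρ a₀ b x) / (b - switchTime ρ a₀ b x))) := by
  rcases ht.eq_or_lt with rfl | ht
  · have hs := H.mem_tsupport_of_lt hx
    rw [map_of_le le_rfl, sub_self, zero_div, H.chord.zero _ (H.ball_left hs) _ (H.ball_right hs),
      (extChartAt (𝓡 n) p).left_inv (H.mem x hs _ (H.switchTime_mem x)).1]
  · exact if_neg (not_le.2 ht)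

theorem chart_map_of_ge (H : S.CellSetup h ρ U p r C ch a a₀ b) {x : N}
    (hx : switchTime ρ a₀ b x < b) {t : ℝ} (ht : t ∈ Icc (switchTime ρ a₀ b x) b) :
    cellMap h ρ p ch a₀ b (x, t) ∈ (extChartAt (𝓡 n) p).source ∧
    extChartAt (𝓡 n) p (cellMap h ρ p ch a₀ b (x, t)) =
      ch (extChartAt (𝓡 n) p (h (x, switchTime ρ a₀ b x)))
      (extChartAt (𝓡 n) p (h (x, b))) ((t - switchTime ρ a₀ b x) / (b - switchTime ρ a₀ b x)) := by
  have hs := H.mem_tsupport_of_lt hx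
  have h1 := (H.chord.mem _ (H.ball_left hs) _ (H.ball_right hs) _ (div_mem hx ht.1 ht.2)).1
  rw [H.map_of_ge hx ht.1]
  exact ⟨(extChartAt (𝓡 n) p).map_target h1, (extChartAt (𝓡 n) p).right_inv h1⟩

theorem map_left (H : S.CellSetup h ρ U p r C ch a a₀ b) (x : N) :
    cellMap h ρ p ch a₀ b (x, a₀) = h (x, a₀) := map_of_le (H.le_switchTime x)

theorem map_right (H : S.CellSetup h ρ U p r C ch a a₀ b) (x : N) :
    cellMap h ρ p ch a₀ b (x, b) = h (x, b) := by
  rcases (H.switchTime_le x).eq_or_lt with h1 | h1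
  · exact map_of_le h1.ge
  · have hs := H.mem_tsupport_of_lt h1
    rw [H.map_of_ge h1 h1.le, div_self (sub_pos.2 h1).ne',
      H.chord.one _ (H.ball_left hs) _ (H.ball_right hs),
      (extChartAt (𝓡 n) p).left_inv (H.mem x hs _ (right_mem_Icc.2 H.lt.le)).1]

/-- The end points of the chord lie on a future directed curve which, over the support of `ρ`, stays
in the chart ball and hence in `U`. -/
theorem fchron_chord (H : S.CellSetup h ρ U p r C ch a a₀ b) {x : N}
    (hx : switchTime ρ a₀ b x < b) :
    S.FChron U ((extChartAt (𝓡 n) p).symm (extChartAt (𝓡 n) p (h (x, switchTime ρ a₀ b x))))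
      ((extChartAt (𝓡 n) p).symm (extChartAt (𝓡 n) p (h (x, b)))) := by
  have hs := H.mem_tsupport_of_lt hx
  have hm : ∀ t ∈ Icc a₀ b, (extChartAt (𝓡 n) p).symm (extChartAt (𝓡 n) p (h (x, t))) = h (x, t) :=
    fun t ht ↦ (extChartAt (𝓡 n) p).left_inv (H.mem x hs t ht).1
  have hU : ∀ t ∈ Icc a₀ b, h (x, t) ∈ U := by
    intro t ht
    rw [← hm t ht]
    exact (H.chord.ball_subset _ (H.mem x hs t ht).2).2
  rw [hm _ (H.switchTime_mem x), hm _ (right_mem_Icc.2 H.lt.le)]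
  exact fchron_of_futureAt (γ := fun t ↦ h (x, t)) H.convexNormal hx
    (fun t ht ↦ hU t ⟨(H.le_switchTime x).trans ht.1, ht.2⟩)
    (fun t _ ↦ (H.future x t).2) (fun t _ ↦ (H.future x t).1)

theorem fchron_map (H : S.CellSetup h ρ U p r C ch a a₀ b) {x : N}
    {t t' : ℝ} (ht : switchTime ρ a₀ b x ≤ t) (htt : t < t') (ht' : t' ≤ b) :
    S.FChron U (cellMap h ρ p ch a₀ b (x, t)) (cellMap h ρ p ch a₀ b (x, t')) := by
  have hx : switchTime ρ a₀ b x < b := (ht.trans_lt htt).trans_le ht'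
  have hs := H.mem_tsupport_of_lt hx
  rw [H.map_of_ge hx ht, H.map_of_ge hx (ht.trans htt.le)]
  refine H.chord.fchron_sub S rfl _ (H.ball_left hs) _ (H.ball_right hs) (H.fchron_chord hx) U
    (fun s hs' ↦ (H.chord.mem _ (H.ball_left hs) _ (H.ball_right hs) s hs').2) _
    (div_mem hx ht (htt.le.trans ht')) _ (div_mem hx (ht.trans htt.le) ht') ?_
  exact div_lt_div_of_pos_right (by linarith) (by linarith)

theorem continuous_left (H : S.CellSetup h ρ U p r C ch a a₀ b) :
    Continuous fun w : N × ℝ ↦ h (w.1, switchTime ρ a₀ b w.1) :=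
  H.continuous.comp (continuous_fst.prodMk (H.continuous_switchTime.comp continuous_fst))

theorem continuous_right (H : S.CellSetup h ρ U p r C ch a a₀ b) :
    Continuous fun w : N × ℝ ↦ h (w.1, b) :=
  H.continuous.comp (continuous_fst.prodMk continuous_const)

/-- The position and the velocity on the chords depend continuously on the parameters. -/
theorem continuousWithinAt_chord (H : S.CellSetup h ρ U p r C ch a a₀ b) {z : N × ℝ}
    (hz : switchTime ρ a₀ b z.1 < b) (hz2 : z.2 ∈ Icc (switchTime ρ a₀ b z.1) b) :
    ContinuousWithinAt (fun w : N × ℝ ↦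
        (ch (extChartAt (𝓡 n) p (h (w.1, switchTime ρ a₀ b w.1))) (extChartAt (𝓡 n) p (h (w.1, b)))
          ((w.2 - switchTime ρ a₀ b w.1) / (b - switchTime ρ a₀ b w.1)),
        a (extChartAt (𝓡 n) p (h (w.1, switchTime ρ a₀ b w.1))) (extChartAt (𝓡 n) p (h (w.1, b)))
          ((w.2 - switchTime ρ a₀ b w.1) / (b - switchTime ρ a₀ b w.1))))
      {w | switchTime ρ a₀ b w.1 < b ∧ w.2 ∈ Icc (switchTime ρ a₀ b w.1) b} z := by
  have hs := H.mem_tsupport_of_lt hz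
  have h1 := H.chord.continuousOn ((extChartAt (𝓡 n) p (h (z.1, switchTime ρ a₀ b z.1)),
    extChartAt (𝓡 n) p (h (z.1, b))), (z.2 - switchTime ρ a₀ b z.1) / (b - switchTime ρ a₀ b z.1))
    ⟨⟨H.ball_left hs, H.ball_right hs⟩, div_mem hz hz2.1 hz2.2⟩
  have hθ : Continuous fun w : N × ℝ ↦ switchTime ρ a₀ b w.1 :=
    H.continuous_switchTime.comp continuous_fst
  refine ContinuousWithinAt.comp (f := fun w : N × ℝ ↦
    ((extChartAt (𝓡 n) p (h (w.1, switchTime ρ a₀ b w.1)), extChartAt (𝓡 n) p (h (w.1, b))),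
      (w.2 - switchTime ρ a₀ b w.1) / (b - switchTime ρ a₀ b w.1))) (x := z) h1 ?_ ?_
  · refine ContinuousAt.continuousWithinAt ?_
    have c1 : ContinuousAt (fun w : N × ℝ ↦ extChartAt (𝓡 n) p (h (w.1, switchTime ρ a₀ b w.1))) z :=
      ContinuousAt.comp (f := fun w : N × ℝ ↦ h (w.1, switchTime ρ a₀ b w.1))
        (continuousAt_extChartAt' (H.mem _ hs _ (H.switchTime_mem _)).1) H.continuous_left.continuousAt
    have c2 : ContinuousAt (fun w : N × ℝ ↦ extChartAt (𝓡 n) p (h (w.1, b))) z :=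
      ContinuousAt.comp (f := fun w : N × ℝ ↦ h (w.1, b))
        (continuousAt_extChartAt' (H.mem _ hs _ (right_mem_Icc.2 H.lt.le)).1)
        H.continuous_right.continuousAt
    have c3 : ContinuousAt (fun w : N × ℝ ↦
        (w.2 - switchTime ρ a₀ b w.1) / (b - switchTime ρ a₀ b w.1)) z :=
      ContinuousAt.div (continuous_snd.sub hθ).continuousAt (continuous_const.sub hθ).continuousAt
        (sub_pos.2 hz).ne'
    exact (c1.prodMk c2).prodMk c3
  · rintro w ⟨hw1, hw2⟩
    have hs' := H.mem_tsupport_of_lt hw1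
    exact ⟨⟨H.ball_left hs', H.ball_right hs'⟩, div_mem hw1 hw2.1 hw2.2⟩

theorem isOpen_switchTime_lt (H : S.CellSetup h ρ U p r C ch a a₀ b) :
    IsOpen {w : N × ℝ | switchTime ρ a₀ b w.1 < b} :=
  isOpen_lt (H.continuous_switchTime.comp continuous_fst) continuous_const

/-- Where the switching time reaches `b` the chord degenerates and the parameter quotient is
singular. There the limit exists because a chord stays within a fixed multiple of the distance of
its end points; away from the support nothing was changed. -/
theorem continuousWithinAt_map_ge (H : S.CellSetup h ρ U p r C ch a a₀ b) {z : N × ℝ}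
    (hz : z.2 ∈ Icc (switchTime ρ a₀ b z.1) b) :
    ContinuousWithinAt (cellMap h ρ p ch a₀ b) {w | w.2 ∈ Icc (switchTime ρ a₀ b w.1) b} z := by
  set φ := extChartAt (𝓡 n) p with hφ
  rcases (H.switchTime_le z.1).lt_or_eq with hlt | heq
  · have hs := H.mem_tsupport_of_lt hlt
    have h1 := (H.continuousWithinAt_chord hlt hz).fst
    have hm := (H.chord.mem _ (H.ball_left hs) _ (H.ball_right hs) _ (div_mem hlt hz.1 hz.2)).1
    have h2 := ContinuousAt.comp_continuousWithinAt (g := φ.symm) (x := z)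
      (f := fun w : N × ℝ ↦ ch (φ (h (w.1, switchTime ρ a₀ b w.1))) (φ (h (w.1, b)))
          ((w.2 - switchTime ρ a₀ b w.1) / (b - switchTime ρ a₀ b w.1)))
      (continuousAt_extChartAt_symm'' hm) h1
    have h3 : ContinuousWithinAt (cellMap h ρ p ch a₀ b)
        {w | switchTime ρ a₀ b w.1 < b ∧ w.2 ∈ Icc (switchTime ρ a₀ b w.1) b} z :=
      h2.congr (fun w hw ↦ H.map_of_ge hw.1 hw.2.1) (H.map_of_ge hlt hz.1)
    refine h3.mono_of_mem_nhdsWithin ?_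
    filter_upwards [self_mem_nhdsWithin, nhdsWithin_le_nhds (H.isOpen_switchTime_lt.mem_nhds hlt)]
      with w hw1 hw2
    exact ⟨hw2, hw1⟩
  · have hzb : z.2 = b := le_antisymm hz.2 (heq ▸ hz.1)
    have hkz : cellMap h ρ p ch a₀ b z = h z := map_of_le (hzb.trans heq.symm).le
    by_cases hs : z.1 ∈ tsupport ρ
    · have hW := H.mem z.1 hs _ (right_mem_Icc.2 H.lt.le)
      -- points of the chord are close to its left end
      set W : Set M := φ.source ∩ φ ⁻¹' Metric.ball (φ p) r with hWdef
      have hWo : IsOpen W := (continuousOn_extChartAt p).isOpen_inter_preimage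
        (isOpen_extChartAt_source p) Metric.isOpen_ball
      have c1 : ContinuousAt (fun w : N × ℝ ↦ φ (h (w.1, switchTime ρ a₀ b w.1))) z :=
        ContinuousAt.comp (f := fun w : N × ℝ ↦ h (w.1, switchTime ρ a₀ b w.1))
          (continuousAt_extChartAt' (H.mem _ hs _ (H.switchTime_mem _)).1)
          H.continuous_left.continuousAt
      have c2 : ContinuousAt (fun w : N × ℝ ↦ φ (h (w.1, b))) z :=
        ContinuousAt.comp (f := fun w : N × ℝ ↦ h (w.1, b))
          (continuousAt_extChartAt' hW.1) H.continuous_right.continuousAt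
      have hWright : ∀ᶠ w : N × ℝ in 𝓝 z, h (w.1, b) ∈ W :=
        H.continuous_right.continuousAt.eventually (hWo.mem_nhds hW)
      set Lc := 1 + 2 * C * r with hLc
      have hest : ∀ᶠ w in 𝓝[{w | w.2 ∈ Icc (switchTime ρ a₀ b w.1) b}] z,
          cellMap h ρ p ch a₀ b w ∈ φ.source ∧
          ‖φ (cellMap h ρ p ch a₀ b w) - φ (h (w.1, switchTime ρ a₀ b w.1))‖ ≤
            Lc * ‖φ (h (w.1, b)) - φ (h (w.1, switchTime ρ a₀ b w.1))‖ := by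
        filter_upwards [self_mem_nhdsWithin, nhdsWithin_le_nhds hWright] with w hw hwW
        rcases (H.switchTime_le w.1).lt_or_eq with h1 | h1
        · have hs' := H.mem_tsupport_of_lt h1
          have h2 := H.chart_map_of_ge h1 hw
          rw [← hφ, Prod.mk.eta] at h2
          refine ⟨h2.1, ?_⟩
          rw [h2.2]
          exact H.chord.dist_le (H.ball_left hs') (H.ball_right hs') (div_mem h1 hw.1 hw.2)
        · have hwb : w.2 = b := le_antisymm hw.2 (h1 ▸ hw.1)
          have h2 : cellMap h ρ p ch a₀ b w = h (w.1, b) := by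
            have h3 : cellMap h ρ p ch a₀ b w = h w := map_of_le (hwb.trans h1.symm).le
            rw [h3, ← hwb]
          rw [h2, h1, sub_self, norm_zero, mul_zero]
          exact ⟨hwW.1, le_rfl⟩
      have hzz : (z.1, b) = z := by rw [← hzb]
      have hlim : Filter.Tendsto (fun w ↦ φ (cellMap h ρ p ch a₀ b w))
          (𝓝[{w | w.2 ∈ Icc (switchTime ρ a₀ b w.1) b}] z) (𝓝 (φ (h z))) := by
        have t1 : Filter.Tendsto (fun w : N × ℝ ↦
            Lc * ‖φ (h (w.1, b)) - φ (h (w.1, switchTime ρ a₀ b w.1))‖)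
            (𝓝[{w | w.2 ∈ Icc (switchTime ρ a₀ b w.1) b}] z) (𝓝 0) := by
          have e0 : Lc * ‖φ (h (z.1, b)) - φ (h (z.1, switchTime ρ a₀ b z.1))‖ = 0 := by
            rw [heq, sub_self, norm_zero, mul_zero]
          rw [← e0]
          exact ((c2.tendsto.sub c1.tendsto).norm.const_mul Lc).mono_left nhdsWithin_le_nhds
        have t2 := squeeze_zero_norm' (hest.mono fun w hw ↦ hw.2) t1
        have t3 : Filter.Tendsto (fun w : N × ℝ ↦ φ (h (w.1, switchTime ρ a₀ b w.1)))
            (𝓝[{w | w.2 ∈ Icc (switchTime ρ a₀ b w.1) b}] z) (𝓝 (φ (h z))) := by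
          have e0 : φ (h z) = φ (h (z.1, switchTime ρ a₀ b z.1)) := by rw [heq, hzz]
          rw [e0]
          exact c1.tendsto.mono_left nhdsWithin_le_nhds
        have t4 := t2.add t3
        simp only [sub_add_cancel, zero_add] at t4
        exact t4
      rw [hzz] at hW
      have h5 : ContinuousAt φ.symm (φ (h z)) := continuousAt_extChartAt_symm'' (φ.map_source hW.1)
      have h6 := h5.tendsto.comp hlim
      rw [φ.left_inv hW.1] at h6
      unfold ContinuousWithinAt
      rw [hkz]
      refine h6.congr' (hest.mono fun w hw ↦ ?_)
      exact φ.left_inv hw.1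
    · refine (H.continuous.continuousWithinAt).congr_of_eventuallyEq ?_ hkz
      have h1 : ∀ᶠ w : N × ℝ in 𝓝 z, w.1 ∉ tsupport ρ :=
        continuous_fst.continuousAt.eventually ((isClosed_tsupport ρ).isOpen_compl.mem_nhds hs)
      filter_upwards [nhdsWithin_le_nhds h1, self_mem_nhdsWithin] with w hw1 hw2
      exact H.map_of_notMem hw1 hw2.2

theorem continuousOn_map (H : S.CellSetup h ρ U p r C ch a a₀ b) :
    ContinuousOn (cellMap h ρ p ch a₀ b) {w | w.2 ∈ Icc a₀ b} := by
  have hθ : Continuous fun w : N × ℝ ↦ switchTime ρ a₀ b w.1 :=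
    H.continuous_switchTime.comp continuous_fst
  have h1 : ContinuousOn (cellMap h ρ p ch a₀ b) {w | w.2 ≤ switchTime ρ a₀ b w.1} :=
    H.continuous.continuousOn.congr fun w hw ↦ map_of_le hw
  have h2 : ContinuousOn (cellMap h ρ p ch a₀ b) {w | w.2 ∈ Icc (switchTime ρ a₀ b w.1) b} :=
    fun z hz ↦ H.continuousWithinAt_map_ge hz
  have h3 := h1.union_of_isClosed h2 (isClosed_le continuous_snd hθ)
    ((isClosed_le hθ continuous_snd).inter (isClosed_le continuous_snd continuous_const))
  refine h3.mono fun w hw ↦ ?_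
  rcases le_total w.2 (switchTime ρ a₀ b w.1) with h4 | h4
  · exact Or.inl h4
  · exact Or.inr ⟨h4, hw.2⟩

theorem continuousOn_map_line (H : S.CellSetup h ρ U p r C ch a a₀ b) (x : N) :
    ContinuousOn (fun t ↦ cellMap h ρ p ch a₀ b (x, t)) (Icc a₀ b) :=
  H.continuousOn_map.comp (by fun_prop) fun _ ht ↦ ht

theorem map_mem (H : S.CellSetup h ρ U p r C ch a a₀ b) {x : N} (hx : switchTime ρ a₀ b x < b)
    {t : ℝ} (ht : t ∈ Icc (switchTime ρ a₀ b x) b) : cellMap h ρ p ch a₀ b (x, t) ∈ U := by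
  have hs := H.mem_tsupport_of_lt hx
  rw [H.map_of_ge hx ht.1]
  exact (H.chord.mem _ (H.ball_left hs) _ (H.ball_right hs) _ (div_mem hx ht.1 ht.2)).2

/-- Before the switching time the curve is the old one; from then on `fchron_map` orders the points
of the chord. -/
theorem futureRight_map (H : S.CellSetup h ρ U p r C ch a a₀ b) {x : N} {t : ℝ} (ht : t ∈ Ico a₀ b) :
    S.FutureRight (fun t ↦ cellMap h ρ p ch a₀ b (x, t)) t := by
  rcases lt_or_ge t (switchTime ρ a₀ b x) with h1 | h1
  · refine (H.future x t).2.congr ?_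
    filter_upwards [nhdsWithin_le_nhds (Iio_mem_nhds h1)] with s hs
    exact map_of_le (le_of_lt hs)
  · have hx := h1.trans_lt ht.2
    refine futureRight_of_exists ?_ H.convexNormal (H.map_mem hx ⟨h1, ht.2.le⟩) ?_
    · refine (H.continuousOn_map_line x t ⟨ht.1, ht.2.le⟩).mono_of_mem_nhdsWithin ?_
      exact Filter.mem_of_superset (Ioo_mem_nhdsGT ht.2) fun s hs ↦ ⟨ht.1.trans hs.1.le, hs.2.le⟩
    · filter_upwards [Ioo_mem_nhdsGT ht.2] with s hs
      exact H.fchron_map h1 hs.1 hs.2.le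

theorem futureLeft_map (H : S.CellSetup h ρ U p r C ch a a₀ b) {x : N} {t : ℝ} (ht : t ∈ Ioc a₀ b) :
    S.FutureLeft (fun t ↦ cellMap h ρ p ch a₀ b (x, t)) t := by
  rcases le_or_gt t (switchTime ρ a₀ b x) with h1 | h1
  · refine (H.future x t).1.congr ?_
    filter_upwards [self_mem_nhdsWithin] with s hs
    exact map_of_le (le_trans hs h1)
  · have hx := h1.trans_le ht.2
    refine futureLeft_of_exists ?_ H.convexNormal (H.map_mem hx ⟨h1.le, ht.2⟩) ?_
    · refine (H.continuousOn_map_line x t ⟨ht.1.le, ht.2⟩).mono_of_mem_nhdsWithin ?_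
      exact Filter.mem_of_superset (Ioo_mem_nhdsLT ht.1) fun s hs ↦ ⟨hs.1.le, hs.2.le.trans ht.2⟩
    · filter_upwards [Ioo_mem_nhdsLT h1] with s hs
      exact H.fchron_map hs.1.le hs.2 ht.2

end Spacetime.CellSetup

end Cells

/-! ### Strictness of the modified cells -/

section CellStrict

variable {n : ℕ} {M : Type*} [TopologicalSpace M] [ChartedSpace (EuclideanSpace ℝ (Fin n)) M]
  [IsManifold (𝓡 n) ∞ M] {N : Type*} [TopologicalSpace N]

local notation "𝔼" => EuclideanSpace ℝ (Fin n)

theorem Spacetime.pullbackCone_smul (S : Spacetime n M) {ψ : 𝔼 → M} {b v : 𝔼}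
    (hv : v ∈ S.pullbackCone ψ b) {c : ℝ} (hc : 0 < c) : c • v ∈ S.pullbackCone ψ b := by
  change dmap n ψ b (c • v) ∈ S.futureCone (ψ b)
  rw [map_smul]
  exact S.futureCone_smul hv hc

namespace Spacetime.CellSetup

variable {S : Spacetime n M} {h : N × ℝ → M} {ρ : N → ℝ} {U : Set M} {p : M}
    {r C : ℝ}
    {ch a : EuclideanSpace ℝ (Fin n) → EuclideanSpace ℝ (Fin n) → ℝ → EuclideanSpace ℝ (Fin n)}
    {a₀ b : ℝ}

theorem exists_slope_chord (H : S.CellSetup h ρ U p r C ch a a₀ b) {K : Set 𝔼} (hK : Convex ℝ K)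
    (hKc : IsClosed K) {x : N} {t t' : ℝ} (ht : switchTime ρ a₀ b x ≤ t) (htt : t < t')
    (ht' : t' ≤ b)
    (hd : ∀ s ∈ Icc t t', (b - switchTime ρ a₀ b x)⁻¹ •
      a (extChartAt (𝓡 n) p (h (x, switchTime ρ a₀ b x))) (extChartAt (𝓡 n) p (h (x, b)))
        ((s - switchTime ρ a₀ b x) / (b - switchTime ρ a₀ b x)) ∈ K) :
    ∃ v ∈ K, extChartAt (𝓡 n) p (cellMap h ρ p ch a₀ b (x, t')) -
      extChartAt (𝓡 n) p (cellMap h ρ p ch a₀ b (x, t)) = (t' - t) • v := by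
  have hx : switchTime ρ a₀ b x < b := (ht.trans_lt htt).trans_le ht'
  have hs := H.mem_tsupport_of_lt hx
  set θ := switchTime ρ a₀ b x with hθ
  rw [(H.chart_map_of_ge hx ⟨ht, htt.le.trans ht'⟩).2, (H.chart_map_of_ge hx ⟨ht.trans htt.le, ht'⟩).2]
  have hder : ∀ s ∈ Icc t t', HasDerivAt (fun s ↦ ch (extChartAt (𝓡 n) p (h (x, θ)))
      (extChartAt (𝓡 n) p (h (x, b))) ((s - θ) / (b - θ)))
      ((b - θ)⁻¹ • a (extChartAt (𝓡 n) p (h (x, θ))) (extChartAt (𝓡 n) p (h (x, b)))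
        ((s - θ) / (b - θ))) s := by
    intro s hs'
    have h1 := H.chord.hasDerivAt _ (H.ball_left hs) _ (H.ball_right hs) _
      (div_mem hx (ht.trans hs'.1) (hs'.2.trans ht'))
    have h2 : HasDerivAt (fun s : ℝ ↦ (s - θ) / (b - θ)) (b - θ)⁻¹ s := by
      simpa [div_eq_mul_inv] using ((hasDerivAt_id s).sub_const θ).mul_const (b - θ)⁻¹
    exact HasDerivAt.scomp s h1 h2
  exact exists_mem_smul_of_hasDerivAt hK hKc htt
    (fun s hs' ↦ (hder s hs').continuousAt.continuousWithinAt)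
    (fun s hs' ↦ ⟨hder s (Ioo_subset_Icc_self hs'), hd s (Ioo_subset_Icc_self hs')⟩)

/-- For a nondegenerate chord, the velocity at `z` lies in the open cone and depends continuously on
the parameters, so a small closed ball around it serves as `K`. -/
theorem strictIn_map_ge_of_lt (H : S.CellSetup h ρ U p r C ch a a₀ b) {z : N × ℝ}
    (hlt : switchTime ρ a₀ b z.1 < b) (hz : z.2 ∈ Icc (switchTime ρ a₀ b z.1) b) :
    S.StrictIn p (cellMap h ρ p ch a₀ b) {w | w.2 ∈ Icc (switchTime ρ a₀ b w.1) b} z := by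
  set φ := extChartAt (𝓡 n) p with hφ
  set vel : N × ℝ → 𝔼 := fun w ↦ (b - switchTime ρ a₀ b w.1)⁻¹ •
    a (φ (h (w.1, switchTime ρ a₀ b w.1))) (φ (h (w.1, b)))
      ((w.2 - switchTime ρ a₀ b w.1) / (b - switchTime ρ a₀ b w.1)) with hvel
  set R : Set (N × ℝ) := {w | switchTime ρ a₀ b w.1 < b ∧ w.2 ∈ Icc (switchTime ρ a₀ b w.1) b} with hR
  have hθ : Continuous fun w : N × ℝ ↦ switchTime ρ a₀ b w.1 :=
    H.continuous_switchTime.comp continuous_fst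
  have hvc : ContinuousWithinAt vel R z := by
    have h1 := (H.continuousWithinAt_chord hlt hz).snd
    have h2 : ContinuousAt (fun w : N × ℝ ↦ (b - switchTime ρ a₀ b w.1)⁻¹) z :=
      (continuous_const.sub hθ).continuousAt.inv₀ (sub_pos.2 hlt).ne'
    exact h2.continuousWithinAt.smul h1
  have hs := H.mem_tsupport_of_lt hlt
  have hcone : vel z ∈ S.pullbackCone φ.symm (φ (cellMap h ρ p ch a₀ b z)) := by
    have h1 := H.chord.cone S rfl _ (H.ball_left hs) _ (H.ball_right hs) (H.fchron_chord hlt) _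
      (div_mem hlt hz.1 hz.2)
    have h2 := (H.chart_map_of_ge hlt hz).2
    rw [Prod.mk.eta] at h2
    rw [h2]
    exact S.pullbackCone_smul h1 (inv_pos.2 (sub_pos.2 hlt))
  obtain ⟨ε, hε, hεc⟩ := Metric.nhds_basis_closedBall.mem_iff.1
    ((S.isOpen_pullbackCone φ.symm _).mem_nhds hcone)
  obtain ⟨O, hO, hOR⟩ := mem_nhdsWithin_iff_exists_mem_nhds_inter.1
    (hvc (Metric.closedBall_mem_nhds _ hε))
  have hO2 := Filter.inter_mem hO (H.isOpen_switchTime_lt.mem_nhds hlt)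
  obtain ⟨u, hu, v, hv, huv⟩ := mem_nhds_prod_iff.1 hO2
  obtain ⟨δ, hδ, hδv⟩ := Metric.mem_nhds_iff.1 hv
  refine ⟨Metric.closedBall (vel z) ε, isCompact_closedBall _ _, convex_closedBall _ _, hεc,
    u ×ˢ Metric.ball z.2 δ, prod_mem_nhds hu (Metric.ball_mem_nhds _ hδ), ?_⟩
  rintro x t t' ⟨h1, h1'⟩ ⟨h2, h2'⟩ htt
  refine H.exists_slope_chord (convex_closedBall _ _) Metric.isClosed_closedBall h1.1 htt h2.2
    fun s hs' ↦ ?_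
  have h3 : (x, s) ∈ u ×ˢ Metric.ball z.2 δ := by
    refine ⟨h1'.1, ?_⟩
    have h4 := h1'.2
    have h5 := h2'.2
    rw [Real.ball_eq_Ioo] at h4 h5 ⊢
    exact ⟨h4.1.trans_le hs'.1, hs'.2.trans_lt h5.2⟩
  have h4 := huv (prod_mono subset_rfl hδv h3)
  have h5 : (x, s) ∈ R := ⟨h4.2, h1.1.trans hs'.1, hs'.2.trans h2.2⟩
  have h6 : vel (x, s) ∈ Metric.closedBall (vel z) ε := hOR ⟨h4.1, h5⟩
  simp only [hvel] at h6
  exact h6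

/-- Near such a point the chords are short. The velocity of the chord over `[θ, b]`, with `θ` the
switching time, is within `C * R ^ 2 * (b - θ)` of the difference quotient of `h` there, which lies
in `K`; so a thickening of `K` works. This is where old strictness is needed. -/
theorem strictIn_map_ge_of_eq (H : S.CellSetup h ρ U p r C ch a a₀ b) {z : N × ℝ}
    (heq : switchTime ρ a₀ b z.1 = b) (hzb : z.2 = b)
    (hst : S.StrictIn p h univ z) :
    S.StrictIn p (cellMap h ρ p ch a₀ b) {w | w.2 ∈ Icc (switchTime ρ a₀ b w.1) b} z := by
  set φ := extChartAt (𝓡 n) p with hφ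
  have hkz : cellMap h ρ p ch a₀ b z = h z := map_of_le (hzb.trans heq.symm).le
  obtain ⟨K, hK, hKc, hKs, O, hO, hsl⟩ := hst
  obtain ⟨ε, hε, hεs⟩ := exists_cthickening_subset_cone hK hKs
  obtain ⟨R, hR, hKR⟩ := hK.isBounded.exists_pos_norm_le
  obtain ⟨u, hu, v, hv, huv⟩ := mem_nhds_prod_iff.1 hO
  obtain ⟨δ, hδ, hδv⟩ := Metric.mem_nhds_iff.1 hv
  have hC := H.chord.nonneg
  set η := ε / (C * R ^ 2 + 1) with hη
  have hη0 : 0 < η := by positivity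
  have hθc : Continuous (switchTime ρ a₀ b) := H.continuous_switchTime
  have hO2 : {w : N × ℝ | b - δ < switchTime ρ a₀ b w.1 ∧ b - η < switchTime ρ a₀ b w.1} ∈ 𝓝 z := by
    have h1 : IsOpen {w : N × ℝ | b - δ < switchTime ρ a₀ b w.1 ∧ b - η < switchTime ρ a₀ b w.1} :=
      (isOpen_lt continuous_const (hθc.comp continuous_fst)).inter
        (isOpen_lt continuous_const (hθc.comp continuous_fst))
    refine h1.mem_nhds ⟨?_, ?_⟩ <;> rw [heq] <;> linarith
  have hO1 : u ×ˢ Metric.ball z.2 δ ∈ 𝓝 z := prod_mem_nhds hu (Metric.ball_mem_nhds _ hδ)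
  refine ⟨Metric.cthickening ε K, hK.cthickening, hKc.cthickening ε, by rwa [hkz], _,
    Filter.inter_mem hO1 hO2, ?_⟩
  rintro x t t' ⟨h1, h1'⟩ ⟨h2, h2'⟩ htt
  have hx : switchTime ρ a₀ b x < b := (h1.1.trans_lt htt).trans_le h2.2
  have hs := H.mem_tsupport_of_lt hx
  refine H.exists_slope_chord (hKc.cthickening ε) Metric.isClosed_cthickening h1.1 htt h2.2
    fun s hs' ↦ ?_
  set θ := switchTime ρ a₀ b x with hθ
  have hmem : ∀ t ∈ Icc θ b, (x, t) ∈ univ ∩ O := by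
    intro t ht
    refine ⟨mem_univ _, huv ⟨h1'.1.1, hδv ?_⟩⟩
    rw [Real.ball_eq_Ioo, hzb]
    exact ⟨h1'.2.1.trans_le ht.1, by linarith [ht.2]⟩
  obtain ⟨w, hw, hwf⟩ := hsl x θ b (hmem θ ⟨le_rfl, hx.le⟩) (hmem b ⟨hx.le, le_rfl⟩) hx
  have hbθ : 0 < b - θ := sub_pos.2 hx
  have h3 := H.chord.norm_sub_le _ (H.ball_left hs) _ (H.ball_right hs) _
    (div_mem hx (h1.1.trans hs'.1) (hs'.2.trans h2.2))
  rw [hwf] at h3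
  refine Metric.mem_cthickening_of_dist_le _ w ε _ hw ?_
  rw [dist_eq_norm]
  have h4 : ∀ A : 𝔼, (b - θ)⁻¹ • A - w = (b - θ)⁻¹ • (A - (b - θ) • w) := by
    intro A
    rw [smul_sub, inv_smul_smul₀ hbθ.ne']
  rw [h4, norm_smul, norm_inv, Real.norm_of_nonneg hbθ.le, inv_mul_le_iff₀ hbθ]
  refine h3.trans ?_
  rw [norm_smul, Real.norm_of_nonneg hbθ.le]
  have h5 : b - θ ≤ η := by linarith [h1'.2.2]
  have h6 : C * R ^ 2 * η ≤ ε := by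
    rw [hη, mul_div_assoc', div_le_iff₀ (by positivity)]
    nlinarith
  calc C * ((b - θ) * ‖w‖) ^ 2 ≤ C * ((b - θ) * R) ^ 2 := by
        have := hKR w hw
        gcongr
    _ = (b - θ) * (C * R ^ 2 * (b - θ)) := by ring
    _ ≤ (b - θ) * (C * R ^ 2 * η) := by gcongr
    _ ≤ (b - θ) * ε := by gcongr

theorem map_self_mem (H : S.CellSetup h ρ U p r C ch a a₀ b) {z : N × ℝ} (hz : z.2 ∈ Icc a₀ b)
    (hs : z.1 ∈ tsupport ρ) : cellMap h ρ p ch a₀ b z ∈ (extChartAt (𝓡 n) p).source := by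
  rcases le_or_gt z.2 (switchTime ρ a₀ b z.1) with h1 | h1
  · have h2 : cellMap h ρ p ch a₀ b z = h z := map_of_le h1
    rw [h2]
    exact (H.mem z.1 hs z.2 hz).1
  · exact (H.chart_map_of_ge (h1.trans_le hz.2) ⟨h1.le, hz.2⟩).1

theorem strictIn_map_of_regions (H : S.CellSetup h ρ U p r C ch a a₀ b) {z : N × ℝ}
    (h₁ : S.StrictIn p (cellMap h ρ p ch a₀ b)
      {w | w.2 ∈ Icc a₀ b ∧ w.2 ≤ switchTime ρ a₀ b w.1} z)
    (h₂ : S.StrictIn p (cellMap h ρ p ch a₀ b) {w | w.2 ∈ Icc (switchTime ρ a₀ b w.1) b} z) :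
    S.StrictIn p (cellMap h ρ p ch a₀ b) {w | w.2 ∈ Icc a₀ b} z := by
  refine StrictIn.split (θ := switchTime ρ a₀ b) h₁ (h₂.mono fun w hw ↦ ⟨hw.2, hw.1.2⟩) ?_
  exact fun x t t' _ _ _ _ ↦ H.switchTime_mem x

theorem strictIn_map_ge_of_gt (H : S.CellSetup h ρ U p r C ch a a₀ b) {z : N × ℝ}
    (hz : z.2 < switchTime ρ a₀ b z.1) :
    S.StrictIn p (cellMap h ρ p ch a₀ b) {w | w.2 ∈ Icc (switchTime ρ a₀ b w.1) b} z := by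
  have hO : IsOpen {w : N × ℝ | w.2 < switchTime ρ a₀ b w.1} :=
    isOpen_lt continuous_snd (H.continuous_switchTime.comp continuous_fst)
  exact strictIn_of_subsingleton (hO.mem_nhds hz) fun x t t' h1 _ ↦
    absurd h1.2 (not_lt.2 h1.1.1)

/-- The modification of a cell preserves strictness. -/
theorem strictIn_map (H : S.CellSetup h ρ U p r C ch a a₀ b) {z : N × ℝ} (hz : z.2 ∈ Icc a₀ b)
    (hst : S.StrictAt h z) :
    ∃ p₀, cellMap h ρ p ch a₀ b z ∈ (extChartAt (𝓡 n) p₀).source ∧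
      S.StrictIn p₀ (cellMap h ρ p ch a₀ b) {w | w.2 ∈ Icc a₀ b} z := by
  by_cases hs : z.1 ∈ tsupport ρ
  · have hst' := hst.strictIn (p₁ := p) H.continuous.continuousAt (H.mem z.1 hs z.2 hz).1
    refine ⟨p, H.map_self_mem hz hs, H.strictIn_map_of_regions ?_ ?_⟩
    · rcases le_or_gt z.2 (switchTime ρ a₀ b z.1) with h1 | h1
      · exact (hst'.mono (subset_univ _)).congr (map_of_le h1) Filter.univ_mem
          fun w hw ↦ map_of_le hw.1.2
      · have hO : IsOpen {w : N × ℝ | switchTime ρ a₀ b w.1 < w.2} :=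
          isOpen_lt (H.continuous_switchTime.comp continuous_fst) continuous_snd
        exact strictIn_of_subsingleton (hO.mem_nhds h1) fun x t t' h2 _ ↦
          absurd h2.2 (not_lt.2 h2.1.2)
    · rcases lt_or_ge z.2 (switchTime ρ a₀ b z.1) with h1 | h1
      · exact H.strictIn_map_ge_of_gt h1
      rcases (H.switchTime_le z.1).lt_or_eq with h2 | h2
      · exact H.strictIn_map_ge_of_lt h2 ⟨h1, hz.2⟩
      · exact H.strictIn_map_ge_of_eq h2 (le_antisymm hz.2 (h2 ▸ h1)) hst'
  -- Off the support `h z` need not lie in the chart around `p`, so the chart around `h z` itself is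
  -- used.
  · have hkz : cellMap h ρ p ch a₀ b z = h z := H.map_of_notMem hs hz.2
    refine ⟨h z, by rw [hkz]; exact mem_extChartAt_source _, ?_⟩
    have h1 : {w : N × ℝ | w.1 ∉ tsupport ρ} ∈ 𝓝 z :=
      continuous_fst.continuousAt.eventually ((isClosed_tsupport ρ).isOpen_compl.mem_nhds hs)
    exact (StrictIn.mono hst (subset_univ _)).congr hkz h1 fun w hw ↦ H.map_of_notMem hw.2 hw.1.2

/-- Where the cutoff function is `1`, the modification of a cell is strict. -/
theorem strictIn_map_of_one (H : S.CellSetup h ρ U p r C ch a a₀ b) {z : N × ℝ}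
    (hz : z.2 ∈ Icc a₀ b) (hρ : ∀ᶠ x in 𝓝 z.1, ρ x = 1) :
    ∃ p₀, cellMap h ρ p ch a₀ b z ∈ (extChartAt (𝓡 n) p₀).source ∧
      S.StrictIn p₀ (cellMap h ρ p ch a₀ b) {w | w.2 ∈ Icc a₀ b} z := by
  have hθ : ∀ x, ρ x = 1 → switchTime ρ a₀ b x = a₀ := fun x hx ↦ by
    simp [switchTime, hx]
  have h0 := hθ _ hρ.self_of_nhds
  have hlt : switchTime ρ a₀ b z.1 < b := by rw [h0]; exact H.lt
  have hs := H.mem_tsupport_of_lt hlt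
  refine ⟨p, H.map_self_mem hz hs, H.strictIn_map_of_regions ?_ ?_⟩
  · have h1 : {w : N × ℝ | ρ w.1 = 1} ∈ 𝓝 z := continuous_fst.continuousAt.eventually hρ
    refine strictIn_of_subsingleton h1 fun x t t' h2 h3 ↦ ?_
    have h4 := h3.1.2
    rw [hθ x h3.2] at h4
    exact h4.trans h2.1.1.1
  · exact H.strictIn_map_ge_of_lt hlt ⟨by rw [h0]; exact hz.1, hz.2⟩

end Spacetime.CellSetup

end CellStrict

/-! ### Modifying all cells of a mesh -/

section StrictApproximation

variable {n : ℕ} {M : Type*} [TopologicalSpace M] [ChartedSpace (EuclideanSpace ℝ (Fin n)) M]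
  [IsManifold (𝓡 n) ∞ M] {N : Type*} [TopologicalSpace N]

local notation "𝔼" => EuclideanSpace ℝ (Fin n)

namespace Spacetime

theorem StrictIn.of_inter_subset {S : Spacetime n M} {p₀ : M} {h : N × ℝ → M} {A A' : Set (N × ℝ)}
    {z : N × ℝ} (hs : S.StrictIn p₀ h A z) {O : Set (N × ℝ)} (hO : O ∈ 𝓝 z) (hA : A' ∩ O ⊆ A) :
    S.StrictIn p₀ h A' z := by
  obtain ⟨K, h1, h2, h3, O', hO', h4⟩ := hs
  exact ⟨K, h1, h2, h3, O ∩ O', Filter.inter_mem hO hO', h4.mono subset_rfl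
    fun w hw ↦ ⟨hA ⟨hw.1, hw.2.1⟩, hw.2.2⟩⟩

/-- A continuous periodic family of future directed curves with prescribed initial points, whose
graph lies in `𝒱`. -/
structure FutureFamily (S : Spacetime n M) (𝒱 : Set ((N × ℝ) × M)) (h₀ : N → M) (h : N × ℝ → M) :
    Prop where
  continuous : Continuous h
  periodic : ∀ x t, h (x, t + 1) = h (x, t)
  future : ∀ x t, S.FutureAt (fun t ↦ h (x, t)) t
  zero : ∀ x, h (x, 0) = h₀ x
  mem : ∀ x, ∀ t ∈ Icc (-1 : ℝ) 1, ((x, t), h (x, t)) ∈ 𝒱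

theorem FutureFamily.add_int {S : Spacetime n M} {𝒱 : Set ((N × ℝ) × M)} {h₀ : N → M}
    {h : N × ℝ → M} (H : S.FutureFamily 𝒱 h₀ h) (x : N) (t : ℝ) (k : ℤ) : h (x, t + k) = h (x, t) := by
  have h1 : Function.Periodic (fun t ↦ h (x, t)) 1 := fun t ↦ H.periodic x t
  simpa using (h1.int_mul k) t

/-- Chords between close points of a curve are close to the curve. -/
theorem eventually_chord_mem {S : Spacetime n M} {h : N × ℝ → M} (hc : Continuous h)
    {𝒱 : Set ((N × ℝ) × M)} (h𝒱 : IsOpen 𝒱) {U : Set M} {p : M} {r C : ℝ} {ch a : 𝔼 → 𝔼 → ℝ → 𝔼}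
    (hch : S.ChordSystem U p r C ch a) {K : Set (N × ℝ)} (hK : IsCompact K)
    (hmem : ∀ w ∈ K, h w ∈ (extChartAt (𝓡 n) p).source ∧
      extChartAt (𝓡 n) p (h w) ∈ Metric.ball (extChartAt (𝓡 n) p p) r)
    (hV : ∀ w ∈ K, (w, h w) ∈ 𝒱) :
    ∀ᶠ αβ : ℝ × ℝ in 𝓝 (0, 0), ∀ w ∈ K, ∀ s ∈ Icc (0 : ℝ) 1,
      (w, (extChartAt (𝓡 n) p).symm (ch (extChartAt (𝓡 n) p (h (w.1, w.2 + αβ.1)))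
        (extChartAt (𝓡 n) p (h (w.1, w.2 + αβ.2))) s)) ∈ 𝒱 := by
  set φ := extChartAt (𝓡 n) p with hφ
  have key := (hK.prod (isCompact_univ (X := Icc (0 : ℝ) 1))).eventually_forall_of_forall_eventually
    (x₀ := ((0 : ℝ), (0 : ℝ))) (P := fun αβ y ↦ (y.1, φ.symm (ch (φ (h (y.1.1, y.1.2 + αβ.1)))
        (φ (h (y.1.1, y.1.2 + αβ.2))) (y.2 : ℝ))) ∈ 𝒱) ?_
  · exact key.mono fun αβ h1 w hw s hs ↦ h1 (w, ⟨s, hs⟩) ⟨hw, mem_univ _⟩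
  rintro ⟨w, s⟩ ⟨hw, -⟩
  have hw' := hmem w hw
  set B := Metric.ball (φ p) r with hB
  have c1 : ∀ (f : (ℝ × ℝ) × ((N × ℝ) × Icc (0 : ℝ) 1) → ℝ), Continuous f → f ((0, 0), (w, s)) = 0 →
      ContinuousAt (fun y : (ℝ × ℝ) × ((N × ℝ) × Icc (0 : ℝ) 1) ↦
        φ (h (y.2.1.1, y.2.1.2 + f y))) ((0, 0), (w, s)) := by
    intro f hf hf0
    have h1 : Continuous fun y : (ℝ × ℝ) × ((N × ℝ) × Icc (0 : ℝ) 1) ↦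
      h (y.2.1.1, y.2.1.2 + f y) := by fun_prop
    refine ContinuousAt.comp (f := fun y : (ℝ × ℝ) × ((N × ℝ) × Icc (0 : ℝ) 1) ↦
      h (y.2.1.1, y.2.1.2 + f y)) (continuousAt_extChartAt' ?_) h1.continuousAt
    rw [hf0, add_zero]
    exact hw'.1
  have c2 := c1 (fun y ↦ y.1.1) (by fun_prop) rfl
  have c3 := c1 (fun y ↦ y.1.2) (by fun_prop) rfl
  have hw2 : h (w.1, w.2 + 0) = h w := by rw [add_zero]
  have hB2 : φ (h (w.1, w.2 + 0)) ∈ B := by rw [hw2]; exact hw'.2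
  -- A chord with equal end points is constant. At zero displacement the assertion is thus the
  -- hypothesis on `h`, and compactness makes it uniform for small displacements.
  have hchw : ch (φ (h (w.1, w.2 + 0))) (φ (h (w.1, w.2 + 0))) s = φ (h w) := by
    have h1 := hch.dist_le hB2 hB2 s.2
    rw [sub_self, norm_zero, mul_zero, norm_le_zero_iff, sub_eq_zero] at h1
    rw [h1, hw2]
  have hBo : IsOpen B := Metric.isOpen_ball
  have c4 : ContinuousAt (fun y : (ℝ × ℝ) × ((N × ℝ) × Icc (0 : ℝ) 1) ↦
      ch (φ (h (y.2.1.1, y.2.1.2 + y.1.1))) (φ (h (y.2.1.1, y.2.1.2 + y.1.2))) (y.2.2 : ℝ))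
      ((0, 0), (w, s)) := by
    have h1 := (hch.continuousOn ((φ (h (w.1, w.2 + 0)), φ (h (w.1, w.2 + 0))), (s : ℝ))
      ⟨⟨hB2, hB2⟩, s.2⟩).fst
    have h2 : Filter.Tendsto (fun y : (ℝ × ℝ) × ((N × ℝ) × Icc (0 : ℝ) 1) ↦
        ((φ (h (y.2.1.1, y.2.1.2 + y.1.1)), φ (h (y.2.1.1, y.2.1.2 + y.1.2))), (y.2.2 : ℝ)))
        (𝓝 ((0, 0), (w, s)))
        (𝓝[(B ×ˢ B) ×ˢ Icc 0 1] ((φ (h (w.1, w.2 + 0)), φ (h (w.1, w.2 + 0))), (s : ℝ))) := by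
      refine tendsto_nhdsWithin_iff.2 ⟨?_, ?_⟩
      · have c5 : Continuous fun y : (ℝ × ℝ) × ((N × ℝ) × Icc (0 : ℝ) 1) ↦ (y.2.2 : ℝ) := by fun_prop
        exact ((c2.prodMk c3).prodMk c5.continuousAt).tendsto
      · filter_upwards [c2.eventually (hBo.mem_nhds hB2), c3.eventually (hBo.mem_nhds hB2)]
          with y hy1 hy2
        exact ⟨⟨hy1, hy2⟩, y.2.2.2⟩
    exact h1.tendsto.comp h2
  have c6 : ContinuousAt φ.symm (ch (φ (h (w.1, w.2 + 0))) (φ (h (w.1, w.2 + 0))) s) := by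
    rw [hchw]
    exact continuousAt_extChartAt_symm'' (φ.map_source hw'.1)
  have c7 := ContinuousAt.comp (f := fun y : (ℝ × ℝ) × ((N × ℝ) × Icc (0 : ℝ) 1) ↦
      ch (φ (h (y.2.1.1, y.2.1.2 + y.1.1))) (φ (h (y.2.1.1, y.2.1.2 + y.1.2))) (y.2.2 : ℝ))
      (x := ((0, 0), (w, s))) c6 c4
  have c8 : Continuous fun y : (ℝ × ℝ) × ((N × ℝ) × Icc (0 : ℝ) 1) ↦ y.2.1 := by fun_prop
  refine (c8.continuousAt.prodMk c7).eventually (h𝒱.mem_nhds ?_)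
  simp only [Function.comp]
  rw [hchw, φ.left_inv hw'.1]
  exact hV w hw

section Mesh

/-- The index of the chart used in the cell `c`, when each of `L` intervals is cut into `m` cells. -/
def cellIndex (L m : ℕ) (c : ℤ) : ℕ := ((c / m) % L).toNat

theorem cellIndex_lt {L m : ℕ} (hL : 0 < L) (c : ℤ) : cellIndex L m c < L := by
  have h1 : 0 ≤ (c / m) % L := Int.emod_nonneg _ (by omega)
  have h2 : (c / m) % L < L := Int.emod_lt_of_pos _ (by omega)
  unfold cellIndex
  omega

/-- Write `c = m * (L * k + j) + e` with `0 ≤ e < m`: up to translation by `k` periods, the cell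
lies in the `j`-th of the `L` intervals of one period. -/
theorem mem_of_mem_cell {L m : ℕ} (hL : 0 < L) (hm : 0 < m) (c : ℤ) {t : ℝ}
    (ht : t ∈ Icc ((c : ℝ) / (L * m : ℕ)) ((c + 1) / (L * m : ℕ))) :
    t - (c / m / L : ℤ) ∈ Icc ((cellIndex L m c : ℝ) / L) ((cellIndex L m c + 1) / L) := by
  have h1 : 0 ≤ (c / m) % L := Int.emod_nonneg _ (by omega)
  have h2 : (cellIndex L m c : ℤ) = (c / m) % L := by
    unfold cellIndex
    omega
  have h3 : c = m * (L * (c / m / L) + cellIndex L m c) + c % m := by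
    rw [h2, Int.mul_ediv_add_emod, Int.mul_ediv_add_emod]
  have h4 : 0 ≤ c % m := Int.emod_nonneg _ (by omega)
  have h5 : c % m + 1 ≤ m := Int.emod_lt_of_pos _ (by omega)
  have hL' : (0 : ℝ) < L := by exact_mod_cast hL
  have hm' : (0 : ℝ) < m := by exact_mod_cast hm
  have h3' : (c : ℝ) = m * (L * (c / m / L : ℤ) + cellIndex L m c) + (c % m : ℤ) := by
    exact_mod_cast h3
  have h4' : (0 : ℝ) ≤ (c % m : ℤ) := by exact_mod_cast h4
  have h5' : ((c % m : ℤ) : ℝ) + 1 ≤ m := by exact_mod_cast h5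
  set k : ℝ := ((c / m / L : ℤ) : ℝ)
  set e : ℝ := ((c % m : ℤ) : ℝ)
  obtain ⟨h6, h7⟩ := ht
  push_cast at h6 h7
  rw [div_le_iff₀ (by positivity)] at h6
  rw [le_div_iff₀ (by positivity)] at h7
  constructor
  · rw [div_le_iff₀ hL']
    nlinarith
  · rw [le_div_iff₀ hL']
    nlinarith

/-- The modification of a family in all cells. -/
noncomputable def meshMap (h : N × ℝ → M) (ρ : N → ℝ) (p : ℕ → M)
    (ch : ℕ → EuclideanSpace ℝ (Fin n) → EuclideanSpace ℝ (Fin n) → ℝ → EuclideanSpace ℝ (Fin n))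
    (L m : ℕ) (w : N × ℝ) : M :=
  cellMap h ρ (p (cellIndex L m ⌊w.2 * (L * m : ℕ)⌋)) (ch (cellIndex L m ⌊w.2 * (L * m : ℕ)⌋))
    ((⌊w.2 * (L * m : ℕ)⌋ : ℝ) / (L * m : ℕ)) ((⌊w.2 * (L * m : ℕ)⌋ + 1) / (L * m : ℕ)) w

/-- The hypotheses under which a family of future directed curves can be modified in all cells. -/
structure MeshSetup (S : Spacetime n M) (𝒱 : Set ((N × ℝ) × M)) (h₀ : N → M) (h : N × ℝ → M)
    (ρ : N → ℝ) (U : ℕ → Set M) (p : ℕ → M) (r C : ℕ → ℝ)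
    (ch a : ℕ → EuclideanSpace ℝ (Fin n) → EuclideanSpace ℝ (Fin n) → ℝ → EuclideanSpace ℝ (Fin n))
    (L : ℕ) : Prop where
  family : S.FutureFamily 𝒱 h₀ h
  pos : 0 < L
  chord : ∀ j < L, S.ChordSystem (U j) (p j) (r j) (C j) (ch j) (a j)
  convexNormal : ∀ j < L, S.IsConvexNormal (U j)
  continuous_cutoff : Continuous ρ
  nonneg : ∀ x, 0 ≤ ρ x
  le_one : ∀ x, ρ x ≤ 1
  mem : ∀ x ∈ tsupport ρ, ∀ j < L, ∀ t ∈ Icc ((j : ℝ) / L) ((j + 1) / L),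
    h (x, t) ∈ (extChartAt (𝓡 n) (p j)).source ∧
    extChartAt (𝓡 n) (p j) (h (x, t)) ∈ Metric.ball (extChartAt (𝓡 n) (p j) (p j)) (r j)

namespace MeshSetup

variable {S : Spacetime n M} {𝒱 : Set ((N × ℝ) × M)} {h₀ : N → M} {h : N × ℝ → M}
  {ρ : N → ℝ} {U : ℕ → Set M} {p : ℕ → M} {r C : ℕ → ℝ}
  {ch a : ℕ → EuclideanSpace ℝ (Fin n) → EuclideanSpace ℝ (Fin n) → ℝ → EuclideanSpace ℝ (Fin n)}
  {L m : ℕ}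

theorem mem_cell (H : S.MeshSetup 𝒱 h₀ h ρ U p r C ch a L) (hm : 0 < m) {x : N} (hx : x ∈ tsupport ρ)
    {c : ℤ} {t : ℝ} (ht : t ∈ Icc ((c : ℝ) / (L * m : ℕ)) ((c + 1) / (L * m : ℕ))) :
    h (x, t) ∈ (extChartAt (𝓡 n) (p (cellIndex L m c))).source ∧
    extChartAt (𝓡 n) (p (cellIndex L m c)) (h (x, t)) ∈ Metric.ball
      (extChartAt (𝓡 n) (p (cellIndex L m c)) (p (cellIndex L m c))) (r (cellIndex L m c)) := by
  have h1 := H.mem x hx _ (cellIndex_lt H.pos c) _ (mem_of_mem_cell H.pos hm c ht)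
  rw [← H.family.add_int x _ (c / m / L), sub_add_cancel] at h1
  exact h1

theorem cellSetup (H : S.MeshSetup 𝒱 h₀ h ρ U p r C ch a L) (hm : 0 < m) (c : ℤ) :
    S.CellSetup h ρ (U (cellIndex L m c)) (p (cellIndex L m c)) (r (cellIndex L m c))
      (C (cellIndex L m c)) (ch (cellIndex L m c)) (a (cellIndex L m c))
      ((c : ℝ) / (L * m : ℕ)) ((c + 1) / (L * m : ℕ)) where
  chord := H.chord _ (cellIndex_lt H.pos c)
  convexNormal := H.convexNormal _ (cellIndex_lt H.pos c)
  continuous := H.family.continuous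
  future := H.family.future
  lt := by
    have : 0 < L * m := Nat.mul_pos H.pos hm
    have : (0 : ℝ) < (L * m : ℕ) := by exact_mod_cast this
    exact div_lt_div_of_pos_right (by linarith) this
  continuous_cutoff := H.continuous_cutoff
  nonneg := H.nonneg
  le_one := H.le_one
  mem x hx t ht := H.mem_cell hm hx ht

/-- The floor assigns the right end of a cell to the next one. The two formulas agree there, since
both equal `h` at the nodes of the mesh. -/
theorem meshMap_eq (H : S.MeshSetup 𝒱 h₀ h ρ U p r C ch a L) (hm : 0 < m) (c : ℤ) {w : N × ℝ}
    (hw : w.2 ∈ Icc ((c : ℝ) / (L * m : ℕ)) ((c + 1) / (L * m : ℕ))) :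
    meshMap h ρ p ch L m w = cellMap h ρ (p (cellIndex L m c)) (ch (cellIndex L m c))
      ((c : ℝ) / (L * m : ℕ)) ((c + 1) / (L * m : ℕ)) w := by
  have h0 : (0 : ℝ) < (L * m : ℕ) := by exact_mod_cast Nat.mul_pos H.pos hm
  obtain ⟨h1, h2⟩ := hw
  rcases h2.lt_or_eq with h3 | h3
  · have hf : ⌊w.2 * (L * m : ℕ)⌋ = c := by
      rw [Int.floor_eq_iff]
      exact ⟨(div_le_iff₀ h0).1 h1, (lt_div_iff₀ h0).1 h3⟩
    rw [meshMap, hf]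
  · have hf : ⌊w.2 * (L * m : ℕ)⌋ = c + 1 := by
      rw [h3, div_mul_cancel₀ _ h0.ne']
      exact_mod_cast Int.floor_intCast (R := ℝ) (c + 1)
    have h4 : w = (w.1, ((c + 1 : ℤ) : ℝ) / (L * m : ℕ)) := by
      rw [Int.cast_add, Int.cast_one, ← h3]
    have h5 := (H.cellSetup hm (c + 1)).map_left w.1
    have h6 := (H.cellSetup hm c).map_right w.1
    rw [← h4] at h5
    rw [← h3] at h6
    rw [meshMap, hf, h5, ← h3, h6]

theorem mem_Ico_floor (H : S.MeshSetup 𝒱 h₀ h ρ U p r C ch a L) (hm : 0 < m) (t : ℝ) :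
    t ∈ Ico ((⌊t * (L * m : ℕ)⌋ : ℝ) / (L * m : ℕ)) ((⌊t * (L * m : ℕ)⌋ + 1) / (L * m : ℕ)) := by
  have h0 : (0 : ℝ) < (L * m : ℕ) := by exact_mod_cast Nat.mul_pos H.pos hm
  exact ⟨(div_le_iff₀ h0).2 (Int.floor_le _), (lt_div_iff₀ h0).2 (Int.lt_floor_add_one _)⟩

theorem mem_Ioc_ceil (H : S.MeshSetup 𝒱 h₀ h ρ U p r C ch a L) (hm : 0 < m) (t : ℝ) :
    t ∈ Ioc (((⌈t * (L * m : ℕ)⌉ - 1 : ℤ) : ℝ) / (L * m : ℕ))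
      (((⌈t * (L * m : ℕ)⌉ - 1 : ℤ) + 1) / (L * m : ℕ)) := by
  have h0 : (0 : ℝ) < (L * m : ℕ) := by exact_mod_cast Nat.mul_pos H.pos hm
  rw [Int.cast_sub, Int.cast_one, sub_add_cancel]
  refine ⟨(div_lt_iff₀ h0).2 ?_, (le_div_iff₀ h0).2 (Int.le_ceil _)⟩
  linarith [Int.ceil_lt_add_one (t * ((L * m : ℕ) : ℝ))]

theorem continuous_meshMap (H : S.MeshSetup 𝒱 h₀ h ρ U p r C ch a L) (hm : 0 < m) :
    Continuous (meshMap h ρ p ch L m) := by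
  have hcell : ∀ c : ℤ, ContinuousOn (meshMap h ρ p ch L m)
      {w | w.2 ∈ Icc ((c : ℝ) / (L * m : ℕ)) ((c + 1) / (L * m : ℕ))} := fun c ↦
    (H.cellSetup hm c).continuousOn_map.congr fun w hw ↦ H.meshMap_eq hm c hw
  have hclosed : ∀ c : ℤ, IsClosed
      {w : N × ℝ | w.2 ∈ Icc ((c : ℝ) / (L * m : ℕ)) ((c + 1) / (L * m : ℕ))} := fun c ↦
    isClosed_Icc.preimage continuous_snd
  rw [continuous_iff_continuousAt]
  intro z
  -- The cell containing `z.2` but not as its left end; together with the following cell it covers a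
  -- neighbourhood of `z`.
  set c := ⌈z.2 * (L * m : ℕ)⌉ - 1 with hc
  have h1 := H.mem_Ioc_ceil hm z.2
  rw [← hc] at h1
  have h0 : (0 : ℝ) < (L * m : ℕ) := by exact_mod_cast Nat.mul_pos H.pos hm
  refine ((hcell c).union_of_isClosed (hcell (c + 1)) (hclosed c) (hclosed (c + 1))).continuousAt ?_
  have h2 : Ioo ((c : ℝ) / (L * m : ℕ)) ((c + 1 + 1) / (L * m : ℕ)) ∈ 𝓝 z.2 := by
    refine Ioo_mem_nhds h1.1 (h1.2.trans_lt ?_)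
    exact div_lt_div_of_pos_right (by linarith) h0
  filter_upwards [continuous_snd.continuousAt.preimage_mem_nhds h2] with w hw
  rcases le_total w.2 ((c + 1) / (L * m : ℕ)) with h3 | h3
  · exact Or.inl ⟨hw.1.le, h3⟩
  · right
    change w.2 ∈ Icc (((c + 1 : ℤ) : ℝ) / (L * m : ℕ)) (((c + 1 : ℤ) + 1) / (L * m : ℕ))
    rw [Int.cast_add, Int.cast_one]
    exact ⟨h3, hw.2.le⟩

theorem meshMap_of_notMem (H : S.MeshSetup 𝒱 h₀ h ρ U p r C ch a L) (hm : 0 < m) {x : N}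
    (hx : x ∉ tsupport ρ) (t : ℝ) : meshMap h ρ p ch L m (x, t) = h (x, t) :=
  (H.cellSetup hm _).map_of_notMem hx (H.mem_Ico_floor hm t).2.le

theorem meshMap_add_one (H : S.MeshSetup 𝒱 h₀ h ρ U p r C ch a L) (hm : 0 < m) (x : N) (t : ℝ) :
    meshMap h ρ p ch L m (x, t + 1) = meshMap h ρ p ch L m (x, t) := by
  have h0 : (0 : ℝ) < (L * m : ℕ) := by exact_mod_cast Nat.mul_pos H.pos hm
  set c := ⌊t * (L * m : ℕ)⌋ with hc
  have hf : ⌊(t + 1) * (L * m : ℕ)⌋ = c + (L * m : ℕ) := by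
    rw [add_mul, one_mul, Int.floor_add_natCast]
  have hidx : cellIndex L m (c + (L * m : ℕ)) = cellIndex L m c := by
    have hm' : (m : ℤ) ≠ 0 := by omega
    unfold cellIndex
    push_cast
    rw [Int.add_mul_ediv_right _ _ hm', Int.add_emod_right]
  have ha : ((c + (L * m : ℕ) : ℤ) : ℝ) / (L * m : ℕ) = c / (L * m : ℕ) + 1 := by
    rw [Int.cast_add, Int.cast_natCast, add_div, div_self h0.ne']
  have hb : (((c + (L * m : ℕ) : ℤ) : ℝ) + 1) / (L * m : ℕ) = (c + 1) / (L * m : ℕ) + 1 := by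
    rw [Int.cast_add, Int.cast_natCast, add_right_comm, add_div, div_self h0.ne']
  have hsw : switchTime ρ ((c : ℝ) / (L * m : ℕ) + 1) ((c + 1) / (L * m : ℕ) + 1) x =
      switchTime ρ ((c : ℝ) / (L * m : ℕ)) ((c + 1) / (L * m : ℕ)) x + 1 := by
    unfold switchTime
    ring
  unfold meshMap
  simp only [hf, ← hc]
  rw [hidx, ha, hb]
  unfold cellMap
  simp only [hsw, H.family.periodic, add_le_add_iff_right, add_sub_add_right_eq_sub]

theorem futureAt_meshMap (H : S.MeshSetup 𝒱 h₀ h ρ U p r C ch a L) (hm : 0 < m) (x : N) (t : ℝ) :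
    S.FutureAt (fun t ↦ meshMap h ρ p ch L m (x, t)) t := by
  constructor
  · have h1 := H.mem_Ioc_ceil hm t
    refine ((H.cellSetup hm _).futureLeft_map (x := x) h1).congr ?_
    have h2 := inter_mem_nhdsWithin (Iic t) (Ioi_mem_nhds h1.1)
    filter_upwards [h2] with s hs
    exact H.meshMap_eq hm _ ⟨le_of_lt hs.2, le_trans hs.1 h1.2⟩
  · have h1 := H.mem_Ico_floor hm t
    refine ((H.cellSetup hm _).futureRight_map (x := x) h1).congr ?_
    have h2 := inter_mem_nhdsWithin (Ici t) (Iio_mem_nhds h1.2)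
    filter_upwards [h2] with s hs
    exact H.meshMap_eq hm _ ⟨le_trans h1.1 hs.1, le_of_lt hs.2⟩

theorem strictAt_meshMap (H : S.MeshSetup 𝒱 h₀ h ρ U p r C ch a L) (hm : 0 < m) {z : N × ℝ}
    (hz : ∀ c : ℤ, z.2 ∈ Icc ((c : ℝ) / (L * m : ℕ)) ((c + 1) / (L * m : ℕ)) →
      ∃ p₀, cellMap h ρ (p (cellIndex L m c)) (ch (cellIndex L m c))
          ((c : ℝ) / (L * m : ℕ)) ((c + 1) / (L * m : ℕ)) z ∈ (extChartAt (𝓡 n) p₀).source ∧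
        S.StrictIn p₀ (cellMap h ρ (p (cellIndex L m c)) (ch (cellIndex L m c))
          ((c : ℝ) / (L * m : ℕ)) ((c + 1) / (L * m : ℕ)))
          {w | w.2 ∈ Icc ((c : ℝ) / (L * m : ℕ)) ((c + 1) / (L * m : ℕ))} z) :
    S.StrictAt (meshMap h ρ p ch L m) z := by
  set h' := meshMap h ρ p ch L m with hh'
  have hcont : ContinuousAt h' z := (H.continuous_meshMap hm).continuousAt
  have hz' : ∀ c : ℤ, z.2 ∈ Icc ((c : ℝ) / (L * m : ℕ)) ((c + 1) / (L * m : ℕ)) →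
      S.StrictIn (h' z) h' {w | w.2 ∈ Icc ((c : ℝ) / (L * m : ℕ)) ((c + 1) / (L * m : ℕ))} z := by
    intro c hc
    obtain ⟨p₀, h1, h2⟩ := hz c hc
    have h3 := h2.congr (h' := h') (H.meshMap_eq hm c hc) Filter.univ_mem
      fun w hw ↦ H.meshMap_eq hm c hw.1
    refine h3.change_chart hcont ?_ (mem_extChartAt_source _)
    rw [hh', H.meshMap_eq hm c hc]
    exact h1
  set c := ⌈z.2 * (L * m : ℕ)⌉ - 1 with hc
  have h1 := H.mem_Ioc_ceil hm z.2
  rw [← hc] at h1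
  have h0 : (0 : ℝ) < (L * m : ℕ) := by exact_mod_cast Nat.mul_pos H.pos hm
  have h2 : Ioo ((c : ℝ) / (L * m : ℕ)) ((c + 1 + 1) / (L * m : ℕ)) ∈ 𝓝 z.2 := by
    refine Ioo_mem_nhds h1.1 (h1.2.trans_lt ?_)
    exact div_lt_div_of_pos_right (by linarith) h0
  have h3 := continuous_snd.continuousAt.preimage_mem_nhds h2
  refine StrictIn.split (θ := fun _ ↦ ((c : ℝ) + 1) / (L * m : ℕ)) ?_ ?_ fun _ _ _ _ _ _ _ ↦ mem_univ _
  · exact (hz' c ⟨h1.1.le, h1.2⟩).of_inter_subset h3 fun w hw ↦ ⟨hw.2.1.le, hw.1.2⟩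
  · rcases h1.2.lt_or_eq with h4 | h4
    · have hO : IsOpen {w : N × ℝ | w.2 < ((c : ℝ) + 1) / (L * m : ℕ)} :=
        isOpen_lt continuous_snd continuous_const
      exact strictIn_of_subsingleton (hO.mem_nhds h4) fun x t t' h5 _ ↦
        absurd h5.2 (not_lt.2 h5.1.2)
    · have h5 : z.2 ∈ Icc (((c + 1 : ℤ) : ℝ) / (L * m : ℕ)) (((c + 1 : ℤ) + 1) / (L * m : ℕ)) := by
        rw [Int.cast_add, Int.cast_one]
        exact ⟨h4.ge, h4.le.trans (div_le_div_of_nonneg_right (by linarith) h0.le)⟩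
      refine (hz' (c + 1) h5).of_inter_subset h3 fun w hw ↦ ?_
      change w.2 ∈ Icc (((c + 1 : ℤ) : ℝ) / (L * m : ℕ)) (((c + 1 : ℤ) + 1) / (L * m : ℕ))
      rw [Int.cast_add, Int.cast_one]
      exact ⟨hw.1.2, hw.2.2.le⟩

/-- For fine meshes, the modification of a family is close to the family. -/
theorem exists_meshMap_mem (H : S.MeshSetup 𝒱 h₀ h ρ U p r C ch a L) (h𝒱 : IsOpen 𝒱)
    (hρ : IsCompact (tsupport ρ)) :
    ∃ m > 0, ∀ x, ∀ t ∈ Icc (-1 : ℝ) 1, ((x, t), meshMap h ρ p ch L m (x, t)) ∈ 𝒱 := by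
  -- The part in `[-1, 1]` of the translates of the `j`-th interval. For the `k` attached to a cell
  -- only the values -1, 0, 1 occur.
  set T : ℕ → ℤ → Set ℝ := fun j k ↦ Icc (-1) 1 ∩ Icc ((j : ℝ) / L + k) ((j + 1) / L + k) with hT
  have h1 : ∀ j ∈ Finset.range L, ∀ k ∈ Finset.Icc (-1 : ℤ) 1, ∀ᶠ αβ : ℝ × ℝ in 𝓝 (0, 0),
      ∀ w ∈ tsupport ρ ×ˢ T j k, ∀ s ∈ Icc (0 : ℝ) 1,
      (w, (extChartAt (𝓡 n) (p j)).symm (ch j (extChartAt (𝓡 n) (p j) (h (w.1, w.2 + αβ.1)))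
        (extChartAt (𝓡 n) (p j) (h (w.1, w.2 + αβ.2))) s)) ∈ 𝒱 := by
    intro j hj k _
    have hjL := Finset.mem_range.1 hj
    refine eventually_chord_mem H.family.continuous h𝒱 (H.chord j hjL)
      (hρ.prod (isCompact_Icc.inter_right isClosed_Icc)) ?_ ?_
    · rintro ⟨x, t⟩ ⟨hx, -, ht⟩
      have h2 := H.mem x hx j hjL (t - k) ⟨by linarith [ht.1], by linarith [ht.2]⟩
      rwa [← H.family.add_int x _ k, sub_add_cancel] at h2
    · rintro ⟨x, t⟩ ⟨_, ht, -⟩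
      exact H.family.mem x t ht
  have h2 : ∀ᶠ αβ : ℝ × ℝ in 𝓝 (0, 0), ∀ j ∈ Finset.range L, ∀ k ∈ Finset.Icc (-1 : ℤ) 1,
      ∀ w ∈ tsupport ρ ×ˢ T j k, ∀ s ∈ Icc (0 : ℝ) 1,
      (w, (extChartAt (𝓡 n) (p j)).symm (ch j (extChartAt (𝓡 n) (p j) (h (w.1, w.2 + αβ.1)))
        (extChartAt (𝓡 n) (p j) (h (w.1, w.2 + αβ.2))) s)) ∈ 𝒱 := by
    rw [Filter.eventually_all_finset]
    intro j hj
    rw [Filter.eventually_all_finset]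
    exact fun k hk ↦ h1 j hj k hk
  obtain ⟨δ, hδ, hball⟩ := Metric.eventually_nhds_iff_ball.1 h2
  -- Cells have length `1 / (L * m) < δ`, so both ends of the chord are within `δ` of the time
  -- considered.
  obtain ⟨m, hm⟩ := exists_nat_gt (1 / δ)
  have hm0 : 0 < m := by
    have : (0 : ℝ) < m := (by positivity : (0 : ℝ) < 1 / δ).trans hm
    exact_mod_cast this
  have hL1 : (1 : ℝ) ≤ L := by exact_mod_cast H.pos
  have hL' : (0 : ℝ) < L := by linarith
  have hmr : (0 : ℝ) < m := by exact_mod_cast hm0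
  have h0 : (0 : ℝ) < (L * m : ℕ) := by exact_mod_cast Nat.mul_pos H.pos hm0
  have hw : 1 / ((L * m : ℕ) : ℝ) < δ := by
    rw [div_lt_iff₀ h0]
    rw [div_lt_iff₀ hδ] at hm
    push_cast
    nlinarith
  refine ⟨m, hm0, fun x t ht ↦ ?_⟩
  set c := ⌊t * (L * m : ℕ)⌋ with hc
  have hcell := H.mem_Ico_floor hm0 t
  rw [← hc] at hcell
  have HC := H.cellSetup hm0 c
  have hcell' : t ∈ Icc ((c : ℝ) / (L * m : ℕ)) ((c + 1) / (L * m : ℕ)) := ⟨hcell.1, hcell.2.le⟩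
  rw [H.meshMap_eq hm0 c hcell']
  set b : ℝ := (c + 1) / (L * m : ℕ) with hb
  set a₀ : ℝ := (c : ℝ) / (L * m : ℕ) with ha₀
  have hba : b - a₀ = 1 / ((L * m : ℕ) : ℝ) := by
    rw [hb, ha₀, ← sub_div, add_sub_cancel_left]
  rcases le_or_gt t (switchTime ρ a₀ b x) with h3 | h3
  · rw [CellSetup.map_of_le h3]
    exact H.family.mem x t ht
  have hx : switchTime ρ a₀ b x < b := h3.trans hcell.2
  have hs := HC.mem_tsupport_of_lt hx
  rw [HC.map_of_ge hx h3.le]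
  set j := cellIndex L m c with hj
  have hjL : j < L := cellIndex_lt H.pos c
  have hmem := mem_of_mem_cell H.pos hm0 c hcell'
  rw [← hj] at hmem
  set k : ℤ := c / m / L with hk
  have hjl : (0 : ℝ) ≤ (j : ℝ) / L := by positivity
  have hju : ((j : ℝ) + 1) / L ≤ 1 := by
    rw [div_le_one hL']
    exact_mod_cast hjL
  have hk1 : -1 ≤ k := by
    by_contra hlt
    have h4 : (k : ℝ) ≤ -2 := by exact_mod_cast (by omega : k ≤ -2)
    have h5 : t < -1 ∨ t = -1 := by
      rcases lt_or_ge t (-1) with h6 | h6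
      · exact Or.inl h6
      · exact Or.inr (by linarith [hmem.2])
    rcases h5 with h5 | h5
    · linarith [ht.1]
    · -- `t = -1` is the left end of its cell
      have h6 : c = -(L * m : ℕ) := by
        rw [hc, h5, neg_one_mul, ← Int.cast_natCast, ← Int.cast_neg, Int.floor_intCast]
      have hm' : (m : ℤ) ≠ 0 := by omega
      have h7 : k = -1 := by
        rw [hk, h6]
        push_cast
        rw [← neg_mul, Int.mul_ediv_cancel _ hm', Int.neg_ediv_self]
        have := H.pos
        omega
      omega
  have hk2 : k ≤ 1 := by
    by_contra hlt
    have h4 : (2 : ℝ) ≤ k := by exact_mod_cast (by omega : 2 ≤ k)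
    linarith [hmem.1, ht.2]
  have h4 := hball (switchTime ρ a₀ b x - t, b - t) ?_ j (Finset.mem_range.2 hjL) k
    (Finset.mem_Icc.2 ⟨hk1, hk2⟩) (x, t)
    ⟨hs, ht, by linarith [hmem.1], by linarith [hmem.2]⟩ _ (CellSetup.div_mem hx h3.le hcell.2.le)
  · simp only [add_sub_cancel] at h4
    exact h4
  · rw [← ball_prod_same]
    refine ⟨?_, ?_⟩
    · rw [mem_ball_zero_iff, Real.norm_eq_abs, abs_lt]
      constructor <;> linarith [HC.le_switchTime x, hcell.2]
    · rw [mem_ball_zero_iff, Real.norm_eq_abs, abs_lt]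
      constructor <;> linarith [hcell.1, hcell.2]

/-- A family of future directed curves can be made strict over a compact set of parameters. -/
theorem exists_strict (H : S.MeshSetup 𝒱 h₀ h ρ U p r C ch a L) (h𝒱 : IsOpen 𝒱)
    (hρ : IsCompact (tsupport ρ)) :
    ∃ h' : N × ℝ → M, S.FutureFamily 𝒱 h₀ h' ∧ (∀ z : N × ℝ, z.1 ∉ tsupport ρ → h' z = h z) ∧
      (∀ z, S.StrictAt h z → S.StrictAt h' z) ∧
      ∀ z : N × ℝ, (∀ᶠ x in 𝓝 z.1, ρ x = 1) → S.StrictAt h' z := by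
  obtain ⟨m, hm, hmem⟩ := H.exists_meshMap_mem h𝒱 hρ
  refine ⟨meshMap h ρ p ch L m, ⟨H.continuous_meshMap hm, H.meshMap_add_one hm,
    H.futureAt_meshMap hm, fun x ↦ ?_, hmem⟩, fun z hz ↦ H.meshMap_of_notMem hm hz z.2,
    fun z hz ↦ H.strictAt_meshMap hm fun c hc ↦ (H.cellSetup hm c).strictIn_map hc hz,
    fun z hz ↦ H.strictAt_meshMap hm fun c hc ↦ (H.cellSetup hm c).strictIn_map_of_one hc hz⟩
  have h1 : meshMap h ρ p ch L m (x, 0) = h (x, 0) := by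
    have h2 := (H.cellSetup hm 0).map_left x
    have h3 := H.mem_Ico_floor hm 0
    rw [zero_mul, Int.floor_zero] at h3
    rw [H.meshMap_eq hm 0 ⟨h3.1, h3.2.le⟩]
    simpa using h2
  rw [h1, H.family.zero]

end MeshSetup

end Mesh

end Spacetime

end StrictApproximation

/-! ### Convolution and closed convex sets -/

section Mollification

open MeasureTheory

variable {G E : Type*} [NormedAddCommGroup G] [NormedSpace ℝ G] [FiniteDimensional ℝ G]
  [MeasurableSpace G] [BorelSpace G] [NormedAddCommGroup E] [NormedSpace ℝ E] [CompleteSpace E]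

/-- Averages with respect to a bump function stay in closed convex sets. -/
theorem ContDiffBump.integral_normed_smul_mem {μ : Measure G} [μ.IsAddHaarMeasure]
    (ψ : ContDiffBump (0 : G)) {w : G → E} (hw : Integrable (fun ξ ↦ ψ.normed μ ξ • w ξ) μ) {T : Set E}
    (hT : Convex ℝ T) (hTc : IsClosed T) (hwT : ∀ ξ ∈ Metric.ball (0 : G) ψ.rOut, w ξ ∈ T) :
    ∫ ξ, ψ.normed μ ξ • w ξ ∂μ ∈ T := by
  by_contra hv
  obtain ⟨l, u, hlu, hu⟩ := geometric_hahn_banach_closed_point hT hTc hv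
  rw [← l.integral_comp_comm hw] at hu
  have h1 : ∫ ξ, l (ψ.normed μ ξ • w ξ) ∂μ ≤ ∫ ξ, ψ.normed μ ξ * u ∂μ := by
    refine integral_mono (l.integrable_comp hw) (ψ.integrable_normed.mul_const u) fun ξ ↦ ?_
    simp only [map_smul, smul_eq_mul]
    by_cases hξ : ξ ∈ Metric.ball (0 : G) ψ.rOut
    · exact mul_le_mul_of_nonneg_left (hlu _ (hwT ξ hξ)).le (ψ.nonneg_normed ξ)
    · have h2 : ψ.normed μ ξ = 0 := by
        rw [← ψ.support_normed_eq (μ := μ), notMem_support] at hξ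
        exact hξ
      simp [h2]
  rw [integral_mul_const, ψ.integral_normed, one_mul] at h1
  linarith

/-- Mollification of a function that is continuous on a compact set. -/
theorem exists_mollification {A : Set G} (hA : IsCompact A) {u : G → E} (hu : ContinuousOn u A)
    {ε : ℝ} (hε : 0 < ε) :
    ∃ v : G → E, ContDiff ℝ ∞ v ∧
      (∀ q, Metric.ball q ε ⊆ A → ∀ T : Set E, Convex ℝ T → IsClosed T →
        (∀ ξ ∈ Metric.ball (0 : G) ε, u (q - ξ) ∈ T) → v q ∈ T) ∧
      (∀ q q', Metric.ball q ε ⊆ A → Metric.ball q' ε ⊆ A → ∀ T : Set E, Convex ℝ T → IsClosed T →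
        (∀ ξ ∈ Metric.ball (0 : G) ε, u (q' - ξ) - u (q - ξ) ∈ T) → v q' - v q ∈ T) := by
  set μ : Measure G := Measure.addHaar
  set ψ : ContDiffBump (0 : G) := ⟨ε / 2, ε, by positivity, by linarith⟩
  -- Extension by zero gives an integrable function. It goes unnoticed in the conclusions, which
  -- only concern points whose `ε`-ball lies in `A`.
  set û : G → E := A.indicator u
  have hint : Integrable û μ :=
    (integrable_indicator_iff hA.measurableSet).2 (hu.integrableOn_compact hA)
  set v : G → E := convolution (ψ.normed μ) û (ContinuousLinearMap.lsmul ℝ ℝ) μ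
  have hvd : ContDiff ℝ ∞ v :=
    ψ.hasCompactSupport_normed.contDiff_convolution_left _ ψ.contDiff_normed hint.locallyIntegrable
  have hv : ∀ q, v q = ∫ ξ, ψ.normed μ ξ • û (q - ξ) ∂μ := fun q ↦ rfl
  have hin : ∀ q, Integrable (fun ξ ↦ ψ.normed μ ξ • û (q - ξ)) μ := fun q ↦
    (ψ.hasCompactSupport_normed.convolutionExists_left (ContinuousLinearMap.lsmul ℝ ℝ)
      ψ.continuous_normed hint.locallyIntegrable) q
  have hball : ∀ q, Metric.ball q ε ⊆ A → ∀ ξ ∈ Metric.ball (0 : G) ε, û (q - ξ) = u (q - ξ) := by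
    intro q hq ξ hξ
    refine indicator_of_mem (hq ?_) u
    rw [mem_ball_iff_norm]
    simpa using hξ
  refine ⟨v, hvd, fun q hq T hT hTc h ↦ ?_, fun q q' hq hq' T hT hTc h ↦ ?_⟩
  · rw [hv]
    refine ψ.integral_normed_smul_mem (hin q) hT hTc fun ξ hξ ↦ ?_
    rw [hball q hq ξ hξ]
    exact h ξ hξ
  · rw [hv, hv, ← integral_sub (hin q') (hin q)]
    simp only [← smul_sub]
    refine ψ.integral_normed_smul_mem (w := fun ξ ↦ û (q' - ξ) - û (q - ξ)) ?_ hT hTc fun ξ hξ ↦ ?_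
    · simp only [smul_sub]
      exact (hin q').sub (hin q)
    · rw [hball q hq ξ hξ, hball q' hq' ξ hξ]
      exact h ξ hξ

end Mollification

/-! ### Strict families are essentially timelike -/

section StrictFamilies

variable {n : ℕ} {M : Type*} [TopologicalSpace M] [ChartedSpace (EuclideanSpace ℝ (Fin n)) M]
  [IsManifold (𝓡 n) ∞ M] {N : Type*} [TopologicalSpace N]

local notation "𝔼" => EuclideanSpace ℝ (Fin n)

namespace Spacetime

variable {S : Spacetime n M} {h : N × ℝ → M} {z : N × ℝ}

/-- Near `(y, K)` with `K` a compact set of future vectors at `y`, all vectors are future vectors. -/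
theorem exists_nhds_cthickening_cone (S : Spacetime n M) (p : M) {y : 𝔼}
    (hy : y ∈ (extChartAt (𝓡 n) p).target) {K : Set 𝔼}
    (hK : IsCompact K) (hKs : K ⊆ S.pullbackCone (extChartAt (𝓡 n) p).symm y) :
    ∃ ε > 0, ∃ Y ∈ 𝓝 y, ∀ y' ∈ Y,
      Metric.cthickening ε K ⊆ S.pullbackCone (extChartAt (𝓡 n) p).symm y' := by
  obtain ⟨ε, hε, hεK⟩ := exists_cthickening_subset_cone hK hKs
  have h1 : ∀ v ∈ Metric.cthickening ε K, ∀ᶠ x : 𝔼 × 𝔼 in 𝓝 (y, v),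
      x.2 ∈ S.pullbackCone (extChartAt (𝓡 n) p).symm x.1 := fun v hv ↦
    Filter.eventually_of_mem ((S.isOpen_cone_chart p).mem_nhds ⟨hy, hεK hv⟩) fun x hx ↦ hx.2
  have h2 := hK.cthickening.eventually_forall_of_forall_eventually
    (P := fun y' v ↦ v ∈ S.pullbackCone (extChartAt (𝓡 n) p).symm y') h1
  exact ⟨ε, hε, _, h2, fun y' hy' ↦ hy'⟩

/-- Close points of a strictly future directed family are chronologically related. -/
theorem StrictAt.exists_fchron (hs : S.StrictAt h z) (hc : ContinuousAt h z) {U : Set M}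
    (hU : S.IsConvexNormal U) (hz : h z ∈ U) :
    ∃ O ∈ 𝓝 z, ∀ x t t', (x, t) ∈ O → (x, t') ∈ O → t < t' → S.FChron U (h (x, t)) (h (x, t')) := by
  obtain ⟨r, C, ch, a, hch⟩ := hU.exists_chordSystem hz
  obtain ⟨K, hK, hKc, hKs, O, hO, hsl⟩ := hs
  set φ := extChartAt (𝓡 n) (h z) with hφ
  obtain ⟨ε, hε, Y, hY, hYK⟩ := S.exists_nhds_cthickening_cone (h z) (mem_extChartAt_target _) hK hKs
  obtain ⟨R, hR, hKR⟩ := hK.isBounded.exists_pos_norm_le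
  have hC := hch.nonneg
  -- For times closer than `η`, the initial velocity of the chord, divided by `t' - t`, is within
  -- `ε` of a difference quotient of `h`. It is therefore in the cone, and the chord is timelike.
  set η := ε / (C * R ^ 2 + 1) with hη
  have hη0 : 0 < η := by positivity
  have hcφ : ContinuousAt (fun w ↦ φ (h w)) z :=
    ContinuousAt.comp (continuousAt_extChartAt (h z)) hc
  have hO2 : {w | φ (h w) ∈ Y ∩ Metric.ball (φ (h z)) r ∧ h w ∈ φ.source} ∈ 𝓝 z :=
    (hcφ.eventually (Filter.inter_mem hY (Metric.ball_mem_nhds _ hch.pos))).and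
      (hc.eventually ((isOpen_extChartAt_source _).mem_nhds (mem_extChartAt_source _)))
  have hO3 : {w : N × ℝ | w.2 ∈ Metric.ball z.2 (η / 2)} ∈ 𝓝 z :=
    continuous_snd.continuousAt.preimage_mem_nhds (Metric.ball_mem_nhds _ (by positivity))
  refine ⟨_, Filter.inter_mem hO (Filter.inter_mem hO2 hO3), fun x t t' h1 h2 htt ↦ ?_⟩
  obtain ⟨v, hv, hvf⟩ := hsl x t t' ⟨mem_univ _, h1.1⟩ ⟨mem_univ _, h2.1⟩ htt
  have htt' : 0 < t' - t := sub_pos.2 htt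
  have h3 := hch.norm_sub_le _ h1.2.1.1.2 _ h2.2.1.1.2 0 (by simp)
  have h4 := hch.fchron_iff S h1.2.1.1.2 h2.2.1.1.2
  rw [← hφ, φ.left_inv h1.2.1.2, φ.left_inv h2.2.1.2] at h4
  rw [h4]
  change φ (h (x, t')) - φ (h (x, t)) = _ at hvf
  rw [hvf, norm_smul, Real.norm_of_nonneg htt'.le] at h3
  set A := a (φ (h (x, t))) (φ (h (x, t'))) 0 with hA
  have h5 : (t' - t)⁻¹ • A ∈ Metric.cthickening ε K := by
    refine Metric.mem_cthickening_of_dist_le _ v ε _ hv ?_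
    have h6 : (t' - t)⁻¹ • A - v = (t' - t)⁻¹ • (A - (t' - t) • v) := by
      rw [smul_sub, inv_smul_smul₀ htt'.ne']
    rw [dist_eq_norm, h6, norm_smul, norm_inv, Real.norm_of_nonneg htt'.le, inv_mul_le_iff₀ htt']
    refine h3.trans ?_
    have h7 : t' - t ≤ η := by
      have h8 : t ∈ Metric.ball z.2 (η / 2) := h1.2.2
      have h9 : t' ∈ Metric.ball z.2 (η / 2) := h2.2.2
      rw [Real.ball_eq_Ioo] at h8 h9
      linarith [h8.1, h9.2]
    have h10 : C * R ^ 2 * η ≤ ε := by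
      rw [hη, mul_div_assoc', div_le_iff₀ (by positivity)]
      nlinarith
    calc C * ((t' - t) * ‖v‖) ^ 2 ≤ C * ((t' - t) * R) ^ 2 := by
          have := hKR v hv
          gcongr
      _ = (t' - t) * (C * R ^ 2 * (t' - t)) := by ring
      _ ≤ (t' - t) * (C * R ^ 2 * η) := by gcongr
      _ ≤ (t' - t) * ε := by gcongr
  have h6 := S.pullbackCone_smul (hYK _ h1.2.1.1.1 h5) htt'
  rwa [smul_inv_smul₀ htt'.ne'] at h6

theorem StrictAt.add_const (hs : S.StrictAt h z) {c : ℝ} (hp : ∀ x t, h (x, t + c) = h (x, t)) :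
    S.StrictAt h (z.1, z.2 + c) := by
  obtain ⟨K, hK, hKc, hKs, O, hO, hsl⟩ := hs
  have hz : h (z.1, z.2 + c) = h z := hp _ _
  unfold StrictAt
  rw [hz]
  refine ⟨K, hK, hKc, by rwa [hz], (fun w : N × ℝ ↦ (w.1, w.2 - c)) ⁻¹' O, ?_, ?_⟩
  · have h1 : Continuous fun w : N × ℝ ↦ (w.1, w.2 - c) := by fun_prop
    refine h1.continuousAt.preimage_mem_nhds ?_
    rwa [add_sub_cancel_right]
  · intro x t t' h1 h2 h3
    obtain ⟨v, hv, hvf⟩ := hsl x (t - c) (t' - c) ⟨mem_univ _, h1.2⟩ ⟨mem_univ _, h2.2⟩ (by linarith)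
    refine ⟨v, hv, ?_⟩
    have h4 := hp x (t - c)
    have h5 := hp x (t' - c)
    rw [sub_add_cancel] at h4 h5
    simp only [h4, h5]
    rw [sub_sub_sub_cancel_right] at hvf
    exact hvf

/-- A continuous periodic strictly future directed family with prescribed initial points, whose
graph lies in `𝒱`. -/
structure StrictFamily (S : Spacetime n M) (𝒱 : Set ((N × ℝ) × M)) (h₀ : N → M) (h : N × ℝ → M) :
    Prop where
  continuous : Continuous h
  periodic : ∀ x t, h (x, t + 1) = h (x, t)
  strict : ∀ z, S.StrictAt h z
  zero : ∀ x, h (x, 0) = h₀ x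
  mem : ∀ x, ∀ t ∈ Icc (-1 : ℝ) 1, ((x, t), h (x, t)) ∈ 𝒱

end Spacetime

end StrictFamilies

/-! ### Interpolating between a strict family and an approximation -/

section Blending

variable {n : ℕ} {M : Type*} [TopologicalSpace M] [ChartedSpace (EuclideanSpace ℝ (Fin n)) M]
  {N : Type*} [TopologicalSpace N]

local notation "𝔼" => EuclideanSpace ℝ (Fin n)

open Classical in
/-- The map which, in the chart around `p`, interpolates between `h` and `w` by means of the cutoff
function `ρ`. -/
noncomputable def blend (p : M) (h : N × ℝ → M) (ρ : N × ℝ → ℝ) (w : N × ℝ → EuclideanSpace ℝ (Fin n))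
    (z : N × ℝ) : M :=
  if ρ z = 0 then h z else (extChartAt (𝓡 n) p).symm
    (extChartAt (𝓡 n) p (h z) + ρ z • (w z - extChartAt (𝓡 n) p (h z)))

variable {p : M} {h : N × ℝ → M} {ρ : N × ℝ → ℝ} {z : N × ℝ}

omit [TopologicalSpace N] in
theorem blend_of_zero {w : N × ℝ → 𝔼} (hz : ρ z = 0) : blend p h ρ w z = h z := if_pos hz

omit [TopologicalSpace N] in
theorem blend_of_mem {w : N × ℝ → 𝔼} (hz : h z ∈ (extChartAt (𝓡 n) p).source) :
    blend p h ρ w z = (extChartAt (𝓡 n) p).symm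
      (extChartAt (𝓡 n) p (h z) + ρ z • (w z - extChartAt (𝓡 n) p (h z))) := by
  by_cases h0 : ρ z = 0
  · rw [blend_of_zero h0, h0, zero_smul, add_zero, (extChartAt (𝓡 n) p).left_inv hz]
  · exact if_neg h0

variable [IsManifold (𝓡 n) ∞ M]

/-- The hypotheses under which interpolation with a small smooth perturbation `w ε` of a strictly
future directed family is possible near `z`. -/
structure Spacetime.BlendSetup (S : Spacetime n M) (p : M) (h : N × ℝ → M) (ρ : N × ℝ → ℝ)
    (w : ℝ → N × ℝ → EuclideanSpace ℝ (Fin n)) (z : N × ℝ) : Prop where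
  continuous : Continuous h
  mem_source : h z ∈ (extChartAt (𝓡 n) p).source
  strict : S.StrictAt h z
  continuous_cutoff : Continuous ρ
  nonneg : ∀ z, 0 ≤ ρ z
  le_one : ∀ z, ρ z ≤ 1
  lipschitz : ∃ Λ ≥ 0, ∃ O ∈ 𝓝 z, ∀ x t t', (x, t) ∈ O → (x, t') ∈ O → t < t' →
    |ρ (x, t') - ρ (x, t)| ≤ Λ * (t' - t)
  continuousAt : ∀ᶠ z' in 𝓝 z, ∀ ε > 0, ContinuousAt (w ε) z'
  close : ∀ η > 0, ∃ O ∈ 𝓝 z, ∀ᶠ ε in 𝓝[>] 0, ∀ z' ∈ O,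
    ‖w ε z' - extChartAt (𝓡 n) p (h z')‖ ≤ η
  slopes : ∀ K : Set (EuclideanSpace ℝ (Fin n)), Convex ℝ K → IsClosed K → ∀ O ∈ 𝓝 z,
    SlopesIn K (fun z' ↦ extChartAt (𝓡 n) p (h z')) O →
    ∃ O' ∈ 𝓝 z, ∀ᶠ ε in 𝓝[>] 0, SlopesIn K (w ε) O'

namespace Spacetime.BlendSetup

variable {S : Spacetime n M} {w : ℝ → N × ℝ → EuclideanSpace ℝ (Fin n)}

theorem exists_mem (H : S.BlendSetup p h ρ w z) {Y : Set 𝔼}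
    (hY : Y ∈ 𝓝 (extChartAt (𝓡 n) p (h z))) :
    ∃ O ∈ 𝓝 z, IsOpen O ∧ ∀ᶠ ε in 𝓝[>] 0, ∀ z' ∈ O, h z' ∈ (extChartAt (𝓡 n) p).source ∧
      extChartAt (𝓡 n) p (h z') + ρ z' • (w ε z' - extChartAt (𝓡 n) p (h z')) ∈ Y := by
  obtain ⟨η, hη, hηY⟩ := Metric.mem_nhds_iff.1 hY
  set φ := extChartAt (𝓡 n) p with hφ
  obtain ⟨O, hO, hw⟩ := H.close (η / 2) (by positivity)
  have hcφ : ContinuousAt (fun w ↦ φ (h w)) z :=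
    ContinuousAt.comp (continuousAt_extChartAt' H.mem_source) H.continuous.continuousAt
  have hO2 : {w | φ (h w) ∈ Metric.ball (φ (h z)) (η / 2) ∧ h w ∈ φ.source} ∈ 𝓝 z :=
    (hcφ.eventually (Metric.ball_mem_nhds _ (by positivity))).and
      (H.continuous.continuousAt.eventually ((isOpen_extChartAt_source _).mem_nhds H.mem_source))
  refine ⟨interior (O ∩ {w | φ (h w) ∈ Metric.ball (φ (h z)) (η / 2) ∧ h w ∈ φ.source}),
    interior_mem_nhds.2 (Filter.inter_mem hO hO2), isOpen_interior, ?_⟩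
  filter_upwards [hw] with ε hε z' hz'
  obtain ⟨h1, h2, h3⟩ := interior_subset hz'
  refine ⟨h3, hηY ?_⟩
  have h4 : ‖ρ z' • (w ε z' - φ (h z'))‖ ≤ η / 2 := by
    rw [norm_smul, Real.norm_of_nonneg (H.nonneg z')]
    calc ρ z' * ‖w ε z' - φ (h z')‖ ≤ 1 * (η / 2) :=
          mul_le_mul (H.le_one z') (hε z' h1) (norm_nonneg _) zero_le_one
      _ = η / 2 := one_mul _
  rw [mem_ball_iff_norm] at h2 ⊢
  have h5 : φ (h z') + ρ z' • (w ε z' - φ (h z')) - φ (h z) =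
    (φ (h z') - φ (h z)) + ρ z' • (w ε z' - φ (h z')) := by abel
  rw [h5]
  calc _ ≤ ‖φ (h z') - φ (h z)‖ + ‖ρ z' • (w ε z' - φ (h z'))‖ := norm_add_le _ _
    _ < η / 2 + η / 2 := by linarith
    _ = η := by ring

theorem exists_blend_mem (H : S.BlendSetup p h ρ w z) {W : Set M} (hW : W ∈ 𝓝 (h z)) :
    ∃ O ∈ 𝓝 z, ∀ᶠ ε in 𝓝[>] 0, ∀ z' ∈ O, blend p h ρ (w ε) z' ∈ W := by
  have h1 : (extChartAt (𝓡 n) p).symm ⁻¹' W ∈ 𝓝 (extChartAt (𝓡 n) p (h z)) := by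
    refine (continuousAt_extChartAt_symm' H.mem_source).preimage_mem_nhds ?_
    rwa [(extChartAt (𝓡 n) p).left_inv H.mem_source]
  obtain ⟨O, hO, -, h2⟩ := H.exists_mem h1
  refine ⟨O, hO, h2.mono fun ε hε z' hz' ↦ ?_⟩
  rw [blend_of_mem (hε z' hz').1]
  exact (hε z' hz').2

/-- Near `z`, the interpolated map is given by a formula in the chart. -/
theorem exists_target (H : S.BlendSetup p h ρ w z) :
    ∃ O ∈ 𝓝 z, IsOpen O ∧ ∀ᶠ ε in 𝓝[>] 0, ∀ z' ∈ O, h z' ∈ (extChartAt (𝓡 n) p).source ∧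
      extChartAt (𝓡 n) p (h z') + ρ z' • (w ε z' - extChartAt (𝓡 n) p (h z')) ∈
        (extChartAt (𝓡 n) p).target :=
  H.exists_mem ((isOpen_extChartAt_target p).mem_nhds ((extChartAt (𝓡 n) p).map_source H.mem_source))

theorem exists_continuousAt (H : S.BlendSetup p h ρ w z) :
    ∃ O ∈ 𝓝 z, ∀ᶠ ε in 𝓝[>] 0, ∀ z' ∈ O, ContinuousAt (blend p h ρ (w ε)) z' := by
  obtain ⟨O, hO, hOo, h1⟩ := H.exists_target
  refine ⟨O ∩ _, Filter.inter_mem hO H.continuousAt, ?_⟩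
  filter_upwards [h1, self_mem_nhdsWithin] with ε hε hε0 z' hz'
  have h2 := hε z' hz'.1
  have h3 : ContinuousAt (fun z ↦ extChartAt (𝓡 n) p (h z)) z' :=
    ContinuousAt.comp (continuousAt_extChartAt' h2.1) H.continuous.continuousAt
  have h4 : ContinuousAt (fun z' ↦ extChartAt (𝓡 n) p (h z') +
      ρ z' • (w ε z' - extChartAt (𝓡 n) p (h z'))) z' :=
    h3.add (H.continuous_cutoff.continuousAt.smul ((hz'.2 ε hε0).sub h3))
  have h5 := ContinuousAt.comp (g := (extChartAt (𝓡 n) p).symm) (f := fun z' ↦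
    extChartAt (𝓡 n) p (h z') + ρ z' • (w ε z' - extChartAt (𝓡 n) p (h z'))) (x := z')
    (continuousAt_extChartAt_symm'' h2.2) h4
  refine h5.congr ?_
  filter_upwards [hOo.mem_nhds hz'.1] with z'' hz''
  exact (blend_of_mem (hε z'' hz'').1).symm

/-- Up to one error, the difference quotients of the interpolation are convex combinations of those
of `h` and of `w ε`, all in `K`. The error is the quotient of the cutoff, at most `Λ`, times the
distance of `w ε` from `h`, at most `ε₁ / (Λ + 1)`; a thickening of `K` absorbs it. -/
theorem exists_strictAt (H : S.BlendSetup p h ρ w z) :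
    ∃ O ∈ 𝓝 z, ∀ᶠ ε in 𝓝[>] 0, ∀ z' ∈ O, S.StrictAt (blend p h ρ (w ε)) z' := by
  set φ := extChartAt (𝓡 n) p with hφ
  obtain ⟨K, hK, hKc, hKs, O₁, hO₁, hsl⟩ := H.strict.strictIn H.continuous.continuousAt H.mem_source
  obtain ⟨ε₁, hε₁, Y, hY, hYK⟩ := S.exists_nhds_cthickening_cone p (φ.map_source H.mem_source) hK hKs
  obtain ⟨Λ, hΛ, O₂, hO₂, hlip⟩ := H.lipschitz
  obtain ⟨O₃, hO₃, hclose⟩ := H.close (ε₁ / (Λ + 1)) (by positivity)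
  obtain ⟨O₄, hO₄, hslw⟩ := H.slopes K hKc hK.isClosed O₁ hO₁ (hsl.mono subset_rfl (by simp))
  obtain ⟨O₅, hO₅, -, hmem⟩ := H.exists_mem (Filter.inter_mem hY
    ((isOpen_extChartAt_target p).mem_nhds (φ.map_source H.mem_source)))
  obtain ⟨O₆, hO₆, hcont⟩ := H.exists_continuousAt
  set O := interior (O₁ ∩ O₂ ∩ O₃ ∩ O₄ ∩ O₅ ∩ O₆) with hOdef
  have hO : O ∈ 𝓝 z := interior_mem_nhds.2 (by
    simp only [Filter.inter_mem_iff]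
    exact ⟨⟨⟨⟨⟨hO₁, hO₂⟩, hO₃⟩, hO₄⟩, hO₅⟩, hO₆⟩)
  refine ⟨O, hO, ?_⟩
  filter_upwards [hclose, hslw, hmem, hcont] with ε h1 h2 h3 h4 z' hz'
  have hval : ∀ z ∈ O, φ (blend p h ρ (w ε) z) = φ (h z) + ρ z • (w ε z - φ (h z)) := by
    intro z hz
    have h5 := h3 z (interior_subset hz).1.2
    rw [blend_of_mem h5.1, φ.right_inv h5.2.2]
  have hz5 := h3 z' (interior_subset hz').1.2
  refine StrictIn.strictAt (p₀ := p) ⟨Metric.cthickening ε₁ K, hK.cthickening, hKc.cthickening ε₁, ?_, O,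
    isOpen_interior.mem_nhds hz', ?_⟩ (h4 z' (interior_subset hz').2) ?_
  · rw [← hφ, hval z' hz']
    exact hYK _ hz5.2.1
  · rintro x t t' ⟨-, hx⟩ ⟨-, hx'⟩ htt
    have htt' : 0 < t' - t := sub_pos.2 htt
    have hxi := interior_subset hx
    have hxi' := interior_subset hx'
    obtain ⟨v₁, hv₁, hf₁⟩ := hsl x t t' ⟨mem_univ _, hxi.1.1.1.1.1⟩ ⟨mem_univ _, hxi'.1.1.1.1.1⟩ htt
    obtain ⟨v₂, hv₂, hf₂⟩ := h2 x t t' hxi.1.1.2 hxi'.1.1.2 htt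
    change φ (h (x, t')) - φ (h (x, t)) = _ at hf₁
    have hl := hlip x t t' hxi.1.1.1.1.2 hxi'.1.1.1.1.2 htt
    have hcl := h1 (x, t) hxi.1.1.1.2
    simp only [← hφ, hval _ hx, hval _ hx']
    have hconv : (1 - ρ (x, t')) • v₁ + ρ (x, t') • v₂ ∈ K :=
      hKc hv₁ hv₂ (sub_nonneg.2 (H.le_one _)) (H.nonneg _) (by ring)
    set e : 𝔼 := (ρ (x, t') - ρ (x, t)) • (w ε (x, t) - φ (h (x, t))) with he
    have hen : ‖e‖ ≤ ε₁ * (t' - t) := by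
      rw [he, norm_smul, Real.norm_eq_abs]
      calc |ρ (x, t') - ρ (x, t)| * ‖w ε (x, t) - φ (h (x, t))‖
          ≤ (Λ * (t' - t)) * (ε₁ / (Λ + 1)) := by gcongr
        _ = ε₁ * (t' - t) * (Λ / (Λ + 1)) := by ring
        _ ≤ ε₁ * (t' - t) * 1 := by
            gcongr
            rw [div_le_one (by positivity)]
            linarith
        _ = _ := mul_one _
    refine ⟨((1 - ρ (x, t')) • v₁ + ρ (x, t') • v₂) + (t' - t)⁻¹ • e,
      Metric.mem_cthickening_of_dist_le _ _ ε₁ _ hconv ?_, ?_⟩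
    · rw [dist_eq_norm, add_sub_cancel_left, norm_smul, norm_inv, Real.norm_of_nonneg htt'.le,
        inv_mul_le_iff₀ htt']
      linarith
    · rw [smul_add, smul_inv_smul₀ htt'.ne', smul_add, smul_comm _ (1 - ρ (x, t')),
        smul_comm _ (ρ (x, t')), ← hf₁, ← hf₂, he]
      module
  · rw [blend_of_mem hz5.1]
    exact φ.map_target hz5.2.2

end Spacetime.BlendSetup

end Blending

/-! ### Mollifications converge and preserve slopes -/

section Mollifiers

open scoped Pointwise

variable {E F : Type*} [NormedAddCommGroup E] [NormedSpace ℝ E] [FiniteDimensional ℝ E]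
  [MeasurableSpace E] [BorelSpace E] [NormedAddCommGroup F] [NormedSpace ℝ F] [CompleteSpace F]

/-- Averages stay in closed convex sets. Applied to closed balls around `u q` this gives locally
uniform closeness, applied to `(t' - t) • K` it gives the statement on slopes. -/
theorem exists_mollifiers {A : Set (E × ℝ)} (hA : IsCompact A) {u : E × ℝ → F}
    (hu : ContinuousOn u A) :
    ∃ V : ℝ → E × ℝ → F, (∀ ε > 0, ContDiff ℝ ∞ (V ε)) ∧
      (∀ q ∈ interior A, ∀ η > 0, ∃ O ∈ 𝓝 q, ∀ᶠ ε in 𝓝[>] 0, ∀ q' ∈ O, ‖V ε q' - u q‖ ≤ η) ∧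
      ∀ q ∈ interior A, ∀ K : Set F, Convex ℝ K → IsClosed K → ∀ O ∈ 𝓝 q, SlopesIn K u O →
        ∃ O' ∈ 𝓝 q, ∀ᶠ ε in 𝓝[>] 0, SlopesIn K (V ε) O' := by
  have h := fun ε : {ε : ℝ // 0 < ε} ↦ exists_mollification hA hu ε.2
  choose V hV using h
  have key : ∀ q : E × ℝ, ∀ O ∈ 𝓝 q, ∃ r > 0, ∀ q' ∈ Metric.ball q r, ∀ ε < r, ∀ ξ ∈ Metric.ball 0 ε,
      q' - ξ ∈ O := by
    intro q O hO
    obtain ⟨r, hr, hrO⟩ := Metric.mem_nhds_iff.1 hO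
    refine ⟨r / 2, by positivity, fun q' hq' ε hε ξ hξ ↦ hrO ?_⟩
    rw [mem_ball_iff_norm] at hq' ⊢
    rw [mem_ball_zero_iff] at hξ
    have h1 : q' - ξ - q = (q' - q) - ξ := by abel
    rw [h1]
    linarith [norm_sub_le (q' - q) ξ]
  have hball : ∀ (q' : E × ℝ) (ε : ℝ) (O : Set (E × ℝ)), (∀ ξ ∈ Metric.ball (0 : E × ℝ) ε, q' - ξ ∈ O) →
      Metric.ball q' ε ⊆ O := by
    intro q' ε O h y hy
    have h1 := h (q' - y) (by rw [mem_ball_zero_iff, norm_sub_rev]; exact mem_ball_iff_norm.1 hy)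
    rwa [sub_sub_cancel] at h1
  refine ⟨fun ε ↦ if hε : 0 < ε then V ⟨ε, hε⟩ else 0, fun ε hε ↦ ?_, fun q hq η hη ↦ ?_,
    fun q hq K hK hKc O hO hs ↦ ?_⟩
  · simp only [dif_pos hε]
    exact (hV ⟨ε, hε⟩).1
  · have hc : ContinuousAt u q := hu.continuousAt (mem_interior_iff_mem_nhds.1 hq)
    obtain ⟨r, hr, h1⟩ := key q _ (Filter.inter_mem (mem_interior_iff_mem_nhds.1 hq)
      (hc.preimage_mem_nhds (Metric.closedBall_mem_nhds (u q) hη)))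
    refine ⟨_, Metric.ball_mem_nhds q hr, ?_⟩
    filter_upwards [Ioo_mem_nhdsGT hr] with ε hε q' hq'
    simp only [dif_pos hε.1]
    have h2 := h1 q' hq' ε hε.2
    have h3 := (hV ⟨ε, hε.1⟩).2.1 q' (hball q' ε A fun ξ hξ ↦ (h2 ξ hξ).1) _
      (convex_closedBall (u q) η) Metric.isClosed_closedBall fun ξ hξ ↦ (h2 ξ hξ).2
    exact mem_closedBall_iff_norm.1 h3
  · obtain ⟨r, hr, h1⟩ := key q _ (Filter.inter_mem (mem_interior_iff_mem_nhds.1 hq) hO)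
    refine ⟨_, Metric.ball_mem_nhds q hr, ?_⟩
    filter_upwards [Ioo_mem_nhdsGT hr] with ε hε x t t' ht ht' htt
    simp only [dif_pos hε.1]
    have h2 := h1 _ ht ε hε.2
    have h3 := h1 _ ht' ε hε.2
    have htt' : 0 < t' - t := sub_pos.2 htt
    have h4 := (hV ⟨ε, hε.1⟩).2.2 (x, t) (x, t') (hball _ ε A fun ξ hξ ↦ (h2 ξ hξ).1)
      (hball _ ε A fun ξ hξ ↦ (h3 ξ hξ).1) ((t' - t) • K) (hK.smul _)
      (hKc.smul_of_ne_zero htt'.ne') fun ξ hξ ↦ ?_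
    · obtain ⟨v, hv, hvf⟩ := h4
      exact ⟨v, hv, hvf.symm⟩
    · obtain ⟨v, hv, hvf⟩ := hs (x - ξ.1) (t - ξ.2) (t' - ξ.2) (h2 ξ hξ).2 (h3 ξ hξ).2 (by linarith)
      rw [sub_sub_sub_cancel_right] at hvf
      exact ⟨v, hv, hvf.symm⟩

end Mollifiers

/-! ### Smoothing a strict family in a box -/

section Smoothing

variable {n : ℕ} {M : Type*} [TopologicalSpace M] [ChartedSpace (EuclideanSpace ℝ (Fin n)) M]
  [IsManifold (𝓡 n) ∞ M] {k : ℕ} {N : Type*} [TopologicalSpace N]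
  [ChartedSpace (EuclideanSpace ℝ (Fin k)) N] [IsManifold (𝓡 k) ∞ N]

local notation "𝔼" => EuclideanSpace ℝ (Fin n)

namespace Spacetime

variable (k) in
/-- The data for smoothing a strictly future directed family over the product of a coordinate
domain of `N` and a time interval. -/
structure BoxSetup (S : Spacetime n M) (𝒱 : Set ((N × ℝ) × M)) (h₀ : N → M) (h : N × ℝ → M)
    (c : N) (f : N → ℝ) (p : M) (τ δ : ℝ) (χ : ℝ → ℝ) : Prop where
  family : S.StrictFamily 𝒱 h₀ h
  contMDiff : ContMDiff (𝓡 k) 𝓘(ℝ, ℝ) ∞ f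
  nonneg : ∀ x, 0 ≤ f x
  le_one : ∀ x, f x ≤ 1
  isCompact : IsCompact (tsupport f)
  subset_source : tsupport f ⊆ (extChartAt (𝓡 k) c).source
  contDiff : ContDiff ℝ ∞ χ
  periodic : ∀ t, χ (t + 1) = χ t
  nonneg' : ∀ t, 0 ≤ χ t
  le_one' : ∀ t, χ t ≤ 1
  window : ∀ t ∈ tsupport χ, ∃ m : ℤ, |t - m - τ| < δ
  lt_half : δ < 1 / 2
  mem : ∀ x ∈ tsupport f, ∀ t ∈ Icc (τ - δ) (τ + δ), h (x, t) ∈ (extChartAt (𝓡 n) p).source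
  int : ∀ m : ℤ, |m - τ| < δ → m = 0
  contMDiff_zero : ContMDiff (𝓡 k) (𝓡 n) ∞ h₀

open Classical in
/-- The smooth approximation, in the chart around `p`, with values prescribed at time `0`. -/
noncomputable def boxApprox (h₀ : N → M) (c : N) (p : M) (τ δ : ℝ)
    (V : ℝ → EuclideanSpace ℝ (Fin k) × ℝ → EuclideanSpace ℝ (Fin n)) (ε : ℝ) (z : N × ℝ) :
    EuclideanSpace ℝ (Fin n) :=
  V ε (extChartAt (𝓡 k) c z.1, z.2 - round (z.2 - τ)) +
    if |τ| < δ then extChartAt (𝓡 n) p (h₀ z.1) - V ε (extChartAt (𝓡 k) c z.1, 0) else 0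

/-- Subtracting `round (t - τ)` moves `t` into the period centred at `τ`. Inside the windows this is
subtraction of a locally constant integer, so periodic continuation costs no smoothness. -/
theorem sub_round_eq {τ t : ℝ} {m : ℤ} (h : |t - m - τ| < 1 / 2) : t - round (t - τ) = t - m := by
  have h1 : round (t - τ) = m := by
    rw [abs_lt] at h
    rw [round_eq, Int.floor_eq_iff]
    constructor <;> linarith
  rw [h1]

namespace BoxSetup

variable {S : Spacetime n M} {𝒱 : Set ((N × ℝ) × M)} {h₀ : N → M} {h : N × ℝ → M} {c : N} {f : N → ℝ}
  {p : M} {τ δ : ℝ} {χ : ℝ → ℝ}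
  {V : ℝ → EuclideanSpace ℝ (Fin k) × ℝ → EuclideanSpace ℝ (Fin n)}

omit [IsManifold (𝓡 k) ∞ N] in
theorem mem_source (H : S.BoxSetup k 𝒱 h₀ h c f p τ δ χ) {z : N × ℝ} (hx : z.1 ∈ tsupport f)
    (ht : z.2 ∈ tsupport χ) : h z ∈ (extChartAt (𝓡 n) p).source := by
  obtain ⟨m, hm⟩ := H.window _ ht
  have h1 := (show Function.Periodic (fun t ↦ h (z.1, t)) 1 from fun t ↦ H.family.periodic z.1 t).sub_int_mul_eq
    (x := z.2) m
  simp only [mul_one] at h1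
  have h2 : h z = h (z.1, z.2 - m) := h1.symm
  rw [h2]
  rw [abs_lt] at hm
  exact H.mem _ hx _ ⟨by linarith, by linarith⟩

omit [IsManifold (𝓡 k) ∞ N] in
/-- The smooth approximations can be used for interpolation at all points of the box. -/
theorem exists_blendSetup (H : S.BoxSetup k 𝒱 h₀ h c f p τ δ χ) :
    ∃ V : ℝ → EuclideanSpace ℝ (Fin k) × ℝ → EuclideanSpace ℝ (Fin n),
      (∀ ε > 0, ContDiff ℝ ∞ (V ε)) ∧
      ∀ z : N × ℝ, z.1 ∈ tsupport f → z.2 ∈ tsupport χ →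
        S.BlendSetup p h (fun z ↦ f z.1 * χ z.2) (boxApprox h₀ c p τ δ V) z := by
  set φ := extChartAt (𝓡 n) p with hφ
  set κ := extChartAt (𝓡 k) c with hκ
  set Ω : Set (EuclideanSpace ℝ (Fin k) × ℝ) := (κ.target ×ˢ univ) ∩
    (fun q ↦ h (κ.symm q.1, q.2)) ⁻¹' φ.source with hΩ
  have hc1 : ContinuousOn (fun q : EuclideanSpace ℝ (Fin k) × ℝ ↦ h (κ.symm q.1, q.2))
      (κ.target ×ˢ univ) := by
    refine H.family.continuous.comp_continuousOn (ContinuousOn.prodMk ?_ continuous_snd.continuousOn)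
    exact (continuousOn_extChartAt_symm c).comp continuous_fst.continuousOn fun q hq ↦ hq.1
  have hΩo : IsOpen Ω := hc1.isOpen_inter_preimage
    ((isOpen_extChartAt_target c).prod isOpen_univ) (isOpen_extChartAt_source p)
  have hQ : IsCompact ((κ '' tsupport f) ×ˢ Icc (τ - δ) (τ + δ)) :=
    (H.isCompact.image_of_continuousOn ((continuousOn_extChartAt c).mono H.subset_source)).prod
      isCompact_Icc
  have hQΩ : (κ '' tsupport f) ×ˢ Icc (τ - δ) (τ + δ) ⊆ Ω := by
    rintro ⟨y, t⟩ ⟨⟨x, hx, hxy⟩, ht⟩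
    simp only at hxy ht
    subst hxy
    refine ⟨⟨κ.map_source (H.subset_source hx), mem_univ _⟩, ?_⟩
    simp only [mem_preimage, κ.left_inv (H.subset_source hx)]
    exact H.mem x hx t ht
  -- A slightly larger compact set: points of the box become interior points, which leaves room for
  -- averaging.
  obtain ⟨A, hA, hQA, hAΩ⟩ := exists_compact_between hQ hΩo hQΩ
  set u : EuclideanSpace ℝ (Fin k) × ℝ → 𝔼 := fun q ↦ φ (h (κ.symm q.1, q.2)) with hu
  have huc : ContinuousOn u A :=
    (continuousOn_extChartAt p).comp (hc1.mono (hAΩ.trans inter_subset_left)) fun q hq ↦ (hAΩ hq).2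
  obtain ⟨V, hVs, hVc, hVk⟩ := exists_mollifiers hA huc
  refine ⟨V, hVs, fun z hzf hzχ ↦ ?_⟩
  obtain ⟨m, hm⟩ := H.window _ hzχ
  have hzs : z.1 ∈ κ.source := H.subset_source hzf
  have hper : ∀ x t, h (x, t - m) = h (x, t) := by
    intro x t
    have h1 := (show Function.Periodic (fun t ↦ h (x, t)) 1 from
      fun t ↦ H.family.periodic x t).sub_int_mul_eq (x := t) m
    simpa only [mul_one] using h1
  have hround : ∀ᶠ z' : N × ℝ in 𝓝 z, z'.2 - round (z'.2 - τ) = z'.2 - m := by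
    have h1 : Continuous fun z' : N × ℝ ↦ |z'.2 - m - τ| := by fun_prop
    filter_upwards [h1.continuousAt.eventually (Iio_mem_nhds (hm.trans H.lt_half))] with z' hz'
    exact sub_round_eq hz'
  have hsrc : ∀ᶠ z' : N × ℝ in 𝓝 z, z'.1 ∈ κ.source :=
    continuous_fst.continuousAt.eventually ((isOpen_extChartAt_source c).mem_nhds hzs)
  have hq0 : ∀ t ∈ Icc (τ - δ) (τ + δ), (κ z.1, t) ∈ interior A := fun t ht ↦
    hQA ⟨⟨z.1, hzf, rfl⟩, ht⟩
  have hq1 : (κ z.1, z.2 - m) ∈ interior A := by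
    rw [abs_lt] at hm
    exact hq0 _ ⟨by linarith, by linarith⟩
  have hθ : ContinuousAt (fun z' : N × ℝ ↦ (κ z'.1, z'.2 - m)) z := by
    refine ContinuousAt.prodMk ?_ (by fun_prop)
    exact ContinuousAt.comp (f := fun z' : N × ℝ ↦ z'.1) (continuousAt_extChartAt' hzs)
      continuous_fst.continuousAt
  have hθ0 : ContinuousAt (fun z' : N × ℝ ↦ (κ z'.1, (0 : ℝ))) z := by
    refine ContinuousAt.prodMk ?_ continuousAt_const
    exact ContinuousAt.comp (f := fun z' : N × ℝ ↦ z'.1) (continuousAt_extChartAt' hzs)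
      continuous_fst.continuousAt
  have hzero : |τ| < δ → h₀ z.1 ∈ φ.source := by
    intro h1
    rw [← H.family.zero]
    rw [abs_lt] at h1
    exact H.mem _ hzf _ ⟨by linarith, by linarith⟩
  have hcz : ContinuousAt (fun z' ↦ φ (h z')) z :=
    ContinuousAt.comp (continuousAt_extChartAt' (H.mem_source hzf hzχ))
      H.family.continuous.continuousAt
  have hc0 : ∀ {z' : N × ℝ}, h₀ z'.1 ∈ φ.source →
      ContinuousAt (fun z' : N × ℝ ↦ φ (h₀ z'.1)) z' := by
    intro z' hz'
    exact ContinuousAt.comp (f := fun z' : N × ℝ ↦ h₀ z'.1) (continuousAt_extChartAt' hz')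
      (H.contMDiff_zero.continuous.comp continuous_fst).continuousAt
  refine ⟨H.family.continuous, H.mem_source hzf hzχ, H.family.strict z, ?_, ?_, ?_, ?_, ?_, ?_, ?_⟩
  · exact (H.contMDiff.continuous.comp continuous_fst).mul (H.contDiff.continuous.comp continuous_snd)
  · exact fun z ↦ mul_nonneg (H.nonneg _) (H.nonneg' _)
  · exact fun z ↦ mul_le_one₀ (H.le_one _) (H.nonneg' _) (H.le_one' _)
  · obtain ⟨Λ, s, hs, hl⟩ := (H.contDiff.contDiffAt (x := z.2)).of_le (m := 1) (by simp)
      |>.exists_lipschitzOnWith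
    refine ⟨Λ, Λ.2, (fun z' : N × ℝ ↦ z'.2) ⁻¹' s, continuous_snd.continuousAt.preimage_mem_nhds hs,
      fun x t t' h1 h2 h3 ↦ ?_⟩
    have h4 := hl.dist_le_mul t' h2 t h1
    rw [Real.dist_eq, Real.dist_eq, abs_of_pos (sub_pos.2 h3)] at h4
    simp only [← mul_sub, abs_mul, abs_of_nonneg (H.nonneg x)]
    calc f x * |χ t' - χ t| ≤ 1 * |χ t' - χ t| :=
          mul_le_mul_of_nonneg_right (H.le_one x) (abs_nonneg _)
      _ ≤ _ := by rw [one_mul]; exact h4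
  · have h1 : ∀ᶠ z' : N × ℝ in 𝓝 z, |τ| < δ → h₀ z'.1 ∈ φ.source := by
      by_cases hτ : |τ| < δ
      · have h2 : Continuous fun z' : N × ℝ ↦ h₀ z'.1 := H.contMDiff_zero.continuous.comp continuous_fst
        filter_upwards [h2.continuousAt.eventually ((isOpen_extChartAt_source p).mem_nhds (hzero hτ))]
          with z' hz' _
        exact hz'
      · exact Filter.Eventually.of_forall fun z' h ↦ absurd h hτ
    filter_upwards [hround.eventually_nhds, hsrc, h1] with z' hz1 hz2 hz3 ε hε
    have hκ' : ContinuousAt (fun z' : N × ℝ ↦ κ z'.1) z' :=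
      ContinuousAt.comp (f := fun z' : N × ℝ ↦ z'.1) (continuousAt_extChartAt' hz2)
        continuous_fst.continuousAt
    unfold boxApprox
    refine ContinuousAt.add ?_ ?_
    · have h2 : ContinuousAt (fun z' : N × ℝ ↦ V ε (κ z'.1, z'.2 - m)) z' :=
        ContinuousAt.comp (f := fun z' : N × ℝ ↦ (κ z'.1, z'.2 - m)) (hVs ε hε).continuous.continuousAt
          (hκ'.prodMk (by fun_prop))
      refine h2.congr ?_
      filter_upwards [hz1] with z'' hz''
      rw [hz'']
    · split_ifs with hτ
      · exact (hc0 (hz3 hτ)).sub (ContinuousAt.comp (f := fun z' : N × ℝ ↦ (κ z'.1, (0 : ℝ)))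
          (hVs ε hε).continuous.continuousAt (hκ'.prodMk continuousAt_const))
      · exact continuousAt_const
  · intro η hη
    obtain ⟨O₁, hO₁, h1⟩ := hVc _ hq1 (η / 4) (by positivity)
    have hu1 : u (κ z.1, z.2 - m) = φ (h z) := by
      simp only [hu, κ.left_inv hzs, hper]
    have hcl := hcz.eventually (Metric.closedBall_mem_nhds (φ (h z)) (by positivity : 0 < η / 4))
    by_cases hτ : |τ| < δ
    · obtain ⟨O₂, hO₂, h2⟩ := hVc (κ z.1, 0) (hq0 0 (by
        rw [abs_lt] at hτ; constructor <;> linarith)) (η / 4) (by positivity)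
      have hu2 : u (κ z.1, 0) = φ (h₀ z.1) := by
        simp only [hu, κ.left_inv hzs, H.family.zero]
      have hcl2 := (hc0 (hzero hτ)).eventually
        (Metric.closedBall_mem_nhds (φ (h₀ z.1)) (by positivity : 0 < η / 4))
      refine ⟨_, Filter.inter_mem (Filter.inter_mem hround (hθ.preimage_mem_nhds hO₁))
        (Filter.inter_mem (Filter.inter_mem (hθ0.preimage_mem_nhds hO₂) hcl) hcl2), ?_⟩
      filter_upwards [h1, h2] with ε hε1 hε2 z' hz'
      obtain ⟨⟨ha, hb⟩, ⟨hc, hd⟩, he⟩ := hz'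
      have e1 := hε1 _ hb
      have e2 := hε2 _ hc
      rw [hu1] at e1
      rw [hu2] at e2
      have e3 : ‖φ (h z') - φ (h z)‖ ≤ η / 4 := mem_closedBall_iff_norm.1 hd
      have e4 : ‖φ (h₀ z'.1) - φ (h₀ z.1)‖ ≤ η / 4 := mem_closedBall_iff_norm.1 he
      have ha' : z'.2 - round (z'.2 - τ) = z'.2 - m := ha
      unfold boxApprox
      rw [if_pos hτ, ha', ← hκ, ← hφ]
      have e5 : V ε (κ z'.1, z'.2 - m) + (φ (h₀ z'.1) - V ε (κ z'.1, 0)) - φ (h z') =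
        ((V ε (κ z'.1, z'.2 - m) - φ (h z)) - (φ (h z') - φ (h z))) +
        ((φ (h₀ z'.1) - φ (h₀ z.1)) - (V ε (κ z'.1, 0) - φ (h₀ z.1))) := by abel
      rw [e5]
      refine (norm_add_le _ _).trans ?_
      have e6 := norm_sub_le (V ε (κ z'.1, z'.2 - m) - φ (h z)) (φ (h z') - φ (h z))
      have e7 := norm_sub_le (φ (h₀ z'.1) - φ (h₀ z.1)) (V ε (κ z'.1, 0) - φ (h₀ z.1))
      linarith
    · refine ⟨_, Filter.inter_mem (Filter.inter_mem hround (hθ.preimage_mem_nhds hO₁)) hcl, ?_⟩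
      filter_upwards [h1] with ε hε1 z' hz'
      obtain ⟨⟨ha, hb⟩, hd⟩ := hz'
      have e1 := hε1 _ hb
      rw [hu1] at e1
      have e3 : ‖φ (h z') - φ (h z)‖ ≤ η / 4 := mem_closedBall_iff_norm.1 hd
      have ha' : z'.2 - round (z'.2 - τ) = z'.2 - m := ha
      unfold boxApprox
      rw [if_neg hτ, ha', ← hκ, ← hφ, add_zero]
      have e5 : V ε (κ z'.1, z'.2 - m) - φ (h z') =
        (V ε (κ z'.1, z'.2 - m) - φ (h z)) - (φ (h z') - φ (h z)) := by abel
      rw [e5]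
      refine (norm_sub_le _ _).trans ?_
      linarith
  -- The correction of the initial value only depends on `x`, so it cancels in differences in time.
  · intro K hK hKc O hO hs
    have hψ : ContinuousAt (fun q : EuclideanSpace ℝ (Fin k) × ℝ ↦ (κ.symm q.1, q.2 + m))
        (κ z.1, z.2 - m) := by
      refine ContinuousAt.prodMk ?_ (by fun_prop)
      exact ContinuousAt.comp (f := fun q : EuclideanSpace ℝ (Fin k) × ℝ ↦ q.1)
        (continuousAt_extChartAt_symm' hzs) continuous_fst.continuousAt
    have hψO := hψ.preimage_mem_nhds (t := O) (by
      simp only [κ.left_inv hzs, sub_add_cancel]; exact hO)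
    obtain ⟨O', hO', h1⟩ := hVk _ hq1 K hK hKc _ hψO (by
      intro x t t' ht ht' htt
      obtain ⟨v, hv, hvf⟩ := hs (κ.symm x) (t + m) (t' + m) ht ht' (by linarith)
      have e1 := hper (κ.symm x) (t + m)
      have e2 := hper (κ.symm x) (t' + m)
      rw [add_sub_cancel_right] at e1 e2
      refine ⟨v, hv, ?_⟩
      simp only [hu, e1, e2]
      rwa [add_sub_add_right_eq_sub] at hvf)
    refine ⟨_, Filter.inter_mem hround (hθ.preimage_mem_nhds hO'), ?_⟩
    filter_upwards [h1] with ε hε x t t' ht ht' htt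
    obtain ⟨v, hv, hvf⟩ := hε (κ x) (t - m) (t' - m) ht.2 ht'.2 (by linarith)
    have e1 : t - round (t - τ) = t - m := ht.1
    have e2 : t' - round (t' - τ) = t' - m := ht'.1
    refine ⟨v, hv, ?_⟩
    unfold boxApprox
    simp only [e1, e2, ← hκ, add_sub_add_right_eq_sub]
    rwa [sub_sub_sub_cancel_right] at hvf

omit [IsManifold (𝓡 n) ∞ M] [IsManifold (𝓡 k) ∞ N] in
theorem boxApprox_add_one (ε : ℝ) (x : N) (t : ℝ) :
    boxApprox h₀ c p τ δ V ε (x, t + 1) = boxApprox h₀ c p τ δ V ε (x, t) := by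
  have h1 : t + 1 - (round (t + 1 - τ) : ℝ) = t - round (t - τ) := by
    rw [add_sub_right_comm t 1 τ, round_add_one]
    push_cast
    ring
  unfold boxApprox
  simp only [h1]

omit [IsManifold (𝓡 k) ∞ N] in
-- If the cutoff vanishes at time 0, the old value is kept. Otherwise 0 lies in a window, which must
-- be the one with `m = 0`, so `|τ| < δ` and the correction makes the approximation exact at time 0.
theorem blend_zero (H : S.BoxSetup k 𝒱 h₀ h c f p τ δ χ) (ε : ℝ) (x : N) :
    blend p h (fun z ↦ f z.1 * χ z.2) (boxApprox h₀ c p τ δ V ε) (x, 0) = h₀ x := by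
  by_cases h0 : f x * χ 0 = 0
  · rw [blend_of_zero h0, H.family.zero]
  have hx : x ∈ tsupport f := subset_tsupport f (left_ne_zero_of_mul h0)
  have ht : (0 : ℝ) ∈ tsupport χ := subset_tsupport χ (right_ne_zero_of_mul h0)
  have hs := H.mem_source (z := (x, 0)) hx ht
  obtain ⟨m, hm⟩ := H.window _ ht
  have hm0 := H.int (-m) (by push_cast; rwa [zero_sub] at hm)
  have hm1 : m = 0 := by omega
  subst hm1
  have hτ : |τ| < δ := by simpa using hm
  have h1 : boxApprox h₀ c p τ δ V ε (x, 0) = extChartAt (𝓡 n) p (h₀ x) := by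
    have h2 := sub_round_eq (hm.trans H.lt_half)
    rw [Int.cast_zero, sub_zero] at h2
    unfold boxApprox
    rw [if_pos hτ]
    simp only [h2, add_sub_cancel]
  rw [blend_of_mem hs, h1, H.family.zero, sub_self, smul_zero, add_zero]
  rw [H.family.zero] at hs
  exact (extChartAt (𝓡 n) p).left_inv hs

theorem contMDiffAt_boxApprox (H : S.BoxSetup k 𝒱 h₀ h c f p τ δ χ) {ε : ℝ}
    (hV : ContDiff ℝ ∞ (V ε)) {z : N × ℝ} (hzf : z.1 ∈ tsupport f) (hzχ : z.2 ∈ tsupport χ) :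
    ContMDiffAt ((𝓡 k).prod 𝓘(ℝ, ℝ)) 𝓘(ℝ, EuclideanSpace ℝ (Fin n)) ∞
      (boxApprox h₀ c p τ δ V ε) z := by
  obtain ⟨m, hm⟩ := H.window _ hzχ
  have hzs : z.1 ∈ (chartAt (EuclideanSpace ℝ (Fin k)) c).source := by
    rw [← extChartAt_source (𝓡 k)]
    exact H.subset_source hzf
  have hround : ∀ᶠ z' : N × ℝ in 𝓝 z, z'.2 - round (z'.2 - τ) = z'.2 - m := by
    have h1 : Continuous fun z' : N × ℝ ↦ |z'.2 - m - τ| := by fun_prop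
    filter_upwards [h1.continuousAt.eventually (Iio_mem_nhds (hm.trans H.lt_half))] with z' hz'
    exact sub_round_eq hz'
  have hκ : ContMDiffAt ((𝓡 k).prod 𝓘(ℝ, ℝ)) 𝓘(ℝ, EuclideanSpace ℝ (Fin k)) ∞
      (fun z' : N × ℝ ↦ extChartAt (𝓡 k) c z'.1) z :=
    ContMDiffAt.comp (g := extChartAt (𝓡 k) c) (f := fun z' : N × ℝ ↦ z'.1) z
      (contMDiffAt_extChartAt' hzs) contMDiffAt_fst
  have hcomp : ∀ s : N × ℝ → ℝ, ContMDiffAt ((𝓡 k).prod 𝓘(ℝ, ℝ)) 𝓘(ℝ, ℝ) ∞ s z →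
      ContMDiffAt ((𝓡 k).prod 𝓘(ℝ, ℝ)) 𝓘(ℝ, EuclideanSpace ℝ (Fin n)) ∞
      (fun z' : N × ℝ ↦ V ε (extChartAt (𝓡 k) c z'.1, s z')) z := fun s hs ↦
    ContMDiffAt.comp (g := V ε) (f := fun z' : N × ℝ ↦ (extChartAt (𝓡 k) c z'.1, s z')) z
      hV.contMDiff.contMDiffAt (hκ.prodMk_space hs)
  have h1 : ContMDiffAt ((𝓡 k).prod 𝓘(ℝ, ℝ)) 𝓘(ℝ, EuclideanSpace ℝ (Fin n)) ∞
      (fun z' : N × ℝ ↦ V ε (extChartAt (𝓡 k) c z'.1, z'.2 - m)) z :=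
    hcomp _ (contMDiffAt_snd.sub contMDiffAt_const)
  have h2 : ContMDiffAt ((𝓡 k).prod 𝓘(ℝ, ℝ)) 𝓘(ℝ, EuclideanSpace ℝ (Fin n)) ∞
      (fun z' : N × ℝ ↦ V ε (extChartAt (𝓡 k) c z'.1, z'.2 - round (z'.2 - τ))) z := by
    refine h1.congr_of_eventuallyEq ?_
    filter_upwards [hround] with z' hz'
    rw [hz']
  unfold boxApprox
  refine h2.add ?_
  split_ifs with hτ
  · refine ContMDiffAt.sub ?_ (hcomp _ contMDiffAt_const)
    have h3 : h₀ z.1 ∈ (chartAt (EuclideanSpace ℝ (Fin n)) p).source := by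
      rw [← extChartAt_source (𝓡 n), ← H.family.zero]
      rw [abs_lt] at hτ
      exact H.mem _ hzf _ ⟨by linarith, by linarith⟩
    exact ContMDiffAt.comp (g := extChartAt (𝓡 n) p) (f := fun z' : N × ℝ ↦ h₀ z'.1) z
      (contMDiffAt_extChartAt' h3)
      (ContMDiffAt.comp (g := h₀) (f := fun z' : N × ℝ ↦ z'.1) z H.contMDiff_zero.contMDiffAt
        contMDiffAt_fst)
  · exact contMDiffAt_const

omit [IsManifold (𝓡 n) ∞ M] [IsManifold (𝓡 k) ∞ N] in
theorem _root_.contMDiffAt_sub_int_iff {h : N × ℝ → M} (hp : ∀ x t, h (x, t + 1) = h (x, t)) (x : N)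
    (t : ℝ) (m : ℤ) : ContMDiffAt ((𝓡 k).prod 𝓘(ℝ, ℝ)) (𝓡 n) ∞ h (x, t - m) ↔
      ContMDiffAt ((𝓡 k).prod 𝓘(ℝ, ℝ)) (𝓡 n) ∞ h (x, t) := by
  have key : ∀ (t : ℝ) (m : ℤ), ContMDiffAt ((𝓡 k).prod 𝓘(ℝ, ℝ)) (𝓡 n) ∞ h (x, t - m) →
      ContMDiffAt ((𝓡 k).prod 𝓘(ℝ, ℝ)) (𝓡 n) ∞ h (x, t) := by
    intro t m h1
    have h2 : ContMDiffAt ((𝓡 k).prod 𝓘(ℝ, ℝ)) ((𝓡 k).prod 𝓘(ℝ, ℝ)) ∞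
        (fun z : N × ℝ ↦ (z.1, z.2 - (m : ℝ))) (x, t) :=
      contMDiffAt_fst.prodMk (contMDiffAt_snd.sub contMDiffAt_const)
    have h3 := ContMDiffAt.comp (g := h) (f := fun z : N × ℝ ↦ (z.1, z.2 - (m : ℝ))) (x, t) h1 h2
    refine h3.congr_of_eventuallyEq (Filter.Eventually.of_forall fun z ↦ ?_)
    have h4 := (show Function.Periodic (fun t ↦ h (z.1, t)) 1 from
      fun t ↦ hp z.1 t).sub_int_mul_eq (x := z.2) m
    simp only [mul_one] at h4
    exact h4.symm
  refine ⟨key t m, fun h1 ↦ key (t - m) (-m) ?_⟩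
  push_cast
  rwa [sub_neg_eq_add, sub_add_cancel]

/-- A strictly future directed family can be made smooth in a box. -/
theorem exists_smooth (H : S.BoxSetup k 𝒱 h₀ h c f p τ δ χ) (h𝒱 : IsOpen 𝒱) :
    ∃ h' : N × ℝ → M, S.StrictFamily 𝒱 h₀ h' ∧ (∀ z, z.1 ∉ tsupport f → h' z = h z) ∧
      (∀ z, ContMDiffAt ((𝓡 k).prod 𝓘(ℝ, ℝ)) (𝓡 n) ∞ h z →
        ContMDiffAt ((𝓡 k).prod 𝓘(ℝ, ℝ)) (𝓡 n) ∞ h' z) ∧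
      ∀ z : N × ℝ, (∀ᶠ x in 𝓝 z.1, f x = 1) → (∀ᶠ t in 𝓝 z.2, χ t = 1) →
        ContMDiffAt ((𝓡 k).prod 𝓘(ℝ, ℝ)) (𝓡 n) ∞ h' z := by
  obtain ⟨V, hVs, hV⟩ := H.exists_blendSetup
  set φ := extChartAt (𝓡 n) p with hφ
  set ρ : N × ℝ → ℝ := fun z ↦ f z.1 * χ z.2 with hρ
  set W := boxApprox h₀ c p τ δ V with hW
  have hQ : IsCompact ((tsupport f) ×ˢ (tsupport χ ∩ Icc (-1) 1)) :=
    H.isCompact.prod (isCompact_Icc.inter_left (isClosed_tsupport χ))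
  -- Each point of the compact box has a neighbourhood on which small `ε` are good, so one `ε` is
  -- good everywhere. By periodicity the times in `[-1, 1]` suffice.
  have hfin : ∀ᶠ ε in 𝓝[>] 0, ∀ z ∈ (tsupport f) ×ˢ (tsupport χ ∩ Icc (-1) 1),
      S.StrictAt (blend p h ρ (W ε)) z ∧ ContinuousAt (blend p h ρ (W ε)) z ∧
      (z, blend p h ρ (W ε) z) ∈ 𝒱 ∧
      ∀ᶠ z' in 𝓝 z, h z' ∈ φ.source ∧ φ (h z') + ρ z' • (W ε z' - φ (h z')) ∈ φ.target := by
    refine hQ.induction_on (p := fun s ↦ ∀ᶠ ε : ℝ in 𝓝[>] 0, ∀ z ∈ s,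
      S.StrictAt (blend p h ρ (W ε)) z ∧ ContinuousAt (blend p h ρ (W ε)) z ∧
      (z, blend p h ρ (W ε) z) ∈ 𝒱 ∧
      ∀ᶠ z' in 𝓝 z, h z' ∈ φ.source ∧ φ (h z') + ρ z' • (W ε z' - φ (h z')) ∈ φ.target) (by simp)
      (fun s t hst h1 ↦ h1.mono fun ε hε z hz ↦ hε z (hst hz)) (fun s t h1 h2 ↦ ?_) ?_
    · filter_upwards [h1, h2] with ε ha hb z hz
      exact hz.elim (ha z) (hb z)
    · rintro z ⟨hzf, hzχ, hzI⟩
      have hB := hV z hzf hzχ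
      have hz𝒱 : (z, h z) ∈ 𝒱 := H.family.mem z.1 z.2 hzI
      obtain ⟨O, hO, W', hW', hOW⟩ := mem_nhds_prod_iff.1 (h𝒱.mem_nhds hz𝒱)
      obtain ⟨O₁, hO₁, h1⟩ := hB.exists_strictAt
      obtain ⟨O₂, hO₂, h2⟩ := hB.exists_continuousAt
      obtain ⟨O₃, hO₃, h3⟩ := hB.exists_blend_mem hW'
      obtain ⟨O₄, hO₄, hO₄o, h4⟩ := hB.exists_target
      refine ⟨_, mem_nhdsWithin_of_mem_nhds (Filter.inter_mem (Filter.inter_mem hO hO₁)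
        (Filter.inter_mem (Filter.inter_mem hO₂ hO₃) hO₄)), ?_⟩
      filter_upwards [h1, h2, h3, h4] with ε e1 e2 e3 e4 z' hz'
      obtain ⟨⟨ha, hb⟩, ⟨hc, hd⟩, he⟩ := hz'
      exact ⟨e1 _ hb, e2 _ hc, hOW ⟨ha, e3 _ hd⟩, Filter.eventually_of_mem (hO₄o.mem_nhds he) e4⟩
  obtain ⟨ε, hε, hε0⟩ := (hfin.and self_mem_nhdsWithin).exists
  set h' := blend p h ρ (W ε) with hh'
  have hper : ∀ x t, h' (x, t + 1) = h' (x, t) := by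
    intro x t
    have h1 : ρ (x, t + 1) = ρ (x, t) := by simp only [hρ, H.periodic]
    have h2 : W ε (x, t + 1) = W ε (x, t) := boxApprox_add_one _ _ _
    simp only [hh', blend, h1, h2, H.family.periodic]
  have hoff : ∀ z : N × ℝ, (z.1 ∉ tsupport f ∨ z.2 ∉ tsupport χ) → h' =ᶠ[𝓝 z] h := by
    rintro z (hz | hz)
    · filter_upwards [continuous_fst.continuousAt.eventually
        ((isClosed_tsupport f).isOpen_compl.mem_nhds hz)] with z' hz'
      refine blend_of_zero ?_
      simp only [hρ, image_eq_zero_of_notMem_tsupport hz', zero_mul]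
    · filter_upwards [continuous_snd.continuousAt.eventually
        ((isClosed_tsupport χ).isOpen_compl.mem_nhds hz)] with z' hz'
      refine blend_of_zero ?_
      simp only [hρ, image_eq_zero_of_notMem_tsupport hz', mul_zero]
  have hall : ∀ z : N × ℝ, z.2 ∈ Icc (-1 : ℝ) 1 →
      S.StrictAt h' z ∧ ContinuousAt h' z ∧ (z, h' z) ∈ 𝒱 := by
    intro z hz
    by_cases h1 : z.1 ∈ tsupport f ∧ z.2 ∈ tsupport χ
    · obtain ⟨e1, e2, e3, -⟩ := hε z ⟨h1.1, h1.2, hz⟩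
      exact ⟨e1, e2, e3⟩
    · have h2 := hoff z (by tauto)
      refine ⟨(H.family.strict z).congr h2, H.family.continuous.continuousAt.congr h2.symm, ?_⟩
      rw [h2.eq_of_nhds]
      exact H.family.mem z.1 z.2 hz
  have hfract : ∀ t : ℝ, t - ⌊t⌋ ∈ Icc (-1 : ℝ) 1 := fun t ↦
    ⟨by linarith [Int.floor_le t], by linarith [Int.lt_floor_add_one t]⟩
  have hperi : ∀ x t (m : ℤ), h' (x, t - m) = h' (x, t) := by
    intro x t m
    have h1 := (show Function.Periodic (fun t ↦ h' (x, t)) 1 from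
      fun t ↦ hper x t).sub_int_mul_eq (x := t) m
    simpa only [mul_one] using h1
  refine ⟨h', ⟨?_, hper, ?_, ?_, ?_⟩, ?_, ?_⟩
  · rw [continuous_iff_continuousAt]
    rintro ⟨x, t⟩
    have h1 := (hall (x, t - ⌊t⌋) (hfract t)).2.1
    have h2 : Continuous fun z : N × ℝ ↦ (z.1, z.2 - (⌊t⌋ : ℝ)) := by fun_prop
    have h3 := ContinuousAt.comp (f := fun z : N × ℝ ↦ (z.1, z.2 - (⌊t⌋ : ℝ))) (x := (x, t)) h1
      h2.continuousAt
    exact h3.congr (Filter.Eventually.of_forall fun z ↦ hperi z.1 z.2 _)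
  · rintro ⟨x, t⟩
    have h1 := (hall (x, t - ⌊t⌋) (hfract t)).1
    have h2 := h1.add_const (c := (⌊t⌋ : ℝ)) fun x s ↦ by
      rw [← hperi x (s + ⌊t⌋) ⌊t⌋, add_sub_cancel_right]
    simpa only [sub_add_cancel] using h2
  · exact fun x ↦ H.blend_zero ε x
  · exact fun x t ht ↦ (hall (x, t) ht).2.2
  · exact fun z hz ↦ (hoff z (Or.inl hz)).eq_of_nhds
  have hform : ∀ z : N × ℝ, z.1 ∈ tsupport f → z.2 ∈ tsupport χ → z.2 ∈ Icc (-1 : ℝ) 1 →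
      ContMDiffAt ((𝓡 k).prod 𝓘(ℝ, ℝ)) 𝓘(ℝ, EuclideanSpace ℝ (Fin n)) ∞
        (fun z' ↦ φ (h z') + ρ z' • (W ε z' - φ (h z'))) z →
      ContMDiffAt ((𝓡 k).prod 𝓘(ℝ, ℝ)) (𝓡 n) ∞ h' z := by
    intro z h1 h2 h3 h4
    have h5 := (hε z ⟨h1, h2, h3⟩).2.2.2
    have h6 := ContMDiffAt.comp (g := φ.symm) (I' := 𝓘(ℝ, EuclideanSpace ℝ (Fin n)))
      (f := fun z' ↦ φ (h z') + ρ z' • (W ε z' - φ (h z'))) z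
      ((contMDiffOn_extChartAt_symm (I := 𝓡 n) (n := ∞) p).contMDiffAt
        ((isOpen_extChartAt_target p).mem_nhds h5.self_of_nhds.2)) h4
    refine h6.congr_of_eventuallyEq ?_
    filter_upwards [h5] with z' hz'
    exact blend_of_mem hz'.1
  have hρs : ContMDiff ((𝓡 k).prod 𝓘(ℝ, ℝ)) 𝓘(ℝ, ℝ) ∞ ρ :=
    (H.contMDiff.comp contMDiff_fst).mul (H.contDiff.contMDiff.comp contMDiff_snd)
  refine ⟨?_, ?_⟩
  · rintro ⟨x, t⟩ hz
    rw [← contMDiffAt_sub_int_iff hper x t ⌊t⌋]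
    rw [← contMDiffAt_sub_int_iff H.family.periodic x t ⌊t⌋] at hz
    by_cases h1 : x ∈ tsupport f ∧ t - ⌊t⌋ ∈ tsupport χ
    · refine hform _ h1.1 h1.2 (hfract t) ?_
      have h2 : h (x, t - ⌊t⌋) ∈ (chartAt (EuclideanSpace ℝ (Fin n)) p).source := by
        rw [← extChartAt_source (𝓡 n)]
        exact H.mem_source (z := (x, t - ⌊t⌋)) h1.1 h1.2
      have h3 := ContMDiffAt.comp (g := φ) (f := h) (x, t - ⌊t⌋) (contMDiffAt_extChartAt' h2) hz
      exact h3.add (hρs.contMDiffAt.smul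
        ((H.contMDiffAt_boxApprox (hVs ε hε0) h1.1 h1.2).sub h3))
    · exact hz.congr_of_eventuallyEq (hoff (x, t - ⌊t⌋) (by tauto))
  -- Where both cutoffs are 1 the formula reduces to the smooth approximation, so no smoothness of
  -- `h` is required.
  · rintro ⟨x, t⟩ hzf hzχ
    rw [← contMDiffAt_sub_int_iff hper x t ⌊t⌋]
    have h0 : ∀ᶠ t' in 𝓝 (t - ⌊t⌋), χ t' = 1 := by
      have h1 : Continuous fun s : ℝ ↦ s + ⌊t⌋ := by fun_prop
      have h2 := h1.continuousAt (x := t - ⌊t⌋)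
      rw [ContinuousAt, sub_add_cancel] at h2
      filter_upwards [h2.eventually hzχ] with s hs
      have h3 := (show Function.Periodic χ 1 from H.periodic).int_mul ⌊t⌋ s
      rw [mul_one] at h3
      rwa [h3] at hs
    have h1 : x ∈ tsupport f := subset_tsupport f (by simp [hzf.self_of_nhds])
    have h2 : t - ⌊t⌋ ∈ tsupport χ := subset_tsupport χ (by rw [mem_support, h0.self_of_nhds]; exact one_ne_zero)
    refine hform _ h1 h2 (hfract t) ?_
    refine (H.contMDiffAt_boxApprox (hVs ε hε0) h1 h2).congr_of_eventuallyEq ?_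
    filter_upwards [continuous_fst.continuousAt.eventually hzf,
      continuous_snd.continuousAt.eventually h0] with z' e1 e2
    simp only [hρ, e1, e2]
    module

end BoxSetup

end Spacetime

end Smoothing

/-! ### Infinitely many modifications, and periodic cutoffs -/

section LocallyFiniteLimits

/-- Infinitely many modifications over a locally finite family of sets have a limit. -/
theorem exists_limit_of_locallyFinite {Z Y ι : Type*} [TopologicalSpace Z] [Countable ι]
    {A K : ι → Set Z} (hA : LocallyFinite A) (hK : ∀ z, ∃ i, z ∈ K i) {P : (Z → Y) → Prop}
    {G : (Z → Y) → Z → Prop} {h₀ : Z → Y} (h0 : P h₀)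
    (step : ∀ i h, P h → ∃ h', P h' ∧ (∀ z ∉ A i, h' z = h z) ∧ (∀ z, G h z → G h' z) ∧
      ∀ z ∈ K i, G h' z)
    (lim : ∀ (h : ℕ → Z → Y) (g : Z → Y), (∀ i, P (h i)) →
      (∀ z, ∀ᶠ i in Filter.atTop, g =ᶠ[𝓝 z] h i) → P g)
    (congr : ∀ h g z, g =ᶠ[𝓝 z] h → G h z → G g z) : ∃ g, P g ∧ ∀ z, G g z := by
  classical
  obtain ⟨e, he⟩ := exists_injective_nat ι
  -- The indices are numbered by `e`; step `m` treats the index with number `m`, and does nothing if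
  -- there is none.
  have step' : ∀ (m : ℕ) (h : {h : Z → Y // P h}), ∃ h' : {h : Z → Y // P h},
      (∀ z, (∀ i, e i = m → z ∉ A i) → h'.1 z = h.1 z) ∧ (∀ z, G h.1 z → G h'.1 z) ∧
      ∀ i, e i = m → ∀ z ∈ K i, G h'.1 z := by
    rintro m ⟨h, hP⟩
    by_cases hm : ∃ i, e i = m
    · obtain ⟨i, hi⟩ := hm
      obtain ⟨h', h1, h2, h3, h4⟩ := step i h hP
      refine ⟨⟨h', h1⟩, fun z hz ↦ h2 z (hz i hi), h3, fun j hj ↦ ?_⟩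
      rw [he (hj.trans hi.symm)]
      exact h4
    · exact ⟨⟨h, hP⟩, fun _ _ ↦ rfl, fun _ h ↦ h, fun i hi ↦ absurd ⟨i, hi⟩ hm⟩
  choose F hF1 hF2 hF3 using step'
  set s : ℕ → {h : Z → Y // P h} := fun m ↦ Nat.rec ⟨h₀, h0⟩ (fun m h ↦ F m h) m with hs
  have hsucc : ∀ m, s (m + 1) = F m (s m) := fun m ↦ rfl
  -- Only finitely many of the sets `A i` meet `O`; beyond the largest of their numbers the maps no
  -- longer change on `O`.
  have hloc : ∀ z, ∃ m, ∃ O ∈ 𝓝 z, ∀ z' ∈ O, ∀ j ≥ m, (s j).1 z' = (s m).1 z' := by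
    intro z
    obtain ⟨O, hO, hfin⟩ := hA z
    obtain ⟨m, hm⟩ := (hfin.image e).bddAbove
    refine ⟨m + 1, O, hO, fun z' hz' j hj ↦ ?_⟩
    induction j, hj using Nat.le_induction with
    | base => rfl
    | succ j hj ih =>
      rw [hsucc, hF1, ih]
      intro i hi hz
      have h1 : e i ≤ m := hm ⟨i, ⟨z', hz, hz'⟩, rfl⟩
      omega
  choose m O hO hst using hloc
  set g : Z → Y := fun z ↦ (s (m z)).1 z with hg
  have hgs : ∀ z, ∀ j ≥ m z, g =ᶠ[𝓝 z] (s j).1 := by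
    intro z j hj
    filter_upwards [hO z] with z' hz'
    have h1 := hst z' z' (mem_of_mem_nhds (hO z')) (max j (m z')) (le_max_right _ _)
    have h2 := hst z z' hz' (max j (m z')) (hj.le.trans (le_max_left _ _))
    rw [hst z z' hz' j hj, ← h2, h1]
  refine ⟨g, lim (fun j ↦ (s j).1) g (fun j ↦ (s j).2) fun z ↦
    Filter.eventually_atTop.2 ⟨m z, hgs z⟩, fun z ↦ ?_⟩
  obtain ⟨i, hi⟩ := hK z
  have h1 : ∀ j ≥ e i + 1, G (s j).1 z := by
    intro j hj
    induction j, hj using Nat.le_induction with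
    | base => exact hF3 _ _ i rfl z hi
    | succ j hj ih => exact hF2 _ _ z ih
  exact congr _ _ z (hgs z (max (m z) (e i + 1)) (le_max_left _ _)) (h1 _ (le_max_right _ _))

/-- A smooth periodic cutoff function on the line. -/
theorem exists_periodic_bump (τ : ℝ) {δ' δ : ℝ} (hδ' : 0 < δ') (hlt : δ' < δ) (hδ : δ < 1 / 2) :
    ∃ χ : ℝ → ℝ, ContDiff ℝ ∞ χ ∧ (∀ t, χ (t + 1) = χ t) ∧ (∀ t, 0 ≤ χ t) ∧ (∀ t, χ t ≤ 1) ∧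
      (∀ t ∈ tsupport χ, ∃ m : ℤ, |t - m - τ| < δ) ∧
      ∀ (t : ℝ) (m : ℤ), |t - m - τ| ≤ δ' → χ t = 1 := by
  -- The cutoff is a smooth step in `cos (2π (t - τ))`, which decreases with the distance of `t`
  -- from `τ + ℤ`. Stopping at `δ₁ < δ` keeps the strict inequality even on the closed support.
  set δ₁ := (δ' + δ) / 2 with hδ₁
  have hπ := Real.pi_pos
  have hcos : Real.cos (2 * Real.pi * δ₁) < Real.cos (2 * Real.pi * δ') := by
    refine Real.strictAntiOn_cos ⟨by positivity, by nlinarith⟩ ⟨by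
      have : 0 < δ₁ := by linarith
      positivity, by nlinarith⟩ ?_
    have : δ' < δ₁ := by linarith
    gcongr
  have hpos := sub_pos.2 hcos
  have hper : ∀ (t : ℝ) (m : ℤ), Real.cos (2 * Real.pi * (t - τ)) = Real.cos (2 * Real.pi * |t - m - τ|) := by
    intro t m
    have h1 : Real.cos (2 * Real.pi * |t - m - τ|) = Real.cos (2 * Real.pi * (t - m - τ)) := by
      rw [← Real.cos_abs (2 * Real.pi * (t - m - τ)), abs_mul, abs_of_pos (by positivity : 0 < 2 * Real.pi)]
    rw [h1, ← Real.cos_sub_int_mul_two_pi _ m]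
    congr 1
    ring
  set χ : ℝ → ℝ := fun t ↦ Real.smoothTransition ((Real.cos (2 * Real.pi * (t - τ)) -
    Real.cos (2 * Real.pi * δ₁)) / (Real.cos (2 * Real.pi * δ') - Real.cos (2 * Real.pi * δ₁))) with hχ
  refine ⟨χ, ?_, fun t ↦ ?_, fun t ↦ Real.smoothTransition.nonneg _, fun t ↦ Real.smoothTransition.le_one _,
    fun t ht ↦ ?_, fun t m ht ↦ ?_⟩
  · refine Real.smoothTransition.contDiff.comp (ContDiff.div_const (ContDiff.sub ?_ contDiff_const) _)
    exact Real.contDiff_cos.comp (contDiff_const.mul (contDiff_id.sub contDiff_const))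
  · have h1 : Real.cos (2 * Real.pi * (t + 1 - τ)) = Real.cos (2 * Real.pi * (t - τ)) := by
      rw [← Real.cos_add_two_pi (2 * Real.pi * (t - τ))]
      congr 1
      ring
    simp only [hχ, h1]
  · have hcl : IsClosed {t : ℝ | Real.cos (2 * Real.pi * δ₁) ≤ Real.cos (2 * Real.pi * (t - τ))} :=
      isClosed_le (by fun_prop) (by fun_prop)
    have hsub : tsupport χ ⊆ {t : ℝ | Real.cos (2 * Real.pi * δ₁) ≤ Real.cos (2 * Real.pi * (t - τ))} := by
      refine closure_minimal (fun s hs ↦ ?_) hcl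
      by_contra hlt'
      exact hs (Real.smoothTransition.zero_of_nonpos (div_nonpos_of_nonpos_of_nonneg
        (sub_nonpos.2 (not_le.1 hlt').le) hpos.le))
    have h1 : Real.cos (2 * Real.pi * δ₁) ≤ Real.cos (2 * Real.pi * (t - τ)) := hsub ht
    refine ⟨round (t - τ), ?_⟩
    rw [hper t (round (t - τ))] at h1
    have h2 : |t - round (t - τ) - τ| ≤ 1 / 2 := by
      have := abs_sub_round (t - τ)
      rwa [sub_right_comm] at this
    by_contra h3
    have h4 : δ₁ < |t - round (t - τ) - τ| := by linarith
    refine absurd h1 (not_le.2 (Real.strictAntiOn_cos ⟨by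
        have : 0 < δ₁ := by linarith
        positivity, by nlinarith⟩
      ⟨by positivity, by nlinarith⟩ ?_))
    gcongr
  · refine Real.smoothTransition.one_of_one_le ?_
    rw [one_le_div hpos]
    refine sub_le_sub_right ?_ _
    rw [hper t m]
    refine Real.strictAntiOn_cos.antitoneOn ⟨by positivity, by nlinarith⟩
      ⟨by positivity, by nlinarith⟩ ?_
    gcongr

end LocallyFiniteLimits

/-! ### Covering a curve by chart balls with chords -/

section Tubes

variable {n : ℕ} {M : Type*} [TopologicalSpace M] [ChartedSpace (EuclideanSpace ℝ (Fin n)) M]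
  [IsManifold (𝓡 n) ∞ M] {N : Type*} [TopologicalSpace N]

local notation "𝔼" => EuclideanSpace ℝ (Fin n)

/-- The points which are mapped by the chart around `p` into the ball of radius `r`. -/
def chartBall (n : ℕ) {M : Type*} [TopologicalSpace M] [ChartedSpace (EuclideanSpace ℝ (Fin n)) M]
    (p : M) (r : ℝ) : Set M :=
  (extChartAt (𝓡 n) p).source ∩ extChartAt (𝓡 n) p ⁻¹' Metric.ball (extChartAt (𝓡 n) p p) r

omit [IsManifold (𝓡 n) ∞ M] in
theorem isOpen_chartBall (p : M) (r : ℝ) : IsOpen (chartBall n p r) :=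
  (continuousOn_extChartAt p).isOpen_inter_preimage (isOpen_extChartAt_source p) Metric.isOpen_ball

namespace Spacetime

/-- Over `O`, the curves of the family `h` run through the chart balls around `p 0, …, p (L - 1)`, in
which there are systems of chords. -/
structure Tube (S : Spacetime n M) (h : N × ℝ → M) (O : Set N) (U : ℕ → Set M) (p : ℕ → M) (r C : ℕ → ℝ)
    (ch a : ℕ → EuclideanSpace ℝ (Fin n) → EuclideanSpace ℝ (Fin n) → ℝ → EuclideanSpace ℝ (Fin n))
    (L : ℕ) : Prop where
  three_le : 3 ≤ L
  convexNormal : ∀ j, S.IsConvexNormal (U j)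
  chord : ∀ j, S.ChordSystem (U j) (p j) (r j) (C j) (ch j) (a j)
  mem : ∀ x ∈ O, ∀ j < L, ∀ t ∈ Icc (((j : ℝ) - 1) / L) ((j + 1) / L), h (x, t) ∈ chartBall n (p j) (r j)

/-- A Lebesgue number for the cover of the curve over `x₀` by chart balls determines `L`;
compactness of the time intervals extends the inclusions to nearby `x`. The intervals overlap, with
length `2 / L`, to leave room for cutoffs in time. -/
theorem exists_tube {S : Spacetime n M} {h : N × ℝ → M} (hc : Continuous h)
    (hS : ∀ q : M, ∃ U, S.IsConvexNormal U ∧ q ∈ U) (x₀ : N) :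
    ∃ O ∈ 𝓝 x₀, ∃ U p r C ch a L, S.Tube h O U p r C ch a L := by
  choose U hU hqU using hS
  have hex := fun q ↦ (hU q).exists_chordSystem (hqU q)
  choose r C ch a hch using hex
  have hcx : Continuous fun t ↦ h (x₀, t) := by fun_prop
  obtain ⟨δ, hδ, hleb⟩ := lebesgue_number_lemma_of_metric (isCompact_Icc (a := (-1 : ℝ)) (b := 1))
    (c := fun q : M ↦ (fun t ↦ h (x₀, t)) ⁻¹' chartBall n q (r q))
    (fun q ↦ (isOpen_chartBall q (r q)).preimage hcx)
    (fun t _ ↦ mem_iUnion.2 ⟨h (x₀, t), mem_extChartAt_source _, Metric.mem_ball_self (hch _).pos⟩)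
  obtain ⟨L₀, hL₀⟩ := exists_nat_gt (1 / δ)
  set L := L₀ + 3 with hL
  have hLpos : (0 : ℝ) < L := by positivity
  have hLδ : 1 / (L : ℝ) < δ := by
    rw [div_lt_comm₀ hLpos hδ]
    refine hL₀.trans ?_
    rw [hL]
    push_cast
    linarith
  have hj : ∀ j : ℕ, ∃ q : M, j < L → Icc (((j : ℝ) - 1) / L) ((j + 1) / L) ⊆
      (fun t ↦ h (x₀, t)) ⁻¹' chartBall n q (r q) := by
    intro j
    by_cases hjL : j < L
    · have hjL' : (j : ℝ) < L := by exact_mod_cast hjL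
      obtain ⟨q, hq⟩ := hleb ((j : ℝ) / L) ⟨by
        have : (0 : ℝ) ≤ j / L := by positivity
        linarith, by rw [div_le_one hLpos]; exact hjL'.le⟩
      refine ⟨q, fun _ t ht ↦ hq ?_⟩
      rw [Real.ball_eq_Ioo]
      rw [sub_div, add_div] at ht
      exact ⟨by linarith [ht.1], by linarith [ht.2]⟩
    · exact ⟨h (x₀, 0), fun h ↦ absurd h hjL⟩
  choose p hp using hj
  refine ⟨{x | ∀ j ∈ {j | j < L}, ∀ t ∈ Icc (((j : ℝ) - 1) / L) ((j + 1) / L),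
    h (x, t) ∈ chartBall n (p j) (r (p j))}, ?_, fun j ↦ U (p j), p, fun j ↦ r (p j), fun j ↦ C (p j),
    fun j ↦ ch (p j), fun j ↦ a (p j), L, by omega, fun j ↦ hU _, fun j ↦ hch _, fun x hx j hj ↦ hx j hj⟩
  refine (Filter.eventually_all_finite (finite_lt_nat L)).2 fun j hj ↦ ?_
  refine isCompact_Icc.eventually_forall_of_forall_eventually
    (P := fun x t ↦ h (x, t) ∈ chartBall n (p j) (r (p j))) fun t ht ↦ ?_
  exact hc.continuousAt.eventually ((isOpen_chartBall _ _).mem_nhds (hp j hj ht))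

/-- All conditions are local in `z`, except periodicity, which compares two points; locally the
limit agrees with a member of the sequence. -/
theorem FutureFamily.of_locally_eq {S : Spacetime n M} {𝒱 : Set ((N × ℝ) × M)} {h₀ : N → M}
    {h : ℕ → N × ℝ → M} {g : N × ℝ → M} (hh : ∀ i, S.FutureFamily 𝒱 h₀ (h i))
    (hg : ∀ z, ∀ᶠ i in Filter.atTop, g =ᶠ[𝓝 z] h i) : S.FutureFamily 𝒱 h₀ g := by
  refine ⟨continuous_iff_continuousAt.2 fun z ↦ ?_, fun x t ↦ ?_, fun x t ↦ ?_, fun x ↦ ?_,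
    fun x t ht ↦ ?_⟩
  · obtain ⟨i, hi⟩ := (hg z).exists
    exact (hh i).continuous.continuousAt.congr hi.symm
  · obtain ⟨i, h1, h2⟩ := ((hg (x, t)).and (hg (x, t + 1))).exists
    rw [h1.eq_of_nhds, h2.eq_of_nhds, (hh i).periodic]
  · obtain ⟨i, hi⟩ := (hg (x, t)).exists
    refine ((hh i).future x t).congr ?_
    have h1 : ContinuousAt (fun t : ℝ ↦ (x, t)) t := by fun_prop
    exact h1.eventually hi
  · obtain ⟨i, hi⟩ := (hg (x, 0)).exists
    rw [hi.eq_of_nhds, (hh i).zero]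
  · obtain ⟨i, hi⟩ := (hg (x, t)).exists
    rw [hi.eq_of_nhds]
    exact (hh i).mem x t ht

theorem StrictFamily.of_locally_eq {S : Spacetime n M} {𝒱 : Set ((N × ℝ) × M)} {h₀ : N → M}
    {h : ℕ → N × ℝ → M} {g : N × ℝ → M} (hh : ∀ i, S.StrictFamily 𝒱 h₀ (h i))
    (hg : ∀ z, ∀ᶠ i in Filter.atTop, g =ᶠ[𝓝 z] h i) : S.StrictFamily 𝒱 h₀ g := by
  refine ⟨continuous_iff_continuousAt.2 fun z ↦ ?_, fun x t ↦ ?_, fun z ↦ ?_, fun x ↦ ?_,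
    fun x t ht ↦ ?_⟩
  · obtain ⟨i, hi⟩ := (hg z).exists
    exact (hh i).continuous.continuousAt.congr hi.symm
  · obtain ⟨i, h1, h2⟩ := ((hg (x, t)).and (hg (x, t + 1))).exists
    rw [h1.eq_of_nhds, h2.eq_of_nhds, (hh i).periodic]
  · obtain ⟨i, hi⟩ := (hg z).exists
    exact ((hh i).strict z).congr hi
  · obtain ⟨i, hi⟩ := (hg (x, 0)).exists
    rw [hi.eq_of_nhds, (hh i).zero]
  · obtain ⟨i, hi⟩ := (hg (x, t)).exists
    rw [hi.eq_of_nhds]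
    exact (hh i).mem x t ht

end Spacetime

end Tubes

/-! ### From future directed to smooth strict families -/

section Smooth

variable {n : ℕ} {M : Type*} [TopologicalSpace M] [ChartedSpace (EuclideanSpace ℝ (Fin n)) M]
  [IsManifold (𝓡 n) ∞ M] {k : ℕ} {N : Type*} [TopologicalSpace N]
  [ChartedSpace (EuclideanSpace ℝ (Fin k)) N] [IsManifold (𝓡 k) ∞ N] [T2Space N]
  [SecondCountableTopology N]

namespace Spacetime

/-- A future directed family can be approximated by a smooth strictly future directed one with the
same initial points. -/
theorem FutureFamily.exists_smooth {S : Spacetime n M} {𝒱 : Set ((N × ℝ) × M)} {h₀ : N → M}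
    {h : N × ℝ → M} (H : S.FutureFamily 𝒱 h₀ h) (h𝒱 : IsOpen 𝒱)
    (hS : ∀ q : M, ∃ U, S.IsConvexNormal U ∧ q ∈ U) (h₀s : ContMDiff (𝓡 k) (𝓡 n) ∞ h₀) :
    ∃ h' : N × ℝ → M, S.StrictFamily 𝒱 h₀ h' ∧ ContMDiff ((𝓡 k).prod 𝓘(ℝ, ℝ)) (𝓡 n) ∞ h' := by
  have : LocallyCompactSpace N := ChartedSpace.locallyCompactSpace (EuclideanSpace ℝ (Fin k)) N
  have htube := fun x ↦ exists_tube H.continuous hS x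
  choose O hO U p r C ch a L hT using htube
  obtain ⟨ι, f, hf⟩ := SmoothBumpCovering.exists_isSubordinate (𝓡 k) (isClosed_univ (X := N))
    (U := O) fun x _ ↦ hO x
  have hlf : LocallyFinite fun i ↦ tsupport (f i) := f.locallyFinite.closure
  have : Countable ι := countable_univ_iff.1 (f.locallyFinite.countable_univ
    fun i ↦ (f i).nonempty_support)
  -- All later families must stay in the chart balls of the tubes chosen for the first one. This is
  -- imposed as a condition on the graph, to be intersected with `𝒱`; it is open because its
  -- complement is a locally finite union of closed sets.
  set 𝒲 : Set ((N × ℝ) × M) := ⋂ i : ι, {y | y.1.1 ∈ tsupport (f i) → ∀ j < L (f.c i),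
    y.1.2 ∈ Icc (((j : ℝ) - 1) / L (f.c i)) ((j + 1) / L (f.c i)) →
      y.2 ∈ chartBall n (p (f.c i) j) (r (f.c i) j)} with h𝒲
  have h𝒲o : IsOpen 𝒲 := by
    have h1 : 𝒲 = (⋃ i, {y : (N × ℝ) × M | y.1.1 ∈ tsupport (f i)} ∩ ⋃ j ∈ {j | j < L (f.c i)},
        ({y | y.1.2 ∈ Icc (((j : ℝ) - 1) / L (f.c i)) ((j + 1) / L (f.c i))} ∩
          {y | y.2 ∉ chartBall n (p (f.c i) j) (r (f.c i) j)}))ᶜ := by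
      ext y
      simp only [h𝒲, mem_iInter, mem_ofPred_eq, mem_compl_iff, mem_iUnion, mem_inter_iff]
      push Not
      rfl
    rw [h1, isOpen_compl_iff]
    have hc1 : Continuous fun y : (N × ℝ) × M ↦ y.1.1 := by fun_prop
    refine LocallyFinite.isClosed_iUnion ((hlf.preimage_continuous hc1).subset
      fun i ↦ inter_subset_left) fun i ↦ ?_
    refine ((isClosed_tsupport _).preimage hc1).inter ((finite_lt_nat _).isClosed_biUnion fun j _ ↦ ?_)
    have hc2 : Continuous fun y : (N × ℝ) × M ↦ y.1.2 := by fun_prop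
    exact (isClosed_Icc.preimage hc2).inter
      ((isOpen_chartBall _ _).isClosed_compl.preimage continuous_snd)
  have hmem : ∀ {g : N × ℝ → M}, (∀ x, ∀ t ∈ Icc (-1 : ℝ) 1, ((x, t), g (x, t)) ∈ 𝒱 ∩ 𝒲) →
      ∀ i, ∀ x ∈ tsupport (f i), ∀ j < L (f.c i),
      ∀ t ∈ Icc (((j : ℝ) - 1) / L (f.c i)) ((j + 1) / L (f.c i)),
      g (x, t) ∈ chartBall n (p (f.c i) j) (r (f.c i) j) := by
    intro g hg i x hx j hj t ht
    have hL := (hT (f.c i)).three_le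
    have h1 : ((x, t), g (x, t)) ∈ 𝒲 := (hg x t ?_).2
    · exact mem_iInter.1 h1 i hx j hj ht
    have hL' : (3 : ℝ) ≤ L (f.c i) := by exact_mod_cast hL
    have hjL : (j : ℝ) + 1 ≤ L (f.c i) := by exact_mod_cast hj
    have h2 : -1 ≤ ((j : ℝ) - 1) / L (f.c i) := by
      rw [le_div_iff₀ (by linarith)]
      have : (0 : ℝ) ≤ j := by positivity
      linarith
    have h3 : ((j : ℝ) + 1) / L (f.c i) ≤ 1 := by
      rw [div_le_one (by linarith)]
      exact hjL
    exact ⟨h2.trans ht.1, ht.2.trans h3⟩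
  have H0 : S.FutureFamily (𝒱 ∩ 𝒲) h₀ h := by
    refine ⟨H.continuous, H.periodic, H.future, H.zero, fun x t ht ↦ ⟨H.mem x t ht, ?_⟩⟩
    exact mem_iInter.2 fun i hx j hj ht ↦ (hT (f.c i)).mem x (hf i hx) j hj t ht
  have hK : ∀ x, ∃ i, ∀ᶠ x' in 𝓝 x, f i x' = 1 := fun x ↦ f.eventuallyEq_one' x (mem_univ x)
  have hcpt : ∀ i, IsCompact (tsupport (f i)) := fun i ↦ (f i).hasCompactSupport
  obtain ⟨h₁, H₁, hs₁⟩ := exists_limit_of_locallyFinite (P := S.FutureFamily (𝒱 ∩ 𝒲) h₀)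
    (G := S.StrictAt) (hlf.preimage_continuous (continuous_fst (X := N) (Y := ℝ)))
    (K := fun i ↦ {z : N × ℝ | ∀ᶠ x in 𝓝 z.1, f i x = 1}) (fun z ↦ hK z.1) H0
    (by
      intro i g hg
      have hL := (hT (f.c i)).three_le
      have hMesh : S.MeshSetup (𝒱 ∩ 𝒲) h₀ g (f i) (U (f.c i)) (p (f.c i)) (r (f.c i)) (C (f.c i))
          (ch (f.c i)) (a (f.c i)) (L (f.c i)) := by
        refine ⟨hg, by omega, fun j _ ↦ (hT _).chord j, fun j _ ↦ (hT _).convexNormal j,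
          (f i).continuous, fun x ↦ (f i).nonneg, fun x ↦ (f i).le_one, fun x hx j hj t ht ↦ ?_⟩
        refine hmem hg.mem i x hx j hj t ⟨le_trans ?_ ht.1, ht.2⟩
        gcongr
        linarith
      exact hMesh.exists_strict (h𝒱.inter h𝒲o) (hcpt i))
    (fun g g' hg hg' ↦ FutureFamily.of_locally_eq hg hg')
    (fun g g' z h1 h2 ↦ h2.congr h1)
  have H₁' : S.StrictFamily (𝒱 ∩ 𝒲) h₀ h₁ := ⟨H₁.continuous, H₁.periodic, hs₁, H₁.zero, H₁.mem⟩
  have hlf2 : LocallyFinite fun ij : Σ i : ι, Fin (L (f.c i)) ↦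
      (Prod.fst : N × ℝ → N) ⁻¹' tsupport (f ij.1) := by
    intro z
    obtain ⟨t, ht, hfin⟩ := hlf.preimage_continuous (continuous_fst (X := N) (Y := ℝ)) z
    refine ⟨t, ht, (hfin.preimage' (f := Sigma.fst) fun i _ ↦ ?_).subset fun ij hij ↦ hij⟩
    rw [← range_sigmaMk]
    exact finite_range _
  obtain ⟨h₂, H₂, hs₂⟩ := exists_limit_of_locallyFinite (P := S.StrictFamily (𝒱 ∩ 𝒲) h₀)
    (G := fun h z ↦ ContMDiffAt ((𝓡 k).prod 𝓘(ℝ, ℝ)) (𝓡 n) ∞ h z) hlf2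
    (K := fun ij ↦ {z : N × ℝ | (∀ᶠ x in 𝓝 z.1, f ij.1 x = 1) ∧
      ∃ m : ℤ, |z.2 - m - (ij.2 : ℕ) / L (f.c ij.1)| ≤ 1 / (2 * L (f.c ij.1))})
    (by
      intro z
      obtain ⟨i, hi⟩ := hK z.1
      have hL := (hT (f.c i)).three_le
      set c : ℤ := round (z.2 * L (f.c i)) with hc
      have hc0 : 0 ≤ c % L (f.c i) := Int.emod_nonneg _ (by omega)
      have hc1 : c % L (f.c i) < L (f.c i) := Int.emod_lt_of_pos _ (by omega)
      refine ⟨⟨i, (c % L (f.c i)).toNat, by omega⟩, hi, c / L (f.c i), ?_⟩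
      have hL' : (0 : ℝ) < L (f.c i) := by exact_mod_cast (by omega : 0 < L (f.c i))
      have h1 : (((c % L (f.c i)).toNat : ℕ) : ℝ) = ((c % L (f.c i) : ℤ) : ℝ) := by
        rw [← Int.cast_natCast, Int.toNat_of_nonneg hc0]
      have h2 : (c : ℝ) = L (f.c i) * ((c / L (f.c i) : ℤ) : ℝ) + ((c % L (f.c i) : ℤ) : ℝ) := by
        exact_mod_cast (Int.mul_ediv_add_emod c (L (f.c i))).symm
      have h3 := abs_sub_round (z.2 * L (f.c i))
      rw [← hc] at h3
      simp only [h1]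
      have h4 : z.2 - ((c / L (f.c i) : ℤ) : ℝ) - ((c % L (f.c i) : ℤ) : ℝ) / L (f.c i) =
          (z.2 * L (f.c i) - c) / L (f.c i) := by
        rw [h2]
        field_simp
        ring
      rw [h4, abs_div, abs_of_pos hL', div_le_div_iff₀ hL' (by positivity)]
      nlinarith) H₁'
    (by
      rintro ⟨i, j⟩ g hg
      have hL := (hT (f.c i)).three_le
      have hL' : (3 : ℝ) ≤ L (f.c i) := by exact_mod_cast hL
      have hLpos : (0 : ℝ) < L (f.c i) := by linarith
      set l : ℝ := 1 / L (f.c i) with hl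
      have hl0 : 0 < l := by positivity
      have hl3 : l ≤ 1 / 3 := by
        rw [hl]
        gcongr
      -- The bump is 1 up to distance `3 / (4 * L)` from `j / L` modulo 1, beyond the `1 / (2 * L)`
      -- that suffices to cover all times. Its support lies within `1 / L`, the half width of the
      -- tube intervals, and `1 / L < 1 / 2` because `L ≥ 3`.
      obtain ⟨χ, hχ1, hχ2, hχ3, hχ4, hχ5, hχ6⟩ := exists_periodic_bump ((j : ℕ) / L (f.c i))
        (by positivity : 0 < 3 / 4 * l) (by linarith : 3 / 4 * l < l) (by linarith)
      have hBox : S.BoxSetup k (𝒱 ∩ 𝒲) h₀ g (f.c i) (f i) (p (f.c i) j) ((j : ℕ) / L (f.c i)) l χ := by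
        refine ⟨hg, (f i).contMDiff, fun x ↦ (f i).nonneg, fun x ↦ (f i).le_one, hcpt i,
          (f i).tsupport_subset_extChartAt_source, hχ1, hχ2, hχ3, hχ4, hχ5, by linarith,
          fun x hx t ht ↦ ?_, fun m hm ↦ ?_, h₀s⟩
        · refine (hmem hg.mem i x hx j j.2 t ?_).1
          rw [sub_div, add_div]
          exact ht
        -- An integer at distance less than `1 / L` from `j / L` satisfies `m * L = j`, and `0 ≤ j <
        -- L` leaves only `m = 0`.
        · have h1 : (m : ℝ) - (j : ℕ) / L (f.c i) = (m * L (f.c i) - (j : ℕ)) * l := by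
            rw [hl]
            field_simp
          rw [h1, abs_mul, abs_of_pos hl0] at hm
          have h2 : |(m : ℝ) * L (f.c i) - (j : ℕ)| < 1 := by
            by_contra h3
            nlinarith
          have h3 : |m * (L (f.c i) : ℤ) - (j : ℕ)| < 1 := by exact_mod_cast h2
          rw [Int.abs_lt_one_iff, sub_eq_zero] at h3
          have h4 := j.2
          by_contra hm0
          rcases lt_or_gt_of_ne hm0 with h5 | h5
          · nlinarith
          · have h6 : (j : ℕ) < (L (f.c i) : ℤ) := by exact_mod_cast h4
            nlinarith
      obtain ⟨g', h1, h2, h3, h4⟩ := hBox.exists_smooth (h𝒱.inter h𝒲o)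
      refine ⟨g', h1, h2, h3, fun z hz ↦ h4 z hz.1 ?_⟩
      obtain ⟨m, hm⟩ := hz.2
      have h5 : 1 / (2 * (L (f.c i) : ℝ)) < 3 / 4 * l := by
        have h6 : 1 / (2 * (L (f.c i) : ℝ)) = 1 / 2 * l := by
          rw [hl]
          field_simp
        rw [h6]
        linarith
      have h6 : Continuous fun t : ℝ ↦ |t - m - (j : ℕ) / L (f.c i)| := by fun_prop
      filter_upwards [h6.continuousAt.eventually (Iio_mem_nhds (hm.trans_lt h5))] with t ht
      exact hχ6 t m (le_of_lt ht))
    (fun g g' hg hg' ↦ StrictFamily.of_locally_eq hg hg')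
    (fun g g' z h1 h2 ↦ h2.congr_of_eventuallyEq h1)
  exact ⟨h₂, ⟨H₂.continuous, H₂.periodic, H₂.strict, H₂.zero, fun x t ht ↦ (H₂.mem x t ht).1⟩, hs₂⟩

end Spacetime

end Smooth

/-! ### Orientation of loops and properness -/

section UniformFamilies

variable {n : ℕ} {M : Type*} [TopologicalSpace M] [ChartedSpace (EuclideanSpace ℝ (Fin n)) M]
  [IsManifold (𝓡 n) ∞ M]

local notation "𝔼" => EuclideanSpace ℝ (Fin n)

omit [IsManifold (𝓡 n) ∞ M] in
theorem velocity_comp_neg {c : ℝ → M} {s : ℝ} (hc : MDifferentiableAt 𝓘(ℝ, ℝ) (𝓡 n) c (-s)) :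
    (velocity n (fun s ↦ c (-s)) s : 𝔼) = -(velocity n c (-s) : 𝔼) := by
  set L : ℝ →L[ℝ] 𝔼 := mfderiv 𝓘(ℝ, ℝ) (𝓡 n) c (-s) with hL
  have h3 : HasMFDerivAt 𝓘(ℝ, ℝ) 𝓘(ℝ, ℝ) (fun s : ℝ ↦ -s) s
      (ContinuousLinearMap.toSpanSingleton ℝ (-1 : ℝ)) :=
    (hasDerivAt_neg s).hasFDerivAt.hasMFDerivAt
  have h4 := hc.hasMFDerivAt.comp s h3
  have h5 := congrArg (fun L : ℝ →L[ℝ] 𝔼 ↦ L 1) h4.mfderiv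
  refine h5.trans ?_
  have h6 : (ContinuousLinearMap.toSpanSingleton ℝ (-1 : ℝ)) 1 = (-1 : ℝ) := by simp
  change L ((ContinuousLinearMap.toSpanSingleton ℝ (-1 : ℝ)) 1) = -(L 1)
  rw [h6, map_neg]

namespace Spacetime

variable {S : Spacetime n M}

theorem reverse_reverse (S : Spacetime n M) : S.reverse.reverse = S := by
  cases S
  simp [reverse]

theorem FChron.reverse {U : Set M} {p q : M} (h : S.FChron U p q) : S.reverse.FChron U q p := by
  rw [← S.reverse_reverse] at h
  exact h.of_reverse

theorem IsEssentiallyTimelike.reverse {γ : ℝ → M} (h : S.IsEssentiallyTimelike γ) :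
    S.reverse.IsEssentiallyTimelike γ := by
  refine ⟨h.1, fun t ↦ ?_⟩
  obtain ⟨δ, hδ, U, hU, htU, hm, hch⟩ := h.2 t
  refine ⟨δ, hδ, U, hU, htU, hm, fun σ hσ τ hτ hne ↦ ?_⟩
  have h1 := hch σ hσ τ hτ hne
  rw [chronIn_iff] at h1 ⊢
  rw [reverse_reverse]
  exact h1.symm

/-- An increasing or decreasing reparametrization of the loops of a uniform family makes them future
directed. -/
theorem IsUniformFamily.exists_orientation {k : ℕ} {N : Type*} [TopologicalSpace N]
    [ChartedSpace (EuclideanSpace ℝ (Fin k)) N] {H : N × UnitAddCircle → M}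
    (hH : S.IsUniformFamily k H) :
    ∃ ς : N → ℝ, (∀ x, ς x = 1 ∨ ς x = -1) ∧ (∀ x, ∀ᶠ x' in 𝓝 x, ς x' = ς x) ∧
      ∀ x t, S.FutureAt (fun t ↦ H (x, ((ς x * t : ℝ) : UnitAddCircle))) t := by
  classical
  set h : N × ℝ → M := fun z ↦ H (z.1, (z.2 : UnitAddCircle)) with hh
  have hc : Continuous h := hH.isProperMap.continuous.comp
    (continuous_fst.prodMk ((AddCircle.continuous_mk' 1).comp continuous_snd))
  have hess : ∀ x, S.IsEssentiallyTimelike (fun t ↦ h (x, t)) := hH.essentiallyTimelike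
  set A : Set N := {x | ∀ t, S.FutureAt (fun t ↦ h (x, t)) t} with hA
  set B : Set N := {x | ∀ t, S.reverse.FutureAt (fun t ↦ h (x, t)) t} with hB
  have hAo : IsOpen A := isOpen_setOf_futureAt hc hess
  have hBo : IsOpen B := isOpen_setOf_futureAt hc fun x ↦ (hess x).reverse
  have hAB : ∀ x, x ∈ A ∨ x ∈ B := fun x ↦ (hess x).futureAt_or
  have hdis : ∀ x ∈ A, x ∉ B := by
    intro x hx hx'
    obtain ⟨δ, -, U, hU, h0U, -⟩ := (hess x).2 0
    exact (hx 0).not_reverse ⟨U, hU, h0U⟩ (hx' 0)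
  refine ⟨fun x ↦ if x ∈ A then 1 else -1, fun x ↦ ?_, fun x ↦ ?_, fun x t ↦ ?_⟩
  · by_cases hx : x ∈ A
    · exact Or.inl (if_pos hx)
    · exact Or.inr (if_neg hx)
  · rcases hAB x with hx | hx
    · filter_upwards [hAo.mem_nhds hx] with x' hx'
      rw [if_pos hx, if_pos hx']
    · filter_upwards [hBo.mem_nhds hx] with x' hx'
      rw [if_neg fun h ↦ hdis _ h hx, if_neg fun h ↦ hdis _ h hx']
  · rcases hAB x with hx | hx
    · simp only [if_pos hx, one_mul]
      exact hx t
    · simp only [if_neg fun h ↦ hdis _ h hx, neg_mul, one_mul]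
      exact FutureAt.comp_neg (γ := fun t ↦ h (x, t)) (hx (-t))

/-- Points at close times are related in any given convex normal set around them by
`StrictAt.exists_fchron`; for `c = -1` the relation is merely reversed. -/
theorem StrictFamily.isEssentiallyTimelike {N : Type*} [TopologicalSpace N]
    {𝒱 : Set ((N × ℝ) × M)} {h₀ : N → M} {h : N × ℝ → M} (H : S.StrictFamily 𝒱 h₀ h)
    (hS : ∀ q : M, ∃ U, S.IsConvexNormal U ∧ q ∈ U) (x : N) {c : ℝ} (hc : c = 1 ∨ c = -1) :
    S.IsEssentiallyTimelike fun t ↦ h (x, c * t) := by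
  have hcont : Continuous fun t ↦ h (x, c * t) := H.continuous.comp (by fun_prop)
  refine ⟨hcont, fun t ↦ ?_⟩
  obtain ⟨U, hU, htU⟩ := hS (h (x, c * t))
  obtain ⟨O, hO, hch⟩ := (H.strict (x, c * t)).exists_fchron H.continuous.continuousAt hU htU
  have h1 : Continuous fun s : ℝ ↦ (x, c * s) := by fun_prop
  obtain ⟨δ, hδ, hδO⟩ := Metric.mem_nhds_iff.1 (Filter.inter_mem
    (h1.continuousAt.preimage_mem_nhds hO) (hcont.continuousAt.preimage_mem_nhds (hU.1.mem_nhds htU)))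
  rw [Real.ball_eq_Ioo] at hδO
  refine ⟨δ, hδ, U, hU, htU, fun s hs ↦ (hδO hs).2, fun σ hσ τ hτ hne ↦ ?_⟩
  rw [chronIn_iff]
  have hc0 : c ≠ 0 := by rcases hc with rfl | rfl <;> norm_num
  rcases lt_or_gt_of_ne (mul_right_injective₀ hc0 |>.ne hne) with h2 | h2
  · exact Or.inl (hch x _ _ (hδO hσ).1 (hδO hτ).1 h2)
  · exact Or.inr (hch x _ _ (hδO hτ).1 (hδO hσ).1 h2).reverse

theorem StrictFamily.isTimelikeOn {k : ℕ} {N : Type*} [TopologicalSpace N]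
    [ChartedSpace (EuclideanSpace ℝ (Fin k)) N]
    {𝒱 : Set ((N × ℝ) × M)} {h₀ : N → M} {h : N × ℝ → M} (H : S.StrictFamily 𝒱 h₀ h)
    (hs : ContMDiff ((𝓡 k).prod 𝓘(ℝ, ℝ)) (𝓡 n) ∞ h) (x : N) {c : ℝ} (hc : c = 1 ∨ c = -1) :
    S.IsTimelikeOn (fun t ↦ h (x, c * t)) univ := by
  have h1 : ContMDiff 𝓘(ℝ, ℝ) (𝓡 n) ∞ fun t ↦ h (x, t) :=
    hs.comp (contMDiff_const.prodMk contMDiff_id)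
  have h2 : ∀ t, S.FutureTimelike (velocity n (fun t ↦ h (x, t)) t) := fun t ↦
    (H.strict (x, t)).futureTimelike_velocity ((h1 t).mdifferentiableAt (by simp))
  rcases hc with rfl | rfl
  · have h3 : (fun t : ℝ ↦ h (x, 1 * t)) = fun t ↦ h (x, t) := by simp
    rw [h3]
    exact ⟨fun s _ ↦ h1 s, Or.inl fun s _ ↦ h2 s⟩
  · have h3 : (fun t : ℝ ↦ h (x, -1 * t)) = fun t ↦ h (x, -t) := by simp
    rw [h3]
    refine ⟨fun s _ ↦ h1.comp (contMDiff_id.neg) s, Or.inr fun s _ ↦ ?_⟩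
    have h4 := velocity_comp_neg (c := fun t ↦ h (x, t)) (s := s)
      ((h1 (-s)).mdifferentiableAt (by simp))
    rw [← futureTimelike_reverse]
    have h5 := (S.futureTimelike_reverse_neg (p := h (x, -s))
      (a := velocity n (fun t ↦ h (x, t)) (-s))).2 (h2 (-s))
    have h6 : ∀ v w : 𝔼, v = w → S.reverse.FutureTimelike (p := h (x, -s)) w →
        S.reverse.FutureTimelike (p := h (x, -s)) v := by
      rintro v w rfl h
      exact h
    exact h6 _ _ h4 h5

end Spacetime

/-- A neighbourhood of the graph of `h₀` whose values stay close to those of `h₀` at infinity. -/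
def properNbhd {Z M : Type*} [TopologicalSpace Z] [TopologicalSpace M] (E : CompactExhaustion M)
    (h₀ : Z → M) : Set (Z × M) :=
  ⋃ m : ℕ, {y | h₀ y.1 ∈ interior (E (m + 1)) ∧ ∀ k < m, y.2 ∉ E k}

/-! ### Graph neighbourhoods that preserve properness -/

section Proper

variable {Z Y : Type*} [TopologicalSpace Z] [TopologicalSpace Y] (E : CompactExhaustion Y) {h₀ : Z → Y}

theorem isOpen_properNbhd [T2Space Y] (hc : Continuous h₀) : IsOpen (properNbhd E h₀) := by
  refine isOpen_iUnion fun m ↦ ?_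
  have h1 : {y : Z × Y | h₀ y.1 ∈ interior (E (m + 1)) ∧ ∀ k < m, y.2 ∉ E k} =
      ((fun y : Z × Y ↦ h₀ y.1) ⁻¹' interior (E (m + 1))) ∩
        (Prod.snd ⁻¹' (⋃ k ∈ {k | k < m}, E k)ᶜ) := by
    ext y
    simp
  rw [h1]
  refine (isOpen_interior.preimage (hc.comp continuous_fst)).inter (IsOpen.preimage continuous_snd ?_)
  exact ((finite_lt_nat m).isClosed_biUnion fun k _ ↦ (E.isCompact k).isClosed).isOpen_compl

theorem mem_properNbhd (z : Z) : (z, h₀ z) ∈ properNbhd E h₀ := by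
  refine mem_iUnion.2 ⟨E.find (h₀ z), E.subset_interior_succ _ (E.mem_find _), fun k hk h ↦ ?_⟩
  exact absurd (E.mem_iff_find_le.1 h) (not_le.2 hk)

/-- A value in `E c` forces the index `m` of the union to be at most `c`. Hence, for a map with
graph in the neighbourhood, the preimage of `E c` lies in the preimage of `E (c + 1)` under `h₀`,
and properness is inherited. -/
theorem mem_of_mem_properNbhd {z : Z} {q : Y} (h : (z, q) ∈ properNbhd E h₀) {c : ℕ} (hq : q ∈ E c) :
    h₀ z ∈ E (c + 1) := by
  obtain ⟨m, h1, h2⟩ := mem_iUnion.1 h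
  have h3 : m ≤ c := not_lt.1 fun h ↦ h2 c h hq
  exact E.subset (by omega) (interior_subset h1)

end Proper

end UniformFamilies

/-! ### Proof of the proposition -/

theorem proposition2 {n : ℕ} {M : Type*} [TopologicalSpace M] [T2Space M]
    [SecondCountableTopology M] [ChartedSpace (EuclideanSpace ℝ (Fin n)) M]
    [IsManifold (𝓡 n) ∞ M] (S : Spacetime n M)
    {k : ℕ} {N : Type*} [TopologicalSpace N] [T2Space N] [SecondCountableTopology N]
    [ChartedSpace (EuclideanSpace ℝ (Fin k)) N] [IsManifold (𝓡 k) ∞ N]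
    (H : N × UnitAddCircle → M) (hH : S.IsUniformFamily k H) :
    ∃ H' : N × UnitAddCircle → M,
      S.IsUniformFamily k H' ∧ SmoothOnCircleProduct n k H' ∧
        ∀ x : N, S.IsTimelikeLoop (fun t ↦ H' (x, t)) := by
  have : LocallyCompactSpace M := ChartedSpace.locallyCompactSpace (EuclideanSpace ℝ (Fin n)) M
  -- Convex normal neighbourhoods need not be constructed: some loop starts at `q`, and essential
  -- timelikeness supplies one.
  have hS : ∀ q : M, ∃ U, S.IsConvexNormal U ∧ q ∈ U := by
    intro q
    obtain ⟨x, hx⟩ := hH.surjective_zero q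
    obtain ⟨δ, -, U, hU, h0U, -⟩ := (hH.essentiallyTimelike x).2 0
    simp only [AddCircle.coe_zero] at h0U hx
    exact ⟨U, hU, hx ▸ h0U⟩
  obtain ⟨ς, hς, hςc, hfut⟩ := hH.exists_orientation
  have hςs : ∀ x, ς x * ς x = 1 := fun x ↦ by rcases hς x with h | h <;> rw [h] <;> norm_num
  have hcoe : ∀ (t : ℝ) (m : ℤ), ((t + m : ℝ) : UnitAddCircle) = t := by
    intro t m
    rw [AddCircle.coe_add, (AddCircle.coe_eq_zero_iff 1 (x := (m : ℝ))).2 ⟨m, by simp⟩, add_zero]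
  have hςi : ∀ x, ∃ m : ℤ, ς x = m := fun x ↦ by
    rcases hς x with h | h
    · exact ⟨1, by simp [h]⟩
    · exact ⟨-1, by simp [h]⟩
  set h : N × ℝ → M := fun z ↦ H (z.1, ((ς z.1 * z.2 : ℝ) : UnitAddCircle)) with hh
  have hςcont : Continuous ς := continuous_iff_continuousAt.2 fun x ↦
    continuousAt_const.congr ((hςc x).mono fun _ h ↦ h.symm)
  have hc : Continuous h := hH.isProperMap.continuous.comp
    (continuous_fst.prodMk ((AddCircle.continuous_mk' 1).comp
      ((hςcont.comp continuous_fst).mul continuous_snd)))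
  have hz : ∀ x, h (x, 0) = H (x, 0) := fun x ↦ by simp only [hh, mul_zero, AddCircle.coe_zero]
  set E : CompactExhaustion M := default with hE
  have F : S.FutureFamily (properNbhd E h) (fun x ↦ H (x, 0)) h := by
    refine ⟨hc, fun x t ↦ ?_, hfut, hz, fun x t _ ↦ mem_properNbhd E _⟩
    obtain ⟨m, hm⟩ := hςi x
    simp only [hh]
    rw [mul_add, mul_one]
    nth_rw 2 [hm]
    rw [hcoe]
  obtain ⟨g, G, hgs⟩ := F.exists_smooth (isOpen_properNbhd E hc) hS hH.contMDiff_zero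
  have hper : ∀ x, Function.Periodic (fun t ↦ g (x, ς x * t)) 1 := by
    intro x t
    obtain ⟨m, hm⟩ := hςi x
    have h1 := (show Function.Periodic (fun t ↦ g (x, t)) 1 from G.periodic x).int_mul m (ς x * t)
    simp only [mul_one] at h1
    simp only [mul_add, mul_one]
    nth_rw 2 [hm]
    exact h1
  -- The reparametrization by `ς` is undone; it is its own inverse, since `ς x * ς x = 1`, and it is
  -- smooth in `x` since `ς` is locally constant.
  set H' : N × UnitAddCircle → M := fun z ↦ (hper z.1).lift z.2 with hH'
  have hlift : ∀ x (t : ℝ), H' (x, (t : UnitAddCircle)) = g (x, ς x * t) := fun x t ↦ rfl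
  have hlift0 : ∀ x, H' (x, 0) = H (x, 0) := by
    intro x
    have h1 := hlift x 0
    rw [mul_zero, G.zero, AddCircle.coe_zero] at h1
    exact h1
  have hlift0' : (fun x ↦ H' (x, 0)) = fun x ↦ H (x, 0) := funext hlift0
  have hsmooth : SmoothOnCircleProduct n k H' := by
    unfold SmoothOnCircleProduct
    simp only [hlift]
    intro z
    have h1 : ContMDiffAt ((𝓡 k).prod 𝓘(ℝ, ℝ)) (𝓡 n) ∞ (fun z' : N × ℝ ↦ g (z'.1, ς z.1 * z'.2)) z :=
      (hgs.comp (contMDiff_fst.prodMk (contMDiff_const.mul contMDiff_snd))) z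
    refine h1.congr_of_eventuallyEq ?_
    filter_upwards [continuous_fst.continuousAt.eventually (hςc z.1)] with z' hz'
    rw [hz']
  have hcont : Continuous H' := by
    have hq : IsOpenQuotientMap (Prod.map id (fun t : ℝ ↦ (t : UnitAddCircle)) : N × ℝ → _) :=
      IsOpenQuotientMap.id.prodMap QuotientAddGroup.isOpenQuotientMap_mk
    rw [← hq.continuous_comp_iff]
    exact hsmooth.continuous
  refine ⟨H', ⟨?_, ?_, ?_, ?_, ?_⟩, hsmooth, fun x ↦ ?_⟩
  · refine isProperMap_iff_isCompact_preimage.2 ⟨hcont, fun K hK ↦ ?_⟩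
    obtain ⟨c, hc'⟩ := E.exists_superset_of_isCompact hK
    refine (hH.isProperMap.isCompact_preimage (E.isCompact (c + 1))).of_isClosed_subset
      (hK.isClosed.preimage hcont) ?_
    rintro ⟨x, τ⟩ hx
    obtain ⟨t, rfl⟩ := QuotientAddGroup.mk_surjective τ
    -- The representative in `[0, 1)` is multiplied by `ς x = ±1`, so it lands in `[-1, 1]`, the
    -- range of times in which the families are controlled by the graph neighbourhood.
    have h1 : ((Int.fract t : ℝ) : UnitAddCircle) = t := by
      rw [← hcoe (Int.fract t) ⌊t⌋, Int.fract_add_floor]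
    change H' (x, ((t : ℝ) : UnitAddCircle)) ∈ K at hx
    change H (x, ((t : ℝ) : UnitAddCircle)) ∈ E (c + 1)
    rw [← h1] at hx ⊢
    rw [hlift] at hx
    have h2 := G.mem x (ς x * Int.fract t) (by
      have h3 := Int.fract_nonneg t
      have h4 := (Int.fract_lt_one t).le
      rcases hς x with h | h <;> rw [h] <;> constructor <;> linarith)
    have h3 := mem_of_mem_properNbhd E h2 (hc' hx)
    simpa only [hh, ← mul_assoc, hςs, one_mul] using h3
  · rw [hlift0']
    exact hH.contMDiff_zero
  · rw [hlift0']
    exact hH.surjective_zero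
  · rw [hlift0']
    exact hH.submersion_zero
  · exact fun x ↦ G.isEssentiallyTimelike hS x (hς x)
  · exact G.isTimelikeOn hgs x (hς x)
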